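/- Conventions. Let $R$ be a commutative ring, $M$ an $R$-module (regarded as a diagonal bimodule), $R\text{-proj}$ the category of finitely generated projective $R$-modules, and $I$ the tautological functor $R\text{-proj}\to R\text{-mod}$. A functor is pointed if it sends $0$ to $0$. A multiplicative elementary extension $\phi$ of $R$ by $M$ is an exact sequence $$0\to I(-)\otimes_R M\xrightarrow{\,b\,}C_1\xrightarrow{\,d\,}C_0\xrightarrow{\,a\,}I\to 0$$ of pointed functors $R\text{-proj}\to R\text{-mod}$, together with the structure of a DG algebra on $C_\bullet=(C_1\to C_0)$ (that is, functorial $R$-bilinear associative unital products $C_i(P)\otimes C_j(Q)\to C_{i+j}(P\otimes_R Q)$ satisfying the Leibniz rule, with $C_2=0$) such that $a$ is multiplicative and unital. A splitting of an elementary extension $0\to B\to C_1\xrightarrow{d}C_0\to A\to0$ in an abelian category is an object $C_{01}$ with maps $c_1:C_1\to C_{01}$ and $c_0:C_{01}\to C_0$ such that $c_0$ is surjective and the square formed by $c_1$, $c_0$, $d:C_1\to\operatorname{Im}d$ and $\operatorname{Im}d\subset C_0$ is cartesian (equivalently: $c_1$ is injective, $c_0c_1=d$, and $c_1(C_1)=c_0^{-1}(\operatorname{Im}d)$).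 If the extension is multiplicative, then a multiplicative splitting is a splitting together with an algebra structure on $C_{01}$ for which $c_0$ is an algebra map and $c_1$ is a map of $C_{01}$-bimodules, where $C_{01}$ acts on $C_1$ through $c_0$. Let $q:R'\to R$ be a commutative square-zero extension of $R$ by $M$, with inclusion $i:M\to R'$, which corresponds to $\phi$: for a splitting $C_{01}$ of $\phi$ considered as an extension of functors with values in abelian groups, $R'$ is identified with the ring of regular endomorphisms of $C_{01}$, that is, those additive endomorphisms which form a commutative diagram with $c_1$, $c_0$ and the multiplication by some $r\in R$ on $C_1$ and on $C_0$. Here $q$ sends such an endomorphism to $r$, and $i(m)$ acts by $z\mapsto c_1\bigl(b(a(c_0(z))\otimes m)\bigr)$. Thus $C_{01}$ takes values in $R'$-modules. For a functor $F$ on $R\text{-proj}$ and a flat $R$-module $V$, put $F(V)=\operatorname{colim}F(P)$, over all maps $P\to V$ with $P$ in $R\text{-proj}$. Let $A$ be a flat associative unital $R$-algebra, and set $HH^n(A,N)=\operatorname{Ext}^n_{A\otimes_R A^{op}}(A,N)$. A lifting of the $R$-module $A$ to $R'$ is a flat $R'$-module $A'$ with an isomorphism $R\otimes_{R'}A'\cong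 A$ of $R$-modules. A lifting of the $R$-algebra $A$ is a flat associative unital $R'$-algebra $A'$ with an isomorphism $R\otimes_{R'}A'\cong A$ of $R$-algebras. Morphisms of liftings are isomorphisms over $A$; morphisms of (multiplicative) splittings are (algebra) maps compatible with $c_0$ and $c_1$. Statement. 1. $C_\bullet(A)$ is a DG algebra over $R$, and it is a multiplicative elementary extension of $A$ by the bimodule $A\otimes_R M$: $$0\to A\otimes_R M\to C_1(A)\to C_0(A)\to A\to0$$ is exact, with the natural bimodule structure on $A\otimes_RM$. 2. $C_{01}$ has a multiplicative structure over $R'$ (functorial $R'$-bilinear associative unital products $C_{01}(P)\otimes C_{01}(Q)\to C_{01}(P\otimes_RQ)$ such that $c_0$ is multiplicative and unital, and $c_1$ is a map of bimodules). In particular, $C_{01}(A)$ is an algebra. 3. There is an equivalence from the category of liftings of the $R$-module $A$ to the category of splittings of $C_\bullet(A)$, which sends $A'$ to the difference $C_{01}(A)-A'$: the quotient of $C_{01}(A)\times_AA'$ by the diagonal copy of $A\otimes_RM$, with the maps $c\mapsto(c_1(c),0)$ and $(z,y)\mapsto c_0(z)$. For any multiplicative structure on $C_{01}$ as in 2, it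 induces an equivalence $$\mathrm{Lift}^\circ(A,R')\cong\mathrm{Spl}^\circ(C_\bullet(A))$$ from the category of liftings of the algebra $A$ to the category of multiplicative splittings of $C_\bullet(A)$: on underlying modules it is the first equivalence, and the product on the splitting corresponding to $A'$ is induced by the products of $C_{01}(A)$ and $A'$. 4. The multiplicative elementary extension $C_\bullet(A)$ has a unique class $o\in HH^3(A,A\otimes_RM)$, and $o=0$ if and only if the algebra $A$ has a lifting to $R'$. Here a class of $C_\bullet(A)$ is the Yoneda class of an exact sequence of bimodules $$0\to A\otimes_RM\to E_1\to E_0\to A\otimes_R A^{op}\to A\to 0$$ such that, with $\Omega=\operatorname{Ker}(A\otimes_R A^{op}\to A)$, there is a DG derivation $C'_\bullet\to(E_1\to E_0)$ over $R$ which is the identity on $A\otimes_RM$ and induces the universal derivation $A\to\Omega$, $x\mapsto 1\otimes x-x\otimes 1$; here $C'_\bullet$ is some multiplicative elementary extension of $A$ by $A\otimes_RM$ with a map $C'_\bullet\to C_\bullet(A)$ of such extensions. 5. If the algebra $A$ has a lifting to $R'$, then the set of isomorphism classes of its liftings is a torsor over $HH^2(A,A\otimes_RM)$. More precisely, it has a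 torsor structure in which the difference of the classes of two liftings $A''$ and $A'$ is the class of the square-zero extension $A''-A'$ of the $R$-algebra $A$ by $A\otimes_RM$ (the quotient of $A'\times_AA''$ by the diagonal copy of $A\otimes_RM$). The class of a square-zero extension $B$ of $A$ by $A\otimes_R M$ is the Yoneda class of an exact sequence of bimodules $$0\to A\otimes_RM\to E\to A\otimes_R A^{op}\to A\to 0$$ such that there is an $R$-linear derivation $B\to E$ which is the identity on $A\otimes_RM$ and induces the universal derivation $A\to\Omega$. -/

import Mathlib

open CategoryTheory CategoryTheory.Limits
open scoped TensorProduct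

universe u

namespace SqZeroLift

/-! ### Finitely generated projective modules and pointed functors -/

/-- Objects of the category `R-proj` of finitely generated projective `R`-modules. -/
structure RProj (R : Type u) [CommRing R] : Type (u + 1) where
  carrier : Type u
  [addCommGroup : AddCommGroup carrier]
  [module : Module R carrier]
  [finite : Module.Finite R carrier]
  [projective : Module.Projective R carrier]

namespace RProj

instance (R : Type u) [CommRing R] : CoeSort (RProj R) (Type u) := ⟨RProj.carrier⟩

attribute [instance] RProj.addCommGroup RProj.module RProj.finite RProj.projective

variable (R : Type u) [CommRing R]

/-- Morphisms of `R-proj` are all `R`-linear maps. -/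
instance category : Category.{u} (RProj R) where
  Hom P Q := P →ₗ[R] Q
  id P := (LinearMap.id : P →ₗ[R] P)
  comp {P Q T} f g := ((g : Q →ₗ[R] T).comp (f : P →ₗ[R] Q) : P →ₗ[R] T)

variable {R}

/-- A linear map, as a morphism of `R-proj`. -/
def ofLin {P Q : RProj R} (f : P →ₗ[R] Q) : P ⟶ Q := f

/-- A morphism of `R-proj`, as a linear map. -/
def lin {P Q : RProj R} (f : P ⟶ Q) : P →ₗ[R] Q := f

@[simp] theorem lin_ofLin {P Q : RProj R} (f : P →ₗ[R] Q) : lin (ofLin f) = f := rfl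
@[simp] theorem lin_id (P : RProj R) : lin (𝟙 P) = LinearMap.id := rfl
@[simp] theorem lin_comp {P Q T : RProj R} (f : P ⟶ Q) (g : Q ⟶ T) :
    lin (f ≫ g) = (lin g).comp (lin f) := rfl

theorem ofLin_comp {P Q T : RProj R} (f : P →ₗ[R] Q) (g : Q →ₗ[R] T) :
    ofLin (g.comp f) = ofLin f ≫ ofLin g := rfl

/-- The free module of rank one. -/
def one (R : Type u) [CommRing R] : RProj R := ⟨R⟩

/-- The tensor product over `R` of finitely generated projective modules. -/
def tensor (P Q : RProj R) : RProj R := ⟨P ⊗[R] Q⟩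

/-- The free module of rank two. -/
def two (R : Type u) [CommRing R] : RProj R := ⟨R × R⟩

variable (R)

/-- The tautological functor `R-proj → R-mod`, denoted `I` in the theory. -/
def incl : RProj R ⥤ ModuleCat.{u} R where
  obj P := ModuleCat.of R P
  map f := ModuleCat.ofHom (lin f)

instance : (incl R).Full := ⟨fun f => ⟨ofLin f.hom, rfl⟩⟩

instance : (incl R).Faithful := ⟨fun h => by
  have := congrArg ModuleCat.Hom.hom h
  exact this⟩

/-- The embedding of `R-proj` into finitely generated modules. -/
def toFG : RProj R ⥤ FGModuleCat.{u} R :=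
  ObjectProperty.lift _ (incl R) (fun P => inferInstanceAs (Module.Finite R P))

instance : EssentiallySmall.{u} (RProj R) :=
  have : (toFG R).Full := ⟨fun f => ⟨ofLin f.hom.hom, rfl⟩⟩
  have : (toFG R).Faithful := ⟨fun h =>
    congrArg (fun k => k.hom.hom) h⟩
  essentiallySmall_of_fully_faithful (toFG R)

/-- The additive functor `P ↦ P ⊗ M` attached to a (diagonal) bimodule `M`. -/
def tensorRight (M : Type u) [AddCommGroup M] [Module R M] : RProj R ⥤ ModuleCat.{u} R where
  obj P := ModuleCat.of R (P ⊗[R] M)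
  map f := ModuleCat.ofHom (LinearMap.rTensor M (lin f))
  map_id P := by ext1; exact LinearMap.rTensor_id M P
  map_comp f g := by ext1; exact LinearMap.rTensor_comp M (lin g) (lin f)

end RProj

open RProj

/-! ### Extending functors from `R-proj` to flat modules -/

section Extension

variable {R : Type u} [CommRing R] {S : Type u} [CommRing S]

/-- The category `J(V)` of finitely generated projective modules `P` with a map `P → V`. -/
abbrev J (V : Type u) [AddCommGroup V] [Module R V] : Type (u + 1) :=
  CostructuredArrow (incl R) (ModuleCat.of R V)

instance (V : Type u) [AddCommGroup V] [Module R V] :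
    HasColimitsOfShape (J (R := R) V) (ModuleCat.{u} S) :=
  hasColimitsOfShape_of_essentiallySmall.{u} _ _

instance (V : Type u) [AddCommGroup V] [Module R V] :
    HasColimitsOfShape (J (R := R) V) AddCommGrpCat.{u} :=
  hasColimitsOfShape_of_essentiallySmall.{u} _ _

variable (F : RProj R ⥤ ModuleCat.{u} S) (V : Type u) [AddCommGroup V] [Module R V]

/-- The value at `V` of the extension of `F`, the colimit of `F(P)` over `P → V` in `J(V)`.
It is used for flat `V`, when `J(V)` is filtering. -/
noncomputable def Ev : Type u :=
  (colimit (CostructuredArrow.proj (incl R) (ModuleCat.of R V) ⋙ F) : ModuleCat.{u} S)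

noncomputable instance : AddCommGroup (Ev F V) :=
  inferInstanceAs (AddCommGroup
    (colimit (CostructuredArrow.proj (incl R) (ModuleCat.of R V) ⋙ F) : ModuleCat.{u} S))

noncomputable instance : Module S (Ev F V) :=
  inferInstanceAs (Module S
    (colimit (CostructuredArrow.proj (incl R) (ModuleCat.of R V) ⋙ F) : ModuleCat.{u} S))

variable {V}

/-- The class in `F(V)` of an element of `F(P)`, for a map `f : P → V`. -/
noncomputable def cls (P : RProj R) (f : P →ₗ[R] V) : F.obj P →ₗ[S] Ev F V :=
  (colimit.ι (CostructuredArrow.proj (incl R) (ModuleCat.of R V) ⋙ F)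
    (CostructuredArrow.mk (Y := P) (S := incl R) (T := ModuleCat.of R V)
      (ModuleCat.ofHom f))).hom

theorem cls_map {P Q : RProj R} (g : P →ₗ[R] Q) (f : Q →ₗ[R] V) (x : F.obj P) :
    cls F Q f ((F.map (ofLin g)).hom x) = cls F P (f.comp g) x := by
  let j : J (R := R) V := CostructuredArrow.mk (Y := P) (S := incl R) (T := ModuleCat.of R V)
      (ModuleCat.ofHom (f.comp g))
  let k : J (R := R) V := CostructuredArrow.mk (Y := Q) (S := incl R) (T := ModuleCat.of R V)
      (ModuleCat.ofHom f)
  let α : j ⟶ k := CostructuredArrow.homMk (ofLin g) rfl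
  have := colimit.w (CostructuredArrow.proj (incl R) (ModuleCat.of R V) ⋙ F) α
  exact congrArg (fun h => h.hom x) this

/-- The underlying abelian group of `F(V)` is the colimit of the underlying groups. -/
noncomputable def isColimitAdd :=
  isColimitOfPreserves (forget₂ (ModuleCat.{u} S) AddCommGrpCat.{u})
    (colimit.isColimit (CostructuredArrow.proj (incl R) (ModuleCat.of R V) ⋙ F))

theorem ev_addHom_ext {B : Type u} [AddCommGroup B] {g h : Ev F V →+ B}
    (H : ∀ (P : RProj R) (f : P →ₗ[R] V) (x : F.obj P), g (cls F P f x) = h (cls F P f x)) :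
    g = h := by
  have : AddCommGrpCat.ofHom g = AddCommGrpCat.ofHom h := by
    refine (isColimitAdd F (V := V)).hom_ext (fun j => ?_)
    ext x
    exact H j.left j.hom.hom x
  exact congrArg AddCommGrpCat.Hom.hom this

/-- Every element of `F(V)` is a sum of classes. -/
theorem ev_induction {p : Ev F V → Prop} (x : Ev F V)
    (hcls : ∀ (P : RProj R) (f : P →ₗ[R] V) (x : F.obj P), p (cls F P f x))
    (hadd : ∀ x y, p x → p y → p (x + y)) : p x := by
  let Z : AddSubgroup (Ev F V) := AddSubgroup.closure
    {y | ∃ (P : RProj R) (f : P →ₗ[R] V) (x : F.obj P), y = cls F P f x}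
  have hZ : QuotientAddGroup.mk' Z = 0 := by
    refine ev_addHom_ext F (fun P f x => ?_)
    exact (QuotientAddGroup.eq_zero_iff _).2 (AddSubgroup.subset_closure ⟨P, f, x, rfl⟩)
  have hx : x ∈ Z := (QuotientAddGroup.eq_zero_iff _).1 (DFunLike.congr_fun hZ x)
  refine AddSubgroup.closure_induction (p := fun y _ => p y ∧ p (-y)) ?_ ?_ ?_ ?_ hx |>.1
  · rintro y ⟨P, f, x, rfl⟩
    exact ⟨hcls P f x, by rw [← map_neg]; exact hcls P f (-x)⟩
  · have : p 0 := by rw [← map_zero (cls F (RProj.one R) (0 : RProj.one R →ₗ[R] V))]; exact hcls _ _ _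
    exact ⟨this, by simpa using this⟩
  · rintro y z _ _ ⟨h1, h2⟩ ⟨h3, h4⟩
    exact ⟨hadd _ _ h1 h3, by rw [neg_add]; exact hadd _ _ h2 h4⟩
  · rintro y _ ⟨h1, h2⟩
    exact ⟨h2, by simpa using h1⟩

/-- Universal property: additive maps out of `F(V)` are compatible families of additive maps. -/
noncomputable def evLift {B : Type u} [AddCommGroup B]
    (g : ∀ (P : RProj R) (_ : P →ₗ[R] V), F.obj P →+ B)
    (hg : ∀ (P Q : RProj R) (e : P →ₗ[R] Q) (f : Q →ₗ[R] V) (x : F.obj P),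
      g Q f ((F.map (ofLin e)).hom x) = g P (f.comp e) x) : Ev F V →+ B :=
  ((isColimitAdd F (V := V)).desc
    { pt := AddCommGrpCat.of B
      ι :=
        { app := fun j => AddCommGrpCat.ofHom (g j.left j.hom.hom)
          naturality := fun j k α => by
            ext x
            have h := hg j.left k.left (lin α.left) k.hom.hom x
            have e : (k.hom.hom).comp (lin α.left) = j.hom.hom :=
              congrArg ModuleCat.Hom.hom (CostructuredArrow.w α)
            exact h.trans (congrArg (fun w : j.left →ₗ[R] V => g j.left w x) e) } }).hom

theorem evLift_cls {B : Type u} [AddCommGroup B]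
    (g : ∀ (P : RProj R) (_ : P →ₗ[R] V), F.obj P →+ B)
    (hg : ∀ (P Q : RProj R) (e : P →ₗ[R] Q) (f : Q →ₗ[R] V) (x : F.obj P),
      g Q f ((F.map (ofLin e)).hom x) = g P (f.comp e) x)
    (P : RProj R) (f : P →ₗ[R] V) (x : F.obj P) : evLift F g hg (cls F P f x) = g P f x :=
  DFunLike.congr_fun (congrArg AddCommGrpCat.Hom.hom ((isColimitAdd F (V := V)).fac _
    (CostructuredArrow.mk (Y := P) (S := incl R) (T := ModuleCat.of R V) (ModuleCat.ofHom f)))) x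

/-- Universal property: `S`-linear maps out of `F(V)` are compatible families of linear maps. -/
noncomputable def evLiftLin {B : Type u} [AddCommGroup B] [Module S B]
    (g : ∀ (P : RProj R) (_ : P →ₗ[R] V), F.obj P →ₗ[S] B)
    (hg : ∀ (P Q : RProj R) (e : P →ₗ[R] Q) (f : Q →ₗ[R] V) (x : F.obj P),
      g Q f ((F.map (ofLin e)).hom x) = g P (f.comp e) x) : Ev F V →ₗ[S] B :=
  let l := evLift F (fun P f => (g P f).toAddMonoidHom) hg
  { toFun := l
    map_add' := map_add l
    map_smul' := fun s x => by
      induction x using ev_induction F with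
      | hadd x y hx hy => rw [smul_add, map_add, map_add, smul_add, hx, hy]
      | hcls P f x =>
        have h : ∀ y, l (cls F P f y) = g P f y := evLift_cls F _ hg P f
        rw [← map_smul, h, h, map_smul, RingHom.id_apply] }

theorem evLiftLin_cls {B : Type u} [AddCommGroup B] [Module S B]
    (g : ∀ (P : RProj R) (_ : P →ₗ[R] V), F.obj P →ₗ[S] B)
    (hg : ∀ (P Q : RProj R) (e : P →ₗ[R] Q) (f : Q →ₗ[R] V) (x : F.obj P),
      g Q f ((F.map (ofLin e)).hom x) = g P (f.comp e) x)
    (P : RProj R) (f : P →ₗ[R] V) (x : F.obj P) : evLiftLin F g hg (cls F P f x) = g P f x :=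
  evLift_cls F (fun P f => (g P f).toAddMonoidHom) hg P f x

end Extension

/-! ### Multiplicative structures on functors -/

section Multiplication

variable {R : Type u} [CommRing R] {S : Type u} [CommRing S]

/-- The map `F(P) → F(Q)` induced by a linear map `P → Q`. -/
def fmap (F : RProj R ⥤ ModuleCat.{u} S) {P Q : RProj R} (f : P →ₗ[R] Q) :
    F.obj P →ₗ[S] F.obj Q :=
  (F.map (ofLin f)).hom

/-- Functorial maps `F(P) ⊗ G(Q) → H(P ⊗ Q)`, written as bilinear maps. -/
structure Pairing (F G H : RProj R ⥤ ModuleCat.{u} S) where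
  app : ∀ P Q : RProj R, F.obj P →ₗ[S] G.obj Q →ₗ[S] H.obj (tensor P Q)
  natural : ∀ {P P' Q Q' : RProj R} (f : P →ₗ[R] P') (g : Q →ₗ[R] Q') (x : F.obj P) (y : G.obj Q),
    app P' Q' (fmap F f x) (fmap G g y) =
      fmap H (P := tensor P Q) (Q := tensor P' Q') (TensorProduct.map f g) (app P Q x y)

/-- The associativity constraint of `R-proj`. -/
def assocMap (P Q T : RProj R) : tensor (tensor P Q) T →ₗ[R] tensor P (tensor Q T) :=
  (TensorProduct.assoc R P Q T).toLinearMap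

/-- The left unit constraint of `R-proj`. -/
def lidMap (P : RProj R) : tensor (RProj.one R) P →ₗ[R] P := (TensorProduct.lid R P).toLinearMap

/-- The right unit constraint of `R-proj`. -/
def ridMap (P : RProj R) : tensor P (RProj.one R) →ₗ[R] P := (TensorProduct.rid R P).toLinearMap

/-- Associativity of a quadruple of pairings: `(x y) z = x (y z)`. -/
def PairAssoc {F G H K L N : RProj R ⥤ ModuleCat.{u} S} (p₁ : Pairing F G K) (p₂ : Pairing K H N)
    (p₃ : Pairing G H L) (p₄ : Pairing F L N) : Prop :=
  ∀ (P Q T : RProj R) (x : F.obj P) (y : G.obj Q) (z : H.obj T),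
    fmap N (assocMap P Q T) (p₂.app _ _ (p₁.app _ _ x y) z) = p₄.app _ _ x (p₃.app _ _ y z)

/-- A multiplicative structure on a functor `F : R-proj → S-mod`: a unit `S → F(R)` (given by the
image of `1`) and an associative unital functorial product `F(P) ⊗ F(Q) → F(P ⊗ Q)`. -/
structure MulStr (F : RProj R ⥤ ModuleCat.{u} S) where
  one : F.obj (RProj.one R)
  mul : Pairing F F F
  assoc : PairAssoc mul mul mul mul
  one_mul : ∀ (P : RProj R) (x : F.obj P), fmap F (lidMap P) (mul.app _ _ one x) = x
  mul_one : ∀ (P : RProj R) (x : F.obj P), fmap F (ridMap P) (mul.app _ _ x one) = x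

/-- The extension of a pairing: a bilinear map `V × W → U` gives `F(V) × G(W) → H(U)`. -/
noncomputable def pairExt {F G H : RProj R ⥤ ModuleCat.{u} S} (p : Pairing F G H)
    {V W U : Type u} [AddCommGroup V] [Module R V] [AddCommGroup W] [Module R W]
    [AddCommGroup U] [Module R U] (β : V →ₗ[R] W →ₗ[R] U) : Ev F V →+ Ev G W →+ Ev H U :=
  evLift F (fun P f => AddMonoidHom.mk' (fun x =>
    evLift G (fun Q g => ((cls H (tensor P Q) (TensorProduct.lift β ∘ₗ TensorProduct.map f g)) ∘ₗ
        (p.app P Q x)).toAddMonoidHom)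
      (fun Q Q' e g y => by
        have h := p.natural (LinearMap.id : P →ₗ[R] P) e x y
        have h' : fmap F (LinearMap.id : P →ₗ[R] P) x = x :=
          congrArg (fun k => k.hom x) (F.map_id P)
        rw [h'] at h
        change cls H _ _ (p.app P Q' x (fmap G e y)) = cls H _ _ (p.app P Q x y)
        rw [h]
        refine (cls_map H (P := tensor P Q) (Q := tensor P Q') _ _ _).trans ?_
        congr 2
        exact TensorProduct.ext' (fun _ _ => rfl)))
    (fun x x' => by
      refine ev_addHom_ext G (fun Q g y => ?_)
      simp only [AddMonoidHom.add_apply, evLift_cls]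
      change cls H _ _ (p.app P Q (x + x') y) =
        cls H _ _ (p.app P Q x y) + cls H _ _ (p.app P Q x' y)
      rw [map_add, LinearMap.add_apply, map_add]))
    (fun P P' e f x => by
      refine ev_addHom_ext G (fun Q g y => ?_)
      simp only [AddMonoidHom.mk'_apply, evLift_cls]
      have h := p.natural e (LinearMap.id : Q →ₗ[R] Q) x y
      have h' : fmap G (LinearMap.id : Q →ₗ[R] Q) y = y :=
        congrArg (fun k => k.hom y) (G.map_id Q)
      rw [h'] at h
      change cls H _ _ (p.app P' Q (fmap F e x) y) = cls H _ _ (p.app P Q x y)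
      rw [h]
      refine (cls_map H (P := tensor P Q) (Q := tensor P' Q) _ _ _).trans ?_
      congr 2
      exact TensorProduct.ext' (fun _ _ => rfl))

theorem pairExt_cls {F G H : RProj R ⥤ ModuleCat.{u} S} (p : Pairing F G H)
    {V W U : Type u} [AddCommGroup V] [Module R V] [AddCommGroup W] [Module R W]
    [AddCommGroup U] [Module R U] (β : V →ₗ[R] W →ₗ[R] U)
    (P : RProj R) (f : P →ₗ[R] V) (x : F.obj P) (Q : RProj R) (g : Q →ₗ[R] W) (y : G.obj Q) :
    pairExt p β (cls F P f x) (cls G Q g y) =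
      cls H (tensor P Q) (TensorProduct.lift β ∘ₗ TensorProduct.map f g) (p.app P Q x y) := by
  simp only [pairExt, evLift_cls, AddMonoidHom.mk'_apply]
  rfl

theorem pairExt_smul_left {F G H : RProj R ⥤ ModuleCat.{u} S} (p : Pairing F G H)
    {V W U : Type u} [AddCommGroup V] [Module R V] [AddCommGroup W] [Module R W]
    [AddCommGroup U] [Module R U] (β : V →ₗ[R] W →ₗ[R] U) (s : S) (x : Ev F V) (y : Ev G W) :
    pairExt p β (s • x) y = s • pairExt p β x y := by
  induction x using ev_induction F with
  | hadd x x' hx hx' => rw [smul_add, map_add, map_add, AddMonoidHom.add_apply,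
      AddMonoidHom.add_apply, hx, hx', smul_add]
  | hcls P f x =>
    induction y using ev_induction G with
    | hadd y y' hy hy' => rw [map_add, map_add, hy, hy', smul_add]
    | hcls Q g y => rw [← map_smul, pairExt_cls, pairExt_cls, map_smul, LinearMap.smul_apply,
        map_smul]

theorem pairExt_smul_right {F G H : RProj R ⥤ ModuleCat.{u} S} (p : Pairing F G H)
    {V W U : Type u} [AddCommGroup V] [Module R V] [AddCommGroup W] [Module R W]
    [AddCommGroup U] [Module R U] (β : V →ₗ[R] W →ₗ[R] U) (s : S) (x : Ev F V) (y : Ev G W) :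
    pairExt p β x (s • y) = s • pairExt p β x y := by
  induction x using ev_induction F with
  | hadd x x' hx hx' => rw [map_add, AddMonoidHom.add_apply, AddMonoidHom.add_apply, hx, hx',
      smul_add]
  | hcls P f x =>
    induction y using ev_induction G with
    | hadd y y' hy hy' => rw [smul_add, map_add, map_add, hy, hy', smul_add]
    | hcls Q g y => rw [← map_smul, pairExt_cls, pairExt_cls, map_smul, map_smul]

variable (A : Type u) [Ring A] [Algebra R A]

theorem pairExt_assoc {F G H K L N : RProj R ⥤ ModuleCat.{u} S} {p₁ : Pairing F G K}
    {p₂ : Pairing K H N} {p₃ : Pairing G H L} {p₄ : Pairing F L N} (h : PairAssoc p₁ p₂ p₃ p₄)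
    (x : Ev F A) (y : Ev G A) (z : Ev H A) :
    pairExt p₂ (LinearMap.mul R A) (pairExt p₁ (LinearMap.mul R A) x y) z =
      pairExt p₄ (LinearMap.mul R A) x (pairExt p₃ (LinearMap.mul R A) y z) := by
  induction x using ev_induction F with
  | hadd x x' hx hx' => simp only [map_add, AddMonoidHom.add_apply, hx, hx']
  | hcls P f x =>
    induction y using ev_induction G with
    | hadd y y' hy hy' => simp only [map_add, AddMonoidHom.add_apply, hy, hy']
    | hcls Q g y =>
      induction z using ev_induction H with
      | hadd z z' hz hz' => simp only [map_add, hz, hz']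
      | hcls T k z =>
        rw [pairExt_cls, pairExt_cls, pairExt_cls, pairExt_cls, ← h]
        refine Eq.trans ?_ (cls_map N (P := tensor (tensor P Q) T) (Q := tensor P (tensor Q T))
          (assocMap P Q T) _ _).symm
        congr 2
        refine TensorProduct.ext_threefold (fun a b c => ?_)
        change (f a * g b) * k c = f a * (g b * k c)
        exact mul_assoc _ _ _

/-- The map `R → A` sending `1` to `1`. -/
def unitMap : RProj.one R →ₗ[R] A := Algebra.linearMap R A

theorem pairExt_one_left {F G : RProj R ⥤ ModuleCat.{u} S} (p : Pairing F G G)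
    (e : F.obj (RProj.one R))
    (h : ∀ (P : RProj R) (x : G.obj P), fmap G (lidMap P) (p.app _ _ e x) = x) (x : Ev G A) :
    pairExt p (LinearMap.mul R A) (cls F _ (unitMap A) e) x = x := by
  induction x using ev_induction G with
  | hadd x x' hx hx' => simp only [map_add, hx, hx']
  | hcls P f x =>
    rw [pairExt_cls]
    conv_rhs => rw [← h P x]
    refine Eq.trans ?_ (cls_map G (P := tensor (RProj.one R) P) (lidMap P) f _).symm
    congr 2
    refine TensorProduct.ext' (fun a b => ?_)
    change (algebraMap R A a) * f b = f ((TensorProduct.lid R P) (a ⊗ₜ b))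
    erw [TensorProduct.lid_tmul, map_smul, Algebra.smul_def]

theorem pairExt_one_right {F G : RProj R ⥤ ModuleCat.{u} S} (p : Pairing G F G)
    (e : F.obj (RProj.one R))
    (h : ∀ (P : RProj R) (x : G.obj P), fmap G (ridMap P) (p.app _ _ x e) = x) (x : Ev G A) :
    pairExt p (LinearMap.mul R A) x (cls F _ (unitMap A) e) = x := by
  induction x using ev_induction G with
  | hadd x x' hx hx' => simp only [map_add, AddMonoidHom.add_apply, hx, hx']
  | hcls P f x =>
    rw [pairExt_cls]
    conv_rhs => rw [← h P x]
    refine Eq.trans ?_ (cls_map G (P := tensor P (RProj.one R)) (ridMap P) f _).symm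
    congr 2
    refine TensorProduct.ext' (fun b a => ?_)
    change f b * (algebraMap R A a) = f ((TensorProduct.rid R P) (b ⊗ₜ a))
    erw [TensorProduct.rid_tmul, map_smul, Algebra.smul_def, Algebra.commutes]

variable {F : RProj R ⥤ ModuleCat.{u} S} (μ : MulStr F)


/-- For a multiplicative functor `F` and an `R`-algebra `A`, the ring `F(A)`. -/
@[reducible] noncomputable def evRing : Ring (Ev F A) :=
  { (inferInstance : AddCommGroup (Ev F A)) with
    mul := fun x y => pairExt μ.mul (LinearMap.mul R A) x y
    one := cls F _ (unitMap A) μ.one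
    mul_assoc := fun x y z => pairExt_assoc A μ.assoc x y z
    one_mul := fun x => pairExt_one_left A μ.mul μ.one μ.one_mul x
    mul_one := fun x => pairExt_one_right A μ.mul μ.one μ.mul_one x
    left_distrib := fun x y z => map_add (pairExt μ.mul (LinearMap.mul R A) x) y z
    right_distrib := fun x y z => by
      change pairExt μ.mul (LinearMap.mul R A) (x + y) z = _
      rw [map_add]; rfl
    zero_mul := fun x => by
      change pairExt μ.mul (LinearMap.mul R A) 0 x = 0
      rw [map_zero]; rfl
    mul_zero := fun x => map_zero (pairExt μ.mul (LinearMap.mul R A) x) }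

/-- The `S`-algebra structure on `F(A)`. -/
@[reducible] noncomputable def evAlgebra :
    letI := evRing A μ
    Algebra S (Ev F A) :=
  letI := evRing A μ
  Algebra.ofModule (fun s x y => pairExt_smul_left μ.mul (LinearMap.mul R A) s x y)
    (fun s x y => pairExt_smul_right μ.mul (LinearMap.mul R A) s x y)

end Multiplication

/-- The generator of the free module of rank one. -/
def oneElt (R : Type u) [CommRing R] : RProj.one R := (1 : R)

/-- The map `R → V` sending `1` to `v`. -/
def oneMap {R : Type u} [CommRing R] {V : Type u} [AddCommGroup V] [Module R V] (v : V) :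
    RProj.one R →ₗ[R] V := LinearMap.toSpanSingleton R V v

theorem oneMap_oneElt {R : Type u} [CommRing R] {V : Type u} [AddCommGroup V] [Module R V] (v : V) :
    oneMap v (oneElt R) = v := one_smul R v

theorem oneMap_comp {R : Type u} [CommRing R] {V W : Type u} [AddCommGroup V] [Module R V]
    [AddCommGroup W] [Module R W] (f : V →ₗ[R] W) (v : V) :
    oneMap (f v) = f.comp (oneMap (R := R) v) :=
  LinearMap.ext (fun r : R => (map_smul f r v).symm)

/-! ### Elementary extensions of `R` by `M` -/

section ElementaryExtensions

variable (R : Type u) [CommRing R] (M : Type u) [AddCommGroup M] [Module R M]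

/-- An elementary extension `0 → I(M) → C₁ → C₀ → I → 0` of `R` by the diagonal bimodule `M` in the
abelian category of pointed functors `R-proj → R-mod` (where exactness is pointwise). -/
structure ElemExt where
  C₁ : RProj R ⥤ ModuleCat.{u} R
  C₀ : RProj R ⥤ ModuleCat.{u} R
  pointed₁ : ∀ P : RProj R, Subsingleton P → Subsingleton (C₁.obj P)
  pointed₀ : ∀ P : RProj R, Subsingleton P → Subsingleton (C₀.obj P)
  b : tensorRight R M ⟶ C₁
  d : C₁ ⟶ C₀
  a : C₀ ⟶ incl R
  b_injective : ∀ P, Function.Injective (b.app P).hom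
  exact_b_d : ∀ P, Function.Exact (b.app P).hom (d.app P).hom
  exact_d_a : ∀ P, Function.Exact (d.app P).hom (a.app P).hom
  a_surjective : ∀ P, Function.Surjective (a.app P).hom

variable {R M}

namespace ElemExt

variable (φ : ElemExt R M)

/-- The component at `P` of `I(M) → C₁`. -/
def bAt (P : RProj R) : P ⊗[R] M →ₗ[R] φ.C₁.obj P := (φ.b.app P).hom

/-- The component at `P` of the differential. -/
def dAt (P : RProj R) : φ.C₁.obj P →ₗ[R] φ.C₀.obj P := (φ.d.app P).hom

/-- The component at `P` of the augmentation. -/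
def aAt (P : RProj R) : φ.C₀.obj P →ₗ[R] P := (φ.a.app P).hom

theorem bAt_natural {P Q : RProj R} (f : P →ₗ[R] Q) (x : P ⊗[R] M) :
    fmap φ.C₁ f (φ.bAt P x) = φ.bAt Q (LinearMap.rTensor M f x) :=
  (congrArg (fun h => h.hom x) (φ.b.naturality (ofLin f))).symm

theorem dAt_natural {P Q : RProj R} (f : P →ₗ[R] Q) (x : φ.C₁.obj P) :
    fmap φ.C₀ f (φ.dAt P x) = φ.dAt Q (fmap φ.C₁ f x) :=
  (congrArg (fun h => h.hom x) (φ.d.naturality (ofLin f))).symm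

theorem aAt_natural {P Q : RProj R} (f : P →ₗ[R] Q) (x : φ.C₀.obj P) :
    f (φ.aAt P x) = φ.aAt Q (fmap φ.C₀ f x) :=
  (congrArg (fun h => h.hom x) (φ.a.naturality (ofLin f))).symm

theorem aAt_dAt (P : RProj R) (x : φ.C₁.obj P) : φ.aAt P (φ.dAt P x) = 0 :=
  (φ.exact_d_a P _).2 ⟨x, rfl⟩

variable (V : Type u) [AddCommGroup V] [Module R V]

/-- The differential `C₁(V) → C₀(V)`. -/
noncomputable def dEv : Ev φ.C₁ V →ₗ[R] Ev φ.C₀ V :=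
  evLiftLin φ.C₁ (fun P f => cls φ.C₀ P f ∘ₗ φ.dAt P) (fun P Q e f x => by
    change cls φ.C₀ Q f (φ.dAt Q (fmap φ.C₁ e x)) = cls φ.C₀ P (f.comp e) (φ.dAt P x)
    rw [← dAt_natural]
    exact cls_map φ.C₀ e f _)

theorem dEv_cls (P : RProj R) (f : P →ₗ[R] V) (x : φ.C₁.obj P) :
    φ.dEv V (cls φ.C₁ P f x) = cls φ.C₀ P f (φ.dAt P x) :=
  evLiftLin_cls φ.C₁ _ _ P f x

/-- The augmentation `C₀(V) → V`. -/
noncomputable def aEv : Ev φ.C₀ V →ₗ[R] V :=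
  evLiftLin φ.C₀ (fun P f => f ∘ₗ φ.aAt P) (fun P Q e f x => by
    change f (φ.aAt Q (fmap φ.C₀ e x)) = f (e (φ.aAt P x))
    rw [← aAt_natural])

theorem aEv_cls (P : RProj R) (f : P →ₗ[R] V) (x : φ.C₀.obj P) :
    φ.aEv V (cls φ.C₀ P f x) = f (φ.aAt P x) :=
  evLiftLin_cls φ.C₀ _ _ P f x

theorem aEv_dEv (x : Ev φ.C₁ V) : φ.aEv V (φ.dEv V x) = 0 := by
  induction x using ev_induction φ.C₁ with
  | hadd x y hx hy => rw [map_add, map_add, hx, hy, add_zero]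
  | hcls P f x => rw [dEv_cls, aEv_cls, aAt_dAt, map_zero]

/-- The value on `v ⊗ m` of the map `V ⊗ M → C₁(V)`: the class of `b(1 ⊗ m)` for `v : R → V`. -/
noncomputable def bPre (v : V) (m : M) : Ev φ.C₁ V :=
  cls φ.C₁ (RProj.one R) (oneMap v) (φ.bAt (RProj.one R) (oneElt R ⊗ₜ m))

variable {V} in
theorem bPre_apply (P : RProj R) (f : P →ₗ[R] V) (p : P) (m : M) :
    φ.bPre V (f p) m = cls φ.C₁ P f (φ.bAt P (p ⊗ₜ m)) := by
  have h : oneMap (f p) = f.comp (oneMap p) := oneMap_comp f p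
  rw [bPre, h, ← cls_map]
  congr 1
  refine (bAt_natural φ _ _).trans ?_
  rw [LinearMap.rTensor_tmul, oneMap_oneElt]

/-- The map `V ⊗ M → C₁(V)` induced by `b`; it sends `f(p) ⊗ m`, for `f : P → V`, to the class of
`b(p ⊗ m)`. -/
noncomputable def bEv : V ⊗[R] M →ₗ[R] Ev φ.C₁ V :=
  TensorProduct.lift <| LinearMap.mk₂ R (fun v m => φ.bPre V v m)
    (fun v₁ v₂ m => by
      let f : two R →ₗ[R] V :=
        (LinearMap.toSpanSingleton R V v₁).coprod (LinearMap.toSpanSingleton R V v₂)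
      let e₁ : two R := ((1, 0) : R × R)
      let e₂ : two R := ((0, 1) : R × R)
      have h₁ : v₁ = f e₁ := by
        change v₁ = (1 : R) • v₁ + (0 : R) • v₂
        rw [one_smul, zero_smul, add_zero]
      have h₂ : v₂ = f e₂ := by
        change v₂ = (0 : R) • v₁ + (1 : R) • v₂
        rw [one_smul, zero_smul, zero_add]
      have h₃ : φ.bPre V (v₁ + v₂) m = φ.bPre V (f (e₁ + e₂)) m := by rw [map_add, ← h₁, ← h₂]
      rw [h₃, bPre_apply, TensorProduct.add_tmul, map_add, map_add, ← bPre_apply, ← bPre_apply,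
        ← h₁, ← h₂])
    (fun r v m => by
      have h : v = oneMap v (oneElt R) := (oneMap_oneElt v).symm
      have h' : φ.bPre V (r • v) m = φ.bPre V (oneMap v (r • oneElt R)) m := by
        rw [map_smul, ← h]
      rw [h', bPre_apply, ← TensorProduct.smul_tmul', map_smul, map_smul, ← bPre_apply, ← h])
    (fun v m₁ m₂ => by simp only [bPre, TensorProduct.tmul_add, map_add])
    (fun r v m => by simp only [bPre, TensorProduct.tmul_smul, map_smul])

theorem bEv_tmul (v : V) (m : M) : φ.bEv V (v ⊗ₜ m) = φ.bPre V v m := rfl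

theorem dEv_bEv (x : V ⊗[R] M) : φ.dEv V (φ.bEv V x) = 0 := by
  induction x with
  | zero => simp
  | add x y hx hy => rw [map_add, map_add, hx, hy, add_zero]
  | tmul v m =>
    rw [bEv_tmul, bPre, dEv_cls]
    have : φ.dAt (RProj.one R) (φ.bAt (RProj.one R) (oneElt R ⊗ₜ m)) = 0 :=
      (φ.exact_b_d (RProj.one R) _).2 ⟨_, rfl⟩
    rw [this, map_zero]

end ElemExt

variable (R M) in
/-- A multiplicative elementary extension of `R` by `M`: the complex `C₁ → C₀` is a DG algebra
object (there are no products `C₁ ⊗ C₁`, since these land in degree two) and `a` is multiplicative.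
The axiom `leibniz` is the Leibniz rule for the product of two elements of degree one. -/
structure MulExt extends ElemExt R M where
  m₀₀ : MulStr C₀
  m₀₁ : Pairing C₀ C₁ C₁
  m₁₀ : Pairing C₁ C₀ C₁
  assoc₀₀₁ : PairAssoc m₀₀.mul m₀₁ m₀₁ m₀₁
  assoc₀₁₀ : PairAssoc m₀₁ m₁₀ m₁₀ m₀₁
  assoc₁₀₀ : PairAssoc m₁₀ m₁₀ m₀₀.mul m₁₀
  one_act : ∀ (P : RProj R) (c : C₁.obj P), fmap C₁ (lidMap P) (m₀₁.app _ _ m₀₀.one c) = c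
  act_one : ∀ (P : RProj R) (c : C₁.obj P), fmap C₁ (ridMap P) (m₁₀.app _ _ c m₀₀.one) = c
  d_m₀₁ : ∀ (P Q : RProj R) (x : C₀.obj P) (c : C₁.obj Q),
    toElemExt.dAt (tensor P Q) (m₀₁.app P Q x c) = m₀₀.mul.app P Q x (toElemExt.dAt Q c)
  d_m₁₀ : ∀ (P Q : RProj R) (c : C₁.obj P) (x : C₀.obj Q),
    toElemExt.dAt (tensor P Q) (m₁₀.app P Q c x) = m₀₀.mul.app P Q (toElemExt.dAt P c) x
  leibniz : ∀ (P Q : RProj R) (c : C₁.obj P) (c' : C₁.obj Q),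
    m₀₁.app P Q (toElemExt.dAt P c) c' = m₁₀.app P Q c (toElemExt.dAt Q c')
  a_one : toElemExt.aAt (RProj.one R) m₀₀.one = (1 : R)
  a_mul : ∀ (P Q : RProj R) (x : C₀.obj P) (y : C₀.obj Q),
    toElemExt.aAt (tensor P Q) (m₀₀.mul.app P Q x y) =
      (toElemExt.aAt P x) ⊗ₜ[R] (toElemExt.aAt Q y)

end ElementaryExtensions

/-! ### Multiplicative elementary extensions of an algebra -/

section DGExtensions

open MulOpposite

attribute [local instance] TensorProduct.Algebra.module

/-- The enveloping algebra `A ⊗ Aᵒᵖ`; its left modules are the `R`-linear `A`-bimodules. -/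
abbrev Env (R : Type u) [CommRing R] (A : Type u) [Ring A] [Algebra R A] : Type u :=
  A ⊗[R] Aᵐᵒᵖ

/-- A DG algebra over `R` concentrated in degrees `0` and `1`, with maps `a : C → A` (of algebras)
and `b : N[1] → C`, where `N` is an `A`-bimodule. -/
structure DGExt (R : Type u) [CommRing R] (A : Type u) [Ring A] [Algebra R A]
    (N : Type u) [AddCommGroup N] where
  C₀ : Type u
  [ring : Ring C₀]
  [algebra : Algebra R C₀]
  C₁ : Type u
  [addCommGroup : AddCommGroup C₁]
  [module : Module R C₁]
  d : C₁ →ₗ[R] C₀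
  a : C₀ →ₐ[R] A
  b : N →+ C₁
  lmul : C₀ →ₗ[R] C₁ →ₗ[R] C₁
  rmul : C₁ →ₗ[R] C₀ →ₗ[R] C₁
  one_lmul : ∀ c, lmul 1 c = c
  rmul_one : ∀ c, rmul c 1 = c
  mul_lmul : ∀ x y c, lmul (x * y) c = lmul x (lmul y c)
  rmul_mul : ∀ c x y, rmul c (x * y) = rmul (rmul c x) y
  lmul_rmul : ∀ x c y, rmul (lmul x c) y = lmul x (rmul c y)
  d_lmul : ∀ x c, d (lmul x c) = x * d c
  d_rmul : ∀ c x, d (rmul c x) = d c * x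
  leibniz : ∀ c c', lmul (d c) c' = rmul c (d c')

attribute [instance] DGExt.ring DGExt.algebra DGExt.addCommGroup DGExt.module

/-- The DG algebra `C` is a multiplicative elementary extension of `A` by the bimodule `N`, that is,
`0 → N → C₁ → C₀ → A → 0` is exact; the bimodule structure on `N` is the one induced by `C`. -/
structure DGExt.IsElementary {R : Type u} [CommRing R] {A : Type u} [Ring A] [Algebra R A]
    {N : Type u} [AddCommGroup N] [Module (Env R A) N] (C : DGExt R A N) : Prop where
  b_injective : Function.Injective C.b
  exact_b_d : Function.Exact C.b C.d
  exact_d_a : Function.Exact C.d C.a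
  a_surjective : Function.Surjective C.a
  lmul_b : ∀ x n, C.lmul x (C.b n) = C.b ((C.a x ⊗ₜ[R] (1 : Aᵐᵒᵖ) : Env R A) • n)
  rmul_b : ∀ n x, C.rmul (C.b n) x = C.b (((1 : A) ⊗ₜ[R] op (C.a x) : Env R A) • n)

variable {R : Type u} [CommRing R] {M : Type u} [AddCommGroup M] [Module R M]

namespace MulExt

variable (φ : MulExt R M) (A : Type u) [Ring A] [Algebra R A]

theorem aEv_mul (x y : Ev φ.C₀ A) :
    φ.aEv A (pairExt φ.m₀₀.mul (LinearMap.mul R A) x y) = φ.aEv A x * φ.aEv A y := by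
  induction x using ev_induction φ.C₀ with
  | hadd x x' hx hx' => simp only [map_add, AddMonoidHom.add_apply, hx, hx', add_mul]
  | hcls P f x =>
    induction y using ev_induction φ.C₀ with
    | hadd y y' hy hy' => simp only [map_add, hy, hy', mul_add]
    | hcls Q g y =>
      rw [pairExt_cls, ElemExt.aEv_cls, φ.a_mul, ElemExt.aEv_cls, ElemExt.aEv_cls]
      rfl

theorem dEv_m₀₁ (x : Ev φ.C₀ A) (c : Ev φ.C₁ A) :
    φ.dEv A (pairExt φ.m₀₁ (LinearMap.mul R A) x c) =
      pairExt φ.m₀₀.mul (LinearMap.mul R A) x (φ.dEv A c) := by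
  induction x using ev_induction φ.C₀ with
  | hadd x x' hx hx' => simp only [map_add, AddMonoidHom.add_apply, hx, hx']
  | hcls P f x =>
    induction c using ev_induction φ.C₁ with
    | hadd y y' hy hy' => simp only [map_add, hy, hy']
    | hcls Q g y =>
      rw [pairExt_cls, ElemExt.dEv_cls, φ.d_m₀₁, ElemExt.dEv_cls, pairExt_cls]

theorem dEv_m₁₀ (c : Ev φ.C₁ A) (x : Ev φ.C₀ A) :
    φ.dEv A (pairExt φ.m₁₀ (LinearMap.mul R A) c x) =
      pairExt φ.m₀₀.mul (LinearMap.mul R A) (φ.dEv A c) x := by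
  induction c using ev_induction φ.C₁ with
  | hadd y y' hy hy' => simp only [map_add, AddMonoidHom.add_apply, hy, hy']
  | hcls P f c =>
    induction x using ev_induction φ.C₀ with
    | hadd x x' hx hx' => simp only [map_add, hx, hx']
    | hcls Q g y =>
      rw [pairExt_cls, ElemExt.dEv_cls, φ.d_m₁₀, ElemExt.dEv_cls, pairExt_cls]

theorem leibnizEv (c c' : Ev φ.C₁ A) :
    pairExt φ.m₀₁ (LinearMap.mul R A) (φ.dEv A c) c' =
      pairExt φ.m₁₀ (LinearMap.mul R A) c (φ.dEv A c') := by
  induction c using ev_induction φ.C₁ with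
  | hadd y y' hy hy' => simp only [map_add, AddMonoidHom.add_apply, hy, hy']
  | hcls P f c =>
    induction c' using ev_induction φ.C₁ with
    | hadd x x' hx hx' => simp only [map_add, hx, hx']
    | hcls Q g y =>
      rw [ElemExt.dEv_cls, pairExt_cls, φ.leibniz, ElemExt.dEv_cls, pairExt_cls]

theorem aEv_one : φ.aEv A (cls φ.C₀ _ (unitMap A) φ.m₀₀.one) = 1 := by
  rw [ElemExt.aEv_cls, φ.a_one]
  exact (algebraMap R A).map_one

/-- A biadditive map compatible with scalars on both sides, as a bilinear map. -/
def toBilin {X Y Z : Type u} [AddCommGroup X] [Module R X] [AddCommGroup Y] [Module R Y]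
    [AddCommGroup Z] [Module R Z] (f : X →+ Y →+ Z) (h₁ : ∀ (r : R) x y, f (r • x) y = r • f x y)
    (h₂ : ∀ (r : R) x y, f x (r • y) = r • f x y) : X →ₗ[R] Y →ₗ[R] Z :=
  LinearMap.mk₂ R (fun x y => f x y) (fun x x' y => by rw [map_add, AddMonoidHom.add_apply]) h₁
    (fun x y y' => map_add _ _ _) h₂

/-- For an `R`-algebra `A`, the DG algebra `C(A)`, with its maps to `A` and from `(A ⊗ M)[1]`. -/
noncomputable def eval : DGExt R A (A ⊗[R] M) where
  C₀ := Ev φ.C₀ A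
  ring := evRing A φ.m₀₀
  algebra := evAlgebra A φ.m₀₀
  C₁ := Ev φ.C₁ A
  d := φ.dEv A
  a :=
    letI := evRing A φ.m₀₀
    letI := evAlgebra A φ.m₀₀
    AlgHom.ofLinearMap (φ.aEv A) (φ.aEv_one A) (φ.aEv_mul A)
  b := (φ.bEv A).toAddMonoidHom
  lmul := toBilin (pairExt φ.m₀₁ (LinearMap.mul R A)) (pairExt_smul_left _ _)
    (pairExt_smul_right _ _)
  rmul := toBilin (pairExt φ.m₁₀ (LinearMap.mul R A)) (pairExt_smul_left _ _)
    (pairExt_smul_right _ _)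
  one_lmul := pairExt_one_left A φ.m₀₁ φ.m₀₀.one φ.one_act
  rmul_one := pairExt_one_right A φ.m₁₀ φ.m₀₀.one φ.act_one
  mul_lmul := pairExt_assoc A φ.assoc₀₀₁
  rmul_mul := fun c x y => (pairExt_assoc A φ.assoc₁₀₀ c x y).symm
  lmul_rmul := pairExt_assoc A φ.assoc₀₁₀
  d_lmul := φ.dEv_m₀₁ A
  d_rmul := φ.dEv_m₁₀ A
  leibniz := φ.leibnizEv A

end MulExt

end DGExtensions

/-! ### Square-zero extensions and their correspondence with elementary extensions -/

section SquareZero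

/-- `R'` is a (commutative) square-zero extension of `R` by the diagonal bimodule `M`, with
projection `q = algebraMap R' R` and inclusion `i`. -/
structure SqZero (R M R' : Type u) [CommRing R] [AddCommGroup M] [Module R M] [CommRing R']
    [Algebra R' R] where
  i : M →+ R'
  i_injective : Function.Injective i
  q_surjective : Function.Surjective (algebraMap R' R)
  exact : Function.Exact i (algebraMap R' R)
  mul_i : ∀ (r : R') (m : M), r * i m = i (algebraMap R' R r • m)

variable {R : Type u} [CommRing R] {M : Type u} [AddCommGroup M] [Module R M]

/-- A splitting `⟨C₀₁, c₀, c₁⟩` of the elementary extension of functors `R-proj → Ab` underlying an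
elementary extension of `R` by `M`. The square formed by `c₁`, `c₀`, `C₁ → Im d` and `Im d ⊂ C₀` is
cartesian, and `c₀` is surjective. -/
structure ZSplitting (φ : ElemExt R M) where
  C₀₁ : RProj R ⥤ AddCommGrpCat.{u}
  c₁ : ∀ P : RProj R, φ.C₁.obj P →+ C₀₁.obj P
  c₀ : ∀ P : RProj R, C₀₁.obj P →+ φ.C₀.obj P
  c₁_natural : ∀ {P Q : RProj R} (f : P →ₗ[R] Q) (c : φ.C₁.obj P),
    (C₀₁.map (ofLin f)).hom (c₁ P c) = c₁ Q (fmap φ.C₁ f c)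
  c₀_natural : ∀ {P Q : RProj R} (f : P →ₗ[R] Q) (z : C₀₁.obj P),
    fmap φ.C₀ f (c₀ P z) = c₀ Q ((C₀₁.map (ofLin f)).hom z)
  c₀_c₁ : ∀ (P : RProj R) (c : φ.C₁.obj P), c₀ P (c₁ P c) = φ.dAt P c
  c₁_injective : ∀ P, Function.Injective (c₁ P)
  c₀_surjective : ∀ P, Function.Surjective (c₀ P)
  cartesian : ∀ (P : RProj R) (z : C₀₁.obj P), (∃ c, φ.dAt P c = c₀ P z) → ∃ c, c₁ P c = z

namespace ZSplitting

variable {φ : ElemExt R M} (T : ZSplitting φ)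

/-- The endomorphism `f` of the functor `C₀₁` fits, together with the multiplication by `r` on `C₁`
and on `C₀`, into a commutative diagram with `c₁` and `c₀`. -/
def IsRegular (f : End T.C₀₁) (r : R) : Prop :=
  (∀ (P : RProj R) (c : φ.C₁.obj P), (f.app P).hom (T.c₁ P c) = T.c₁ P (r • c)) ∧
  ∀ (P : RProj R) (z : T.C₀₁.obj P), T.c₀ P ((f.app P).hom z) = r • T.c₀ P z

/-- The ring of regular endomorphisms of the functor `C₀₁`. -/
def regular : Subring (End T.C₀₁) where
  carrier := {f | ∃ r : R, T.IsRegular f r}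
  mul_mem' := by
    rintro f g ⟨r, hr⟩ ⟨s, hs⟩
    refine ⟨r * s, fun P c => ?_, fun P z => ?_⟩
    · change (f.app P).hom ((g.app P).hom (T.c₁ P c)) = _
      rw [hs.1, hr.1, mul_smul]
    · change T.c₀ P ((f.app P).hom ((g.app P).hom z)) = _
      rw [hr.2, hs.2, mul_smul]
  one_mem' := ⟨1, fun P c => by rw [one_smul]; rfl, fun P z => by rw [one_smul]; rfl⟩
  add_mem' := by
    rintro f g ⟨r, hr⟩ ⟨s, hs⟩
    refine ⟨r + s, fun P c => ?_, fun P z => ?_⟩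
    · change (f.app P).hom (T.c₁ P c) + (g.app P).hom (T.c₁ P c) = _
      rw [hr.1, hs.1, add_smul, map_add]
    · change T.c₀ P ((f.app P).hom z + (g.app P).hom z) = _
      rw [map_add, hr.2, hs.2, add_smul]
  zero_mem' := ⟨0, fun P c => by rw [zero_smul, map_zero]; rfl,
    fun P z => by rw [zero_smul]; exact map_zero _⟩
  neg_mem' := by
    rintro f ⟨r, hr⟩
    refine ⟨-r, fun P c => ?_, fun P z => ?_⟩
    · change -((f.app P).hom (T.c₁ P c)) = _
      rw [hr.1, neg_smul, map_neg]
    · change T.c₀ P (-((f.app P).hom z)) = _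
      rw [map_neg, hr.2, neg_smul]

end ZSplitting

variable {R' : Type u} [CommRing R'] [Algebra R' R]

/-- The square-zero extension `R'` corresponds to the elementary extension `φ`: for a splitting
`C₀₁` of the underlying extension of functors to abelian groups, `R'` is identified, as a
square-zero extension of `R` by `M`, with the ring of regular endomorphisms of `C₀₁`. Here the
projection of the latter ring to `R` sends `f` to the `r` in `IsRegular f r`, and `m` in `M` gives
the endomorphism `C₀₁ → C₀ → I → I(M) → C₁ → C₀₁` induced by `p ↦ p ⊗ m`. -/
structure Corr (X : SqZero R M R') (φ : ElemExt R M) where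
  T : ZSplitting φ
  ρ : R' ≃+* T.regular
  ρ_q : ∀ r : R', T.IsRegular (ρ r : End T.C₀₁) (algebraMap R' R r)
  ρ_i : ∀ (m : M) (P : RProj R) (z : T.C₀₁.obj P),
    ((ρ (X.i m) : End T.C₀₁).app P).hom z = T.c₁ P (φ.bAt P (φ.aAt P (T.c₀ P z) ⊗ₜ m))

namespace Corr

variable {X : SqZero R M R'} {φ : ElemExt R M} (S : Corr X φ)

/-- The action of `R'` on `C₀₁(P)`. -/
@[reducible] def moduleAt (P : RProj R) : Module R' (S.T.C₀₁.obj P) where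
  smul r z := ((S.ρ r : End S.T.C₀₁).app P).hom z
  one_smul z := by
    change ((S.ρ 1 : End S.T.C₀₁).app P).hom z = z
    rw [map_one]; rfl
  mul_smul r s z := by
    change ((S.ρ (r * s) : End S.T.C₀₁).app P).hom z =
      ((S.ρ r : End S.T.C₀₁).app P).hom (((S.ρ s : End S.T.C₀₁).app P).hom z)
    rw [map_mul]; rfl
  smul_zero r := map_zero _
  smul_add r := map_add _
  add_smul r s z := by
    change ((S.ρ (r + s) : End S.T.C₀₁).app P).hom z =
      ((S.ρ r : End S.T.C₀₁).app P).hom z + ((S.ρ s : End S.T.C₀₁).app P).hom z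
    rw [S.ρ.map_add]; rfl
  zero_smul z := by
    change ((S.ρ 0 : End S.T.C₀₁).app P).hom z = 0
    rw [map_zero]; rfl

/-- The canonical splitting `C₀₁`, as a functor `R-proj → R'-mod`. -/
def functor : RProj R ⥤ ModuleCat.{u} R' where
  obj P :=
    letI := S.moduleAt P
    ModuleCat.of R' (S.T.C₀₁.obj P)
  map {P Q} f :=
    letI := S.moduleAt P
    letI := S.moduleAt Q
    ModuleCat.ofHom
      { (S.T.C₀₁.map f).hom with
        map_smul' := fun r z =>
          (congrArg (fun h => h.hom z) ((S.ρ r : End S.T.C₀₁).naturality f)).symm }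
  map_id P := by
    let _ := S.moduleAt P
    refine ModuleCat.hom_ext (DFunLike.ext _ _ (fun z => ?_))
    exact congrArg (fun h => h.hom z) (S.T.C₀₁.map_id P)
  map_comp f g := by
    refine ModuleCat.hom_ext (DFunLike.ext _ _ (fun z => ?_))
    exact congrArg (fun h => h.hom z) (S.T.C₀₁.map_comp f g)

/-- The map `c₁ : C₁(P) → C₀₁(P)`. -/
def c₁At (P : RProj R) : φ.C₁.obj P →+ S.functor.obj P := S.T.c₁ P

/-- The map `c₀ : C₀₁(P) → C₀(P)`. -/
def c₀At (P : RProj R) : S.functor.obj P →+ φ.C₀.obj P := S.T.c₀ P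

theorem c₁At_natural {P Q : RProj R} (f : P →ₗ[R] Q) (c : φ.C₁.obj P) :
    fmap S.functor f (S.c₁At P c) = S.c₁At Q (fmap φ.C₁ f c) := S.T.c₁_natural f c

theorem c₀At_natural {P Q : RProj R} (f : P →ₗ[R] Q) (z : S.functor.obj P) :
    fmap φ.C₀ f (S.c₀At P z) = S.c₀At Q (fmap S.functor f z) := S.T.c₀_natural f z

theorem c₀At_smul (P : RProj R) (r : R') (z : S.functor.obj P) :
    S.c₀At P (r • z) = algebraMap R' R r • S.c₀At P z := (S.ρ_q r).2 P z

variable (V : Type u) [AddCommGroup V] [Module R V]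

/-- The map `c₁ : C₁(V) → C₀₁(V)`. -/
noncomputable def c₁Ev : Ev φ.C₁ V →+ Ev S.functor V :=
  evLift φ.C₁ (fun P f => (cls S.functor P f).toAddMonoidHom.comp (S.c₁At P)) (fun P Q e f x => by
    change cls S.functor Q f (S.c₁At Q (fmap φ.C₁ e x)) =
      cls S.functor P (f.comp e) (S.c₁At P x)
    rw [← c₁At_natural]
    exact cls_map S.functor e f _)

theorem c₁Ev_cls (P : RProj R) (f : P →ₗ[R] V) (x : φ.C₁.obj P) :
    S.c₁Ev V (cls φ.C₁ P f x) = cls S.functor P f (S.c₁At P x) := evLift_cls _ _ _ P f x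

/-- The map `c₀ : C₀₁(V) → C₀(V)`. -/
noncomputable def c₀Ev : Ev S.functor V →+ Ev φ.C₀ V :=
  evLift S.functor (fun P f => (cls φ.C₀ P f).toAddMonoidHom.comp (S.c₀At P)) (fun P Q e f x => by
    change cls φ.C₀ Q f (S.c₀At Q (fmap S.functor e x)) = cls φ.C₀ P (f.comp e) (S.c₀At P x)
    rw [← c₀At_natural]
    exact cls_map φ.C₀ e f _)

theorem c₀Ev_cls (P : RProj R) (f : P →ₗ[R] V) (x : S.functor.obj P) :
    S.c₀Ev V (cls S.functor P f x) = cls φ.C₀ P f (S.c₀At P x) := evLift_cls _ _ _ P f x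

theorem c₀Ev_smul (r : R') (z : Ev S.functor V) :
    S.c₀Ev V (r • z) = algebraMap R' R r • S.c₀Ev V z := by
  induction z using ev_induction S.functor with
  | hadd x y hx hy => rw [smul_add, map_add, map_add, hx, hy, smul_add]
  | hcls P f x => rw [← map_smul, c₀Ev_cls, c₀Ev_cls, c₀At_smul, map_smul]

theorem c₀Ev_c₁Ev (c : Ev φ.C₁ V) : S.c₀Ev V (S.c₁Ev V c) = φ.dEv V c := by
  induction c using ev_induction φ.C₁ with
  | hadd x y hx hy => rw [map_add, map_add, map_add, hx, hy]
  | hcls P f x =>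
    rw [c₁Ev_cls, c₀Ev_cls, ElemExt.dEv_cls]
    congr 1
    exact S.T.c₀_c₁ P x

end Corr

/-- A multiplicative structure over `R'` on the canonical splitting `C₀₁` of a multiplicative
elementary extension: `c₀` is multiplicative and `c₁` is a map of bimodules over `C₀₁` (which acts
on `C₁` through `c₀`); that is, `C₁ → C₀₁` is a DG algebra and its map to `C₁ → C₀` is a DG algebra
map. -/
structure MulCorr {X : SqZero R M R'} {φ : MulExt R M} (S : Corr X φ.toElemExt) where
  str : MulStr S.functor
  c₀_one : S.c₀At _ str.one = φ.m₀₀.one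
  c₀_mul : ∀ (P Q : RProj R) (z : S.functor.obj P) (w : S.functor.obj Q),
    S.c₀At (tensor P Q) (str.mul.app P Q z w) = φ.m₀₀.mul.app P Q (S.c₀At P z) (S.c₀At Q w)
  c₁_left : ∀ (P Q : RProj R) (z : S.functor.obj P) (c : φ.C₁.obj Q),
    S.c₁At (tensor P Q) (φ.m₀₁.app P Q (S.c₀At P z) c) = str.mul.app P Q z (S.c₁At Q c)
  c₁_right : ∀ (P Q : RProj R) (c : φ.C₁.obj P) (z : S.functor.obj Q),
    S.c₁At (tensor P Q) (φ.m₁₀.app P Q c (S.c₀At Q z)) = str.mul.app P Q (S.c₁At P c) z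

namespace MulCorr

variable {X : SqZero R M R'} {φ : MulExt R M} {S : Corr X φ.toElemExt} (μ : MulCorr S)
  (A : Type u) [Ring A] [Algebra R A]

/-- The product of the algebra `C₀₁(A)`. -/
noncomputable def mulEv : Ev S.functor A →+ Ev S.functor A →+ Ev S.functor A :=
  pairExt μ.str.mul (LinearMap.mul R A)

theorem c₀Ev_mulEv (z w : Ev S.functor A) : S.c₀Ev A (μ.mulEv A z w) =
    pairExt φ.m₀₀.mul (LinearMap.mul R A) (S.c₀Ev A z) (S.c₀Ev A w) := by
  induction z using ev_induction S.functor with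
  | hadd x x' hx hx' => simp only [map_add, AddMonoidHom.add_apply, hx, hx']
  | hcls P f x =>
    induction w using ev_induction S.functor with
    | hadd y y' hy hy' => simp only [map_add, hy, hy']
    | hcls Q g y =>
      rw [mulEv, pairExt_cls, Corr.c₀Ev_cls, μ.c₀_mul, Corr.c₀Ev_cls, Corr.c₀Ev_cls, pairExt_cls]

end MulCorr

end SquareZero

/-! ### Liftings -/

section Liftings

variable (R' : Type u) [CommRing R'] (R : Type u) [CommRing R] [Algebra R' R]

/-- A lifting of an `R`-module `V` to `R'`: a flat `R'`-module with an isomorphism of its reduction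
with `V`. -/
structure Lift (V : Type u) [AddCommGroup V] [Module R V] where
  carrier : Type u
  [addCommGroup : AddCommGroup carrier]
  [module : Module R' carrier]
  [flat : Module.Flat R' carrier]
  iso : R ⊗[R'] carrier ≃ₗ[R] V

attribute [instance] Lift.addCommGroup Lift.module Lift.flat

/-- A lifting of an associative unital `R`-algebra `A` to `R'`: a flat associative unital
`R'`-algebra with an isomorphism of its reduction with `A`. -/
structure AlgLift (A : Type u) [Ring A] [Algebra R A] where
  carrier : Type u
  [ring : Ring carrier]
  [algebra : Algebra R' carrier]
  [flat : Module.Flat R' carrier]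
  iso : R ⊗[R'] carrier ≃ₐ[R] A

attribute [instance] AlgLift.ring AlgLift.algebra AlgLift.flat

variable {R' R}

namespace Lift

variable {V : Type u} [AddCommGroup V] [Module R V]

/-- The projection of a lifting `V'` of `V` to `V`. -/
noncomputable def proj (L : Lift R' R V) : L.carrier →+ V :=
  L.iso.toLinearMap.toAddMonoidHom.comp (TensorProduct.mk R' R L.carrier 1).toAddMonoidHom

theorem proj_apply (L : Lift R' R V) (y : L.carrier) : L.proj y = L.iso (1 ⊗ₜ y) := rfl

theorem proj_smul (L : Lift R' R V) (r : R') (y : L.carrier) :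
    L.proj (r • y) = algebraMap R' R r • L.proj y := by
  rw [proj_apply, proj_apply, ← map_smul, TensorProduct.smul_tmul', smul_eq_mul, mul_one,
    TensorProduct.tmul_smul, TensorProduct.smul_tmul', Algebra.smul_def, mul_one]

/-- Morphisms of liftings are the isomorphisms over `V`. -/
instance : Category.{u} (Lift R' R V) where
  Hom L L' := {f : L.carrier ≃ₗ[R'] L'.carrier // ∀ y, L'.proj (f y) = L.proj y}
  id L := ⟨LinearEquiv.refl R' _, fun _ => rfl⟩
  comp f g := ⟨f.1.trans g.1, fun y => (g.2 _).trans (f.2 y)⟩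

/-- The linear map underlying a morphism of liftings. -/
def hom {L L' : Lift R' R V} (f : L ⟶ L') : L.carrier →ₗ[R'] L'.carrier := f.1.toLinearMap

theorem proj_hom {L L' : Lift R' R V} (f : L ⟶ L') (y : L.carrier) :
    L'.proj (hom f y) = L.proj y := f.2 y

end Lift

namespace AlgLift

variable {A : Type u} [Ring A] [Algebra R A]

/-- The lifting of the module underlying `A` which underlies a lifting of the algebra `A`. -/
abbrev toLift (L : AlgLift R' R A) : Lift R' R A where
  carrier := L.carrier
  iso := L.iso.toLinearEquiv

/-- The projection of a lifting `A'` of `A` to `A`. -/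
noncomputable def proj (L : AlgLift R' R A) : L.carrier →+* A :=
  L.iso.toAlgHom.toRingHom.comp
    (Algebra.TensorProduct.includeRight : L.carrier →ₐ[R'] R ⊗[R'] L.carrier).toRingHom

theorem proj_eq (L : AlgLift R' R A) (y : L.carrier) : L.proj y = L.toLift.proj y := rfl

/-- Morphisms of liftings are the isomorphisms of algebras over `A`. -/
instance : Category.{u} (AlgLift R' R A) where
  Hom L L' := {f : L.carrier ≃ₐ[R'] L'.carrier // ∀ y, L'.proj (f y) = L.proj y}
  id L := ⟨AlgEquiv.refl, fun _ => rfl⟩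
  comp f g := ⟨f.1.trans g.1, fun y => (g.2 _).trans (f.2 y)⟩

variable (R' R A) in
/-- Forgetting the multiplication of a lifting. -/
def forget : AlgLift R' R A ⥤ Lift R' R A where
  obj L := L.toLift
  map f := ⟨f.1.toLinearEquiv, f.2⟩

end AlgLift

end Liftings

/-! ### Splittings -/

section Splittings

variable {R : Type u} [CommRing R] {A : Type u} [Ring A] [Algebra R A]
  {N : Type u} [AddCommGroup N]

/-- A splitting `⟨C₀₁, c₀, c₁⟩` of the elementary extension of `R`-modules underlying `C`: the
square formed by `c₁`, `c₀`, `C₁ → Im d` and `Im d ⊂ C₀` is cartesian, and `c₀` is surjective. -/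
structure Spl (C : DGExt R A N) where
  carrier : Type u
  [addCommGroup : AddCommGroup carrier]
  [module : Module R carrier]
  c₁ : C.C₁ →ₗ[R] carrier
  c₀ : carrier →ₗ[R] C.C₀
  c₀_c₁ : ∀ c, c₀ (c₁ c) = C.d c
  c₁_injective : Function.Injective c₁
  c₀_surjective : Function.Surjective c₀
  cartesian : ∀ z, (∃ c, C.d c = c₀ z) → ∃ c, c₁ c = z

attribute [instance] Spl.addCommGroup Spl.module

/-- A multiplicative splitting: a splitting `⟨C₀₁, c₀, c₁⟩` with a DG algebra structure on the
complex `C₁ → C₀₁` such that the map to `C₁ → C₀` given by `c₀` and the identity is a DG algebra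
map. Explicitly, `C₀₁` is an algebra, `c₀` is an algebra map, `C₀₁` then has to act on `C₁` through
`c₀`, and `c₁` is a bimodule map. -/
structure MulSpl (C : DGExt R A N) where
  carrier : Type u
  [ring : Ring carrier]
  [algebra : Algebra R carrier]
  c₁ : C.C₁ →ₗ[R] carrier
  c₀ : carrier →ₐ[R] C.C₀
  c₀_c₁ : ∀ c, c₀ (c₁ c) = C.d c
  c₁_injective : Function.Injective c₁
  c₀_surjective : Function.Surjective c₀
  cartesian : ∀ z, (∃ c, C.d c = c₀ z) → ∃ c, c₁ c = z
  c₁_lmul : ∀ z c, c₁ (C.lmul (c₀ z) c) = z * c₁ c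
  c₁_rmul : ∀ c z, c₁ (C.rmul c (c₀ z)) = c₁ c * z

attribute [instance] MulSpl.ring MulSpl.algebra

namespace Spl

variable {C : DGExt R A N}

instance : Category.{u} (Spl C) where
  Hom B₁ B₂ := {f : B₁.carrier →ₗ[R] B₂.carrier //
    (∀ c, f (B₁.c₁ c) = B₂.c₁ c) ∧ ∀ z, B₂.c₀ (f z) = B₁.c₀ z}
  id B₁ := ⟨LinearMap.id, fun _ => rfl, fun _ => rfl⟩
  comp f g := ⟨g.1.comp f.1, fun c => (congrArg g.1 (f.2.1 c)).trans (g.2.1 c),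
    fun z => (g.2.2 _).trans (f.2.2 z)⟩

/-- The linear map underlying a morphism of splittings. -/
def hom {B₁ B₂ : Spl C} (f : B₁ ⟶ B₂) : B₁.carrier →ₗ[R] B₂.carrier := f.1

end Spl

namespace MulSpl

variable {C : DGExt R A N}

instance : Category.{u} (MulSpl C) where
  Hom B₁ B₂ := {f : B₁.carrier →ₐ[R] B₂.carrier //
    (∀ c, f (B₁.c₁ c) = B₂.c₁ c) ∧ ∀ z, B₂.c₀ (f z) = B₁.c₀ z}
  id B₁ := ⟨AlgHom.id R _, fun _ => rfl, fun _ => rfl⟩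
  comp f g := ⟨g.1.comp f.1, fun c => (congrArg g.1 (f.2.1 c)).trans (g.2.1 c),
    fun z => (g.2.2 _).trans (f.2.2 z)⟩

/-- The splitting underlying a multiplicative splitting. -/
def toSpl (B₁ : MulSpl C) : Spl C where
  carrier := B₁.carrier
  c₁ := B₁.c₁
  c₀ := B₁.c₀.toLinearMap
  c₀_c₁ := B₁.c₀_c₁
  c₁_injective := B₁.c₁_injective
  c₀_surjective := B₁.c₀_surjective
  cartesian := B₁.cartesian

variable (C) in
/-- Forgetting the multiplication of a splitting. -/
def forget : MulSpl C ⥤ Spl C where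
  obj B₁ := B₁.toSpl
  map f := ⟨f.1.toLinearMap, f.2⟩

end MulSpl

end Splittings

/-! ### The difference `C₀₁(A) - A'` -/

section Difference

variable {R : Type u} [CommRing R] {M : Type u} [AddCommGroup M] [Module R M]
  {R' : Type u} [CommRing R'] [Algebra R' R] {X : SqZero R M R'}
  {φ : MulExt R M} (S : Corr X φ.toElemExt) {A : Type u} [Ring A] [Algebra R A]
  (L : Lift R' R A)

/-- The fibre product `C₀₁(A) ×_A A'`. -/
noncomputable def pairs : Submodule R' (Ev S.functor A × L.carrier) where
  carrier := {z | φ.aEv A (S.c₀Ev A z.1) = L.proj z.2}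
  add_mem' {z w} hz hw := by
    change _ = _ at hz hw
    change φ.aEv A (S.c₀Ev A (z.1 + w.1)) = L.proj (z.2 + w.2)
    rw [map_add, map_add, map_add, hz, hw]
  zero_mem' := by
    change φ.aEv A (S.c₀Ev A 0) = L.proj 0
    rw [map_zero, map_zero, map_zero]
  smul_mem' r z hz := by
    change _ = _ at hz
    change φ.aEv A (S.c₀Ev A (r • z.1)) = L.proj (r • z.2)
    rw [S.c₀Ev_smul, map_smul, hz, L.proj_smul]

/-- The image in `C₀₁(A) ×_A A'` of the diagonal embedding of `A ⊗ M`; the embedding of `A ⊗ M` into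
`C₀₁(A)` is `c₁ ∘ b`, and the one into `A'` sends `ȳ ⊗ m` to `i(m) y`. -/
noncomputable def diag : Submodule R' (pairs S L) :=
  Submodule.span R' {z | ∃ (y : L.carrier) (m : M),
    (z : Ev S.functor A × L.carrier) = (S.c₁Ev A (φ.bEv A (L.proj y ⊗ₜ m)), X.i m • y)}

/-- The `R'`-module underlying the difference `C₀₁(A) - A'`: the middle homology of
`A ⊗ M → C₀₁(A) ⊕ A' → A`. -/
abbrev Diff : Type u := pairs S L ⧸ diag S L

theorem c₁_mem_pairs (c : Ev φ.C₁ A) : ((S.c₁Ev A c, 0) : Ev S.functor A × L.carrier) ∈ pairs S L := by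
  change φ.aEv A (S.c₀Ev A (S.c₁Ev A c)) = L.proj 0
  rw [S.c₀Ev_c₁Ev, φ.aEv_dEv, map_zero]

variable {L} in
theorem map_mem_pairs {L' : Lift R' R A} (f : L ⟶ L') (z : pairs S L) :
    ((z.1.1, Lift.hom f z.1.2) : Ev S.functor A × L'.carrier) ∈ pairs S L' := by
  change φ.aEv A (S.c₀Ev A z.1.1) = L'.proj (Lift.hom f z.1.2)
  rw [Lift.proj_hom]
  exact z.2

variable {S} in
theorem mul_mem_pairs (μ : MulCorr S) (L : AlgLift R' R A) (z w : pairs S L.toLift) :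
    ((μ.mulEv A z.1.1 w.1.1, (z.1.2 * w.1.2 : L.carrier)) :
      Ev S.functor A × L.toLift.carrier) ∈ pairs S L.toLift := by
  have hz : φ.aEv A (S.c₀Ev A z.1.1) = L.proj z.1.2 := z.2
  have hw : φ.aEv A (S.c₀Ev A w.1.1) = L.proj w.1.2 := w.2
  change φ.aEv A (S.c₀Ev A (μ.mulEv A z.1.1 w.1.1)) = L.proj (z.1.2 * w.1.2 : L.carrier)
  rw [μ.c₀Ev_mulEv, φ.aEv_mul, hz, hw, map_mul]

/-- The product of the ring `C₀₁(A) ×_A A'`, for a lifting `A'` of the algebra `A`. -/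
noncomputable def pairsMul (μ : MulCorr S) (L : AlgLift R' R A) (z w : pairs S L.toLift) :
    pairs S L.toLift :=
  ⟨(μ.mulEv A z.1.1 w.1.1, (z.1.2 * w.1.2 : L.carrier)), mul_mem_pairs μ L z w⟩

/-- An identification of the splitting `B₁` of `C(A)`, considered as a splitting over `R'`, with
the splitting `C₀₁(A) - A'`: the latter consists of the `R'`-module `Diff S L`, of the map
`c ↦ (c₁(c), 0)`, and of the map `(z, y) ↦ c₀(z)`. -/
structure DiffIso (B₁ : Spl (φ.eval A)) where
  toEquiv : Diff S L ≃+ B₁.carrier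
  map_smul : ∀ (r : R') (z : Diff S L), toEquiv (r • z) = algebraMap R' R r • toEquiv z
  map_c₁ : ∀ c : Ev φ.C₁ A,
    toEquiv (Submodule.Quotient.mk ⟨(S.c₁Ev A c, 0), c₁_mem_pairs S L c⟩) = B₁.c₁ c
  c₀_map : ∀ z : pairs S L, B₁.c₀ (toEquiv (Submodule.Quotient.mk z)) = S.c₀Ev A z.1.1

/-- The functor `E` sends every lifting `A'` of the module `A` to `C₀₁(A) - A'`, naturally. -/
structure IsDiff (E : Lift R' R A ⥤ Spl (φ.eval A)) where
  iso : ∀ L : Lift R' R A, DiffIso S L (E.obj L)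
  natural : ∀ {L L' : Lift R' R A} (f : L ⟶ L') (z : pairs S L),
    Spl.hom (E.map f) ((iso L).toEquiv (Submodule.Quotient.mk z)) =
      (iso L').toEquiv (Submodule.Quotient.mk ⟨(z.1.1, Lift.hom f z.1.2), map_mem_pairs S f z⟩)

variable {S} in
/-- The functor `E'` on liftings of the algebra `A` is induced by `E`: on underlying modules it is
`E`, and the product on `E' A'` comes from the products of `C₀₁(A)` and `A'`. -/
structure IsMulDiff {E : Lift R' R A ⥤ Spl (φ.eval A)} (D : IsDiff S E) (μ : MulCorr S)
    (E' : AlgLift R' R A ⥤ MulSpl (φ.eval A)) where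
  forgetIso : AlgLift.forget R' R A ⋙ E ≅ E' ⋙ MulSpl.forget (φ.eval A)
  map_mul : ∀ (L : AlgLift R' R A) (z w : pairs S L.toLift),
    let θ : pairs S L.toLift → (E'.obj L).carrier := fun z =>
      Spl.hom (forgetIso.hom.app L) ((D.iso L.toLift).toEquiv (Submodule.Quotient.mk z))
    θ (pairsMul S μ L z w) = θ z * θ w

end Difference

/-! ### Hochschild cohomology and the classes of extensions -/

section Hochschild

open MulOpposite Abelian

attribute [local instance] TensorProduct.Algebra.module

variable (R : Type u) [CommRing R] (A : Type u) [Ring A] [Algebra R A]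

/-- Hochschild cohomology `HHⁿ(A, N) = Extⁿ(A, N)` over `A ⊗ Aᵒᵖ`. -/
abbrev HH (N : Type u) [AddCommGroup N] [Module (Env R A) N] (n : ℕ) : Type u :=
  Ext (ModuleCat.of (Env R A) A) (ModuleCat.of (Env R A) N) n

/-- The multiplication `A ⊗ Aᵒᵖ → A`, a map of bimodules. -/
noncomputable def envMul : Env R A →ₗ[Env R A] A := LinearMap.toSpanSingleton (Env R A) A 1

theorem envMul_tmul (x : A) (y : Aᵐᵒᵖ) : envMul R A (x ⊗ₜ y) = x * y.unop := by
  change (x ⊗ₜ[R] y : Env R A) • (1 : A) = _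
  rw [TensorProduct.Algebra.smul_def]
  change x * (1 * y.unop) = _
  rw [one_mul]

/-- The bimodule `Ω` of noncommutative differentials, the kernel of the multiplication. -/
noncomputable abbrev Omega : Submodule (Env R A) (Env R A) := LinearMap.ker (envMul R A)

/-- The universal derivation `a ↦ 1 ⊗ a - a ⊗ 1`. -/
noncomputable def univDer (x : A) : Omega R A :=
  ⟨1 ⊗ₜ op x - x ⊗ₜ 1, by
    rw [LinearMap.mem_ker, map_sub, envMul_tmul, envMul_tmul]; simp⟩

/-- The sequence `0 → Ω → A ⊗ Aᵒᵖ → A → 0`. -/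
noncomputable def omegaSeq : ShortComplex (ModuleCat.{u} (Env R A)) where
  X₁ := ModuleCat.of (Env R A) (Omega R A)
  X₂ := ModuleCat.of (Env R A) (Env R A)
  X₃ := ModuleCat.of (Env R A) A
  f := ModuleCat.ofHom (X := Omega R A) (Y := Env R A) (Submodule.subtype (Omega R A))
  g := ModuleCat.ofHom (envMul R A)
  zero := ModuleCat.hom_ext (LinearMap.ext (fun x : Omega R A => x.2))

theorem omegaSeq_shortExact : (omegaSeq R A).ShortExact where
  exact := (ShortComplex.moduleCat_exact_iff _).2 (fun x hx => ⟨(⟨x, hx⟩ : Omega R A), rfl⟩)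
  mono_f := (ModuleCat.mono_iff_injective _).2 (Subtype.val_injective (p := fun x => x ∈ Omega R A))
  epi_g := (ModuleCat.epi_iff_surjective _).2 (fun x : A => ⟨(x ⊗ₜ 1 : Env R A), by
    change envMul R A (x ⊗ₜ 1) = x
    rw [envMul_tmul]; simp⟩)

/-- The class of `0 → Ω → A ⊗ Aᵒᵖ → A → 0`. -/
noncomputable def omegaClass :
    Ext (ModuleCat.of (Env R A) A) (ModuleCat.of (Env R A) (Omega R A)) 1 :=
  (omegaSeq_shortExact R A).extClass

variable {R A}
variable {N : Type u} [AddCommGroup N] [Module (Env R A) N]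

/-- Left multiplication by an element of `A`, as an element of `A ⊗ Aᵒᵖ`. -/
def lft (x : A) : Env R A := x ⊗ₜ 1

/-- Right multiplication by an element of `A`, as an element of `A ⊗ Aᵒᵖ`. -/
def rgt (x : A) : Env R A := 1 ⊗ₜ op x

/-- Maps of DG algebras over `A` which are the identity on `A` and on `N`. -/
structure DGExt.Hom (C' C : DGExt R A N) where
  f₀ : C'.C₀ →ₐ[R] C.C₀
  f₁ : C'.C₁ →ₗ[R] C.C₁
  comm_a : ∀ x, C.a (f₀ x) = C'.a x
  comm_b : ∀ n, f₁ (C'.b n) = C.b n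
  comm_d : ∀ c, C.d (f₁ c) = f₀ (C'.d c)
  map_lmul : ∀ x c, f₁ (C'.lmul x c) = C.lmul (f₀ x) (f₁ c)
  map_rmul : ∀ c x, f₁ (C'.rmul c x) = C.rmul (f₁ c) (f₀ x)

/-- An exact sequence of bimodules `0 → N → E₁ → E₀ → Ω → 0`, decomposed into two short exact
sequences with the middle term `K`. -/
structure FourTerm (R : Type u) [CommRing R] (A : Type u) [Ring A] [Algebra R A]
    (N : Type u) [AddCommGroup N] [Module (Env R A) N] where
  E₁ : ModuleCat.{u} (Env R A)
  K : ModuleCat.{u} (Env R A)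
  E₀ : ModuleCat.{u} (Env R A)
  ι : ModuleCat.of (Env R A) N ⟶ E₁
  p : E₁ ⟶ K
  j : K ⟶ E₀
  π : E₀ ⟶ ModuleCat.of (Env R A) (Omega R A)
  ι_p : ι ≫ p = 0
  j_π : j ≫ π = 0
  exact₁ : (ShortComplex.mk ι p ι_p).ShortExact
  exact₀ : (ShortComplex.mk j π j_π).ShortExact

/-- The Yoneda class in `HH³(A, N)` of the exact sequence
`0 → N → E₁ → E₀ → A ⊗ Aᵒᵖ → A → 0`. -/
noncomputable def FourTerm.cls (E : FourTerm R A N) : HH R A N 3 :=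
  ((omegaClass R A).comp E.exact₀.extClass (rfl : 1 + 1 = 2)).comp
    E.exact₁.extClass (rfl : 2 + 1 = 3)

/-- A DG derivation of `C` with values in the complex of bimodules `E₁ → E₀` which restricts to the
identity of `N` and induces the universal derivation `A → Ω`. -/
structure DGDer (C : DGExt R A N) (E : FourTerm R A N) where
  D₀ : C.C₀ →+ E.E₀
  D₁ : C.C₁ →+ E.E₁
  map_mul : ∀ x y, D₀ (x * y) = (lft (C.a x) : Env R A) • D₀ y + (rgt (C.a y) : Env R A) • D₀ x
  map_scalar : ∀ r : R, D₀ (algebraMap R C.C₀ r) = 0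
  map_lmul : ∀ x c, D₁ (C.lmul x c) = (lft (C.a x) : Env R A) • D₁ c
  map_rmul : ∀ c x, D₁ (C.rmul c x) = (rgt (C.a x) : Env R A) • D₁ c
  map_d : ∀ c, D₀ (C.d c) = E.j.hom (E.p.hom (D₁ c))
  map_b : ∀ n, D₁ (C.b n) = E.ι.hom n
  π_D₀ : ∀ x, E.π.hom (D₀ x) = univDer R A (C.a x)

/-- `o` is the class in `HH³(A, N)` of the multiplicative elementary extension `C` of `A` by `N`:
for some multiplicative elementary extension `C'` equivalent to `C` by a map `C' → C`, it is the
class of an exact sequence of bimodules `0 → N → E₁ → E₀ → Ω → 0` that receives a DG derivation from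
`C'`, identical on `N` and universal on `A`. -/
def IsObstructionClass (C : DGExt R A N) (o : HH R A N 3) : Prop :=
  ∃ (C' : DGExt R A N) (_ : C'.IsElementary) (_ : DGExt.Hom C' C) (E : FourTerm R A N)
    (_ : DGDer C' E), o = E.cls

variable {M : Type u} [AddCommGroup M] [Module R M]
  {R' : Type u} [CommRing R'] [Algebra R' R]

theorem AlgLift.proj_algebraMap (L : AlgLift R' R A) (r : R') :
    L.proj (algebraMap R' L.carrier r) = algebraMap R A (algebraMap R' R r) := by
  rw [Algebra.algebraMap_eq_smul_one, proj_eq, Lift.proj_smul, ← proj_eq, map_one,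
    Algebra.algebraMap_eq_smul_one (A := A)]

/-- The fibre product `A' ×_A A''` of two liftings. -/
noncomputable def fibre (L L' : AlgLift R' R A) : Subring (L.carrier × L'.carrier) :=
  RingHom.eqLocus (L.proj.comp (RingHom.fst _ _)) (L'.proj.comp (RingHom.snd _ _))

/-- The diagonal image of a scalar in the fibre product. -/
noncomputable def fibreScalar (L L' : AlgLift R' R A) (r : R') : fibre L L' :=
  ⟨(algebraMap R' _ r, algebraMap R' _ r), by
    change L.proj (algebraMap R' L.carrier r) = L'.proj (algebraMap R' L'.carrier r)
    rw [L.proj_algebraMap, L'.proj_algebraMap]⟩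

/-- The element `(0, i(m) y)` of the fibre product. -/
noncomputable def fibreIncl (X : SqZero R M R') (L L' : AlgLift R' R A) (m : M) (y : L'.carrier) : fibre L L' :=
  ⟨(0, X.i m • y), by
    change L.proj 0 = L'.proj (X.i m • y)
    have h : algebraMap R' R (X.i m) = 0 := (X.exact _).2 ⟨m, rfl⟩
    rw [map_zero, AlgLift.proj_eq, Lift.proj_smul, h, zero_smul]⟩

/-- `ξ` is the class in `HH²(A, A ⊗ M)` of the difference `A'' - A'` of two liftings of `A`. This
difference is the square-zero extension of the `R`-algebra `A` by `A ⊗ M` which is the quotient of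
`A' ×_A A''` by the diagonal copy of `A ⊗ M`; it has class `ξ` if it has a derivation, identical on
`A ⊗ M` and universal on `A`, with values in an extension `E` of the bimodule `Ω` by `A ⊗ M`, and
`0 → A ⊗ M → E → A ⊗ Aᵒᵖ → A → 0` represents `ξ`. The derivation is written as an `R'`-linear
derivation `D` of the fibre product; `R'`-linearity makes it vanish on the diagonal copy. -/
def IsDiffClass (X : SqZero R M R') (L L' : AlgLift R' R A) (ξ : HH R A (A ⊗[R] M) 2) : Prop :=
  ∃ (E : ModuleCat.{u} (Env R A)) (ι : ModuleCat.of (Env R A) (A ⊗[R] M) ⟶ E)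
    (π : E ⟶ ModuleCat.of (Env R A) (Omega R A)) (w : ι ≫ π = 0)
    (h : (ShortComplex.mk ι π w).ShortExact) (D : fibre L L' →+ E),
    (∀ z z' : fibre L L', D (z * z') = (lft (L.proj z.1.1) : Env R A) • D z' +
      (rgt (L.proj z'.1.1) : Env R A) • D z) ∧
    (∀ r : R', D (fibreScalar L L' r) = 0) ∧
    (∀ (m : M) (y : L'.carrier), D (fibreIncl X L L' m y) = ι.hom (L'.proj y ⊗ₜ m)) ∧
    (∀ z : fibre L L', π.hom (D z) = univDer R A (L.proj z.1.1)) ∧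
    ξ = (omegaClass R A).comp h.extClass (rfl : 1 + 1 = 2)

/-- Isomorphism classes of liftings of `A` to `R'`. -/
abbrev LiftClasses (R' R A : Type u) [CommRing R'] [CommRing R] [Algebra R' R] [Ring A]
    [Algebra R A] : Type (u + 1) := Quotient (isIsomorphicSetoid (AlgLift R' R A))

/-- The isomorphism class of a lifting. -/
def AlgLift.toClass (L : AlgLift R' R A) : LiftClasses R' R A := Quotient.mk _ L

end Hochschild

end SqZeroLift

open SqZeroLift

attribute [local instance] TensorProduct.Algebra.module

/-! For flat A the finitely generated projective modules over A form a filtered category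
(`isFiltered_J`), so evaluation at A is exact and preserves both the extension and the cartesian
square. The action of C₀(A) on the image of b is the natural one because, by the Leibniz rule,
boundaries act on that image by zero (`MulExt.m₀₁_bEv`, `MulExt.m₁₀_bEv`).

A lift of the unit to C₀₁(R) yields elements [p] of C₀₁(P), not additive in p, and every element is
uniquely [p] + c₁(c). In these coordinates there are two candidates for the product, one visibly
linear in the left factor and one in the right factor; the Leibniz rule says that they coincide
(`Corr.prodAt_eq`).

A lifting of A is the same thing as an extension of A by A ⊗ M over R' on which each i(m) acts in
the prescribed way (`LiftData`; flatness is the local criterion, `LiftData.flat`). On C₀₁(A) the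
elements i(m) act by the same recipe (`Corr.i_smul`), so the two actions cancel in the difference,
which is therefore an R-module and a splitting. Conversely a splitting B gives the lifting C₀₁(A)
×_{C₀(A)} B modulo C₁(A). Both constructions respect products.

For the obstruction, C is replaced by its pullback to the free algebra F on the set C₀
(`DGExt.pull`). Let E₀ → Ω be the presentation of Ω by the free bimodule on the same set. The
conormal bimodule C₁ / Ker(a) C₁ of the pullback is an extension of Ker(E₀ → Ω) by N = A ⊗ M. Its
exactness rests on two vanishing statements for free algebras, of the kind expressed by Tor, which
need A flat: `mem_closure_of_freeDer_eq_zero` and `eq_zero_of_mem_closure`. They are proved with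
characters, since the character module of a flat module is injective. The universal derivation of
the pullback determines the class uniquely (`DGExt.isObstructionClass_iff`). Shifting dimensions
through A ⊗ Aᵒᵖ and E₀ shows that the class vanishes exactly when the conormal bimodule retracts
onto N. Such a retraction exists if and only if a multiplicative splitting does, hence if and only
if a lifting does.

For the torsor, every lifting is presented by the free algebra over R' on the set A. On relations
two presentations differ by a bimodule map θ from Ker(E₀ → Ω) to A ⊗ M (`exists_isTransition`), and
the class of the difference is the image of θ in HH². Transitions add up, θ has zero class if and
only if it extends to E₀, which happens if and only if the liftings are isomorphic, and every θ
occurs for some twist of a given lifting (`exists_twist`). -/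

namespace SqZeroLift

open RProj

/-! ### Elements of the extension of a functor to a flat module -/

section Elements

variable {R : Type u} [CommRing R] {S : Type u} [CommRing S]
  (F : RProj R ⥤ ModuleCat.{u} S) {V : Type u} [AddCommGroup V] [Module R V]

/-- The direct sum of finitely generated projective modules. -/
def RProj.prod (P Q : RProj R) : RProj R := ⟨P × Q⟩

/-- Every element of `F(V)` is a class. -/
theorem exists_cls (x : Ev F V) : ∃ (P : RProj R) (f : P →ₗ[R] V) (y : F.obj P), cls F P f y = x := by
  induction x using ev_induction F with
  | hcls P f x => exact ⟨P, f, x, rfl⟩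
  | hadd x x' hx hx' =>
    obtain ⟨P, f, y, rfl⟩ := hx
    obtain ⟨Q, g, z, rfl⟩ := hx'
    refine ⟨RProj.prod P Q, (f.coprod g : P × Q →ₗ[R] V),
      fmap F (Q := RProj.prod P Q) (LinearMap.inl R P Q) y +
        fmap F (Q := RProj.prod P Q) (LinearMap.inr R P Q) z, ?_⟩
    rw [map_add]
    congr 1
    · refine (cls_map F (Q := RProj.prod P Q) (LinearMap.inl R P Q) _ y).trans ?_
      congr 1
      exact congrArg _ (LinearMap.coprod_inl f g)
    · refine (cls_map F (Q := RProj.prod P Q) (LinearMap.inr R P Q) _ z).trans ?_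
      congr 1
      exact congrArg _ (LinearMap.coprod_inr f g)

/-- An object of `J(V)`. -/
abbrev J.mk {P : RProj R} (f : P →ₗ[R] V) : J (R := R) V :=
  CostructuredArrow.mk (Y := P) (S := incl R) (T := ModuleCat.of R V) (ModuleCat.ofHom f)

/-- Flatness enters through the coequalizers. Two maps P → Q over V differ by some k that Q → V
kills; the cokernel of k is finitely presented, and a map from a finitely presented module to a flat
one factors through a finite free module, where the two maps become equal. Direct sums bound pairs
of objects. -/
instance isFiltered_J [Module.Flat R V] : IsFiltered (J (R := R) V) where
  nonempty := ⟨J.mk (P := RProj.one R) 0⟩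
  cocone_objs X Y := by
    let P := X.left
    let Q := Y.left
    let f : P →ₗ[R] V := X.hom.hom
    let g : Q →ₗ[R] V := Y.hom.hom
    refine ⟨J.mk (P := RProj.prod P Q) (f.coprod g : P × Q →ₗ[R] V),
      CostructuredArrow.homMk (ofLin (Q := RProj.prod P Q) (LinearMap.inl R P Q)) ?_,
      CostructuredArrow.homMk (ofLin (Q := RProj.prod P Q) (LinearMap.inr R P Q)) ?_, trivial⟩
    · exact ModuleCat.hom_ext (LinearMap.coprod_inl f g)
    · exact ModuleCat.hom_ext (LinearMap.coprod_inr f g)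
  cocone_maps X Y e e' := by
    let P := X.left
    let Q := Y.left
    let f : P →ₗ[R] V := X.hom.hom
    let g : Q →ₗ[R] V := Y.hom.hom
    let k : P →ₗ[R] Q := lin e.left - lin e'.left
    have hk : g ∘ₗ k = 0 := by
      have h : ∀ e : X ⟶ Y, g ∘ₗ lin e.left = f := fun e =>
        congrArg ModuleCat.Hom.hom (CostructuredArrow.w e)
      rw [LinearMap.comp_sub, h, h, sub_self]
    have : Module.FinitePresentation R Q := Module.finitePresentation_of_projective R Q
    have : Module.FinitePresentation R (Q ⧸ LinearMap.range k) :=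
      Module.finitePresentation_of_surjective (LinearMap.range k).mkQ
        (Submodule.mkQ_surjective _) (by
          rw [Submodule.ker_mkQ, LinearMap.range_eq_map]
          exact Module.Finite.fg_top.map k)
    obtain ⟨n, h₂, h₃, h⟩ := Module.Flat.exists_factorization_of_finitePresentation
      ((LinearMap.range k).liftQ g (LinearMap.range_le_ker_iff.2 hk))
    have hg : h₃ ∘ₗ (h₂ ∘ₗ (LinearMap.range k).mkQ) = g := by
      rw [← LinearMap.comp_assoc, ← h, Submodule.liftQ_mkQ]
    let T : RProj R := ⟨Fin n →₀ R⟩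
    refine ⟨J.mk (P := T) h₃, CostructuredArrow.homMk
      (ofLin (Q := T) (h₂ ∘ₗ (LinearMap.range k).mkQ)) (ModuleCat.hom_ext hg), ?_⟩
    refine CostructuredArrow.hom_ext _ _ (LinearMap.ext fun p : P => ?_)
    change h₂ ((LinearMap.range k).mkQ (lin e.left p)) = h₂ ((LinearMap.range k).mkQ (lin e'.left p))
    congr 1
    exact (Submodule.Quotient.eq _).2 ⟨p, rfl⟩

/-- In a filtered colimit an element that dies does so at some stage. The criterion concerns sets,
so the forgetful functor has to preserve the colimit; `J` is a large category and is replaced by a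
small model for this. -/
theorem cls_eq_zero [Module.Flat R V] {P : RProj R} {f : P →ₗ[R] V} {x : F.obj P}
    (h : cls F P f x = 0) :
    ∃ (Q : RProj R) (e : P →ₗ[R] Q) (g : Q →ₗ[R] V), g ∘ₗ e = f ∧ fmap F e x = 0 := by
  have : IsFiltered (SmallModel.{u} (J (R := R) V)) :=
    IsFiltered.of_equivalence (equivSmallModel.{u} (J (R := R) V))
  have : PreservesColimitsOfShape (J (R := R) V) (CategoryTheory.forget (ModuleCat.{u} S)) :=
    preservesColimitsOfShape_of_equiv (equivSmallModel.{u} (J (R := R) V)).symm _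
  let G := CostructuredArrow.proj (incl R) (ModuleCat.of R V) ⋙ F
  have hc := isColimitOfPreserves (CategoryTheory.forget (ModuleCat.{u} S)) (colimit.isColimit G)
  obtain ⟨k, a, b, hab⟩ := (Types.FilteredColimit.isColimit_eq_iff _ hc (i := J.mk f) (j := J.mk f)
    (xi := x) (xj := (0 : F.obj P))).1 (h.trans (map_zero (cls F P f)).symm)
  refine ⟨k.left, lin a.left, k.hom.hom, congrArg ModuleCat.Hom.hom (CostructuredArrow.w a), ?_⟩
  -- The map `b` is applied to `0`, so it need not agree with `a`.
  exact hab.trans (map_zero (F.map b.left).hom)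

/-- The analogue of `cls_eq_zero` for the tautological functor, for exactness at C₀, where an
element of P dies in V itself. The maps R → P given by p and by 0 have equal composites to V, so a
coequalizer in `J` kills p. -/
theorem exists_factorization_apply_eq_zero [Module.Flat R V] {P : RProj R} (f : P →ₗ[R] V) (p : P)
    (h : f p = 0) : ∃ (Q : RProj R) (e : P →ₗ[R] Q) (g : Q →ₗ[R] V), g ∘ₗ e = f ∧ e p = 0 := by
  let X : J (R := R) V := J.mk (P := RProj.one R) 0
  have h' : f ∘ₗ oneMap p = 0 := by
    rw [← oneMap_comp, h]
    exact LinearMap.ext fun (r : R) => smul_zero r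
  let a : X ⟶ J.mk f := CostructuredArrow.homMk (ofLin (oneMap p)) (ModuleCat.hom_ext h')
  let b : X ⟶ J.mk f := CostructuredArrow.homMk (ofLin 0)
    (ModuleCat.hom_ext (LinearMap.comp_zero (f : P →ₗ[R] V)))
  let c := IsFiltered.coeqHom a b
  refine ⟨_, lin c.left, (IsFiltered.coeq a b).hom.hom,
    congrArg ModuleCat.Hom.hom (CostructuredArrow.w c), ?_⟩
  have h₁ := congrArg (fun u => lin u.left (oneElt R)) (IsFiltered.coeq_condition a b)
  have h₂ : lin c.left (oneMap p (oneElt R)) = lin c.left (0 : P) := h₁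
  rwa [oneMap_oneElt, map_zero] at h₂

theorem exists_rTensor (M : Type u) [AddCommGroup M] [Module R M] (x : V ⊗[R] M) :
    ∃ (P : RProj R) (f : P →ₗ[R] V) (y : P ⊗[R] M), LinearMap.rTensor M f y = x := by
  induction x with
  | zero => exact ⟨RProj.one R, 0, 0, map_zero _⟩
  | tmul v m =>
    exact ⟨RProj.one R, oneMap v, oneElt R ⊗ₜ m, by rw [LinearMap.rTensor_tmul, oneMap_oneElt]⟩
  | add x x' hx hx' =>
    obtain ⟨P, f, y, rfl⟩ := hx
    obtain ⟨Q, g, z, rfl⟩ := hx'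
    refine ⟨RProj.prod P Q, (f.coprod g : P × Q →ₗ[R] V),
      LinearMap.rTensor M (LinearMap.inl R P Q) y + LinearMap.rTensor M (LinearMap.inr R P Q) z, ?_⟩
    refine (map_add (LinearMap.rTensor M (f.coprod g : P × Q →ₗ[R] V)) _ _).trans ?_
    congr 1
    · refine (LinearMap.rTensor_comp_apply M _ _ y).symm.trans ?_
      rw [LinearMap.coprod_inl]
    · refine (LinearMap.rTensor_comp_apply M _ _ z).symm.trans ?_
      rw [LinearMap.coprod_inr]

end Elements

/-! ### Exactness of the evaluation at a flat module -/

namespace ElemExt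

variable {R : Type u} [CommRing R] {M : Type u} [AddCommGroup M] [Module R M] (φ : ElemExt R M)
  {V : Type u} [AddCommGroup V] [Module R V]

theorem bEv_rTensor (P : RProj R) (f : P →ₗ[R] V) (y : P ⊗[R] M) :
    φ.bEv V (LinearMap.rTensor M f y) = cls φ.C₁ P f (φ.bAt P y) := by
  induction y with
  | zero => simp only [map_zero]
  | tmul p m => rw [LinearMap.rTensor_tmul, bEv_tmul, bPre_apply]
  | add x y hx hy => simp only [map_add, hx, hy]

theorem aEv_surjective : Function.Surjective (φ.aEv V) := fun v => by
  obtain ⟨x, hx⟩ := φ.a_surjective (RProj.one R) (oneElt R)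
  refine ⟨cls φ.C₀ (RProj.one R) (oneMap v) x, ?_⟩
  rw [aEv_cls]
  exact (congrArg (oneMap (R := R) v) hx).trans (oneMap_oneElt v)

variable [Module.Flat R V]

/-- Exactness of filtered colimits, by elements: a class that vanishes is moved to a stage Q where
its representative vanishes, and there pointwise exactness applies. The other exactness statements
at V follow the same pattern. -/
theorem bEv_injective : Function.Injective (φ.bEv V) := by
  refine (injective_iff_map_eq_zero _).2 fun x hx => ?_
  obtain ⟨P, f, y, rfl⟩ := exists_rTensor M x
  rw [bEv_rTensor] at hx
  obtain ⟨Q, e, g, rfl, h⟩ := cls_eq_zero _ hx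
  rw [bAt_natural] at h
  have h' := φ.b_injective Q (h.trans (map_zero (φ.bAt Q)).symm)
  have h'' : LinearMap.rTensor M e y = 0 := h'
  rw [LinearMap.rTensor_comp_apply, h'', map_zero]

theorem exact_bEv_dEv : Function.Exact (φ.bEv V) (φ.dEv V) := fun c => by
  refine ⟨fun hc => ?_, ?_⟩
  · obtain ⟨P, f, x, rfl⟩ := exists_cls _ c
    rw [dEv_cls] at hc
    obtain ⟨Q, e, g, rfl, h⟩ := cls_eq_zero _ hc
    rw [dAt_natural] at h
    obtain ⟨y, hy⟩ := (φ.exact_b_d Q _).1 h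
    refine ⟨LinearMap.rTensor M g (y : Q ⊗[R] M), ?_⟩
    refine (φ.bEv_rTensor Q g y).trans ?_
    rw [← cls_map]
    exact congrArg (cls φ.C₁ Q g) hy
  · rintro ⟨x, rfl⟩
    exact φ.dEv_bEv V x

theorem exact_dEv_aEv : Function.Exact (φ.dEv V) (φ.aEv V) := fun c => by
  refine ⟨fun hc => ?_, ?_⟩
  · obtain ⟨P, f, x, rfl⟩ := exists_cls _ c
    rw [aEv_cls] at hc
    obtain ⟨Q, e, g, rfl, h⟩ := exists_factorization_apply_eq_zero f _ hc
    rw [aAt_natural] at h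
    obtain ⟨y, hy⟩ := (φ.exact_d_a Q _).1 h
    refine ⟨cls φ.C₁ Q g y, ?_⟩
    rw [dEv_cls, ← cls_map]
    exact congrArg (cls φ.C₀ Q g) hy
  · rintro ⟨x, rfl⟩
    exact φ.aEv_dEv V x

end ElemExt

/-! ### The canonical splitting evaluated at a flat module. -/

namespace Corr

variable {R : Type u} [CommRing R] {M : Type u} [AddCommGroup M] [Module R M]
  {R' : Type u} [CommRing R'] [Algebra R' R] {X : SqZero R M R'} {φ : ElemExt R M} (S : Corr X φ)
  {V : Type u} [AddCommGroup V] [Module R V]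

theorem c₁At_smul (P : RProj R) (r : R') (c : φ.C₁.obj P) :
    S.c₁At P (algebraMap R' R r • c) = r • S.c₁At P c := ((S.ρ_q r).1 P c).symm

theorem c₁Ev_smul (r : R') (c : Ev φ.C₁ V) :
    S.c₁Ev V (algebraMap R' R r • c) = r • S.c₁Ev V c := by
  induction c using ev_induction φ.C₁ with
  | hadd x y hx hy => simp only [smul_add, map_add, hx, hy]
  | hcls P f x => rw [← map_smul, c₁Ev_cls, c₁Ev_cls, c₁At_smul, map_smul]

/-- The formula for the action of i(m) is functorial in P, so it passes to the colimit. It has the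
same shape as the action of i(m) on a lifting, which is why the two cancel in the difference. -/
theorem i_smul (m : M) (z : Ev S.functor V) :
    X.i m • z = S.c₁Ev V (φ.bEv V (φ.aEv V (S.c₀Ev V z) ⊗ₜ m)) := by
  induction z using ev_induction S.functor with
  | hadd x y hx hy => simp only [smul_add, map_add, TensorProduct.add_tmul, hx, hy]
  | hcls P f x =>
    rw [← map_smul, c₀Ev_cls, ElemExt.aEv_cls, ElemExt.bEv_tmul, ElemExt.bPre_apply, c₁Ev_cls]
    exact congrArg (cls S.functor P f) (S.ρ_i m P x)

theorem c₀Ev_surjective : Function.Surjective (S.c₀Ev V) := fun x => by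
  obtain ⟨P, f, y, rfl⟩ := exists_cls _ x
  obtain ⟨z, rfl⟩ := S.T.c₀_surjective P y
  exact ⟨cls S.functor P f z, S.c₀Ev_cls V P f z⟩

variable [Module.Flat R V]

theorem c₁Ev_injective : Function.Injective (S.c₁Ev V) := by
  refine (injective_iff_map_eq_zero _).2 fun x hx => ?_
  obtain ⟨P, f, y, rfl⟩ := exists_cls _ x
  rw [c₁Ev_cls] at hx
  obtain ⟨Q, e, g, rfl, h⟩ := cls_eq_zero _ hx
  rw [c₁At_natural] at h
  have h' : fmap φ.C₁ e y = 0 := S.T.c₁_injective Q (h.trans (map_zero (S.T.c₁ Q)).symm)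
  rw [← cls_map]
  exact (congrArg (cls φ.C₁ Q g) h').trans (map_zero _)

/-- At a stage where the augmentation of the representative dies, its image in C₀ is a boundary, and
the cartesian square supplies the element of C₁. So C₀₁(V) is an extension of V by C₁(V). -/
theorem exists_c₁Ev {z : Ev S.functor V} (h : φ.aEv V (S.c₀Ev V z) = 0) :
    ∃ c, S.c₁Ev V c = z := by
  obtain ⟨P, f, x, rfl⟩ := exists_cls _ z
  rw [c₀Ev_cls, ElemExt.aEv_cls] at h
  obtain ⟨Q, e, g, rfl, h'⟩ := exists_factorization_apply_eq_zero f _ h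
  rw [ElemExt.aAt_natural, c₀At_natural] at h'
  obtain ⟨c, hc⟩ := (φ.exact_d_a Q _).1 h'
  obtain ⟨c, hc⟩ := S.T.cartesian Q _ ⟨c, hc⟩
  refine ⟨cls φ.C₁ Q g c, ?_⟩
  rw [c₁Ev_cls, ← cls_map]
  exact congrArg (cls S.functor Q g) hc

end Corr


/-! ### The DG algebra `C(A)` -/

namespace MulExt

variable {R : Type u} [CommRing R] {M : Type u} [AddCommGroup M] [Module R M] (φ : MulExt R M)
  {A : Type u} [Ring A] [Algebra R A]

theorem lift_mul_comp_map_oneMap (x y : A) :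
    TensorProduct.lift (LinearMap.mul R A) ∘ₗ TensorProduct.map (oneMap (R := R) x) (oneMap y) =
      oneMap (x * y) ∘ₗ lidMap (RProj.one R) := by
  refine TensorProduct.ext' fun (r s : R) => ?_
  change (r • x) * (s • y) = (r * s) • (x * y)
  rw [smul_mul_smul_comm]

theorem lift_mul_comp_map_oneMap' (x y : A) :
    TensorProduct.lift (LinearMap.mul R A) ∘ₗ TensorProduct.map (oneMap (R := R) x) (oneMap y) =
      oneMap (x * y) ∘ₗ ridMap (RProj.one R) := by
  refine TensorProduct.ext' fun (r s : R) => ?_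
  change (r • x) * (s • y) = (s * r) • (x * y)
  rw [smul_mul_smul_comm, mul_comm]

/-- Modulo boundaries every element of C₀(A) is the value of the unit at an element of A. Boundaries
multiply the image of b by zero, so products with that image can be computed on these values. -/
theorem sub_oneMap_mem (x : Ev φ.C₀ A) [Module.Flat R A] :
    ∃ c, φ.dEv A c = x - cls φ.C₀ _ (oneMap (φ.aEv A x)) φ.m₀₀.one := by
  refine (φ.exact_dEv_aEv _).1 ?_
  rw [map_sub, ElemExt.aEv_cls, φ.a_one]
  exact sub_eq_zero.2 (oneMap_oneElt _).symm

/-- By the Leibniz rule d(c) b(n) = c d(b(n)) = 0, so x may be replaced by the value of the unit at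
a(x), and the product is then given by the unit axiom. This makes the left module structure on A ⊗ M
the natural one. -/
theorem m₀₁_bEv [Module.Flat R A] (x : Ev φ.C₀ A) (v : A) (m : M) :
    pairExt φ.m₀₁ (LinearMap.mul R A) x (φ.bEv A (v ⊗ₜ m)) = φ.bEv A ((φ.aEv A x * v) ⊗ₜ m) := by
  obtain ⟨c, hc⟩ := φ.sub_oneMap_mem x
  have h : pairExt φ.m₀₁ (LinearMap.mul R A) (φ.dEv A c) (φ.bEv A (v ⊗ₜ m)) = 0 := by
    rw [φ.leibnizEv, φ.dEv_bEv, map_zero]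
  rw [hc, map_sub, AddMonoidHom.sub_apply, sub_eq_zero] at h
  rw [h, ElemExt.bEv_tmul, ElemExt.bEv_tmul, ElemExt.bPre, ElemExt.bPre, pairExt_cls]
  refine (congrArg (fun k => cls φ.C₁ _ k _) (lift_mul_comp_map_oneMap _ _)).trans ?_
  refine (cls_map φ.C₁ (lidMap (RProj.one R)) _ _).symm.trans ?_
  exact congrArg _ (φ.one_act _ _)

theorem m₁₀_bEv [Module.Flat R A] (x : Ev φ.C₀ A) (v : A) (m : M) :
    pairExt φ.m₁₀ (LinearMap.mul R A) (φ.bEv A (v ⊗ₜ m)) x = φ.bEv A ((v * φ.aEv A x) ⊗ₜ m) := by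
  obtain ⟨c, hc⟩ := φ.sub_oneMap_mem x
  have h : pairExt φ.m₁₀ (LinearMap.mul R A) (φ.bEv A (v ⊗ₜ m)) (φ.dEv A c) = 0 := by
    rw [← φ.leibnizEv, φ.dEv_bEv, map_zero, AddMonoidHom.zero_apply]
  rw [hc, map_sub, sub_eq_zero] at h
  rw [h, ElemExt.bEv_tmul, ElemExt.bEv_tmul, ElemExt.bPre, ElemExt.bPre, pairExt_cls]
  refine (congrArg (fun k => cls φ.C₁ _ k _) (lift_mul_comp_map_oneMap' _ _)).trans ?_
  refine (cls_map φ.C₁ (ridMap (RProj.one R)) _ _).symm.trans ?_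
  exact congrArg _ (φ.act_one _ _)

open MulOpposite in
theorem eval_isElementary [Module.Flat R A] : (φ.eval A).IsElementary where
  b_injective := φ.bEv_injective
  exact_b_d := φ.exact_bEv_dEv
  exact_d_a := φ.exact_dEv_aEv
  a_surjective := φ.aEv_surjective
  lmul_b x n := by
    induction n with
    | zero => simp only [smul_zero, map_zero]
    | add n n' h h' => simp only [smul_add, map_add, h, h']
    | tmul v m =>
      have h : ((φ.eval A).a x ⊗ₜ[R] (1 : Aᵐᵒᵖ) : Env R A) • (v ⊗ₜ[R] m) =
          ((φ.aEv A x * v) ⊗ₜ[R] m) := by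
        change (φ.eval A).a x • (1 : Aᵐᵒᵖ) • (v ⊗ₜ[R] m) = _
        rw [one_smul, TensorProduct.smul_tmul']
        rfl
      rw [h]
      exact φ.m₀₁_bEv x v m
  rmul_b n x := by
    induction n with
    | zero => simp only [smul_zero, map_zero, LinearMap.zero_apply]
    | add n n' h h' => simp only [smul_add, map_add, LinearMap.add_apply, h, h']
    | tmul v m =>
      have h : ((1 : A) ⊗ₜ[R] op ((φ.eval A).a x) : Env R A) • (v ⊗ₜ[R] m) =
          ((v * φ.aEv A x) ⊗ₜ[R] m) := by
        change (1 : A) • op ((φ.eval A).a x) • (v ⊗ₜ[R] m) = _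
        rw [one_smul, TensorProduct.smul_tmul']
        rfl
      rw [h]
      exact φ.m₁₀_bEv x v m

end MulExt

open RProj

/-! ### The multiplicative structure of the canonical splitting -/

section Functoriality

variable {R : Type u} [CommRing R] {S : Type u} [CommRing S]

theorem fmap_comp (F : RProj R ⥤ ModuleCat.{u} S) {P Q T : RProj R} (f : P →ₗ[R] Q) (g : Q →ₗ[R] T)
    (x : F.obj P) : fmap F g (fmap F f x) = fmap F (g ∘ₗ f) x :=
  (congrArg (fun k => k.hom x) (F.map_comp (ofLin f) (ofLin g))).symm

theorem fmap_id (F : RProj R ⥤ ModuleCat.{u} S) {P : RProj R} (x : F.obj P) :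
    fmap F (LinearMap.id : P →ₗ[R] P) x = x := congrArg (fun k => k.hom x) (F.map_id P)

/-- The map `p ↦ p ⊗ q`. -/
def tmulRight (P : RProj R) {Q : RProj R} (q : Q) : P →ₗ[R] tensor P Q :=
  (TensorProduct.mk R P Q).flip q

/-- The map `q ↦ p ⊗ q`. -/
def tmulLeft {P : RProj R} (Q : RProj R) (p : P) : Q →ₗ[R] tensor P Q := TensorProduct.mk R P Q p

/-- The tensor product of maps of `R-proj`. -/
def tmap {P P' Q Q' : RProj R} (f : P →ₗ[R] P') (g : Q →ₗ[R] Q') : tensor P Q →ₗ[R] tensor P' Q' :=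
  TensorProduct.map f g

theorem tmulRight_comp_ridMap (P : RProj R) {Q : RProj R} (q : Q) :
    tmulRight P q ∘ₗ ridMap P = tmap LinearMap.id (oneMap (R := R) q) :=
  TensorProduct.ext' fun p (r : R) => TensorProduct.smul_tmul r p q

theorem tmulLeft_comp_lidMap {P : RProj R} (Q : RProj R) (p : P) :
    tmulLeft Q p ∘ₗ lidMap Q = tmap (oneMap (R := R) p) LinearMap.id :=
  TensorProduct.ext' fun (r : R) q => (TensorProduct.smul_tmul r p q).symm

/-- Unitality and naturality determine the product with the image of the unit under R → Q, r ↦ rq: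
it is the functorial map attached to p ↦ p ⊗ q. -/
theorem Pairing.app_oneMap_right {F G : RProj R ⥤ ModuleCat.{u} S} (p : Pairing F G F)
    {e : G.obj (RProj.one R)} (h : ∀ (P : RProj R) (x : F.obj P), fmap F (ridMap P) (p.app _ _ x e) = x)
    {P Q : RProj R} (x : F.obj P) (q : Q) :
    p.app P Q x (fmap G (oneMap (R := R) q) e) = fmap F (tmulRight P q) x := by
  conv_rhs => rw [← h P x, fmap_comp, tmulRight_comp_ridMap]
  conv_lhs => rw [← fmap_id F x]
  exact p.natural _ _ _ _

theorem Pairing.app_oneMap_left {F G : RProj R ⥤ ModuleCat.{u} S} (p : Pairing F G G)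
    {e : F.obj (RProj.one R)} (h : ∀ (P : RProj R) (x : G.obj P), fmap G (lidMap P) (p.app _ _ e x) = x)
    {P Q : RProj R} (y : G.obj Q) (x : P) :
    p.app P Q (fmap F (oneMap (R := R) x) e) y = fmap G (tmulLeft Q x) y := by
  conv_rhs => rw [← h Q y, fmap_comp, tmulLeft_comp_lidMap]
  conv_lhs => rw [← fmap_id G y]
  exact p.natural _ _ _ _

end Functoriality

namespace MulExt

variable {R : Type u} [CommRing R] {M : Type u} [AddCommGroup M] [Module R M] (φ : MulExt R M)

theorem m₁₀_bracket {P Q : RProj R} (c : φ.C₁.obj P) (q : Q) :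
    φ.m₁₀.app P Q c (fmap φ.C₀ (oneMap (R := R) q) φ.m₀₀.one) = fmap φ.C₁ (tmulRight P q) c :=
  φ.m₁₀.app_oneMap_right φ.act_one c q

theorem m₀₁_bracket {P Q : RProj R} (c : φ.C₁.obj Q) (p : P) :
    φ.m₀₁.app P Q (fmap φ.C₀ (oneMap (R := R) p) φ.m₀₀.one) c = fmap φ.C₁ (tmulLeft Q p) c :=
  φ.m₀₁.app_oneMap_left φ.one_act c p

end MulExt

namespace Corr

variable {R : Type u} [CommRing R] {M : Type u} [AddCommGroup M] [Module R M]
  {R' : Type u} [CommRing R'] [Algebra R' R] {X : SqZero R M R'} {φ : MulExt R M}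
  (S : Corr X φ.toElemExt)

theorem c₀At_c₁At (P : RProj R) (c : φ.C₁.obj P) : S.c₀At P (S.c₁At P c) = φ.dAt P c :=
  S.T.c₀_c₁ P c

/-- An element of `C₀₁(R)` over the unit of `C₀(R)`. -/
noncomputable def unitLift : S.functor.obj (RProj.one R) :=
  (S.T.c₀_surjective (RProj.one R) φ.m₀₀.one).choose

theorem c₀At_unitLift : S.c₀At _ S.unitLift = φ.m₀₀.one :=
  (S.T.c₀_surjective (RProj.one R) φ.m₀₀.one).choose_spec

/-- The element of `C₀₁(P)` induced by the lift of the unit, for an element of `P`. -/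
noncomputable def bracket {P : RProj R} (p : P) : S.functor.obj P :=
  fmap S.functor (oneMap (R := R) p) S.unitLift

theorem fmap_bracket {P Q : RProj R} (f : P →ₗ[R] Q) (p : P) :
    fmap S.functor f (S.bracket p) = S.bracket (f p) := by
  rw [bracket, fmap_comp, bracket, oneMap_comp]

theorem c₀At_bracket {P : RProj R} (p : P) :
    S.c₀At P (S.bracket p) = fmap φ.C₀ (oneMap (R := R) p) φ.m₀₀.one := by
  rw [bracket, ← c₀At_natural, c₀At_unitLift]

/-- The image in `P` of an element of `C₀₁(P)`. -/
noncomputable def aug {P : RProj R} (z : S.functor.obj P) : P := φ.aAt P (S.c₀At P z)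

theorem aug_bracket {P : RProj R} (p : P) : S.aug (S.bracket p) = p := by
  rw [aug, c₀At_bracket, ← ElemExt.aAt_natural, φ.a_one]
  exact oneMap_oneElt p

theorem aug_fmap {P Q : RProj R} (f : P →ₗ[R] Q) (z : S.functor.obj P) :
    S.aug (fmap S.functor f z) = f (S.aug z) := by
  rw [aug, aug, ← c₀At_natural, ElemExt.aAt_natural]

/-- The elements z and [aug z] have the same image in P, so their images in C₀ differ by a boundary
and, by the cartesian square, they differ by an element of C₁. Since p ↦ [p] need not be additive,
this is a decomposition of sets only. -/
theorem exists_rem {P : RProj R} (z : S.functor.obj P) :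
    ∃ c, z = S.bracket (S.aug z) + S.c₁At P c := by
  obtain ⟨c, hc⟩ := (φ.exact_d_a P (S.c₀At P (z - S.bracket (S.aug z)))).1 (by
    have h : φ.aAt P (S.c₀At P (S.bracket (S.aug z))) = φ.aAt P (S.c₀At P z) := S.aug_bracket _
    change φ.aAt P _ = 0
    rw [map_sub, map_sub, h, sub_self])
  obtain ⟨c, hc⟩ := S.T.cartesian P _ ⟨c, hc⟩
  exact ⟨c, (add_eq_of_eq_sub' hc).symm⟩

/-- The component in `C₁(P)` of an element of `C₀₁(P)`. -/
noncomputable def rem {P : RProj R} (z : S.functor.obj P) : φ.C₁.obj P := (S.exists_rem z).choose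

theorem eq_bracket_add {P : RProj R} (z : S.functor.obj P) :
    z = S.bracket (S.aug z) + S.c₁At P (S.rem z) := (S.exists_rem z).choose_spec

theorem rem_eq {P : RProj R} {z : S.functor.obj P} {c : φ.C₁.obj P}
    (h : z = S.bracket (S.aug z) + S.c₁At P c) : S.rem z = c :=
  S.T.c₁_injective P (add_left_cancel (a := S.bracket (S.aug z))
    (b := S.c₁At P _) (c := S.c₁At P _) ((S.eq_bracket_add z).symm.trans h))

theorem rem_bracket {P : RProj R} (p : P) : S.rem (S.bracket p) = 0 :=
  S.rem_eq (by rw [aug_bracket, map_zero, add_zero])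

theorem rem_fmap {P Q : RProj R} (f : P →ₗ[R] Q) (z : S.functor.obj P) :
    S.rem (fmap S.functor f z) = fmap φ.C₁ f (S.rem z) :=
  S.rem_eq (by
    rw [aug_fmap, ← fmap_bracket, ← c₁At_natural, ← map_add, ← eq_bracket_add])

theorem c₀At_eq {P : RProj R} (z : S.functor.obj P) :
    S.c₀At P z = fmap φ.C₀ (oneMap (R := R) (S.aug z)) φ.m₀₀.one + φ.dAt P (S.rem z) := by
  conv_lhs => rw [S.eq_bracket_add z, map_add, c₀At_bracket, c₀At_c₁At]

/-- The product of `C₀₁`. -/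
noncomputable def prodAt {P Q : RProj R} (z : S.functor.obj P) (w : S.functor.obj Q) :
    S.functor.obj (tensor P Q) :=
  fmap S.functor (tmulRight P (S.aug w)) z + S.c₁At _ (φ.m₀₁.app P Q (S.c₀At P z) (S.rem w))

/-- Write z = [p] + c₁(e) and w = [q] + c₁(f). Both formulas give [p ⊗ q] plus c₁ of three terms;
two of these agree outright, and the third is d(e) f in one formula and e d(f) in the other, equal
by the Leibniz rule. The defining formula is linear in z and this one in w, so together they give
bilinearity, which neither shows alone. -/
theorem prodAt_eq {P Q : RProj R} (z : S.functor.obj P) (w : S.functor.obj Q) :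
    S.prodAt z w =
      fmap S.functor (tmulLeft Q (S.aug z)) w + S.c₁At _ (φ.m₁₀.app P Q (S.rem z) (S.c₀At Q w)) := by
  have h : fmap S.functor (tmulRight P (S.aug w)) z =
      S.bracket (P := tensor P Q) (S.aug z ⊗ₜ S.aug w) +
        S.c₁At _ (fmap φ.C₁ (tmulRight P (S.aug w)) (S.rem z)) := by
    conv_lhs => rw [S.eq_bracket_add z, map_add, fmap_bracket, c₁At_natural]
    rfl
  have h' : fmap S.functor (tmulLeft Q (S.aug z)) w =
      S.bracket (P := tensor P Q) (S.aug z ⊗ₜ S.aug w) +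
        S.c₁At _ (fmap φ.C₁ (tmulLeft Q (S.aug z)) (S.rem w)) := by
    conv_lhs => rw [S.eq_bracket_add w, map_add, fmap_bracket, c₁At_natural]
    rfl
  rw [prodAt, h, h', S.c₀At_eq z, S.c₀At_eq w, map_add, map_add, LinearMap.add_apply, map_add,
    map_add, φ.leibniz, φ.m₁₀_bracket, φ.m₀₁_bracket]
  abel

theorem prodAt_bracket {P Q : RProj R} (z : S.functor.obj P) (q : Q) :
    S.prodAt z (S.bracket q) = fmap S.functor (tmulRight P q) z := by
  rw [prodAt, rem_bracket, aug_bracket, map_zero, map_zero, add_zero]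

theorem bracket_prodAt {P Q : RProj R} (p : P) (z : S.functor.obj Q) :
    S.prodAt (S.bracket p) z = fmap S.functor (tmulLeft Q p) z := by
  rw [prodAt_eq, rem_bracket, aug_bracket, map_zero, LinearMap.zero_apply, map_zero, add_zero]

theorem prodAt_c₁At {P Q : RProj R} (z : S.functor.obj P) (c : φ.C₁.obj Q) :
    S.prodAt z (S.c₁At Q c) = S.c₁At _ (φ.m₀₁.app P Q (S.c₀At P z) c) := by
  rw [prodAt_eq, c₁At_natural, c₀At_c₁At, ← φ.leibniz, ← φ.m₀₁_bracket, ← map_add,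
    ← LinearMap.add_apply, ← map_add, ← c₀At_eq]

theorem c₁At_prodAt {P Q : RProj R} (c : φ.C₁.obj P) (z : S.functor.obj Q) :
    S.prodAt (S.c₁At P c) z = S.c₁At _ (φ.m₁₀.app P Q c (S.c₀At Q z)) := by
  rw [prodAt, c₁At_natural, c₀At_c₁At, φ.leibniz, ← φ.m₁₀_bracket, ← map_add, ← map_add, ← c₀At_eq]

theorem c₀At_prodAt {P Q : RProj R} (z : S.functor.obj P) (w : S.functor.obj Q) :
    S.c₀At _ (S.prodAt z w) = φ.m₀₀.mul.app P Q (S.c₀At P z) (S.c₀At Q w) := by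
  rw [prodAt, map_add, c₀At_c₁At, φ.d_m₀₁, ← c₀At_natural,
    ← φ.m₀₀.mul.app_oneMap_right φ.m₀₀.mul_one, ← map_add, ← c₀At_eq]

theorem fmap_prodAt {P P' Q Q' : RProj R} (f : P →ₗ[R] P') (g : Q →ₗ[R] Q') (z : S.functor.obj P)
    (w : S.functor.obj Q) : S.prodAt (fmap S.functor f z) (fmap S.functor g w) =
      fmap S.functor (tmap f g) (S.prodAt z w) := by
  have h : tmulRight P' (g (S.aug w)) ∘ₗ f = tmap f g ∘ₗ tmulRight P (S.aug w) :=
    LinearMap.ext fun p => rfl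
  rw [prodAt, prodAt, map_add, aug_fmap, rem_fmap, fmap_comp, fmap_comp, h, ← c₀At_natural,
    φ.m₀₁.natural, c₁At_natural]
  rfl

theorem prodAt_add_left {P Q : RProj R} (z z' : S.functor.obj P) (w : S.functor.obj Q) :
    S.prodAt (z + z') w = S.prodAt z w + S.prodAt z' w := by
  simp only [prodAt, map_add, LinearMap.add_apply]
  abel

theorem prodAt_add_right {P Q : RProj R} (z : S.functor.obj P) (w w' : S.functor.obj Q) :
    S.prodAt z (w + w') = S.prodAt z w + S.prodAt z w' := by
  simp only [prodAt_eq, map_add]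
  abel

/-- By additivity the last factor may be taken of the form [t] or c₁(c). In the first case the
product with it is a functorial map and the identity is naturality; in the second it is the
associativity of the action of C₀ on C₁. -/
theorem prodAt_assoc {P Q T : RProj R} (x : S.functor.obj P) (y : S.functor.obj Q)
    (z : S.functor.obj T) :
    fmap S.functor (assocMap P Q T) (S.prodAt (S.prodAt x y) z) = S.prodAt x (S.prodAt y z) := by
  have h : assocMap P Q T ∘ₗ tmulRight (tensor P Q) (S.aug z) =
      tmap LinearMap.id (tmulRight Q (S.aug z)) :=
    TensorProduct.ext' fun p q => rfl
  rw [S.eq_bracket_add z, prodAt_add_right, prodAt_add_right, prodAt_add_right, map_add]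
  congr 1
  · rw [prodAt_bracket, prodAt_bracket, fmap_comp, h, ← fmap_prodAt, fmap_id]
  · rw [prodAt_c₁At, prodAt_c₁At, prodAt_c₁At, c₀At_prodAt, c₁At_natural, φ.assoc₀₀₁]

theorem prodAt_smul_left {P Q : RProj R} (r : R') (z : S.functor.obj P) (w : S.functor.obj Q) :
    S.prodAt (r • z) w = r • S.prodAt z w := by
  rw [prodAt, prodAt, map_smul, c₀At_smul, map_smul, LinearMap.smul_apply, c₁At_smul, smul_add]

theorem prodAt_smul_right {P Q : RProj R} (r : R') (z : S.functor.obj P) (w : S.functor.obj Q) :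
    S.prodAt z (r • w) = r • S.prodAt z w := by
  rw [prodAt_eq, prodAt_eq, map_smul, c₀At_smul, map_smul, c₁At_smul, smul_add]

theorem bracket_oneElt : S.bracket (oneElt R) = S.unitLift := by
  have h : oneMap (R := R) (oneElt R) = LinearMap.id := LinearMap.ext fun (r : R) => mul_one r
  rw [bracket, h, fmap_id]

/-- The multiplicative structure on `C₀₁` determined by a lift of the unit. -/
noncomputable def mulCorr : MulCorr S where
  str :=
    { one := S.unitLift
      mul :=
        { app := fun P Q => LinearMap.mk₂ R' S.prodAt S.prodAt_add_left S.prodAt_smul_left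
            S.prodAt_add_right S.prodAt_smul_right
          natural := S.fmap_prodAt }
      assoc := fun P Q T => S.prodAt_assoc
      one_mul := fun P x => by
        change fmap S.functor (lidMap P) (S.prodAt S.unitLift x) = x
        have h : lidMap P ∘ₗ tmulLeft P (oneElt R) = LinearMap.id :=
          LinearMap.ext fun p => one_smul R p
        rw [← bracket_oneElt, bracket_prodAt, fmap_comp, h, fmap_id]
      mul_one := fun P x => by
        change fmap S.functor (ridMap P) (S.prodAt x S.unitLift) = x
        have h : ridMap P ∘ₗ tmulRight P (oneElt R) = LinearMap.id :=
          LinearMap.ext fun p => one_smul R p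
        rw [← bracket_oneElt, prodAt_bracket, fmap_comp, h, fmap_id] }
  c₀_one := S.c₀At_unitLift
  c₀_mul P Q := S.c₀At_prodAt
  c₁_left P Q z c := (S.prodAt_c₁At z c).symm
  c₁_right P Q c z := (S.c₁At_prodAt c z).symm

end Corr

/-! ### Liftings as square-zero extensions of modules -/

section LiftData

variable {R M R' : Type u} [CommRing R] [CommRing R'] [Algebra R' R] [AddCommGroup M] [Module R M]

theorem SqZero.algebraMap_i (X : SqZero R M R') (m : M) : algebraMap R' R (X.i m) = 0 :=
  (X.exact _).2 ⟨m, rfl⟩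

theorem SqZero.i_mul_i (X : SqZero R M R') (m m' : M) : X.i m * X.i m' = 0 := by
  rw [X.mul_i, X.algebraMap_i, zero_smul, map_zero]

/-- A presentation of an `R'`-module `Y` as an extension of the `R`-module `V` by `V ⊗ M` in which
the kernel of `R' → R` acts by the canonical map. -/
structure LiftData (X : SqZero R M R') (V : Type u) [AddCommGroup V] [Module R V] (Y : Type u)
    [AddCommGroup Y] [Module R' Y] where
  p : Y →+ V
  j : V ⊗[R] M →+ Y
  p_smul : ∀ (r : R') (y : Y), p (r • y) = algebraMap R' R r • p y
  p_surjective : Function.Surjective p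
  j_injective : Function.Injective j
  exact : Function.Exact j p
  j_tmul : ∀ (y : Y) (m : M), j (p y ⊗ₜ m) = X.i m • y

/-- For modules over the quotient R, tensor products over R' and over R coincide, so injectivity can
be tested over R, where V is flat. -/
theorem rTensor_injective_of_surjective (h : Function.Surjective (algebraMap R' R))
    (V : Type u) [AddCommGroup V] [Module R V] [Module R' V] [IsScalarTower R' R V] [Module.Flat R V]
    {U U' : Type u} [AddCommGroup U] [Module R U] [Module R' U] [IsScalarTower R' R U]
    [AddCommGroup U'] [Module R U'] [Module R' U'] [IsScalarTower R' R U']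
    (f : U →ₗ[R] U') (hf : Function.Injective f) :
    Function.Injective (LinearMap.rTensor V (f.restrictScalars R')) := by
  have := TensorProduct.CompatibleSMul.of_algebraMap_surjective (M := U) (N := V) h
  have := TensorProduct.CompatibleSMul.of_algebraMap_surjective (M := U') (N := V) h
  let e : U ⊗[R] V ≃ₗ[R'] U ⊗[R'] V := TensorProduct.equivOfCompatibleSMul R' R R' U V
  let e' : U' ⊗[R] V ≃ₗ[R'] U' ⊗[R'] V := TensorProduct.equivOfCompatibleSMul R' R R' U' V
  have he : ∀ x, LinearMap.rTensor V (f.restrictScalars R') (e x) = e' (LinearMap.rTensor V f x) :=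
    fun x => by
      induction x with
      | zero => simp only [map_zero]
      | add x y hx hy => simp only [map_add, hx, hy]
      | tmul u v => rfl
  refine (injective_iff_map_eq_zero _).2 fun x hx => ?_
  obtain ⟨x, rfl⟩ := e.surjective x
  rw [he, LinearEquiv.map_eq_zero_iff] at hx
  rw [Module.Flat.rTensor_preserves_injective_linearMap f hf (hx.trans (map_zero _).symm), map_zero]

namespace LiftData

variable {X : SqZero R M R'} {V : Type u} [AddCommGroup V] [Module R V] {Y : Type u}
  [AddCommGroup Y] [Module R' Y] (D : LiftData X V Y)

-- The local criterion of flatness for a square-zero ideal. Let J be an ideal of R', q(J) its image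
-- in R, and M_J the part of M that i sends into J. If x in J ⊗ Y dies in Y, its image in q(J) ⊗ V
-- dies in V, hence vanishes as V is flat; so x comes from some t in M_J ⊗ Y. Then t dies in M ⊗ V
-- because `D.j` is injective, hence already in M_J ⊗ V, again by flatness. So t comes from M_J ⊗
-- Ker p, which maps to zero in J ⊗ Y since i(M) has square zero.
include D in
theorem flat [Module.Flat R V] : Module.Flat R' Y := by
  let : Module R' V := Module.compHom V (algebraMap R' R)
  let : Module R' M := Module.compHom M (algebraMap R' R)
  have hV : IsScalarTower R' R V := ⟨fun r s v => by rw [Algebra.smul_def, mul_smul]; rfl⟩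
  have hM : IsScalarTower R' R M := ⟨fun r s v => by rw [Algebra.smul_def, mul_smul]; rfl⟩
  let p : Y →ₗ[R'] V := { D.p with map_smul' := D.p_smul }
  have hp : Function.Surjective p := D.p_surjective
  rw [Module.Flat.iff_rTensor_injective']
  intro J
  refine (injective_iff_map_eq_zero _).2 fun x hx => ?_
  let iM : M →ₗ[R'] R' := { X.i with map_smul' := fun r m => (X.mul_i r m).symm }
  let MJ : Submodule R M :=
    { carrier := {m | X.i m ∈ J}
      add_mem' := fun {a b} ha hb => by
        change X.i (a + b) ∈ J
        rw [map_add]; exact J.add_mem ha hb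
      zero_mem' := by change X.i 0 ∈ J; rw [map_zero]; exact J.zero_mem
      smul_mem' := fun r m hm => by
        obtain ⟨r, rfl⟩ := X.q_surjective r
        change X.i _ ∈ J
        rw [← X.mul_i]; exact J.mul_mem_left r hm }
  let iJ : MJ →ₗ[R'] J :=
    { toFun := fun m => ⟨X.i m, m.2⟩
      map_add' := fun a b => Subtype.ext (map_add X.i _ _)
      map_smul' := fun r m => Subtype.ext (X.mul_i r m).symm }
  let qJ : Ideal R := J.map (algebraMap R' R)
  let g : J →ₗ[R'] qJ :=
    { toFun := fun r => ⟨algebraMap R' R r, Ideal.mem_map_of_mem _ r.2⟩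
      map_add' := fun a b => Subtype.ext (map_add _ _ _)
      map_smul' := fun r m => Subtype.ext (by
        change algebraMap R' R (r * m) = r • algebraMap R' R m
        rw [map_mul, Algebra.smul_def]) }
  have hg : Function.Surjective g := fun ⟨y, hy⟩ => by
    obtain ⟨r, hr, rfl⟩ := (Ideal.mem_map_iff_of_surjective _ X.q_surjective).1 hy
    exact ⟨⟨r, hr⟩, rfl⟩
  have hig : Function.Exact iJ g := fun r => by
    constructor
    · intro h
      obtain ⟨m, hm⟩ := (X.exact _).1 (congrArg Subtype.val h)
      exact ⟨⟨m, show X.i m ∈ J by rw [hm]; exact r.2⟩, Subtype.ext hm⟩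
    · rintro ⟨m, rfl⟩
      exact Subtype.ext (X.algebraMap_i m)
  have hker : Function.Exact (LinearMap.ker p).subtype p := LinearMap.exact_subtype_ker_map p
  have hkj : ∀ k : LinearMap.ker p, ∃ n, D.j n = k := fun k => (D.exact _).1 k.2
  -- The image of J ⊗ Ker p also comes from M_J ⊗ Y: an element of Ker p is a sum of terms i(m) y,
  -- and i(m) moves across the tensor sign, where r i(m) = i(q(r) m) lies in J.
  have hJ : ∀ (r : J) (n : V ⊗[R] M), ∃ t : MJ ⊗[R'] Y, LinearMap.rTensor Y iJ t = r ⊗ₜ D.j n := by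
    intro r n
    induction n with
    | zero => exact ⟨0, by simp only [map_zero, TensorProduct.tmul_zero]⟩
    | add n n' h h' =>
      obtain ⟨t, ht⟩ := h
      obtain ⟨t', ht'⟩ := h'
      exact ⟨t + t', by rw [map_add, ht, ht', map_add, TensorProduct.tmul_add]⟩
    | tmul v m =>
      obtain ⟨y, rfl⟩ := D.p_surjective v
      refine ⟨(⟨algebraMap R' R r • m, ?_⟩ : MJ) ⊗ₜ y, ?_⟩
      · change X.i _ ∈ J
        rw [← X.mul_i]; exact J.mul_mem_right _ r.2
      · rw [LinearMap.rTensor_tmul, D.j_tmul, ← TensorProduct.smul_tmul]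
        congr 1
        refine Subtype.ext ?_
        change X.i _ = X.i m * r
        rw [← X.mul_i, mul_comm]
  -- The same move now produces the factor i(m') i(m) = 0.
  have hMJ : ∀ (m : MJ) (n : V ⊗[R] M), LinearMap.rTensor Y iJ (m ⊗ₜ D.j n) = 0 := by
    intro m n
    induction n with
    | zero => simp only [map_zero, TensorProduct.tmul_zero]
    | add n n' h h' => rw [map_add, TensorProduct.tmul_add, map_add, h, h', add_zero]
    | tmul v m' =>
      obtain ⟨y, rfl⟩ := D.p_surjective v
      rw [LinearMap.rTensor_tmul, D.j_tmul, ← TensorProduct.smul_tmul]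
      have h0 : X.i m' • iJ m = 0 := Subtype.ext (X.i_mul_i m' m)
      rw [h0, TensorProduct.zero_tmul]
  have hqJ : Function.Injective (LinearMap.rTensor V (qJ.subtype.restrictScalars R')) :=
    rTensor_injective_of_surjective X.q_surjective V qJ.subtype Subtype.val_injective
  have hMJ' : Function.Injective (LinearMap.rTensor V (MJ.subtype.restrictScalars R')) :=
    rTensor_injective_of_surjective X.q_surjective V MJ.subtype Subtype.val_injective
  -- the image of `x` in `qJ ⊗ V` vanishes
  have h₁ : LinearMap.rTensor V g (LinearMap.lTensor J p x) = 0 := by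
    refine hqJ ?_
    rw [map_zero]
    have h : ∀ x : J ⊗[R'] Y, LinearMap.rTensor V (qJ.subtype.restrictScalars R')
        (LinearMap.rTensor V g (LinearMap.lTensor J p x)) =
        TensorProduct.map (Algebra.linearMap R' R) p (LinearMap.rTensor Y J.subtype x) := fun x => by
      induction x with
      | zero => simp only [map_zero]
      | add x y hx hy => simp only [map_add, hx, hy]
      | tmul r y => rfl
    rw [h, hx, map_zero]
  obtain ⟨t, ht⟩ := (rTensor_exact V hig hg _).1 h₁
  obtain ⟨t, rfl⟩ := LinearMap.lTensor_surjective MJ hp t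
  have h₂ : LinearMap.lTensor J p (x - LinearMap.rTensor Y iJ t) = 0 := by
    rw [map_sub, ← ht, sub_eq_zero]
    exact DFunLike.congr_fun ((LinearMap.rTensor_comp_lTensor _ iJ p).trans
      (LinearMap.lTensor_comp_rTensor _ iJ p).symm) t
  obtain ⟨s, hs⟩ := (lTensor_exact J hker hp _).1 h₂
  have h₃ : ∃ t', LinearMap.rTensor Y iJ t' = LinearMap.lTensor J (LinearMap.ker p).subtype s := by
    clear hs
    induction s with
    | zero => exact ⟨0, by simp only [map_zero]⟩
    | add s s' h h' =>
      obtain ⟨t, ht⟩ := h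
      obtain ⟨t', ht'⟩ := h'
      exact ⟨t + t', by rw [map_add, ht, ht', map_add]⟩
    | tmul r k =>
      obtain ⟨n, hn⟩ := hkj k
      obtain ⟨t, ht⟩ := hJ r n
      exact ⟨t, by rw [ht, hn]; rfl⟩
  obtain ⟨t', ht'⟩ := h₃
  obtain ⟨t, rfl⟩ : ∃ t, LinearMap.rTensor Y iJ t = x :=
    ⟨t' + t, by rw [map_add, ht', hs, sub_add_cancel]⟩
  -- the element `t` vanishes in `M ⊗ V`
  have := TensorProduct.CompatibleSMul.of_algebraMap_surjective (M := M) (N := V) X.q_surjective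
  let ε : M ⊗[R'] V →+ Y := (D.j.comp (TensorProduct.comm R M V).toLinearMap.toAddMonoidHom).comp
    (TensorProduct.equivOfCompatibleSMul R R' R' M V).toLinearMap.toAddMonoidHom
  have hε : Function.Injective ε := (D.j_injective.comp (TensorProduct.comm R M V).injective).comp
    (TensorProduct.equivOfCompatibleSMul R R' R' M V).injective
  -- On M_J ⊗ Y the multiplication map to Y is the injection `ε` applied to the image in M ⊗ V.
  have h₄ : ∀ t : MJ ⊗[R'] Y,
      ε (LinearMap.rTensor V (MJ.subtype.restrictScalars R') (LinearMap.lTensor MJ p t)) =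
      TensorProduct.lid R' Y (LinearMap.rTensor Y J.subtype (LinearMap.rTensor Y iJ t)) := fun t => by
    induction t with
    | zero => simp only [map_zero]
    | add x y hx hy => simp only [map_add, hx, hy]
    | tmul m y => exact D.j_tmul y m
  have h₅ : LinearMap.lTensor MJ p t = 0 := by
    refine hMJ' (hε ?_)
    rw [h₄, hx]
    simp only [map_zero]
  obtain ⟨s, rfl⟩ := (lTensor_exact MJ hker hp _).1 h₅
  clear hx ht ht' hs h₅ h₂ h₁
  induction s with
  | zero => simp only [map_zero]
  | add s s' h h' => rw [map_add, map_add, h, h', add_zero]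
  | tmul m k =>
    obtain ⟨n, hn⟩ := hkj k
    have := hMJ m n
    rwa [hn] at this

theorem eq_one_tmul (X : SqZero R M R') (x : R ⊗[R'] Y) : ∃ y, (1 : R) ⊗ₜ[R'] y = x := by
  induction x with
  | zero => exact ⟨0, TensorProduct.tmul_zero _ _⟩
  | add x x' h h' =>
    obtain ⟨y, rfl⟩ := h
    obtain ⟨y', rfl⟩ := h'
    exact ⟨y + y', TensorProduct.tmul_add _ _ _⟩
  | tmul r y =>
    obtain ⟨r, rfl⟩ := X.q_surjective r
    exact ⟨r • y, by rw [← TensorProduct.smul_tmul, Algebra.smul_def, mul_one]⟩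

theorem one_tmul_i_smul (X : SqZero R M R') (m : M) (y : Y) : (1 : R) ⊗ₜ[R'] (X.i m • y) = 0 := by
  rw [← TensorProduct.smul_tmul, Algebra.smul_def, X.algebraMap_i, zero_mul,
    TensorProduct.zero_tmul]

/-- The reduction of `Y` is `V`. -/
noncomputable def iso : R ⊗[R'] Y ≃ₗ[R] V :=
  letI : Module R' V := Module.compHom V (algebraMap R' R)
  haveI hV : IsScalarTower R' R V := ⟨fun r s v => by rw [Algebra.smul_def, mul_smul]; rfl⟩
  let p : Y →ₗ[R'] V := { D.p with map_smul' := D.p_smul }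
  LinearEquiv.ofBijective (p.liftBaseChange R) (by
    constructor
    · refine (injective_iff_map_eq_zero _).2 fun x hx => ?_
      obtain ⟨y, rfl⟩ := eq_one_tmul X x
      rw [LinearMap.liftBaseChange_tmul, one_smul] at hx
      obtain ⟨n, rfl⟩ := (D.exact y).1 hx
      clear hx
      induction n with
      | zero => rw [map_zero, TensorProduct.tmul_zero]
      | add n n' h h' => rw [map_add, TensorProduct.tmul_add, h, h', add_zero]
      | tmul v m =>
        obtain ⟨y, rfl⟩ := D.p_surjective v
        rw [D.j_tmul, one_tmul_i_smul]
    · intro v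
      obtain ⟨y, rfl⟩ := D.p_surjective v
      exact ⟨1 ⊗ₜ y, by rw [LinearMap.liftBaseChange_tmul, one_smul]; rfl⟩)

theorem iso_tmul (r : R) (y : Y) : D.iso (r ⊗ₜ y) = r • D.p y := rfl

/-- A lifting of `V` from a presentation as an extension. -/
noncomputable def toLift [Module.Flat R V] : Lift R' R V where
  carrier := Y
  flat := D.flat
  iso := D.iso

theorem toLift_proj [Module.Flat R V] (y : Y) : D.toLift.proj y = D.p y :=
  (D.iso_tmul 1 y).trans (one_smul R _)

theorem j_eq_zero_iff (D : LiftData X V Y) (n : V ⊗[R] M) : D.j n = 0 ↔ n = 0 :=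
  map_eq_zero_iff _ D.j_injective

theorem p_j (n : V ⊗[R] M) : D.p (D.j n) = 0 := (D.exact _).2 ⟨n, rfl⟩

theorem j_smul (r : R') (n : V ⊗[R] M) : D.j (algebraMap R' R r • n) = r • D.j n := by
  induction n with
  | zero => simp only [smul_zero, map_zero]
  | add n n' h h' => simp only [smul_add, map_add, h, h']
  | tmul v m =>
    obtain ⟨y, rfl⟩ := D.p_surjective v
    rw [TensorProduct.smul_tmul', ← D.p_smul, D.j_tmul, D.j_tmul, smul_comm]

/-- A morphism of extensions which is compatible with the projections is the identity on `V ⊗ M`. -/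
theorem map_j {Y' : Type u} [AddCommGroup Y'] [Module R' Y'] (D' : LiftData X V Y')
    (f : Y →ₗ[R'] Y') (hf : ∀ y, D'.p (f y) = D.p y) (n : V ⊗[R] M) : f (D.j n) = D'.j n := by
  induction n with
  | zero => simp only [map_zero]
  | add n n' h h' => simp only [map_add, h, h']
  | tmul v m =>
    obtain ⟨y, rfl⟩ := D.p_surjective v
    rw [D.j_tmul, map_smul, ← hf, D'.j_tmul]

/-- The five lemma. Any linear map of liftings over V is therefore invertible, so only linear maps
have to be constructed. -/
theorem bijective_of_comp {Y' : Type u} [AddCommGroup Y'] [Module R' Y'] (D' : LiftData X V Y')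
    (f : Y →ₗ[R'] Y') (hf : ∀ y, D'.p (f y) = D.p y) : Function.Bijective f := by
  constructor
  · refine (injective_iff_map_eq_zero _).2 fun y hy => ?_
    obtain ⟨n, rfl⟩ := (D.exact y).1 (by rw [← hf, hy, map_zero])
    rw [map_j D D' f hf, j_eq_zero_iff] at hy
    rw [hy, map_zero]
  · intro y'
    obtain ⟨y, hy⟩ := D.p_surjective (D'.p y')
    obtain ⟨n, hn⟩ := (D'.exact (y' - f y)).1 (by rw [map_sub, hf, hy, sub_self])
    exact ⟨y + D.j n, by rw [map_add, map_j D D' f hf, hn, add_sub_cancel]⟩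

end LiftData

/-! ### The presentation of a lifting as an extension -/

namespace Lift

variable (X : SqZero R M R') {V : Type u} [AddCommGroup V] [Module R V] (L : Lift R' R V)

/-- The map `R ⊗ Y → Y` induced by the multiplication by an element of `M`. -/
noncomputable def mulAux (m : M) : R ⊗[R'] L.carrier →ₗ[R'] L.carrier :=
  TensorProduct.lift (LinearMap.lsmul R' L.carrier ∘ₗ
    ({ toFun := fun r => X.i (r • m)
       map_add' := fun r s => by rw [add_smul, map_add]
       map_smul' := fun r s => by
        rw [Algebra.smul_def, mul_smul, ← X.mul_i]; rfl } : R →ₗ[R'] R'))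

theorem mulAux_tmul (m : M) (r : R) (y : L.carrier) : L.mulAux X m (r ⊗ₜ y) = X.i (r • m) • y := rfl

theorem mulAux_smul (m : M) (r : R) (x : R ⊗[R'] L.carrier) :
    L.mulAux X m (r • x) = L.mulAux X (r • m) x := by
  induction x with
  | zero => simp only [smul_zero, map_zero]
  | add n n' h h' => simp only [smul_add, map_add, h, h']
  | tmul s y =>
    rw [TensorProduct.smul_tmul', mulAux_tmul, mulAux_tmul, smul_eq_mul, mul_comm, mul_smul]

theorem mulAux_add (m m' : M) (x : R ⊗[R'] L.carrier) :
    L.mulAux X (m + m') x = L.mulAux X m x + L.mulAux X m' x := by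
  induction x with
  | zero => simp only [map_zero, add_zero]
  | add n n' h h' => simp only [map_add, h, h']; abel
  | tmul s y => rw [mulAux_tmul, mulAux_tmul, mulAux_tmul, smul_add, map_add, add_smul]

/-- The embedding of `V ⊗ M` into a lifting of `V`. -/
noncomputable def incl : V ⊗[R] M →+ L.carrier :=
  TensorProduct.liftAddHom
    (AddMonoidHom.mk' (fun v => AddMonoidHom.mk' (fun m => L.mulAux X m (L.iso.symm v))
      (fun m m' => L.mulAux_add X m m' _))
      (fun v v' => AddMonoidHom.ext fun m => by
        simp only [AddMonoidHom.mk'_apply, map_add, AddMonoidHom.add_apply]))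
    (fun r v m => by
      simp only [AddMonoidHom.mk'_apply, map_smul, mulAux_smul])

theorem incl_tmul (y : L.carrier) (m : M) : L.incl X (L.proj y ⊗ₜ m) = X.i m • y := by
  change L.mulAux X m (L.iso.symm (L.iso (1 ⊗ₜ y))) = _
  rw [LinearEquiv.symm_apply_apply, mulAux_tmul, one_smul]

theorem proj_surjective (X : SqZero R M R') : Function.Surjective L.proj := fun v => by
  obtain ⟨y, hy⟩ := LiftData.eq_one_tmul X (L.iso.symm v)
  exact ⟨y, by rw [proj_apply, hy, LinearEquiv.apply_symm_apply]⟩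

theorem proj_incl (n : V ⊗[R] M) : L.proj (L.incl X n) = 0 := by
  induction n with
  | zero => simp only [map_zero]
  | add n n' h h' => simp only [map_add, h, h', add_zero]
  | tmul v m =>
    obtain ⟨y, rfl⟩ := L.proj_surjective X v
    rw [incl_tmul, proj_smul, X.algebraMap_i, zero_smul]

/-- Tensoring 0 → M → R' → R → 0 with the flat module L gives the exact sequence 0 → M ⊗ L → L → R ⊗
L → 0. The statement speaks of some type over V ⊗ M because the tensor product over R' uses module
structures on V and M that exist only inside the proof. -/
theorem incl_aux : ∃ (T : Type u) (s : T → V ⊗[R] M), Function.Surjective s ∧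
    Function.Injective (fun t => L.incl X (s t)) ∧
    (∀ y, L.proj y = 0 → ∃ t, L.incl X (s t) = y) := by
  let _ : Module R' V := Module.compHom V (algebraMap R' R)
  let _ : Module R' M := Module.compHom M (algebraMap R' R)
  have hV : IsScalarTower R' R V := ⟨fun r s v => by rw [Algebra.smul_def, mul_smul]; rfl⟩
  have hM : IsScalarTower R' R M := ⟨fun r s v => by rw [Algebra.smul_def, mul_smul]; rfl⟩
  have := TensorProduct.CompatibleSMul.of_algebraMap_surjective (M := M) (N := V) X.q_surjective
  let iM : M →ₗ[R'] R' := { X.i with map_smul' := fun r m => (X.mul_i r m).symm }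
  let p : L.carrier →ₗ[R'] V := { L.proj with map_smul' := L.proj_smul }
  let s : M ⊗[R'] L.carrier →+ V ⊗[R] M :=
    ((TensorProduct.comm R M V).toLinearMap.toAddMonoidHom.comp
      (TensorProduct.mapOfCompatibleSMul R R' R' M V).toAddMonoidHom).comp
      (LinearMap.lTensor M p).toAddMonoidHom
  have hs : ∀ t : M ⊗[R'] L.carrier, L.incl X (s t) =
      TensorProduct.lid R' L.carrier (LinearMap.rTensor L.carrier iM t) := fun t => by
    induction t with
    | zero => simp only [map_zero]
    | add x y hx hy => simp only [map_add, hx, hy]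
    | tmul m y => exact L.incl_tmul X y m
  have hq : Function.Exact iM (Algebra.linearMap R' R) := X.exact
  refine ⟨M ⊗[R'] L.carrier, s, ?_, fun t t' h => ?_, fun y hy => ?_⟩
  · refine ((TensorProduct.comm R M V).surjective.comp
      (TensorProduct.mapOfCompatibleSMul_surjective R R' R' M V)).comp
      (LinearMap.lTensor_surjective M (L.proj_surjective X))
  · simp only [hs] at h
    exact Module.Flat.rTensor_preserves_injective_linearMap (M := L.carrier) iM X.i_injective
      ((TensorProduct.lid R' L.carrier).injective h)
  · have h : LinearMap.rTensor L.carrier (Algebra.linearMap R' R) (1 ⊗ₜ y) = 0 := by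
      rw [LinearMap.rTensor_tmul, Algebra.linearMap_apply, map_one]
      rwa [proj_apply, LinearEquiv.map_eq_zero_iff] at hy
    obtain ⟨t, ht⟩ := (rTensor_exact L.carrier hq X.q_surjective _).1 h
    exact ⟨t, by rw [hs, ht, TensorProduct.lid_tmul, one_smul]⟩

/-- A lifting of `V` is an extension of `V` by `V ⊗ M`. -/
noncomputable def data : LiftData X V L.carrier where
  p := L.proj
  j := L.incl X
  p_smul := L.proj_smul
  p_surjective := L.proj_surjective X
  j_injective := by
    obtain ⟨T, s, h₁, h₂, -⟩ := L.incl_aux X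
    intro n n' h
    obtain ⟨t, rfl⟩ := h₁ n
    obtain ⟨t', rfl⟩ := h₁ n'
    exact congrArg s (h₂ h)
  exact y := by
    obtain ⟨T, s, -, -, h₃⟩ := L.incl_aux X
    constructor
    · intro h
      obtain ⟨t, ht⟩ := h₃ y h
      exact ⟨s t, ht⟩
    · rintro ⟨n, rfl⟩
      exact L.proj_incl X n
  j_tmul := L.incl_tmul X

end Lift

/-! ### Liftings of algebras -/

section AlgLiftData

variable {X : SqZero R M R'} {A : Type u} [Ring A] [Algebra R A]

/-- A lifting of the algebra `A` from a presentation as an extension. -/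
noncomputable def LiftData.toAlgLift [Module.Flat R A] {Y : Type u} [Ring Y] [Algebra R' Y]
    (D : LiftData X A Y) (h₁ : D.p 1 = 1) (h : ∀ y y', D.p (y * y') = D.p y * D.p y') :
    AlgLift R' R A where
  carrier := Y
  flat := D.flat
  iso := Algebra.TensorProduct.algEquivOfLinearEquivTensorProduct D.iso
    (fun r s y z => by
      rw [D.iso_tmul, D.iso_tmul, D.iso_tmul, h, smul_mul_smul_comm])
    (by rw [D.iso_tmul, h₁, one_smul])

theorem LiftData.toAlgLift_proj [Module.Flat R A] {Y : Type u} [Ring Y] [Algebra R' Y]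
    (D : LiftData X A Y) (h₁ : D.p 1 = 1) (h : ∀ y y', D.p (y * y') = D.p y * D.p y') (y : Y) :
    (D.toAlgLift h₁ h).proj y = D.p y :=
  (D.iso_tmul 1 y).trans (one_smul R _)

/-- A lifting of `A` is an extension of `A` by `A ⊗ M`. -/
noncomputable def AlgLift.data (X : SqZero R M R') (L : AlgLift R' R A) : LiftData X A L.carrier :=
  L.toLift.data X

theorem AlgLift.data_p (L : AlgLift R' R A) (y : L.carrier) : (L.data X).p y = L.proj y := rfl

theorem LiftData.mul_j {Y : Type u} [Ring Y] [Algebra R' Y] (D : LiftData X A Y)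
    (h : ∀ y y', D.p (y * y') = D.p y * D.p y') (y : Y) (a : A) (m : M) :
    y * D.j (a ⊗ₜ m) = D.j ((D.p y * a) ⊗ₜ m) := by
  obtain ⟨y', rfl⟩ := D.p_surjective a
  rw [D.j_tmul, ← h, D.j_tmul, mul_smul_comm]

theorem LiftData.j_mul {Y : Type u} [Ring Y] [Algebra R' Y] (D : LiftData X A Y)
    (h : ∀ y y', D.p (y * y') = D.p y * D.p y') (y : Y) (a : A) (m : M) :
    D.j (a ⊗ₜ m) * y = D.j ((a * D.p y) ⊗ₜ m) := by
  obtain ⟨y', rfl⟩ := D.p_surjective a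
  rw [D.j_tmul, ← h, D.j_tmul, smul_mul_assoc]

theorem lft_smul_tmul (a x : A) (m : M) : (lft a : Env R A) • (x ⊗ₜ[R] m) = (a * x) ⊗ₜ m := by
  change a • (1 : Aᵐᵒᵖ) • (x ⊗ₜ[R] m) = _
  rw [one_smul, TensorProduct.smul_tmul']
  rfl

theorem rgt_smul_tmul (a x : A) (m : M) : (rgt a : Env R A) • (x ⊗ₜ[R] m) = (x * a) ⊗ₜ m := by
  change (1 : A) • MulOpposite.op a • (x ⊗ₜ[R] m) = _
  rw [one_smul, TensorProduct.smul_tmul']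
  rfl

theorem LiftData.mul_j' {Y : Type u} [Ring Y] [Algebra R' Y] (D : LiftData X A Y)
    (h : ∀ y y', D.p (y * y') = D.p y * D.p y') (y : Y) (n : A ⊗[R] M) :
    y * D.j n = D.j ((lft (D.p y) : Env R A) • n) := by
  induction n with
  | zero => simp only [smul_zero, map_zero, mul_zero]
  | add n n' h h' => simp only [smul_add, map_add, mul_add, h, h']
  | tmul a m => rw [D.mul_j h, lft_smul_tmul]

theorem LiftData.j_mul' {Y : Type u} [Ring Y] [Algebra R' Y] (D : LiftData X A Y)
    (h : ∀ y y', D.p (y * y') = D.p y * D.p y') (y : Y) (n : A ⊗[R] M) :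
    D.j n * y = D.j ((rgt (D.p y) : Env R A) • n) := by
  induction n with
  | zero => simp only [smul_zero, map_zero, zero_mul]
  | add n n' h h' => simp only [smul_add, map_add, add_mul, h, h']
  | tmul a m => rw [D.j_mul h, rgt_smul_tmul]

end AlgLiftData

end LiftData

/-! ### Algebras given by bilinear products -/

/-- An associative unital bilinear product on a module. -/
structure BilinAlg (k : Type u) [CommRing k] (P : Type u) [AddCommGroup P] [Module k P] where
  mul : P →ₗ[k] P →ₗ[k] P
  one : P
  assoc : ∀ x y z, mul (mul x y) z = mul x (mul y z)
  one_mul : ∀ x, mul one x = x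
  mul_one : ∀ x, mul x one = x

namespace BilinAlg

variable {k : Type u} [CommRing k] {P : Type u} [AddCommGroup P] [Module k P]

/-- The ring underlying a bilinear product. -/
@[reducible] def toRing (m : BilinAlg k P) : Ring P :=
  { (inferInstance : AddCommGroup P) with
    mul := fun x y => m.mul x y
    one := m.one
    mul_assoc := m.assoc
    one_mul := m.one_mul
    mul_one := m.mul_one
    left_distrib := fun x y z => map_add (m.mul x) y z
    right_distrib := fun x y z => m.mul.map_add₂ x y z
    zero_mul := fun x => m.mul.map_zero₂ x
    mul_zero := fun x => map_zero (m.mul x) }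

/-- The algebra underlying a bilinear product. -/
@[reducible] def toAlgebra (m : BilinAlg k P) : letI := m.toRing; Algebra k P :=
  letI := m.toRing
  Algebra.ofModule (fun r x y => m.mul.map_smul₂ r x y) (fun r x y => map_smul (m.mul x) r y)

/-- The product of an algebra. -/
def ofAlgebra (k : Type u) [CommRing k] (B : Type u) [Ring B] [Algebra k B] : BilinAlg k B where
  mul := LinearMap.mul k B
  one := 1
  assoc := _root_.mul_assoc
  one_mul := _root_.one_mul
  mul_one := _root_.mul_one

/-- The product of two algebras. -/
def prod {Q : Type u} [AddCommGroup Q] [Module k Q] (m : BilinAlg k P) (n : BilinAlg k Q) :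
    BilinAlg k (P × Q) where
  mul := LinearMap.mk₂ k (fun x y => (m.mul x.1 y.1, n.mul x.2 y.2))
    (fun _ _ _ => Prod.ext (m.mul.map_add₂ _ _ _) (n.mul.map_add₂ _ _ _))
    (fun _ _ _ => Prod.ext (m.mul.map_smul₂ _ _ _) (n.mul.map_smul₂ _ _ _))
    (fun _ _ _ => Prod.ext (map_add (m.mul _) _ _) (map_add (n.mul _) _ _))
    (fun _ _ _ => Prod.ext (map_smul (m.mul _) _ _) (map_smul (n.mul _) _ _))
  one := (m.one, n.one)
  assoc _ _ _ := Prod.ext (m.assoc _ _ _) (n.assoc _ _ _)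
  one_mul _ := Prod.ext (m.one_mul _) (n.one_mul _)
  mul_one _ := Prod.ext (m.mul_one _) (n.mul_one _)

/-- A subalgebra. -/
def sub (m : BilinAlg k P) (U : Submodule k P) (h₁ : m.one ∈ U)
    (h : ∀ x ∈ U, ∀ y ∈ U, m.mul x y ∈ U) : BilinAlg k U where
  mul := LinearMap.mk₂ k (fun x y => ⟨m.mul x y, h _ x.2 _ y.2⟩)
    (fun _ _ _ => Subtype.ext (m.mul.map_add₂ _ _ _))
    (fun _ _ _ => Subtype.ext (m.mul.map_smul₂ _ _ _))
    (fun _ _ _ => Subtype.ext (map_add (m.mul _) _ _))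
    (fun _ _ _ => Subtype.ext (map_smul (m.mul _) _ _))
  one := ⟨m.one, h₁⟩
  assoc _ _ _ := Subtype.ext (m.assoc _ _ _)
  one_mul _ := Subtype.ext (m.one_mul _)
  mul_one _ := Subtype.ext (m.mul_one _)

variable (m : BilinAlg k P) (I : Submodule k P) (hl : ∀ x, ∀ y ∈ I, m.mul x y ∈ I)
  (hr : ∀ x ∈ I, ∀ y, m.mul x y ∈ I)

/-- The quotient by a two-sided ideal. -/
def quot : BilinAlg k (P ⧸ I) where
  mul := I.liftQ
    { toFun := fun x => I.mapQ I (m.mul x) (hl x)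
      map_add' := fun x y => Submodule.linearMap_qext _ (LinearMap.ext fun z =>
        congrArg (Submodule.Quotient.mk (p := I)) (m.mul.map_add₂ x y z))
      map_smul' := fun r x => Submodule.linearMap_qext _ (LinearMap.ext fun z =>
        congrArg (Submodule.Quotient.mk (p := I)) (m.mul.map_smul₂ r x z)) }
    (fun x hx => Submodule.linearMap_qext _ (LinearMap.ext fun z =>
      (Submodule.Quotient.mk_eq_zero I).2 (hr x hx z)))
  one := Submodule.Quotient.mk m.one
  assoc x y z := by
    obtain ⟨x, rfl⟩ := Submodule.Quotient.mk_surjective I x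
    obtain ⟨y, rfl⟩ := Submodule.Quotient.mk_surjective I y
    obtain ⟨z, rfl⟩ := Submodule.Quotient.mk_surjective I z
    exact congrArg (Submodule.Quotient.mk (p := I)) (m.assoc x y z)
  one_mul x := by
    obtain ⟨x, rfl⟩ := Submodule.Quotient.mk_surjective I x
    exact congrArg (Submodule.Quotient.mk (p := I)) (m.one_mul x)
  mul_one x := by
    obtain ⟨x, rfl⟩ := Submodule.Quotient.mk_surjective I x
    exact congrArg (Submodule.Quotient.mk (p := I)) (m.mul_one x)

end BilinAlg

/-! ### Morphisms of splittings are isomorphisms -/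

section SplGroupoid

variable {R : Type u} [CommRing R] {A : Type u} [Ring A] [Algebra R A] {N : Type u} [AddCommGroup N]
  {C : DGExt R A N}

/-- The five lemma again: the kernel of `f` lies in C₁ by the cartesian square, with 0 as the
element having the required boundary, and `f` is injective there. So splittings form a groupoid, and
essential surjectivity only needs a comparison morphism. -/
theorem Spl.bijective_of_comm {B₁ B₂ : Spl C} (f : B₁.carrier →+ B₂.carrier)
    (h₁ : ∀ c, f (B₁.c₁ c) = B₂.c₁ c) (h₀ : ∀ z, B₂.c₀ (f z) = B₁.c₀ z) :
    Function.Bijective f := by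
  constructor
  · refine (injective_iff_map_eq_zero _).2 fun z hz => ?_
    obtain ⟨c, rfl⟩ := B₁.cartesian z ⟨0, by rw [← h₀, hz, map_zero, map_zero]⟩
    rw [h₁] at hz
    rw [B₂.c₁_injective (hz.trans (map_zero _).symm), map_zero]
  · intro z
    obtain ⟨w, hw⟩ := B₁.c₀_surjective (B₂.c₀ z)
    obtain ⟨c, hc⟩ := B₂.cartesian (z - f w) ⟨0, by rw [map_zero, map_sub, h₀, hw, sub_self]⟩
    exact ⟨w + B₁.c₁ c, by rw [map_add, h₁, hc, add_sub_cancel]⟩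

instance Spl.isIso {B₁ B₂ : Spl C} (f : B₁ ⟶ B₂) : IsIso f := by
  let e := LinearEquiv.ofBijective f.1 (Spl.bijective_of_comm f.1.toAddMonoidHom f.2.1 f.2.2)
  have he : ∀ z, f.1 z = e z := fun z => rfl
  refine ⟨⟨e.symm.toLinearMap, fun c => ?_, fun z => ?_⟩, ?_, ?_⟩
  · refine e.injective ?_
    rw [← he (B₁.c₁ c), f.2.1]
    exact e.apply_symm_apply _
  · rw [← f.2.2]
    exact congrArg B₂.c₀ (e.apply_symm_apply z)
  · exact Subtype.ext (LinearMap.ext e.symm_apply_apply)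
  · exact Subtype.ext (LinearMap.ext e.apply_symm_apply)

instance MulSpl.isIso {B₁ B₂ : MulSpl C} (f : B₁ ⟶ B₂) : IsIso f := by
  let e := AlgEquiv.ofBijective f.1
    (Spl.bijective_of_comm (B₁ := B₁.toSpl) (B₂ := B₂.toSpl) (f.1 : B₁.carrier →+ B₂.carrier)
      f.2.1 f.2.2)
  have he : ∀ z, f.1 z = e z := fun z => rfl
  refine ⟨⟨e.symm.toAlgHom, fun c => ?_, fun z => ?_⟩, ?_, ?_⟩
  · refine e.injective ?_
    rw [← he (B₁.c₁ c), f.2.1]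
    exact e.apply_symm_apply _
  · rw [← f.2.2]
    exact congrArg B₂.c₀ (e.apply_symm_apply z)
  · exact Subtype.ext (AlgHom.ext e.symm_apply_apply)
  · exact Subtype.ext (AlgHom.ext e.apply_symm_apply)

end SplGroupoid

/-! ### The difference functor -/

section DiffFunctor

variable {R : Type u} [CommRing R] {M : Type u} [AddCommGroup M] [Module R M]
  {R' : Type u} [CommRing R'] [Algebra R' R] {X : SqZero R M R'}
  {φ : MulExt R M} (S : Corr X φ.toElemExt) {A : Type u} [Ring A] [Algebra R A]

/-- Scalars of a module over `R'` on which the kernel of `R' → R` acts by zero. -/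
@[reducible] noncomputable def reducedModule (h : Function.Surjective (algebraMap R' R))
    {Y : Type u} [AddCommGroup Y] [Module R' Y]
    (hY : ∀ r : R', algebraMap R' R r = 0 → ∀ y : Y, r • y = 0) : Module R Y :=
  letI : SMul R Y := ⟨fun r y => Function.surjInv h r • y⟩
  Function.Surjective.moduleLeft (algebraMap R' R) h (fun r y => by
    change Function.surjInv h (algebraMap R' R r) • y = r • y
    rw [← sub_eq_zero, ← sub_smul]
    exact hY _ (by rw [map_sub, Function.surjInv_eq h, sub_self]) y)

theorem reducedModule_smul (h : Function.Surjective (algebraMap R' R))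
    {Y : Type u} [AddCommGroup Y] [Module R' Y]
    (hY : ∀ r : R', algebraMap R' R r = 0 → ∀ y : Y, r • y = 0) (r : R') (y : Y) :
    letI := reducedModule h hY
    algebraMap R' R r • y = r • y := by
  change Function.surjInv h (algebraMap R' R r) • y = r • y
  rw [← sub_eq_zero, ← sub_smul]
  exact hY _ (by rw [map_sub, Function.surjInv_eq h, sub_self]) y

variable (L : Lift R' R A)

/-- Since A' → A is onto, the given generators are the diagonal elements of all pure tensors. The
diagonal copy of A ⊗ M is stable under R', so passing to the span adds nothing to it. -/
theorem mem_diag_iff (z : pairs S L) :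
    z ∈ diag S L ↔ ∃ n, z.1.1 = S.c₁Ev A (φ.bEv A n) ∧ z.1.2 = L.incl X n := by
  constructor
  · intro hz
    induction hz using Submodule.span_induction with
    | mem z hz =>
      obtain ⟨y, m, h⟩ := hz
      exact ⟨L.proj y ⊗ₜ m, congrArg Prod.fst h, by rw [h, L.incl_tmul]⟩
    | zero => exact ⟨0, by simp only [map_zero]; exact ⟨rfl, rfl⟩⟩
    | add z w _ _ hz hw =>
      obtain ⟨n, h₁, h₂⟩ := hz
      obtain ⟨n', h₃, h₄⟩ := hw
      refine ⟨n + n', ?_, ?_⟩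
      · rw [map_add, map_add, ← h₁, ← h₃]; rfl
      · rw [map_add, ← h₂, ← h₄]; rfl
    | smul r z _ hz =>
      obtain ⟨n, h₁, h₂⟩ := hz
      refine ⟨algebraMap R' R r • n, ?_, ?_⟩
      · rw [map_smul, S.c₁Ev_smul, ← h₁]; rfl
      · refine Eq.trans ?_ ((L.data X).j_smul r n).symm
        exact congrArg (r • ·) h₂
  · rintro ⟨n, h₁, h₂⟩
    obtain ⟨⟨w, y⟩, hz⟩ := z
    dsimp only at h₁ h₂
    subst h₁ h₂
    induction n with
    | zero => convert (diag S L).zero_mem using 1; exact Subtype.ext (by simp only [map_zero]; rfl)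
    | tmul a m =>
      obtain ⟨y, rfl⟩ := L.proj_surjective X a
      exact Submodule.subset_span ⟨y, m, Prod.ext rfl (L.incl_tmul X y m)⟩
    | add n n' h h' =>
      have hn : ∀ n, ((S.c₁Ev A (φ.bEv A n), L.incl X n) : Ev S.functor A × L.carrier) ∈
          pairs S L := fun n => by
        change φ.aEv A (S.c₀Ev A (S.c₁Ev A (φ.bEv A n))) = L.proj (L.incl X n)
        rw [S.c₀Ev_c₁Ev, φ.aEv_dEv, L.proj_incl]
      convert (diag S L).add_mem (h (hn n)) (h' (hn n')) using 1
      exact Subtype.ext (by simp only [map_add]; rfl)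

/-- The class of a pair in the difference. -/
noncomputable def diffMk (w : Ev S.functor A) (y : L.carrier) (h : φ.aEv A (S.c₀Ev A w) = L.proj y) : Diff S L :=
  Submodule.Quotient.mk ⟨(w, y), h⟩

theorem exists_diffMk (ξ : Diff S L) : ∃ w y h, diffMk S L w y h = ξ := by
  obtain ⟨⟨⟨w, y⟩, h⟩, rfl⟩ := Submodule.Quotient.mk_surjective _ ξ
  exact ⟨w, y, h, rfl⟩

theorem diffMk_eq_iff {w w' : Ev S.functor A} {y y' : L.carrier} (h h') :
    diffMk S L w y h = diffMk S L w' y' h' ↔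
      ∃ n, w - w' = S.c₁Ev A (φ.bEv A n) ∧ y - y' = L.incl X n :=
  (Submodule.Quotient.eq _).trans (mem_diag_iff S L _)

/-- On both factors of the fibre product i(m) acts by way of the common image in A, so it moves a
pair into the diagonal copy of A ⊗ M. This is why the difference is a module over R. -/
theorem diff_torsion (r : R') (hr : algebraMap R' R r = 0) (ξ : Diff S L) : r • ξ = 0 := by
  obtain ⟨m, rfl⟩ := (X.exact r).1 hr
  obtain ⟨w, y, h, rfl⟩ := exists_diffMk S L ξ
  refine (Submodule.Quotient.mk_eq_zero _).2 ((mem_diag_iff S L _).2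
    ⟨φ.aEv A (S.c₀Ev A w) ⊗ₜ m, S.i_smul m w, ?_⟩)
  rw [h, L.incl_tmul]
  rfl

/-- The `R`-module structure of the difference. -/
@[reducible] noncomputable def diffModule : Module R (Diff S L) :=
  reducedModule X.q_surjective (diff_torsion S L)

theorem diffModule_smul (r : R') (ξ : Diff S L) :
    letI := diffModule S L
    algebraMap R' R r • ξ = r • ξ := reducedModule_smul X.q_surjective (diff_torsion S L) r ξ

/-- The map from `C₁(A)` to the difference. -/
noncomputable def diffC₁ : letI := diffModule S L; Ev φ.C₁ A →ₗ[R] Diff S L :=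
  letI := diffModule S L
  { toFun := fun c => Submodule.Quotient.mk ⟨(S.c₁Ev A c, 0), c₁_mem_pairs S L c⟩
    map_add' := fun c c' => congrArg (Submodule.Quotient.mk (p := diag S L))
      (Subtype.ext (Prod.ext (map_add _ _ _) (add_zero _).symm))
    map_smul' := fun r c => by
      obtain ⟨r, rfl⟩ := X.q_surjective r
      rw [RingHom.id_apply, diffModule_smul]
      exact congrArg (Submodule.Quotient.mk (p := diag S L))
        (Subtype.ext (Prod.ext (S.c₁Ev_smul r c) (smul_zero _).symm)) }

/-- The map from the difference to `C₀(A)`. -/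
noncomputable def diffC₀ : letI := diffModule S L; Diff S L →ₗ[R] Ev φ.C₀ A :=
  letI := diffModule S L
  let f : Diff S L →+ Ev φ.C₀ A := QuotientAddGroup.lift (diag S L).toAddSubgroup
    ((S.c₀Ev A).comp ((AddMonoidHom.fst _ _).comp (pairs S L).subtype.toAddMonoidHom))
    (fun z hz => by
      obtain ⟨n, h, -⟩ := (mem_diag_iff S L z).1 hz
      change S.c₀Ev A z.1.1 = 0
      rw [h, S.c₀Ev_c₁Ev, φ.dEv_bEv])
  { f with
    map_smul' := fun r ξ => by
      obtain ⟨r, rfl⟩ := X.q_surjective r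
      obtain ⟨w, y, h, rfl⟩ := exists_diffMk S L ξ
      rw [RingHom.id_apply, diffModule_smul]
      exact S.c₀Ev_smul A r w }

theorem diffC₀_diffMk (w : Ev S.functor A) (y : L.carrier) (h) :
    diffC₀ S L (diffMk S L w y h) = S.c₀Ev A w := rfl

theorem diffC₁_apply (c : Ev φ.C₁ A) :
    diffC₁ S L c = diffMk S L (S.c₁Ev A c) 0 (c₁_mem_pairs S L c) := rfl

theorem diffC₀_surjective : Function.Surjective (diffC₀ S L) := fun x => by
  obtain ⟨w, rfl⟩ := S.c₀Ev_surjective x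
  obtain ⟨y, hy⟩ := L.proj_surjective X (φ.aEv A (S.c₀Ev A w))
  exact ⟨diffMk S L w y hy.symm, rfl⟩

variable [Module.Flat R A]

/-- A pair (c₁(c), 0) is diagonal only for the zero element of A ⊗ M, because A ⊗ M embeds in A'. -/
theorem diffC₁_injective : Function.Injective (diffC₁ S L) := by
  let _ := diffModule S L
  refine (injective_iff_map_eq_zero _).2 fun c hc => ?_
  obtain ⟨n, h₁, h₂⟩ := (mem_diag_iff S L _).1 ((Submodule.Quotient.mk_eq_zero _).1 hc)
  have hn : n = 0 := ((L.data X).j_eq_zero_iff n).1 h₂.symm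
  rw [hn] at h₁
  exact S.c₁Ev_injective (h₁.trans (by simp only [map_zero]))

theorem diff_cartesian (ξ : Diff S L) (h : φ.aEv A (diffC₀ S L ξ) = 0) :
    ∃ c, diffC₁ S L c = ξ := by
  obtain ⟨w, y, hw, rfl⟩ := exists_diffMk S L ξ
  rw [diffC₀_diffMk] at h
  obtain ⟨c, rfl⟩ := S.exists_c₁Ev h
  obtain ⟨n, rfl⟩ := ((L.data X).exact y).1 (hw.symm.trans h)
  -- Modulo the diagonal element of n, the pair (c₁(c), n) is congruent to (c₁(c - b(n)), 0).
  refine ⟨c - φ.bEv A n, ?_⟩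
  rw [diffC₁_apply]
  refine (diffMk_eq_iff S L _ _).2 ⟨-n, ?_, ?_⟩
  · simp only [map_sub, map_neg]; abel
  · rw [zero_sub, map_neg]; rfl

/-- The splitting `C₀₁(A) - A'`. -/
noncomputable def diffSpl : Spl (φ.eval A) :=
  letI := diffModule S L
  { carrier := Diff S L
    c₁ := diffC₁ S L
    c₀ := diffC₀ S L
    c₀_c₁ := fun c => S.c₀Ev_c₁Ev A c
    c₁_injective := diffC₁_injective S L
    c₀_surjective := diffC₀_surjective S L
    cartesian := fun ξ ⟨c, hc⟩ => diff_cartesian S L ξ (by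
      have hc' : φ.dEv A c = diffC₀ S L ξ := hc
      rw [← hc']
      exact φ.aEv_dEv A c) }

variable {L}

/-- The map of differences induced by a morphism of liftings. -/
noncomputable def diffMap {L' : Lift R' R A} (f : L ⟶ L') : Diff S L →ₗ[R'] Diff S L' :=
  (diag S L).mapQ (diag S L')
    { toFun := fun z => ⟨(z.1.1, Lift.hom f z.1.2), map_mem_pairs S f z⟩
      map_add' := fun z w => Subtype.ext (Prod.ext rfl (map_add _ _ _))
      map_smul' := fun r w => Subtype.ext (Prod.ext rfl (map_smul _ _ _)) }
    (fun z hz => by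
      obtain ⟨n, h₁, h₂⟩ := (mem_diag_iff S L z).1 hz
      refine (mem_diag_iff S L' _).2 ⟨n, h₁, ?_⟩
      change Lift.hom f z.1.2 = _
      rw [h₂]
      exact LiftData.map_j (L.data X) (L'.data X) (Lift.hom f) (Lift.proj_hom f) n)

/-- The map of differences induced by a morphism of liftings is `R`-linear. -/
noncomputable def diffMapLin {L' : Lift R' R A} (f : L ⟶ L') :
    letI := diffModule S L
    letI := diffModule S L'
    Diff S L →ₗ[R] Diff S L' :=
  letI := diffModule S L
  letI := diffModule S L'
  { toFun := diffMap S f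
    map_add' := map_add _
    map_smul' := fun r ξ => by
      obtain ⟨r, rfl⟩ := X.q_surjective r
      rw [diffModule_smul, RingHom.id_apply, diffModule_smul, map_smul] }

variable (A) in
/-- The functor `A' ↦ C₀₁(A) - A'`. -/
noncomputable def diffFunctor : Lift R' R A ⥤ Spl (φ.eval A) where
  obj L := diffSpl S L
  map {L L'} f :=
    ⟨diffMapLin S f,
      fun c => congrArg (Submodule.Quotient.mk (p := diag S L'))
        (Subtype.ext (Prod.ext rfl (map_zero (Lift.hom f)))),
      fun ξ => by
        obtain ⟨w, y, h, rfl⟩ := exists_diffMk S L ξ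
        rfl⟩
  map_id L := Subtype.ext (LinearMap.ext fun ξ => by
    obtain ⟨w, y, h, rfl⟩ := exists_diffMk S L ξ
    rfl)
  map_comp f g := Subtype.ext (LinearMap.ext fun ξ => by
    obtain ⟨w, y, h, rfl⟩ := exists_diffMk S _ ξ
    rfl)

variable (A) in
/-- The values of the difference functor are the differences. -/
noncomputable def isDiff : IsDiff S (diffFunctor S A) where
  iso L :=
    { toEquiv := AddEquiv.refl _
      map_smul := fun r z => (diffModule_smul S L r z).symm
      map_c₁ := fun _ => rfl
      c₀_map := fun _ => rfl }
  natural _ _ := rfl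

end DiffFunctor

/-! ### The difference functor is fully faithful -/

section FullyFaithful

variable {R : Type u} [CommRing R] {M : Type u} [AddCommGroup M] [Module R M]
  {R' : Type u} [CommRing R'] [Algebra R' R] {X : SqZero R M R'}
  {φ : MulExt R M} (S : Corr X φ.toElemExt) {A : Type u} [Ring A] [Algebra R A]

theorem exists_c₀Ev_eq {L : Lift R' R A} (y : L.carrier) :
    ∃ w : Ev S.functor A, φ.aEv A (S.c₀Ev A w) = L.proj y := by
  obtain ⟨x, hx⟩ := φ.aEv_surjective (L.proj y)
  obtain ⟨w, rfl⟩ := S.c₀Ev_surjective x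
  exact ⟨w, hx⟩

theorem diffMk_add {L : Lift R' R A} {w w' : Ev S.functor A} {y y' : L.carrier} (h h') :
    diffMk S L w y h + diffMk S L w' y' h' =
      diffMk S L (w + w') (y + y') (by simp only [map_add, h, h']) := rfl

theorem diffMk_smul {L : Lift R' R A} (r : R') {w : Ev S.functor A} {y : L.carrier} (h) :
    r • diffMk S L w y h =
      diffMk S L (r • w) (r • y) (by rw [S.c₀Ev_smul, map_smul, h, L.proj_smul]) := rfl

variable [Module.Flat R A]

/-- For a fixed first component the class determines the second, because A ⊗ M embeds in C₀₁(A).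
This recovers maps of liftings from maps of differences, and proves identities between them. -/
theorem diffMk_right_injective {L : Lift R' R A} {w : Ev S.functor A} {y y' : L.carrier} {h h'}
    (e : diffMk S L w y h = diffMk S L w y' h') : y = y' := by
  obtain ⟨n, h₁, h₂⟩ := (diffMk_eq_iff S L h h').1 e
  rw [sub_self] at h₁
  have h₃ : φ.bEv A n = 0 := S.c₁Ev_injective (h₁.symm.trans (map_zero _).symm)
  have h₄ : n = 0 := φ.bEv_injective (h₃.trans (map_zero _).symm)
  rw [h₄, map_zero] at h₂
  exact sub_eq_zero.1 h₂

/-- Elements of C₀₁(A) with equal images in C₀(A) differ by an element of A ⊗ M, which the diagonal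
moves to the other component. -/
theorem exists_diffMk_of_eq {L : Lift R' R A} (ξ : Diff S L) (w : Ev S.functor A)
    (h : diffC₀ S L ξ = S.c₀Ev A w) : ∃ y h, diffMk S L w y h = ξ := by
  obtain ⟨w', y, h', rfl⟩ := exists_diffMk S L ξ
  rw [diffC₀_diffMk] at h
  have h₀ : S.c₀Ev A (w' - w) = 0 := by rw [map_sub, h, sub_self]
  obtain ⟨c, hc⟩ := S.exists_c₁Ev (z := w' - w) (by rw [h₀, map_zero])
  obtain ⟨n, rfl⟩ := (φ.exact_bEv_dEv c).1 (by rw [← S.c₀Ev_c₁Ev, hc, h₀])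
  refine ⟨y - L.incl X n, ?_, ?_⟩
  · rw [map_sub, L.proj_incl, sub_zero, ← h, h']
  · refine ((diffMk_eq_iff S L _ _).2 ⟨n, hc.symm, ?_⟩).symm
    rw [sub_sub_cancel]

/-- Compatibility with c₀ allows the image of [w, y] to be written [w, y'] with the same w, and y'
is then unique. It does not depend on w because two choices over the same element of A differ by
some c₁(c), and the map is compatible with c₁. Linearity of y ↦ y' follows by comparing second
components. -/
theorem exists_map_of_diff {L L' : Lift R' R A} (g : Diff S L →ₗ[R'] Diff S L')
    (h₁ : ∀ c, g (diffC₁ S L c) = diffC₁ S L' c) (h₀ : ∀ ξ, diffC₀ S L' (g ξ) = diffC₀ S L ξ) :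
    ∃ f : L.carrier →ₗ[R'] L'.carrier, ∀ w y h, ∃ h', g (diffMk S L w y h) = diffMk S L' w (f y) h' := by
  choose s hs using exists_c₀Ev_eq S (L := L)
  have hg : ∀ w y h, ∃ y' h', diffMk S L' w y' h' = g (diffMk S L w y h) := fun w y h =>
    exists_diffMk_of_eq S _ w (by rw [h₀, diffC₀_diffMk])
  choose f hf using fun y => hg (s y) y (hs y)
  have key : ∀ w y h, ∃ h', g (diffMk S L w y h) = diffMk S L' w (f y) h' := fun w y h => by
    obtain ⟨c, hc⟩ := S.exists_c₁Ev (z := w - s y) (by rw [map_sub, map_sub, h, hs, sub_self])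
    obtain ⟨h', hf'⟩ := hf y
    have h'' : φ.aEv A (S.c₀Ev A w) = L'.proj (f y) := by rw [← h', hs, h]
    refine ⟨h'', ?_⟩
    have e₁ : diffMk S L w y h = diffC₁ S L c + diffMk S L (s y) y (hs y) := by
      refine Eq.trans ?_ (diffMk_add S (L := L) (c₁_mem_pairs S L c) (hs y)).symm
      congr 1
      · rw [hc, sub_add_cancel]
      · rw [zero_add]
    have e₂ : diffMk S L' w (f y) h'' = diffC₁ S L' c + diffMk S L' (s y) (f y) h' := by
      refine Eq.trans ?_ (diffMk_add S (L := L') (c₁_mem_pairs S L' c) h').symm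
      congr 1
      · rw [hc, sub_add_cancel]
      · rw [zero_add]
    rw [e₁, e₂, map_add, h₁, hf']
  refine ⟨{ toFun := f, map_add' := fun y z => ?_, map_smul' := fun r y => ?_ }, key⟩
  · obtain ⟨w, hw⟩ := exists_c₀Ev_eq S y
    obtain ⟨w', hw'⟩ := exists_c₀Ev_eq S z
    obtain ⟨h₂, e₂⟩ := key w y hw
    obtain ⟨h₃, e₃⟩ := key w' z hw'
    obtain ⟨h₄, e₄⟩ := key (w + w') (y + z) (by simp only [map_add, hw, hw'])
    rw [← diffMk_add S hw hw', map_add, e₂, e₃, diffMk_add] at e₄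
    exact (diffMk_right_injective S e₄).symm
  · obtain ⟨w, hw⟩ := exists_c₀Ev_eq S y
    obtain ⟨h₂, e₂⟩ := key w y hw
    obtain ⟨h₄, e₄⟩ := key (r • w) (r • y) (by rw [S.c₀Ev_smul, map_smul, hw, L.proj_smul])
    rw [← diffMk_smul S r hw, map_smul, e₂, diffMk_smul] at e₄
    exact (diffMk_right_injective S e₄).symm

/-- A morphism of liftings from an additive map over `V`. -/
noncomputable def Lift.homOfLin (X : SqZero R M R') {L L' : Lift R' R A}
    (f : L.carrier →ₗ[R'] L'.carrier) (h : ∀ y, L'.proj (f y) = L.proj y) : L ⟶ L' :=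
  ⟨LinearEquiv.ofBijective f (LiftData.bijective_of_comp (L.data X) (L'.data X) f h), h⟩

instance diffFunctor_full : (diffFunctor S A).Full where
  map_surjective {L L'} g := by
    let g₁ : Diff S L →ₗ[R'] Diff S L' :=
      { toFun := g.1
        map_add' := map_add g.1
        map_smul' := fun r ξ => by
          let := diffModule S L
          let := diffModule S L'
          have h₁ := diffModule_smul S L r ξ
          have h₂ := diffModule_smul S L' r (g.1 ξ)
          have h₃ := map_smul g.1 (algebraMap R' R r) ξ
          rw [← h₁, RingHom.id_apply, ← h₂]
          exact h₃ }
    obtain ⟨f, hf⟩ := exists_map_of_diff S g₁ g.2.1 g.2.2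
    refine ⟨Lift.homOfLin X f (fun y => ?_), Subtype.ext (LinearMap.ext fun ξ => ?_)⟩
    · obtain ⟨w, hw⟩ := exists_c₀Ev_eq S y
      obtain ⟨h, -⟩ := hf w y hw
      rw [← h, hw]
    · obtain ⟨w, y, h, rfl⟩ := exists_diffMk S L ξ
      obtain ⟨h', e⟩ := hf w y h
      exact e.symm

instance diffFunctor_faithful : (diffFunctor S A).Faithful where
  map_injective {L L'} f f' e := by
    refine Subtype.ext (LinearEquiv.ext fun y => ?_)
    obtain ⟨w, hw⟩ := exists_c₀Ev_eq S y
    have h : diffMapLin S f (diffMk S L w y hw) = diffMapLin S f' (diffMk S L w y hw) :=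
      congrArg (fun g => g.1 (diffMk S L w y hw)) e
    exact diffMk_right_injective S (h := by rw [hw]; exact (f.2 y).symm)
      (h' := by rw [hw]; exact (f'.2 y).symm) h

end FullyFaithful

/-! ### The lifting attached to a splitting -/

section EssSurj

variable {R : Type u} [CommRing R] {M : Type u} [AddCommGroup M] [Module R M]
  {R' : Type u} [CommRing R'] [Algebra R' R] {X : SqZero R M R'}
  {φ : MulExt R M} (S : Corr X φ.toElemExt) {A : Type u} [Ring A] [Algebra R A]
  (B : Spl (φ.eval A))

/-- A splitting of `C(A)` as an `R'`-module. -/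
def Res (_ : Corr X φ.toElemExt) (B : Spl (φ.eval A)) : Type u := B.carrier

instance : AddCommGroup (Res S B) := inferInstanceAs (AddCommGroup B.carrier)

instance : Module R (Res S B) := inferInstanceAs (Module R B.carrier)

instance : Module R' (Res S B) := Module.compHom (Res S B) (algebraMap R' R)

theorem res_smul (r : R') (b : Res S B) : r • b = algebraMap R' R r • b := rfl

/-- The map from `C₁(A)`. -/
def resC₁ : Ev φ.C₁ A →ₗ[R] Res S B := B.c₁

/-- The map to `C₀(A)`. -/
def resC₀ : Res S B →ₗ[R] Ev φ.C₀ A := B.c₀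

theorem resC₀_resC₁ (c : Ev φ.C₁ A) : resC₀ S B (resC₁ S B c) = φ.dEv A c := B.c₀_c₁ c

/-- The fibre product of `C₀₁(A)` and a splitting over `C₀(A)`. -/
noncomputable def compPairs : Submodule R' (Ev S.functor A × Res S B) where
  carrier := {z | S.c₀Ev A z.1 = resC₀ S B z.2}
  add_mem' {z w} hz hw := by
    change _ = _ at hz hw
    change S.c₀Ev A (z.1 + w.1) = resC₀ S B (z.2 + w.2)
    rw [map_add, map_add, hz, hw]
  zero_mem' := by
    change S.c₀Ev A 0 = resC₀ S B 0
    rw [map_zero, map_zero]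
  smul_mem' r z hz := by
    change _ = _ at hz
    change S.c₀Ev A (r • z.1) = resC₀ S B (r • z.2)
    rw [S.c₀Ev_smul, hz, res_smul, map_smul]

/-- The diagonal copy of `C₁(A)`. -/
noncomputable def compDiag : Submodule R' (compPairs S B) where
  carrier := {z | ∃ c, z.1.1 = S.c₁Ev A c ∧ z.1.2 = resC₁ S B c}
  add_mem' {z w} := by
    rintro ⟨c, h₁, h₂⟩ ⟨c', h₃, h₄⟩
    refine ⟨c + c', ?_, ?_⟩
    · rw [map_add, ← h₁, ← h₃]; rfl
    · rw [map_add, ← h₂, ← h₄]; rfl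
  zero_mem' := ⟨0, (map_zero _).symm, (map_zero _).symm⟩
  smul_mem' r z := by
    rintro ⟨c, h₁, h₂⟩
    refine ⟨algebraMap R' R r • c, ?_, ?_⟩
    · rw [S.c₁Ev_smul, ← h₁]; rfl
    · rw [map_smul, ← h₂]; rfl

/-- The lifting attached to a splitting, as an `R'`-module. -/
abbrev CompDiff : Type u := compPairs S B ⧸ compDiag S B

/-- The class of a pair. -/
noncomputable def compMk (w : Ev S.functor A) (b : Res S B) (h : S.c₀Ev A w = resC₀ S B b) :
    CompDiff S B := Submodule.Quotient.mk ⟨(w, b), h⟩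

theorem exists_compMk (ξ : CompDiff S B) : ∃ w b h, compMk S B w b h = ξ := by
  obtain ⟨⟨⟨w, y⟩, h⟩, rfl⟩ := Submodule.Quotient.mk_surjective _ ξ
  exact ⟨w, y, h, rfl⟩

theorem compMk_eq_iff {w w' : Ev S.functor A} {b b' : Res S B} (h h') :
    compMk S B w b h = compMk S B w' b' h' ↔
      ∃ c, w - w' = S.c₁Ev A c ∧ b - b' = resC₁ S B c :=
  Submodule.Quotient.eq _

theorem compMk_add {w w' : Ev S.functor A} {b b' : Res S B} (h h') :
    compMk S B w b h + compMk S B w' b' h' =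
      compMk S B (w + w') (b + b') (by simp only [map_add, h, h']) := rfl

theorem compMk_smul (r : R') {w : Ev S.functor A} {b : Res S B} (h) :
    r • compMk S B w b h =
      compMk S B (r • w) (r • b) (by rw [S.c₀Ev_smul, h, res_smul, map_smul]) := rfl

theorem exists_c₀Ev_eq_resC₀ (b : Res S B) : ∃ w : Ev S.functor A, S.c₀Ev A w = resC₀ S B b :=
  S.c₀Ev_surjective _

/-- The projection to `A` of the lifting attached to a splitting. -/
noncomputable def compProj : CompDiff S B →+ A :=
  QuotientAddGroup.lift (compDiag S B).toAddSubgroup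
    (((φ.aEv A).toAddMonoidHom.comp (S.c₀Ev A)).comp
      ((AddMonoidHom.fst _ _).comp (compPairs S B).subtype.toAddMonoidHom))
    (fun z ⟨c, h, _⟩ => by
      change φ.aEv A (S.c₀Ev A z.1.1) = 0
      rw [h, S.c₀Ev_c₁Ev, φ.aEv_dEv])

theorem compProj_compMk {w : Ev S.functor A} {b : Res S B} (h) :
    compProj S B (compMk S B w b h) = φ.aEv A (S.c₀Ev A w) := rfl

theorem c₀Ev_c₁Ev_bEv (n : A ⊗[R] M) : S.c₀Ev A (S.c₁Ev A (φ.bEv A n)) = 0 := by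
  rw [S.c₀Ev_c₁Ev, φ.dEv_bEv]

theorem c₀Ev_c₁Ev_bEv' (n : A ⊗[R] M) :
    S.c₀Ev A (S.c₁Ev A (φ.bEv A n)) = resC₀ S B 0 := by
  rw [c₀Ev_c₁Ev_bEv, map_zero]

/-- The lifting attached to a splitting, as an extension. -/
noncomputable def compData [Module.Flat R A] : LiftData X A (CompDiff S B) where
  p := compProj S B
  j := AddMonoidHom.mk' (fun n => compMk S B (S.c₁Ev A (φ.bEv A n)) 0 (c₀Ev_c₁Ev_bEv' S B n))
    (fun n n' => by
      rw [compMk_add]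
      congr 1
      · simp only [map_add]
      · rw [add_zero])
  p_smul r ξ := by
    obtain ⟨w, b, h, rfl⟩ := exists_compMk S B ξ
    rw [compMk_smul, compProj_compMk, compProj_compMk, S.c₀Ev_smul, map_smul]
  p_surjective a := by
    obtain ⟨x, rfl⟩ := φ.aEv_surjective a
    obtain ⟨w, rfl⟩ := S.c₀Ev_surjective x
    obtain ⟨b, hb⟩ := B.c₀_surjective (S.c₀Ev A w)
    exact ⟨compMk S B w b hb.symm, rfl⟩
  j_injective n n' e := by
    obtain ⟨c, h₁, h₂⟩ := (compMk_eq_iff S B _ _).1 e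
    have hc : c = 0 := B.c₁_injective (h₂.symm.trans ((sub_self _).trans (map_zero B.c₁).symm))
    rw [hc, map_zero, sub_eq_zero] at h₁
    exact φ.bEv_injective (S.c₁Ev_injective h₁)
  exact ξ := by
    constructor
    · intro h
      obtain ⟨w, b, hw, rfl⟩ := exists_compMk S B ξ
      rw [compProj_compMk] at h
      obtain ⟨c, rfl⟩ := S.exists_c₁Ev h
      rw [S.c₀Ev_c₁Ev] at hw
      obtain ⟨c', hc''⟩ : ∃ c' : Ev φ.C₁ A, resC₁ S B c' = b := B.cartesian b ⟨c, hw⟩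
      obtain ⟨n, hn⟩ := (φ.exact_bEv_dEv (c - c')).1 (by
        rw [map_sub, hw, ← hc'', resC₀_resC₁, sub_self])
      -- Subtracting the diagonal element of c' makes the second component zero and the first c₁(c -
      -- c') = c₁(b(n)).
      refine ⟨n, (compMk_eq_iff S B _ _).2 ⟨-c', ?_, ?_⟩⟩
      · rw [hn, map_neg, map_sub]; abel
      · rw [map_neg, hc'', zero_sub]
    · rintro ⟨n, rfl⟩
      change φ.aEv A (S.c₀Ev A (S.c₁Ev A (φ.bEv A n))) = 0
      rw [c₀Ev_c₁Ev_bEv, map_zero]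
  j_tmul ξ m := by
    obtain ⟨w, b, h, rfl⟩ := exists_compMk S B ξ
    rw [compMk_smul]
    change compMk S B _ _ _ = _
    congr 1
    · exact (S.i_smul m w).symm
    · rw [res_smul, X.algebraMap_i, zero_smul]

variable [Module.Flat R A]

/-- The lifting attached to a splitting. -/
noncomputable def compLift : Lift R' R A := (compData S B).toLift

theorem compLift_proj {w : Ev S.functor A} {b : Res S B} (h) :
    (compLift S B).proj (compMk S B w b h) = φ.aEv A (S.c₀Ev A w) :=
  (compData S B).toLift_proj (compMk S B w b h)

theorem compLift_incl (n : A ⊗[R] M) : (compLift S B).incl X n =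
    compMk S B (S.c₁Ev A (φ.bEv A n)) 0 (c₀Ev_c₁Ev_bEv' S B n) :=
  (LiftData.map_j (compData S B) ((compData S B).toLift.data X) LinearMap.id
    (fun y => (compData S B).toLift_proj y) n).symm

/-- The class in the difference of `C₀₁(A)` and the lifting attached to a splitting. -/
noncomputable def compDiffMk (w : Ev S.functor A) (b : Res S B) (h : S.c₀Ev A w = resC₀ S B b) :
    Diff S (compLift S B) :=
  diffMk S (compLift S B) w (compMk S B w b h) (compLift_proj S B h).symm

/-- Changing w by an element of A ⊗ M changes (w, [w, b]) by its diagonal image, so the class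
depends on b alone. This gives the comparison map from B to the difference of C₀₁(A) and the lifting
attached to B. -/
theorem compDiffMk_eq {w w' : Ev S.functor A} {b : Res S B} (h h') :
    compDiffMk S B w b h = compDiffMk S B w' b h' := by
  have h₀ : S.c₀Ev A (w - w') = 0 := by rw [map_sub, h, h', sub_self]
  obtain ⟨c, hc⟩ := S.exists_c₁Ev (z := w - w') (by rw [h₀, map_zero])
  obtain ⟨n, rfl⟩ := (φ.exact_bEv_dEv c).1 (by rw [← S.c₀Ev_c₁Ev, hc, h₀])
  refine (diffMk_eq_iff S _ _ _).2 ⟨n, hc.symm, ?_⟩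
  rw [compLift_incl]
  refine (sub_eq_iff_eq_add (G := CompDiff S B)).2 ?_
  refine Eq.trans ?_ (compMk_add S B _ _).symm
  congr 1
  · rw [hc, sub_add_cancel]
  · rw [zero_add]

/-- The map from a splitting to the difference of `C₀₁(A)` and the attached lifting. -/
noncomputable def toCompDiff (b : Res S B) : Diff S (compLift S B) :=
  compDiffMk S B _ b (exists_c₀Ev_eq_resC₀ S B b).choose_spec

theorem toCompDiff_eq (w : Ev S.functor A) (b : Res S B) (h : S.c₀Ev A w = resC₀ S B b) :
    toCompDiff S B b = compDiffMk S B w b h := compDiffMk_eq S B _ _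

theorem toCompDiff_add (b b' : Res S B) :
    toCompDiff S B (b + b') = toCompDiff S B b + toCompDiff S B b' := by
  obtain ⟨w, hw⟩ := exists_c₀Ev_eq_resC₀ S B b
  obtain ⟨w', hw'⟩ := exists_c₀Ev_eq_resC₀ S B b'
  rw [toCompDiff_eq S B w b hw, toCompDiff_eq S B w' b' hw',
    toCompDiff_eq S B (w + w') (b + b') (by simp only [map_add, hw, hw'])]
  rfl

theorem toCompDiff_smul (r : R') (b : Res S B) :
    toCompDiff S B (r • b) = r • toCompDiff S B b := by
  obtain ⟨w, hw⟩ := exists_c₀Ev_eq_resC₀ S B b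
  rw [toCompDiff_eq S B w b hw, toCompDiff_eq S B (r • w) (r • b)
    (by rw [S.c₀Ev_smul, hw, res_smul, map_smul])]
  rfl

theorem toCompDiff_resC₁ (c : Ev φ.C₁ A) :
    toCompDiff S B (resC₁ S B c) = diffC₁ S (compLift S B) c := by
  rw [toCompDiff_eq S B (S.c₁Ev A c) _ (by rw [S.c₀Ev_c₁Ev, resC₀_resC₁])]
  refine (diffMk_eq_iff S _ _ _).2 ⟨0, by simp only [sub_self, map_zero], ?_⟩
  rw [map_zero]
  refine (sub_zero (G := CompDiff S B) _).trans ?_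
  exact (Submodule.Quotient.mk_eq_zero _).2 ⟨c, rfl, rfl⟩

theorem diffC₀_toCompDiff (b : Res S B) :
    diffC₀ S (compLift S B) (toCompDiff S B b) = resC₀ S B b := by
  obtain ⟨w, hw⟩ := exists_c₀Ev_eq_resC₀ S B b
  rw [toCompDiff_eq S B w b hw, ← hw]
  rfl

/-- The comparison of a splitting with the difference of `C₀₁(A)` and the attached lifting. -/
noncomputable def compHom : B ⟶ diffSpl S (compLift S B) :=
  letI := diffModule S (compLift S B)
  ⟨{ toFun := toCompDiff S B
     map_add' := toCompDiff_add S B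
     map_smul' := fun r b => by
      obtain ⟨r, rfl⟩ := X.q_surjective r
      exact (toCompDiff_smul S B r b).trans (diffModule_smul S _ r _).symm },
    toCompDiff_resC₁ S B, diffC₀_toCompDiff S B⟩

instance diffFunctor_essSurj : (diffFunctor S A).EssSurj where
  mem_essImage B := ⟨compLift S B, ⟨(asIso (compHom S B)).symm⟩⟩

instance diffFunctor_isEquivalence : (diffFunctor S A).IsEquivalence where

end EssSurj

/-! ### Splittings with a bilinear product -/

section SplAlg

/-- A product which is bilinear over `k'` is bilinear over a quotient `k` of `k'`. -/
def BilinAlg.ofSurjective {k k' : Type u} [CommRing k] [CommRing k'] [Algebra k' k]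
    (hk : Function.Surjective (algebraMap k' k)) {P : Type u} [AddCommGroup P] [Module k' P]
    [Module k P] (m : BilinAlg k' P) (hP : ∀ (r : k') (x : P), algebraMap k' k r • x = r • x) :
    BilinAlg k P where
  mul := LinearMap.mk₂ k (fun x y => m.mul x y) (fun _ _ _ => m.mul.map_add₂ _ _ _)
    (fun r x y => by
      obtain ⟨r, rfl⟩ := hk r
      rw [hP, hP]
      exact m.mul.map_smul₂ _ _ _)
    (fun _ _ _ => map_add (m.mul _) _ _)
    (fun r x y => by
      obtain ⟨r, rfl⟩ := hk r
      rw [hP, hP]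
      exact map_smul (m.mul _) _ _)
  one := m.one
  assoc := m.assoc
  one_mul := m.one_mul
  mul_one := m.mul_one

variable {R : Type u} [CommRing R] {A : Type u} [Ring A] [Algebra R A] {N : Type u} [AddCommGroup N]
  {C : DGExt R A N}

/-- A splitting with a compatible product. -/
def Spl.toMulSpl (B : Spl C) (m : BilinAlg R B.carrier) (h₁ : B.c₀ m.one = 1)
    (h : ∀ z w, B.c₀ (m.mul z w) = B.c₀ z * B.c₀ w)
    (hl : ∀ z c, B.c₁ (C.lmul (B.c₀ z) c) = m.mul z (B.c₁ c))
    (hr : ∀ c z, B.c₁ (C.rmul c (B.c₀ z)) = m.mul (B.c₁ c) z) : MulSpl C where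
  carrier := B.carrier
  ring := m.toRing
  algebra := m.toAlgebra
  c₁ := B.c₁
  c₀ :=
    letI := m.toRing
    letI := m.toAlgebra
    AlgHom.ofLinearMap B.c₀ h₁ h
  c₀_c₁ := B.c₀_c₁
  c₁_injective := B.c₁_injective
  c₀_surjective := B.c₀_surjective
  cartesian := B.cartesian
  c₁_lmul := hl
  c₁_rmul := hr

/-- The product of a multiplicative splitting. -/
abbrev MulSpl.mul (B : MulSpl C) (x y : B.carrier) : B.carrier := x * y

/-- The unit of a multiplicative splitting. -/
abbrev MulSpl.one (B : MulSpl C) : B.carrier := 1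

/-- A multiplicative morphism of the underlying splittings. -/
def MulSpl.homMk {B₁ B₂ : MulSpl C} (f : B₁.toSpl ⟶ B₂.toSpl) (h₁ : f.1 B₁.one = B₂.one)
    (h : ∀ z w, f.1 (B₁.mul z w) = B₂.mul (f.1 z) (f.1 w)) : B₁ ⟶ B₂ :=
  ⟨AlgHom.ofLinearMap (B := B₂.carrier) f.1 h₁ h, f.2⟩

end SplAlg

/-! ### The difference functor on liftings of algebras -/

section MulDiff

variable {R : Type u} [CommRing R] {M : Type u} [AddCommGroup M] [Module R M]
  {R' : Type u} [CommRing R'] [Algebra R' R] {X : SqZero R M R'}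
  {φ : MulExt R M} {S : Corr X φ.toElemExt} (μ : MulCorr S) {A : Type u} [Ring A] [Algebra R A]

/-- The algebra `C₀₁(A)`. -/
noncomputable def wAlg : BilinAlg R' (Ev S.functor A) where
  mul := MulExt.toBilin (μ.mulEv A) (pairExt_smul_left _ _) (pairExt_smul_right _ _)
  one := cls S.functor _ (unitMap A) μ.str.one
  assoc := pairExt_assoc A μ.str.assoc
  one_mul := pairExt_one_left A μ.str.mul μ.str.one μ.str.one_mul
  mul_one := pairExt_one_right A μ.str.mul μ.str.one μ.str.mul_one

theorem c₀Ev_wAlg_one : S.c₀Ev A (wAlg μ).one = cls φ.C₀ _ (unitMap A) φ.m₀₀.one := by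
  refine (S.c₀Ev_cls A _ _ _).trans ?_
  rw [μ.c₀_one]

theorem mulEv_c₁Ev (z : Ev S.functor A) (c : Ev φ.C₁ A) : μ.mulEv A z (S.c₁Ev A c) =
    S.c₁Ev A (pairExt φ.m₀₁ (LinearMap.mul R A) (S.c₀Ev A z) c) := by
  induction z using ev_induction S.functor with
  | hadd x x' hx hx' => simp only [map_add, AddMonoidHom.add_apply, hx, hx']
  | hcls P f x =>
    induction c using ev_induction φ.C₁ with
    | hadd y y' hy hy' => simp only [map_add, hy, hy']
    | hcls Q g y =>
      rw [MulCorr.mulEv, Corr.c₁Ev_cls, Corr.c₀Ev_cls, pairExt_cls, pairExt_cls, Corr.c₁Ev_cls,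
        μ.c₁_left]

theorem c₁Ev_mulEv (c : Ev φ.C₁ A) (z : Ev S.functor A) : μ.mulEv A (S.c₁Ev A c) z =
    S.c₁Ev A (pairExt φ.m₁₀ (LinearMap.mul R A) c (S.c₀Ev A z)) := by
  induction c using ev_induction φ.C₁ with
  | hadd x x' hx hx' => simp only [map_add, AddMonoidHom.add_apply, hx, hx']
  | hcls P f x =>
    induction z using ev_induction S.functor with
    | hadd y y' hy hy' => simp only [map_add, hy, hy']
    | hcls Q g y =>
      rw [MulCorr.mulEv, Corr.c₁Ev_cls, Corr.c₀Ev_cls, pairExt_cls, pairExt_cls, Corr.c₁Ev_cls,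
        μ.c₁_right]

theorem m₀₁_bEv_eq_lft [Module.Flat R A] (x : Ev φ.C₀ A) (n : A ⊗[R] M) :
    pairExt φ.m₀₁ (LinearMap.mul R A) x (φ.bEv A n) =
      φ.bEv A ((lft (φ.aEv A x) : Env R A) • n) := φ.eval_isElementary.lmul_b x n

theorem m₁₀_bEv_eq_rgt [Module.Flat R A] (x : Ev φ.C₀ A) (n : A ⊗[R] M) :
    pairExt φ.m₁₀ (LinearMap.mul R A) (φ.bEv A n) x =
      φ.bEv A ((rgt (φ.aEv A x) : Env R A) • n) := φ.eval_isElementary.rmul_b n x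

/-- The algebra underlying a multiplicative splitting, over `R'`. -/
noncomputable def resAlg (S : Corr X φ.toElemExt) (B : MulSpl (φ.eval A)) :
    BilinAlg R' (Res S B.toSpl) where
  mul := LinearMap.mk₂ R' B.mul (fun x y z => add_mul (R := B.carrier) x y z)
    (fun r x y => smul_mul_assoc (β := B.carrier) (algebraMap R' R r) x y)
    (fun x y z => mul_add (R := B.carrier) x y z)
    (fun r x y => mul_smul_comm (β := B.carrier) (algebraMap R' R r) x y)
  one := B.one
  assoc x y z := mul_assoc (G := B.carrier) x y z
  one_mul x := one_mul (M := B.carrier) x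
  mul_one x := mul_one (M := B.carrier) x

theorem mul_mem_compPairs (B : MulSpl (φ.eval A)) (x : Ev S.functor A × Res S B.toSpl) (hx : x ∈ compPairs S B.toSpl)
    (y : Ev S.functor A × Res S B.toSpl) (hy : y ∈ compPairs S B.toSpl) :
    ((wAlg μ).prod (resAlg S B)).mul x y ∈ compPairs S B.toSpl := by
  have h₁ : S.c₀Ev A x.1 = resC₀ S B.toSpl x.2 := hx
  have h₂ : S.c₀Ev A y.1 = resC₀ S B.toSpl y.2 := hy
  refine (μ.c₀Ev_mulEv A x.1 y.1).trans ?_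
  rw [h₁, h₂]
  exact (map_mul (M := B.carrier) B.c₀ x.2 y.2).symm

variable (L : AlgLift R' R A)

theorem one_mem_pairs : ((wAlg μ).one, (1 : L.carrier)) ∈ pairs S L.toLift := by
  change φ.aEv A (S.c₀Ev A (wAlg μ).one) = L.proj 1
  rw [c₀Ev_wAlg_one, φ.aEv_one, map_one]

/-- The algebra `C₀₁(A) ×_A A'`. -/
noncomputable def pairsAlg : BilinAlg R' (pairs S L.toLift) :=
  ((wAlg μ).prod (BilinAlg.ofAlgebra R' L.carrier)).sub (pairs S L.toLift) (one_mem_pairs μ L)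
    (fun x hx y hy => mul_mem_pairs μ L ⟨x, hx⟩ ⟨y, hy⟩)

variable [Module.Flat R A]

/-- The algebra `C₀₁(A) - A'`. -/
noncomputable def diffAlg : BilinAlg R' (Diff S L.toLift) :=
  (pairsAlg μ L).quot (diag S L.toLift)
    (fun z w hw => by
      obtain ⟨n, h₁, h₂⟩ := (mem_diag_iff S _ w).1 hw
      refine (mem_diag_iff S _ _).2 ⟨(lft (L.proj z.1.2) : Env R A) • n, ?_, ?_⟩
      · change μ.mulEv A z.1.1 w.1.1 = _
        have hz : φ.aEv A (S.c₀Ev A z.1.1) = L.proj z.1.2 := z.2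
        rw [h₁, mulEv_c₁Ev, m₀₁_bEv_eq_lft, hz]
      · change (z.1.2 * w.1.2 : L.carrier) = _
        rw [h₂]
        exact (L.data X).mul_j' (map_mul L.proj) z.1.2 n)
    (fun w hw z => by
      obtain ⟨n, h₁, h₂⟩ := (mem_diag_iff S _ w).1 hw
      refine (mem_diag_iff S _ _).2 ⟨(rgt (L.proj z.1.2) : Env R A) • n, ?_, ?_⟩
      · change μ.mulEv A w.1.1 z.1.1 = _
        have hz : φ.aEv A (S.c₀Ev A z.1.1) = L.proj z.1.2 := z.2
        rw [h₁, c₁Ev_mulEv, m₁₀_bEv_eq_rgt, hz]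
      · change (w.1.2 * z.1.2 : L.carrier) = _
        rw [h₂]
        exact (L.data X).j_mul' (map_mul L.proj) z.1.2 n)

/-- The multiplicative splitting `C₀₁(A) - A'`. -/
noncomputable def mulDiffSpl : MulSpl (φ.eval A) :=
  letI := diffModule S L.toLift
  (diffSpl S L.toLift).toMulSpl
    ((diffAlg μ L).ofSurjective X.q_surjective (diffModule_smul S L.toLift))
    (c₀Ev_wAlg_one μ)
    (fun ξ η => by
      obtain ⟨w, y, h, rfl⟩ := exists_diffMk S L.toLift ξ
      obtain ⟨w', y', h', rfl⟩ := exists_diffMk S L.toLift η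
      exact μ.c₀Ev_mulEv A w w')
    (fun ξ c => by
      obtain ⟨w, y, h, rfl⟩ := exists_diffMk S L.toLift ξ
      refine (diffMk_eq_iff S L.toLift _ _).2 ⟨0, ?_, ?_⟩
      · rw [map_zero, map_zero, sub_eq_zero]
        exact (mulEv_c₁Ev μ w c).symm
      · refine Eq.trans ?_ (map_zero _).symm
        exact (congrArg (fun x : L.carrier => 0 - x) (mul_zero (M₀ := L.carrier) y)).trans
          (sub_zero 0))
    (fun c ξ => by
      obtain ⟨w, y, h, rfl⟩ := exists_diffMk S L.toLift ξ
      refine (diffMk_eq_iff S L.toLift _ _).2 ⟨0, ?_, ?_⟩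
      · rw [map_zero, map_zero, sub_eq_zero]
        exact (c₁Ev_mulEv μ c w).symm
      · refine Eq.trans ?_ (map_zero _).symm
        exact (congrArg (fun x : L.carrier => 0 - x) (zero_mul (M₀ := L.carrier) y)).trans
          (sub_zero 0))

variable (A) in
/-- The functor `A' ↦ C₀₁(A) - A'` on liftings of the algebra `A`. -/
noncomputable def mulDiffFunctor : AlgLift R' R A ⥤ MulSpl (φ.eval A) where
  obj L := mulDiffSpl μ L
  map {L L'} f := MulSpl.homMk (B₁ := mulDiffSpl μ L) (B₂ := mulDiffSpl μ L')
    ((diffFunctor S A).map ((AlgLift.forget R' R A).map f))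
    (congrArg (Submodule.Quotient.mk (p := diag S L'.toLift))
      (Subtype.ext (Prod.ext rfl (map_one f.1))))
    (fun ξ η => by
      obtain ⟨w, y, h, rfl⟩ := exists_diffMk S L.toLift ξ
      obtain ⟨w', y', h', rfl⟩ := exists_diffMk S L.toLift η
      exact congrArg (Submodule.Quotient.mk (p := diag S L'.toLift))
        (Subtype.ext (Prod.ext rfl (map_mul f.1 y y'))))
  map_id L := Subtype.ext (AlgHom.ext fun ξ => by
    obtain ⟨w, y, h, rfl⟩ := exists_diffMk S L.toLift ξ
    rfl)
  map_comp {L _ _} f g := Subtype.ext (AlgHom.ext fun ξ => by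
    obtain ⟨w, y, h, rfl⟩ := exists_diffMk S L.toLift ξ
    rfl)

variable (A) in
/-- The multiplicative difference functor is induced by the difference functor. -/
noncomputable def isMulDiff : IsMulDiff (isDiff S A) μ (mulDiffFunctor μ A) where
  forgetIso := NatIso.ofComponents (fun L => Iso.refl (diffSpl S L.toLift)) (fun _ => rfl)
  map_mul _ _ _ := rfl

instance mulDiffFunctor_faithful : (mulDiffFunctor μ A).Faithful where
  map_injective {L L'} f f' e := by
    have h : (AlgLift.forget R' R A).map f = (AlgLift.forget R' R A).map f' := by
      refine (diffFunctor S A).map_injective (Subtype.ext (LinearMap.ext fun ξ => ?_))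
      exact congrArg (fun g => g.1 ξ) e
    exact Subtype.ext (AlgEquiv.ext fun y => congrArg (fun g => g.1 y) h)

/-- The morphism exists on the level of modules. It respects units and products because the second
component of a class is determined once the first is fixed. -/
instance mulDiffFunctor_full : (mulDiffFunctor μ A).Full where
  map_surjective {L L'} g := by
    obtain ⟨f, hf⟩ := (diffFunctor S A).map_surjective (X := L.toLift) (Y := L'.toLift)
      ((MulSpl.forget (φ.eval A)).map g)
    have hg : ∀ w y h, g.1 (diffMk S L.toLift w y h) =
        diffMk S L'.toLift w (f.1 y) (h.trans (f.2 y).symm) := fun w y h =>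
      (congrArg (fun k => k.1 (diffMk S L.toLift w y h)) hf).symm
    have h₁ : (f.1 (1 : L.carrier) : L'.carrier) = 1 := by
      have e := (hg _ _ (one_mem_pairs μ L)).symm.trans (map_one g.1)
      exact diffMk_right_injective S (h' := one_mem_pairs μ L') e
    have h₂ : ∀ y z : L.carrier, (f.1 (y * z : L.carrier) : L'.carrier) =
        (f.1 y : L'.carrier) * (f.1 z : L'.carrier) := fun y z => by
      obtain ⟨w, hw⟩ := exists_c₀Ev_eq S (L := L.toLift) y
      obtain ⟨w', hw'⟩ := exists_c₀Ev_eq S (L := L.toLift) z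
      have e := (hg _ _ (mul_mem_pairs μ L ⟨(w, y), hw⟩ ⟨(w', z), hw'⟩)).symm.trans
        ((map_mul (M := (mulDiffSpl μ L).carrier) g.1 (diffMk S L.toLift w y hw)
          (diffMk S L.toLift w' z hw')).trans
          (congrArg₂ (fun a b => (diffAlg μ L').mul a b) (hg w y hw) (hg w' z hw')))
      exact diffMk_right_injective S e
    refine ⟨⟨AlgEquiv.ofLinearEquiv f.1 h₁ h₂, f.2⟩, Subtype.ext (AlgHom.ext fun ξ => ?_)⟩
    exact congrArg (fun k => k.1 ξ) hf

variable (B : MulSpl (φ.eval A))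

/-- The algebra underlying the lifting attached to a multiplicative splitting. -/
noncomputable def compAlg : BilinAlg R' (CompDiff S B.toSpl) :=
  (((wAlg μ).prod (resAlg S B)).sub (compPairs S B.toSpl)
    ((c₀Ev_wAlg_one μ).trans (map_one B.c₀).symm) (mul_mem_compPairs μ B)).quot
    (compDiag S B.toSpl)
    (fun z w ⟨c, h₁, h₂⟩ => by
      have hz : S.c₀Ev A z.1.1 = resC₀ S B.toSpl z.1.2 := z.2
      refine ⟨pairExt φ.m₀₁ (LinearMap.mul R A) (S.c₀Ev A z.1.1) c, ?_, ?_⟩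
      · change μ.mulEv A z.1.1 w.1.1 = _
        rw [h₁, mulEv_c₁Ev]
      · change B.mul z.1.2 w.1.2 = _
        rw [h₂, hz]
        exact (B.c₁_lmul z.1.2 c).symm)
    (fun w ⟨c, h₁, h₂⟩ z => by
      have hz : S.c₀Ev A z.1.1 = resC₀ S B.toSpl z.1.2 := z.2
      refine ⟨pairExt φ.m₁₀ (LinearMap.mul R A) c (S.c₀Ev A z.1.1), ?_, ?_⟩
      · change μ.mulEv A w.1.1 z.1.1 = _
        rw [h₁, c₁Ev_mulEv]
      · change B.mul w.1.2 z.1.2 = _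
        rw [h₂, hz]
        exact (B.c₁_rmul c z.1.2).symm)

/-- The lifting of the algebra attached to a multiplicative splitting. -/
noncomputable def mulCompLift : AlgLift R' R A :=
  letI := (compAlg μ B).toRing
  letI := (compAlg μ B).toAlgebra
  (compData S B.toSpl).toAlgLift
    ((congrArg (φ.aEv A) (c₀Ev_wAlg_one μ)).trans (φ.aEv_one A))
    (fun y z => by
      obtain ⟨w, b, h, rfl⟩ := exists_compMk S B.toSpl y
      obtain ⟨w', b', h', rfl⟩ := exists_compMk S B.toSpl z
      exact (congrArg (φ.aEv A) (μ.c₀Ev_mulEv A w w')).trans (φ.aEv_mul A _ _))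

/-- The comparison of a multiplicative splitting with the difference. -/
noncomputable def mulCompHom : B ⟶ mulDiffSpl μ (mulCompLift μ B) :=
  MulSpl.homMk (B₂ := mulDiffSpl μ (mulCompLift μ B)) (compHom S B.toSpl)
    (toCompDiff_eq S B.toSpl (wAlg μ).one B.one
      ((c₀Ev_wAlg_one μ).trans (map_one B.c₀).symm))
    (fun b b' => by
      obtain ⟨w, hw⟩ := exists_c₀Ev_eq_resC₀ S B.toSpl b
      obtain ⟨w', hw'⟩ := exists_c₀Ev_eq_resC₀ S B.toSpl b'
      refine (toCompDiff_eq S B.toSpl (μ.mulEv A w w') (B.mul b b')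
        (mul_mem_compPairs μ B (w, b) hw (w', b') hw')).trans ?_
      exact (congrArg₂ (fun x y => (diffAlg μ (mulCompLift μ B)).mul x y)
        (toCompDiff_eq S B.toSpl w b hw) (toCompDiff_eq S B.toSpl w' b' hw')).symm)

instance mulDiffFunctor_essSurj : (mulDiffFunctor μ A).EssSurj where
  mem_essImage B := ⟨mulCompLift μ B, ⟨(asIso (mulCompHom μ B)).symm⟩⟩

instance mulDiffFunctor_isEquivalence : (mulDiffFunctor μ A).IsEquivalence where

end MulDiff

/-! ### Derivations on free algebras -/

section BlockMap

variable {k : Type u} [CommRing k] {X C B : Type u} [AddCommGroup B] [Module k B]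

/-- Maps out of a free algebra into block triangular matrices. -/
theorem exists_blockMap [AddCommGroup C] [Module k C] (g : FreeAlgebra k X →ₐ[k] Module.End k C)
    (h : FreeAlgebra k X →ₐ[k] Module.End k B) (δ : X → C →ₗ[k] B) :
    ∃ Δ : FreeAlgebra k X →ₗ[k] C →ₗ[k] B, (∀ x, Δ (FreeAlgebra.ι k x) = δ x) ∧
      ∀ u v c, Δ (u * v) c = h u (Δ v c) + Δ u (g v c) := by
  -- Block triangular operators on C × B with diagonal blocks `g` and `h`. As the algebra is free,
  -- the off-diagonal block can be prescribed on generators, and Δ u is the off-diagonal block of ρ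
  -- u.
  let ρ : FreeAlgebra k X →ₐ[k] Module.End k (C × B) := FreeAlgebra.lift k fun x =>
    LinearMap.prod (g (FreeAlgebra.ι k x) ∘ₗ LinearMap.fst k C B)
      (h (FreeAlgebra.ι k x) ∘ₗ LinearMap.snd k C B + δ x ∘ₗ LinearMap.fst k C B)
  have hι : ∀ x c b, ρ (FreeAlgebra.ι k x) (c, b) =
      (g (FreeAlgebra.ι k x) c, h (FreeAlgebra.ι k x) b + δ x c) := fun x c b => by
    simp only [ρ, FreeAlgebra.lift_ι_apply]
    rfl
  have hρ : ∀ u c b, ρ u (c, b) = (g u c, h u b + (ρ u (c, 0)).2) := fun u => by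
    induction u using FreeAlgebra.induction with
    | grade0 r =>
      intro c b
      simp only [AlgHom.commutes, Module.algebraMap_end_apply, Prod.smul_mk, smul_zero, add_zero]
    | grade1 x =>
      intro c b
      rw [hι, hι, map_zero, zero_add]
    | mul u v hu hv =>
      intro c b
      rw [map_mul, map_mul, map_mul, Module.End.mul_apply, Module.End.mul_apply,
        Module.End.mul_apply, Module.End.mul_apply, hv c b, hv c 0, hu, hu _ (_ + _)]
      refine Prod.ext rfl ?_
      simp only [map_add, map_zero, zero_add]
      abel
    | add u v hu hv =>
      intro c b
      rw [map_add, map_add, map_add, LinearMap.add_apply, LinearMap.add_apply,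
        LinearMap.add_apply, LinearMap.add_apply, hu c b, hv c b]
      refine Prod.ext rfl ?_
      simp only [Prod.snd_add]
      abel
  refine ⟨LinearMap.mk₂ k (fun u c => (ρ u (c, 0)).2) ?_ ?_ ?_ ?_, ?_, ?_⟩
  · intro u v c
    rw [map_add]; rfl
  · intro r u c
    rw [map_smul]; rfl
  · intro u c c'
    rw [← Prod.snd_add, ← map_add, Prod.mk_add_mk, add_zero]
  · intro r u c
    rw [← Prod.smul_snd, ← map_smul, Prod.smul_mk, smul_zero]
  · intro x
    refine LinearMap.ext fun c => ?_
    rw [LinearMap.mk₂_apply, hι, map_zero, zero_add]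
  · intro u v c
    rw [LinearMap.mk₂_apply, map_mul, Module.End.mul_apply, hρ v, hρ u, map_zero, zero_add]
    rfl

/-- Derivations on a free algebra with prescribed values on the generators. -/
theorem exists_twistedDer [Ring C] [Algebra k C] (l : FreeAlgebra k X →ₐ[k] Module.End k B)
    (q : FreeAlgebra k X →ₐ[k] C) (r : B →ₗ[k] C →ₗ[k] B) (hr₁ : ∀ b, r b 1 = b)
    (hr : ∀ b c c', r b (c * c') = r (r b c) c') (hlr : ∀ u b c, l u (r b c) = r (l u b) c)
    (e : X → B) :
    ∃ δ : FreeAlgebra k X →ₗ[k] B, (∀ x, δ (FreeAlgebra.ι k x) = e x) ∧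
      (∀ u v, δ (u * v) = l u (δ v) + r (δ u) (q v)) ∧
      ∀ s, δ (algebraMap k _ s) = 0 := by
  -- With C acting on itself by left multiplication through `q`, the off-diagonal block is
  -- determined by its value at 1 and the right action `r`; that value is the derivation.
  obtain ⟨Δ, h₁, h₂⟩ := exists_blockMap ((Algebra.lmul k C).comp q) l (fun x => r (e x))
  have h₀ : ∀ s, Δ (algebraMap k _ s) = 0 := fun s => by
    have h : Δ 1 = 0 := LinearMap.ext fun c => by
      have := h₂ 1 1 c
      rw [mul_one, map_one l, map_one ((Algebra.lmul k C).comp q), Module.End.one_apply,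
        Module.End.one_apply] at this
      exact left_eq_add.1 this
    rw [Algebra.algebraMap_eq_smul_one, map_smul, h, smul_zero]
  have h₃ : ∀ u c, Δ u c = r (Δ u 1) c := fun u => by
    induction u using FreeAlgebra.induction with
    | grade0 s => intro c; rw [h₀, LinearMap.zero_apply, LinearMap.zero_apply, map_zero]; rfl
    | grade1 x => intro c; rw [h₁, hr₁]
    | add u v hu hv =>
      intro c
      rw [map_add, LinearMap.add_apply, LinearMap.add_apply, hu, hv, map_add]; rfl
    | mul u v hu hv =>
      intro c
      rw [h₂, h₂, map_add, LinearMap.add_apply, hv, hlr, hu, hu (((Algebra.lmul k C).comp q) v 1),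
        ← hr]
      congr 2
      change q v * c = (q v * 1) * c
      rw [mul_one]
  refine ⟨Δ.flip 1, fun x => ?_, fun u v => ?_, fun s => ?_⟩
  · rw [LinearMap.flip_apply, h₁, hr₁]
  · rw [LinearMap.flip_apply, h₂, h₃ u]
    congr 2
    change q v * 1 = q v
    rw [mul_one]
  · rw [LinearMap.flip_apply, h₀]; rfl

end BlockMap

/-! ### The bimodule of differentials -/

section Bimodules

open MulOpposite

variable {R : Type u} [CommRing R] {A : Type u} [Ring A] [Algebra R A]

theorem lft_one : (lft 1 : Env R A) = 1 := rfl

theorem rgt_one : (rgt 1 : Env R A) = 1 := rfl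

theorem lft_mul (a b : A) : (lft (a * b) : Env R A) = lft a * lft b := by
  simp only [lft, Algebra.TensorProduct.tmul_mul_tmul, mul_one]

theorem rgt_mul (a b : A) : (rgt (a * b) : Env R A) = rgt b * rgt a := by
  simp only [rgt, Algebra.TensorProduct.tmul_mul_tmul, mul_one, op_mul]

theorem lft_add (a b : A) : (lft (a + b) : Env R A) = lft a + lft b := TensorProduct.add_tmul _ _ _

theorem rgt_add (a b : A) : (rgt (a + b) : Env R A) = rgt a + rgt b :=
  (congrArg (fun x => (1 : A) ⊗ₜ[R] x) (op_add a b)).trans (TensorProduct.tmul_add _ _ _)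

theorem lft_zero : (lft 0 : Env R A) = 0 := TensorProduct.zero_tmul _ _

theorem rgt_zero : (rgt 0 : Env R A) = 0 := TensorProduct.tmul_zero _ _

theorem lft_mul_smul {E : Type u} [AddCommGroup E] [Module (Env R A) E] (a b : A) (e : E) :
    (lft (a * b) : Env R A) • e = (lft a : Env R A) • (lft b : Env R A) • e := by
  rw [lft_mul, mul_smul]

theorem rgt_mul_smul {E : Type u} [AddCommGroup E] [Module (Env R A) E] (a b : A) (e : E) :
    (rgt (a * b) : Env R A) • e = (rgt b : Env R A) • (rgt a : Env R A) • e := by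
  rw [rgt_mul, mul_smul]

theorem lft_zero_smul {E : Type u} [AddCommGroup E] [Module (Env R A) E] (e : E) :
    (lft 0 : Env R A) • e = 0 := by
  have h : (lft 0 : Env R A) • e = (0 : Env R A) • e := congrArg (fun z : Env R A => z • e) lft_zero
  exact h.trans (zero_smul (Env R A) e)

theorem rgt_zero_smul {E : Type u} [AddCommGroup E] [Module (Env R A) E] (e : E) :
    (rgt 0 : Env R A) • e = 0 := by
  have h : (rgt 0 : Env R A) • e = (0 : Env R A) • e := congrArg (fun z : Env R A => z • e) rgt_zero
  exact h.trans (zero_smul (Env R A) e)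

theorem tmul_eq_lft_mul_rgt (a : A) (b : Aᵐᵒᵖ) : (a ⊗ₜ b : Env R A) = lft a * rgt b.unop := by
  simp only [lft, rgt, Algebra.TensorProduct.tmul_mul_tmul, mul_one, one_mul, op_unop]

theorem lft_mul_rgt_comm (a b : A) : (lft a * rgt b : Env R A) = rgt b * lft a := by
  simp only [lft, rgt, Algebra.TensorProduct.tmul_mul_tmul, mul_one, one_mul]

theorem lft_algebraMap (r : R) : (lft (algebraMap R A r) : Env R A) = algebraMap R _ r := rfl

theorem rgt_algebraMap (r : R) : (rgt (algebraMap R A r) : Env R A) = algebraMap R _ r := by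
  rw [rgt, Algebra.algebraMap_eq_smul_one, Algebra.algebraMap_eq_smul_one, op_smul, op_one,
    TensorProduct.tmul_smul]
  rfl

variable {E : Type u} [AddCommGroup E] [Module (Env R A) E]

theorem lft_smul_rgt_smul (a b : A) (e : E) :
    (lft a : Env R A) • (rgt b : Env R A) • e = (rgt b : Env R A) • (lft a : Env R A) • e := by
  rw [smul_smul, smul_smul, lft_mul_rgt_comm]

/-- Additive maps of bimodules are linear over the enveloping algebra. -/
def envLin {E' : Type u} [AddCommGroup E'] [Module (Env R A) E'] (f : E →+ E')
    (hl : ∀ (a : A) e, f ((lft a : Env R A) • e) = (lft a : Env R A) • f e)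
    (hr : ∀ (a : A) e, f ((rgt a : Env R A) • e) = (rgt a : Env R A) • f e) :
    E →ₗ[Env R A] E' :=
  { f with
    map_smul' := fun z e => by
      change f (z • e) = z • f e
      induction z using TensorProduct.induction_on with
      | zero =>
        exact (congrArg f (zero_smul (Env R A) e)).trans
          ((map_zero f).trans (zero_smul (Env R A) (f e)).symm)
      | add z w hz hw => rw [add_smul, add_smul, map_add, hz, hw]
      | tmul a b => rw [tmul_eq_lft_mul_rgt, mul_smul, hl, hr, mul_smul] }

theorem univDer_mul (x y : A) : univDer R A (x * y) =
    (lft x : Env R A) • univDer R A y + (rgt y : Env R A) • univDer R A x := by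
  refine Subtype.ext ?_
  change (rgt (x * y) - lft (x * y) : Env R A) =
    lft x * (rgt y - lft y) + rgt y * (rgt x - lft x)
  rw [rgt_mul, lft_mul, mul_sub, mul_sub, lft_mul_rgt_comm]
  abel

theorem univDer_add (x y : A) : univDer R A (x + y) = univDer R A x + univDer R A y := by
  refine Subtype.ext ?_
  change (rgt (x + y) - lft (x + y) : Env R A) = (rgt x - lft x) + (rgt y - lft y)
  rw [rgt_add, lft_add]
  abel

theorem univDer_algebraMap (r : R) : univDer R A (algebraMap R A r) = 0 := by
  refine Subtype.ext ?_
  change (rgt (algebraMap R A r) - lft (algebraMap R A r) : Env R A) = 0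
  rw [rgt_algebraMap, lft_algebraMap, sub_self]

end Bimodules

/-! ### Free bimodules and the universal derivation of a free algebra. -/

section FreeDer

open MulOpposite

variable {k R A X : Type u} [CommRing k] [CommRing R] [Algebra k R] [Ring A] [Algebra R A]
  [Algebra k A] [IsScalarTower k R A]

variable (k) in
/-- The map from the free algebra attached to elements of `A`. -/
noncomputable def aug (α : X → A) : FreeAlgebra k X →ₐ[k] A := FreeAlgebra.lift k α

theorem aug_ι (α : X → A) (x : X) : aug k α (FreeAlgebra.ι k x) = α x :=
  FreeAlgebra.lift_ι_apply α x

theorem aug_surjective {α : X → A} (hα : Function.Surjective α) : Function.Surjective (aug k α) :=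
  fun a => ⟨FreeAlgebra.ι k (Function.surjInv hα a), (aug_ι α _).trans (Function.surjInv_eq hα a)⟩

theorem lft_smul_scalar (s : k) (c : A) : (lft (s • c) : Env R A) = s • lft c :=
  (TensorProduct.smul_tmul' s c 1).symm

theorem rgt_smul_scalar (s : k) (c : A) :
    (rgt (s • c) : Env R A) = lft (algebraMap k A s) * rgt c := by
  have h : s • c = algebraMap k R s • c := by
    rw [Algebra.smul_def, Algebra.smul_def, IsScalarTower.algebraMap_apply k R A]
  rw [h, IsScalarTower.algebraMap_apply k R A, lft_algebraMap, Algebra.smul_def, rgt_mul,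
    rgt_algebraMap, Algebra.commutes]

variable (R A X) in
/-- The free bimodule on a set. -/
def FreeBimod : Type u := X →₀ Env R A

namespace FreeBimod

noncomputable instance : AddCommGroup (FreeBimod R A X) := inferInstanceAs (AddCommGroup (X →₀ Env R A))

noncomputable instance : Module (Env R A) (FreeBimod R A X) := Finsupp.module X (Env R A)

noncomputable instance : Module k (FreeBimod R A X) := Finsupp.module X (Env R A)

theorem scalar_smul (s : k) (e : FreeBimod R A X) :
    s • e = (lft (algebraMap k A s) : Env R A) • e := by
  refine Finsupp.ext fun x => ?_
  change s • (show X →₀ Env R A from e) x = lft (algebraMap k A s) * (show X →₀ Env R A from e) x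
  rw [Algebra.algebraMap_eq_smul_one, lft_smul_scalar, lft_one]
  exact (smul_one_mul s _).symm

/-- The generators of the free bimodule. -/
noncomputable def gen (x : X) : FreeBimod R A X := Finsupp.single x (1 : Env R A)

/-- The universal property of the free bimodule. -/
noncomputable def lift {E : Type u} [AddCommGroup E] [Module (Env R A) E] (v : X → E) :
    FreeBimod R A X →ₗ[Env R A] E := Finsupp.linearCombination (Env R A) v

theorem lift_gen {E : Type u} [AddCommGroup E] [Module (Env R A) E] (v : X → E) (x : X) :
    lift v (gen (R := R) (A := A) x) = v x :=
  (Finsupp.linearCombination_single (Env R A) 1 x).trans (one_smul _ _)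

theorem induction {p : FreeBimod R A X → Prop} (e : FreeBimod R A X) (h₀ : p 0)
    (hadd : ∀ e e', p e → p e' → p (e + e'))
    (hgen : ∀ a b x, p ((lft a : Env R A) • (rgt b : Env R A) • gen x)) : p e := by
  refine Finsupp.induction_linear (motive := p) e h₀ hadd (fun x z => (?_ : p (Finsupp.single x z)))
  have hz : ∀ z : Env R A, (Finsupp.single x z : FreeBimod R A X) = z • gen x := fun z =>
    ((Finsupp.smul_single z x 1).trans (congrArg _ (mul_one z))).symm
  rw [hz]
  have h₁ : ∀ z : Env R A, p (z • gen x) := fun z => by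
    induction z using TensorProduct.induction_on with
    | zero => exact (zero_smul (Env R A) (gen (R := R) (A := A) x)).symm ▸ h₀
    | add z z' h h' => rw [add_smul]; exact hadd _ _ h h'
    | tmul a b => rw [tmul_eq_lft_mul_rgt, mul_smul]; exact hgen _ _ _
  exact h₁ z

theorem hom_ext {E : Type u} [AddCommGroup E] [Module (Env R A) E]
    {f g : FreeBimod R A X →ₗ[Env R A] E} (h : ∀ x, f (gen x) = g (gen x)) : f = g :=
  LinearMap.ext fun e => by
    induction e using induction with
    | h₀ => rw [map_zero, map_zero]
    | hadd e e' he he' => rw [map_add, map_add, he, he']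
    | hgen a b x => rw [map_smul, map_smul, map_smul, map_smul, h]

end FreeBimod

/-- A derivation of a free algebra may take any values on generators, here those of the free
bimodule. The base ring k is R for the obstruction and R' for the torsor, since presentations of
liftings live over R'. -/
theorem exists_freeDer (α : X → A) : ∃ D : FreeAlgebra k X →ₗ[k] FreeBimod R A X,
    (∀ x, D (FreeAlgebra.ι k x) = FreeBimod.gen x) ∧
    (∀ u v, D (u * v) = (lft (aug k α u) : Env R A) • D v + (rgt (aug k α v) : Env R A) • D u) ∧
    ∀ s, D (algebraMap k _ s) = 0 := by
  have hc : ∀ (s : k) (a : A) (b : FreeBimod R A X),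
      s • (lft a : Env R A) • b = (lft a : Env R A) • s • b := fun s a b => by
    rw [FreeBimod.scalar_smul, FreeBimod.scalar_smul, smul_smul, smul_smul, ← lft_mul, ← lft_mul,
      Algebra.commutes]
  let l : A →ₐ[k] Module.End k (FreeBimod R A X) := AlgHom.ofLinearMap
    (LinearMap.mk₂ k (fun a b => (lft a : Env R A) • b) (fun a a' b => by rw [lft_add, add_smul])
      (fun s a b => by rw [Algebra.smul_def, lft_mul, mul_smul, FreeBimod.scalar_smul])
      (fun a b b' => smul_add _ _ _) (fun s a b => (hc s a b).symm))
    (LinearMap.ext fun b => one_smul _ b)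
    (fun a a' => LinearMap.ext fun b => by
      change (lft (a * a') : Env R A) • b = (lft a : Env R A) • (lft a' : Env R A) • b
      rw [lft_mul, mul_smul])
  exact exists_twistedDer (l.comp (aug k α)) (aug k α)
    (LinearMap.mk₂ k (fun b c => (rgt c : Env R A) • b) (fun b b' c => smul_add _ _ _)
      (fun s b c => by
        rw [FreeBimod.scalar_smul, FreeBimod.scalar_smul, lft_smul_rgt_smul])
      (fun b c c' => by rw [rgt_add, add_smul])
      (fun s b c => by rw [FreeBimod.scalar_smul, rgt_smul_scalar, mul_smul]))
    (fun b => one_smul _ b) (fun b c c' => by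
      rw [LinearMap.mk₂_apply, LinearMap.mk₂_apply, LinearMap.mk₂_apply, rgt_mul, mul_smul])
    (fun u b c => lft_smul_rgt_smul _ _ _) FreeBimod.gen

variable (k R) in
/-- The universal derivation of the free algebra with values in `A`-bimodules. -/
noncomputable def freeDer (α : X → A) : FreeAlgebra k X →ₗ[k] FreeBimod R A X :=
  (exists_freeDer α).choose

theorem freeDer_ι (α : X → A) (x : X) : freeDer k R α (FreeAlgebra.ι k x) = FreeBimod.gen x :=
  (exists_freeDer α).choose_spec.1 x

theorem freeDer_mul (α : X → A) (u v : FreeAlgebra k X) : freeDer k R α (u * v) =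
    (lft (aug k α u) : Env R A) • freeDer k R α v + (rgt (aug k α v) : Env R A) • freeDer k R α u :=
  (exists_freeDer α).choose_spec.2.1 u v

theorem freeDer_algebraMap (α : X → A) (s : k) : freeDer k R α (algebraMap k _ s) = 0 :=
  (exists_freeDer α).choose_spec.2.2 s

theorem freeDer_mul_of_right {α : X → A} (u : FreeAlgebra k X) {v : FreeAlgebra k X}
    (hv : aug k α v = 0) : freeDer k R α (u * v) = (lft (aug k α u) : Env R A) • freeDer k R α v := by
  rw [freeDer_mul, hv, rgt_zero_smul, add_zero]

theorem freeDer_mul_of_left {α : X → A} {u : FreeAlgebra k X} (hu : aug k α u = 0)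
    (v : FreeAlgebra k X) : freeDer k R α (u * v) = (rgt (aug k α v) : Env R A) • freeDer k R α u := by
  rw [freeDer_mul, hu, lft_zero_smul, zero_add]

/-- A derivation is determined by its values on the generators of the free algebra. -/
theorem eq_comp_freeDer {α : X → A} {E : Type u} [AddCommGroup E] [Module (Env R A) E]
    (D : FreeAlgebra k X →+ E) (hm : ∀ u v, D (u * v) =
      (lft (aug k α u) : Env R A) • D v + (rgt (aug k α v) : Env R A) • D u)
    (hs : ∀ s, D (algebraMap k _ s) = 0) (u : FreeAlgebra k X) :
    D u = FreeBimod.lift (fun x => D (FreeAlgebra.ι k x))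
      (freeDer k R α u) := by
  induction u using FreeAlgebra.induction with
  | grade0 s => rw [hs, freeDer_algebraMap, map_zero]
  | grade1 x => rw [freeDer_ι, FreeBimod.lift_gen]
  | mul u v hu hv => rw [hm, freeDer_mul, map_add, map_smul, map_smul, ← hu, ← hv]
  | add u v hu hv => rw [map_add, map_add, map_add, hu, hv]

variable (R) in
/-- The presentation of the bimodule of differentials. -/
noncomputable def freePi (α : X → A) : FreeBimod R A X →ₗ[Env R A] Omega R A :=
  FreeBimod.lift (fun x => univDer R A (α x))

theorem freePi_freeDer (α : X → A) (u : FreeAlgebra k X) :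
    freePi R α (freeDer k R α u) = univDer R A (aug k α u) := by
  have h := eq_comp_freeDer (R := R) (α := α)
    (AddMonoidHom.mk' (fun u => univDer R A (aug k α u)) (fun u v => by
      rw [map_add, univDer_add]))
    (fun u v => by
      change univDer R A _ = _
      rw [map_mul, univDer_mul]; rfl)
    (fun s => by
      change univDer R A _ = _
      rw [AlgHom.commutes, IsScalarTower.algebraMap_apply k R A, univDer_algebraMap]) u
  refine Eq.trans ?_ h.symm
  rw [freePi]
  congr 2
  funext x
  change _ = univDer R A (aug k α _)
  rw [aug_ι]

/-- The elements a ⊗ b - ab ⊗ 1 = a · d(b) are in the image, and they add up to z - μ(z) ⊗ 1 for any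
z, where μ is the multiplication. On Ω this is z itself. -/
theorem freePi_surjective {α : X → A} (hα : Function.Surjective α) :
    Function.Surjective (freePi R α) := by
  have key : ∀ z : Env R A, ∃ e, ((freePi R α e : Omega R A) : Env R A) =
      z - lft (envMul R A z) := fun z => by
    induction z using TensorProduct.induction_on with
    | zero => exact ⟨0, by rw [map_zero, map_zero, lft_zero, sub_zero]; rfl⟩
    | add z w hz hw =>
      obtain ⟨e, he⟩ := hz
      obtain ⟨e', he'⟩ := hw
      refine ⟨e + e', ?_⟩
      rw [map_add, map_add, lft_add, Submodule.coe_add, he, he']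
      abel
    | tmul a b =>
      obtain ⟨x, hx⟩ := hα b.unop
      refine ⟨(lft a : Env R A) • FreeBimod.gen x, ?_⟩
      rw [map_smul, freePi, FreeBimod.lift_gen, envMul_tmul, hx,
        tmul_eq_lft_mul_rgt, lft_mul]
      exact mul_sub _ _ _
  intro z
  obtain ⟨e, he⟩ := key z
  refine ⟨e, Subtype.ext ?_⟩
  have hz : envMul R A z = 0 := z.2
  rw [he, hz, lft_zero, sub_zero]

/-- The kernel of the presentation of the differentials comes from the relations of `A`. -/
theorem exists_freeDer_eq (hk : Function.Surjective (algebraMap k R)) {α : X → A}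
    (hα : Function.Surjective α) {e : FreeBimod R A X} (he : freePi R α e = 0) :
    ∃ w, aug k α w = 0 ∧ freeDer k R α w = e := by
  -- The derivatives of relations form a subbimodule, since D(uwv) = u · D(w) · v for a relation w.
  let Z : Submodule (Env R A) (FreeBimod R A X) :=
    { carrier := {e | ∃ w, aug k α w = 0 ∧ freeDer k R α w = e}
      zero_mem' := ⟨0, map_zero _, map_zero _⟩
      add_mem' := by
        rintro _ _ ⟨w, h, rfl⟩ ⟨w', h', rfl⟩
        exact ⟨w + w', by rw [map_add, h, h', add_zero], map_add _ _ _⟩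
      smul_mem' := by
        rintro z _ ⟨w, h, rfl⟩
        induction z using TensorProduct.induction_on with
        | zero => exact ⟨0, map_zero _, (map_zero _).trans (zero_smul (Env R A) (freeDer k R α w)).symm⟩
        | add z z' hz hz' =>
          obtain ⟨v, h₁, h₂⟩ := hz
          obtain ⟨v', h₃, h₄⟩ := hz'
          exact ⟨v + v', by rw [map_add, h₁, h₃, add_zero], by rw [map_add, h₂, h₄, add_smul]⟩
        | tmul a b =>
          obtain ⟨u, rfl⟩ := aug_surjective (k := k) hα a
          obtain ⟨v, hv⟩ := aug_surjective (k := k) hα b.unop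
          refine ⟨u * (w * v), by rw [map_mul, map_mul, h, zero_mul, mul_zero], ?_⟩
          rw [freeDer_mul_of_right _ (by rw [map_mul, h, zero_mul]), freeDer_mul_of_left h,
            tmul_eq_lft_mul_rgt, mul_smul, hv] }
  let s := Function.surjInv (aug_surjective (k := k) hα)
  have hs : ∀ a, aug k α (s a) = a := Function.surjInv_eq _
  -- Modulo `Z` the universal derivation factors through A. It extends to a ⊗ b ↦ a · D(b) on A ⊗
  -- Aᵒᵖ, and the composite of this with `freePi` is the projection to the quotient by `Z`; hence
  -- the kernel of `freePi` lies in `Z`.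
  let D : A → FreeBimod R A X ⧸ Z := fun a => Submodule.Quotient.mk (freeDer k R α (s a))
  have hD : ∀ u, Submodule.Quotient.mk (freeDer k R α u) = D (aug k α u) := fun u =>
    (Submodule.Quotient.eq Z).2 ⟨u - s (aug k α u), by rw [map_sub, hs, sub_self], map_sub _ _ _⟩
  have hD_add : ∀ a b, D (a + b) = D a + D b := fun a b => by
    have := hD (s a + s b)
    rw [map_add, map_add, hs, hs] at this
    exact this.symm
  have hD_smul : ∀ (r : R) b, D (r • b) = (lft (algebraMap R A r) : Env R A) • D b := fun r b => by
    obtain ⟨t, rfl⟩ := hk r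
    have := hD (algebraMap k _ t * s b)
    rw [freeDer_mul, freeDer_algebraMap, smul_zero, add_zero, map_mul, hs, AlgHom.commutes,
      IsScalarTower.algebraMap_apply k R A, ← Algebra.smul_def] at this
    exact this.symm
  have hD_mul : ∀ a b, D (a * b) = (lft a : Env R A) • D b + (rgt b : Env R A) • D a :=
    fun a b => by
      have := hD (s a * s b)
      rw [freeDer_mul, map_mul, hs, hs] at this
      exact this.symm
  let T : Env R A →+ FreeBimod R A X ⧸ Z := TensorProduct.liftAddHom
    (AddMonoidHom.mk' (fun a => AddMonoidHom.mk' (fun b => (lft a : Env R A) • D b.unop)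
        (fun b b' => by rw [MulOpposite.unop_add, hD_add, smul_add]))
      (fun a a' => AddMonoidHom.ext fun b => by
        simp only [AddMonoidHom.mk'_apply, AddMonoidHom.add_apply, lft_add, add_smul]))
    (fun r a b => by
      simp only [AddMonoidHom.mk'_apply, MulOpposite.unop_smul]
      rw [hD_smul, Algebra.smul_def, Algebra.commutes, lft_mul_smul])
  have hT : ∀ a b, T (a ⊗ₜ b) = (lft a : Env R A) • D b.unop := fun a b => rfl
  have key : ∀ e, T (freePi R α e : Omega R A) = Submodule.Quotient.mk e := fun e => by
    induction e using FreeBimod.induction with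
    | h₀ => rw [map_zero]; exact map_zero T
    | hadd e e' h h' => rw [map_add, Submodule.coe_add, map_add, h, h']; rfl
    | hgen a b x =>
      have e₁ : ((lft a : Env R A) • (rgt b : Env R A) • univDer R A (α x) : Omega R A) =
          (a ⊗ₜ (op (α x * b)) - (a * α x) ⊗ₜ op b : Env R A) := by
        change lft a * (rgt b * (rgt (α x) - lft (α x))) = (_ : Env R A)
        rw [mul_sub, ← rgt_mul, ← lft_mul_rgt_comm, mul_sub, ← mul_assoc, ← lft_mul,
          tmul_eq_lft_mul_rgt, tmul_eq_lft_mul_rgt]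
        rfl
      rw [map_smul, map_smul, freePi, FreeBimod.lift_gen, e₁, map_sub, hT, hT, unop_op, unop_op,
        hD_mul, smul_add, lft_mul_smul, add_sub_cancel_left, ← aug_ι (k := k) α x, ← hD,
        freeDer_ι]
      rfl
  have h := key e
  rw [he] at h
  exact (Submodule.Quotient.mk_eq_zero Z).1 (h.symm.trans (map_zero T))

end FreeDer

/-! ### Consequences of flatness for relations of free algebras -/

section Characters

variable {k R A X : Type u} [CommRing k] [CommRing R] [Algebra k R] [Ring A] [Algebra R A]
  [Algebra k A] [IsScalarTower k R A]

/-- An additive map to the circle, as an element of the character module. -/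
def toChar {B : Type u} [AddCommGroup B] (f : B →+ AddCircle (1 : ℚ)) : CharacterModule B := f

variable (k) in
/-- The left action of `A` on its character module. -/
noncomputable def charAct : A →ₐ[k] Module.End k (CharacterModule A) :=
  AlgHom.ofLinearMap
    (LinearMap.mk₂ k
      (fun (a : A) (χ : CharacterModule A) =>
        toChar ((show A →+ AddCircle (1 : ℚ) from χ).comp (AddMonoidHom.mulRight a)))
      (fun a a' χ => CharacterModule.ext A fun x => by
        change χ (x * (a + a')) = χ (x * a) + χ (x * a')
        rw [mul_add, map_add])
      (fun s a χ => CharacterModule.ext A fun x => by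
        change χ (x * (s • a)) = χ ((s • x) * a)
        rw [mul_smul_comm, smul_mul_assoc])
      (fun a χ χ' => rfl)
      (fun s a χ => CharacterModule.ext A fun x => by
        change χ (s • (x * a)) = χ ((s • x) * a)
        rw [smul_mul_assoc]))
    (LinearMap.ext fun χ => CharacterModule.ext A fun x => by
      change χ (x * 1) = χ x
      rw [mul_one])
    (fun a a' => LinearMap.ext fun χ => CharacterModule.ext A fun x => by
      change χ (x * (a * a')) = χ (x * a * a')
      rw [mul_assoc])

theorem charAct_apply (a : A) (χ : CharacterModule A) (x : A) : charAct k a χ x = χ (x * a) := rfl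

/-- Extension of maps which are linear over a ring `k` surjecting onto `R`. -/
theorem exists_extension_of_baer (hk : Function.Surjective (algebraMap k R)) {Q : Type u}
    [AddCommGroup Q] [Module R Q] [Module k Q] [IsScalarTower k R Q] (hQ : Module.Baer R Q)
    {F : Type u} [AddCommGroup F] [Module k F] (U : Submodule k F) (θ : U →ₗ[k] Q)
    (hθ : ∀ w : U, (w : F) ∈ RingHom.ker (algebraMap k R) • (⊤ : Submodule k F) → θ w = 0) :
    ∃ θ' : F →ₗ[k] Q, ∀ w : U, θ' w = θ w := by
  -- Since θ kills the elements of U in Ker(k → R) F, it descends to a problem about R-modules,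
  -- where the Baer property applies.
  let P : Submodule k F := RingHom.ker (algebraMap k R) • (⊤ : Submodule k F)
  let P' : Submodule k U := P.comap U.subtype
  have hP : ∀ r : k, algebraMap k R r = 0 → ∀ y : F ⧸ P, r • y = 0 := fun r hr y => by
    obtain ⟨y, rfl⟩ := Submodule.Quotient.mk_surjective P y
    exact (Submodule.Quotient.mk_eq_zero P).2 (Submodule.smul_mem_smul hr trivial)
  have hP' : ∀ r : k, algebraMap k R r = 0 → ∀ y : U ⧸ P', r • y = 0 := fun r hr y => by
    obtain ⟨y, rfl⟩ := Submodule.Quotient.mk_surjective P' y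
    exact (Submodule.Quotient.mk_eq_zero P').2
      (Submodule.smul_mem_smul (N := (⊤ : Submodule k F)) hr trivial)
  let _ : Module R (F ⧸ P) := reducedModule hk hP
  let _ : Module R (U ⧸ P') := reducedModule hk hP'
  have t : ∀ (r : k) (s : R) (y : F ⧸ P), (r • s) • y = r • s • y := fun r s y => by
    rw [Algebra.smul_def, mul_smul]
    exact reducedModule_smul hk hP r _
  have t' : ∀ (r : k) (s : R) (y : U ⧸ P'), (r • s) • y = r • s • y := fun r s y => by
    rw [Algebra.smul_def, mul_smul]
    exact reducedModule_smul hk hP' r _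
  have : IsScalarTower k R (F ⧸ P) := ⟨t⟩
  have : IsScalarTower k R (U ⧸ P') := ⟨t'⟩
  let i : U ⧸ P' →ₗ[k] F ⧸ P := P'.mapQ P U.subtype le_rfl
  have hi : Function.Injective i := by
    refine (injective_iff_map_eq_zero i).2 fun y hy => ?_
    obtain ⟨y, rfl⟩ := Submodule.Quotient.mk_surjective P' y
    exact (Submodule.Quotient.mk_eq_zero P').2 ((Submodule.Quotient.mk_eq_zero P).1 hy)
  let g : U ⧸ P' →ₗ[k] Q := P'.liftQ θ hθ
  obtain ⟨h, hh⟩ := hQ.extension_property (i.extendScalarsOfSurjective hk) hi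
    (g.extendScalarsOfSurjective hk)
  exact ⟨(h.restrictScalars k).comp P.mkQ,
    fun w => LinearMap.congr_fun hh (Submodule.Quotient.mk w)⟩

/-- Additive maps out of a free bimodule. -/
noncomputable def FreeBimod.liftAdd {Q : Type u} [AddCommGroup Q] (T : X → Env R A →+ Q) :
    FreeBimod R A X →+ Q := Finsupp.liftAddHom T

theorem FreeBimod.liftAdd_gen {Q : Type u} [AddCommGroup Q] (T : X → Env R A →+ Q) (a b : A)
    (x : X) : FreeBimod.liftAdd T ((lft a : Env R A) • (rgt b : Env R A) • FreeBimod.gen x) =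
      T x (a ⊗ₜ MulOpposite.op b) := by
  have e : (lft a * rgt b : Env R A) = a ⊗ₜ MulOpposite.op b := by
    rw [tmul_eq_lft_mul_rgt, MulOpposite.unop_op]
  have e' : (lft a : Env R A) • (rgt b : Env R A) • (FreeBimod.gen x : FreeBimod R A X) =
      (lft a * rgt b : Env R A) • (FreeBimod.gen x : FreeBimod R A X) := (mul_smul _ _ _).symm
  have e'' : ∀ z : Env R A,
      FreeBimod.liftAdd T (z • (FreeBimod.gen x : FreeBimod R A X)) = T x z := fun z => by
    refine (congrArg (FreeBimod.liftAdd T) (Finsupp.smul_single z x (1 : Env R A))).trans ?_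
    exact (Finsupp.liftAddHom_apply_single T x _).trans (congrArg (T x) (mul_one z))
  rw [e', e'', e]

variable [Module.Flat R A]

/-- A relation whose universal derivative vanishes is decomposable, up to scalars. -/
theorem mem_closure_of_freeDer_eq_zero (hk : Function.Surjective (algebraMap k R)) {α : X → A}
    (hα : Function.Surjective α) {v : FreeAlgebra k X} (hv : aug k α v = 0)
    (hD : freeDer k R α v = 0) :
    v ∈ AddSubgroup.closure ({w | ∃ x y, aug k α x = 0 ∧ aug k α y = 0 ∧ x * y = w} ∪
      {w | ∃ (r : k) (x : _), algebraMap k R r = 0 ∧ r • x = w}) := by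
  set U := AddSubgroup.closure ({w | ∃ x y, aug k α x = 0 ∧ aug k α y = 0 ∧ x * y = w} ∪
    {w | ∃ (r : k) (x : FreeAlgebra k X), algebraMap k R r = 0 ∧ r • x = w}) with hU
  have hU₁ : ∀ x y, aug k α x = 0 → aug k α y = 0 → x * y ∈ U := fun x y hx hy =>
    AddSubgroup.subset_closure (Or.inl ⟨x, y, hx, hy, rfl⟩)
  have hU₂ : ∀ (r : k) x, algebraMap k R r = 0 → r • x ∈ U := fun r x hr =>
    AddSubgroup.subset_closure (Or.inr ⟨r, x, hr, rfl⟩)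
  let s := Function.surjInv (aug_surjective (k := k) hα)
  have hs : ∀ a, aug k α (s a) = a := Function.surjInv_eq _
  rw [← QuotientAddGroup.eq_zero_iff]
  -- Membership is tested by characters χ of the free algebra that vanish on `U`. Such a χ gives a
  -- left linear map θ from the relations to the character module of A, sending w to a ↦ χ(s(a) w).
  refine CharacterModule.eq_zero_of_character_apply fun χ' => ?_
  let χ : FreeAlgebra k X →+ AddCircle (1 : ℚ) :=
    (χ' : _ →+ AddCircle (1 : ℚ)).comp (QuotientAddGroup.mk' U)
  change χ v = 0
  have hχ : ∀ w ∈ U, χ w = 0 := fun w hw => by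
    change χ' (QuotientAddGroup.mk w) = 0
    rw [(QuotientAddGroup.eq_zero_iff w).2 hw, map_zero]
  have hχ' : ∀ u u' w, aug k α w = 0 → aug k α u = aug k α u' → χ (u * w) = χ (u' * w) :=
    fun u u' w hw hu => by
      rw [← sub_eq_zero, ← map_sub, ← sub_mul]
      exact hχ _ (hU₁ _ _ (by rw [map_sub, hu, sub_self]) hw)
  let Jm : Submodule k (FreeAlgebra k X) := LinearMap.ker (aug k α).toLinearMap
  have hJ : ∀ w : Jm, aug k α w = 0 := fun w => w.2
  let θ : Jm →ₗ[k] CharacterModule A :=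
    { toFun := fun w => toChar (AddMonoidHom.mk' (fun a => χ (s a * w)) (fun a b => by
        rw [← map_add, ← add_mul]
        exact hχ' _ _ _ (hJ w) (by rw [map_add, hs, hs, hs])))
      map_add' := fun w w' => CharacterModule.ext A fun a => by
        change χ (s a * (w + w')) = χ (s a * w) + χ (s a * w')
        rw [mul_add, map_add]
      map_smul' := fun r w => CharacterModule.ext A fun a => by
        change χ (s a * (r • w)) = χ (s (r • a) * w)
        rw [mul_smul_comm, ← smul_mul_assoc]
        exact hχ' _ _ _ (hJ w) (by rw [map_smul, hs, hs]) }
  have hθ : ∀ w a, θ w a = χ (s a * w) := fun w a => rfl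
  have : IsScalarTower k R (CharacterModule A) := ⟨fun r t χ => CharacterModule.ext A fun a => by
    change χ ((r • t) • a) = χ (t • r • a)
    rw [smul_assoc, smul_comm]⟩
  -- Flatness of A is used here: its character module is injective over R, so θ extends to the whole
  -- free algebra, though only linearly over k.
  obtain ⟨θ', hθ'⟩ := exists_extension_of_baer hk
    ((Module.Flat.iff_characterModule_baer (R := R) (M := A)).1 inferInstance) Jm θ
    (fun w hw => CharacterModule.ext A fun a => by
      rw [hθ]
      change _ = 0
      refine hχ _ ?_
      refine Submodule.smul_induction_on (p := fun x => s a * x ∈ U) hw (fun r hr n _ => ?_)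
        (fun x y hx hy => ?_)
      · rw [mul_smul_comm]
        exact hU₂ _ _ hr
      · rw [mul_add]
        exact U.add_mem hx hy)
  have hJ' : ∀ u w (_ : aug k α w = 0), θ' (u * w) = charAct k (aug k α u) (θ' w) := fun u w hw => by
    have e₁ := hθ' ⟨w, hw⟩
    have e₂ := hθ' ⟨u * w, by
      change aug k α (u * w) = 0
      rw [map_mul, hw, mul_zero]⟩
    change θ' w = _ at e₁
    change θ' (u * w) = _ at e₂
    rw [e₁, e₂]
    refine CharacterModule.ext A fun a => ?_
    rw [charAct_apply, hθ, hθ]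
    change χ (s a * (u * w)) = χ (s (a * aug k α u) * w)
    rw [← mul_assoc]
    exact hχ' _ _ _ hw (by rw [map_mul, hs, hs])
  -- The defect of left linearity of θ' at a generator. It vanishes on relations, so it depends only
  -- on the image in A, and all these defects together define an additive map Φ on the free
  -- bimodule.
  let ε : X → FreeAlgebra k X →ₗ[k] CharacterModule A := fun x =>
    θ'.comp (LinearMap.mulLeft k (FreeAlgebra.ι k x)) - (charAct k (α x)).comp θ'
  have hε : ∀ x f, ε x f = θ' (FreeAlgebra.ι k x * f) - charAct k (α x) (θ' f) := fun x f => rfl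
  have hε' : ∀ x f f', aug k α f = aug k α f' → ε x f = ε x f' := fun x f f' h => by
    rw [← sub_eq_zero, ← map_sub, hε, hJ' _ _ (by rw [map_sub, h, sub_self]), aug_ι, sub_self]
  let T : X → Env R A →+ CharacterModule A := fun x => TensorProduct.liftAddHom
    (AddMonoidHom.mk' (fun a => AddMonoidHom.mk' (fun b => charAct k a (ε x (s b.unop)))
        (fun b b' => by
          rw [← map_add, ← map_add]
          exact congrArg _ (hε' _ _ _ (by rw [map_add, hs, hs, hs, MulOpposite.unop_add]))))
      (fun a a' => AddMonoidHom.ext fun b => by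
        simp only [AddMonoidHom.mk'_apply, AddMonoidHom.add_apply, map_add, LinearMap.add_apply]))
    (fun r a b => by
      obtain ⟨r, rfl⟩ := hk r
      have h : ∀ x : A, algebraMap k R r • x = r • x := fun x => by
        rw [Algebra.smul_def, Algebra.smul_def, IsScalarTower.algebraMap_apply k R A]
      simp only [AddMonoidHom.mk'_apply, h, MulOpposite.unop_smul]
      rw [hε' x (s (r • b.unop)) (r • s b.unop) (by rw [map_smul, hs, hs])]
      simp only [map_smul, LinearMap.smul_apply])
  let Φ : FreeBimod R A X →+ CharacterModule A := FreeBimod.liftAdd T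
  have hΦ : ∀ a b x, Φ ((lft a : Env R A) • (rgt b : Env R A) • FreeBimod.gen x) =
      charAct k a (ε x (s b)) := fun a b x => by
    exact FreeBimod.liftAdd_gen T a b x
  have hΦ' : ∀ a e, Φ ((lft a : Env R A) • e) = charAct k a (Φ e) := fun a e => by
    induction e using FreeBimod.induction with
    | h₀ => simp only [smul_zero, map_zero]
    | hadd e e' h h' => simp only [smul_add, map_add, h, h']
    | hgen a' b x =>
      rw [← lft_mul_smul, hΦ, hΦ, map_mul]
      rfl
  -- The defect at any u is computed by Φ from D(u). For the given relation times 1, whose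
  -- derivative is zero, this says that θ' vanishes on the relation; and χ is recovered from θ by
  -- evaluation at 1.
  have key : ∀ u v, θ' (u * v) = charAct k (aug k α u) (θ' v) +
      Φ ((rgt (aug k α v) : Env R A) • freeDer k R α u) := fun u => by
    induction u using FreeAlgebra.induction with
    | grade0 r =>
      intro v
      rw [freeDer_algebraMap, smul_zero, map_zero, add_zero, AlgHom.commutes, AlgHom.commutes,
        ← Algebra.smul_def, map_smul]
      rfl
    | grade1 x =>
      intro v
      have h := hΦ 1 (aug k α v) x
      rw [lft_one, one_smul, map_one, hε' x _ v (hs _)] at h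
      rw [freeDer_ι, h, aug_ι]
      exact (add_sub_cancel _ _).symm
    | mul u u' hu hu' =>
      intro v
      rw [mul_assoc, hu, hu', freeDer_mul, map_mul, map_mul, smul_add, map_add, map_add,
        ← lft_smul_rgt_smul, hΦ', map_mul, rgt_mul_smul, ← add_assoc]
      rfl
    | add u u' hu hu' =>
      intro v
      rw [add_mul, map_add, hu, hu', map_add, map_add, map_add, smul_add, map_add,
        LinearMap.add_apply]
      abel
  have h := key v 1
  rw [mul_one, hv, hD, smul_zero, map_zero, map_zero, LinearMap.zero_apply, add_zero] at h
  have h₁ := hθ' ⟨v, hv⟩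
  change θ' v = _ at h₁
  rw [h] at h₁
  have h₂ : θ ⟨v, hv⟩ 1 = 0 := by rw [← h₁]; rfl
  rw [hθ] at h₂
  rw [← h₂]
  refine (congrArg χ (one_mul v)).symm.trans ?_
  exact hχ' _ _ _ hv (by rw [hs, map_one])

/-- A flatness property of modules over a free algebra which map to it. -/
theorem eq_zero_of_mem_closure {α : X → A} (hα : Function.Surjective α) {M₁ : Type u}
    [AddCommGroup M₁] [Module R M₁] (l : FreeAlgebra R X →ₐ[R] Module.End R M₁)
    (d : M₁ →ₗ[R] FreeAlgebra R X) (hd : ∀ u m, d (l u m) = u * d m)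
    (hl : ∀ u m, aug R α u = 0 → d m = 0 → l u m = 0) {n : M₁} (hn : d n = 0)
    (hJ : n ∈ AddSubgroup.closure {z | ∃ u m, aug R α u = 0 ∧ l u m = z}) : n = 0 := by
  let s := Function.surjInv (aug_surjective (k := R) hα)
  have hs : ∀ a, aug R α (s a) = a := Function.surjInv_eq _
  let K := LinearMap.ker d
  suffices h : (⟨n, hn⟩ : K) = 0 from congrArg Subtype.val h
  -- The method is the same. Relations kill K, so K is an A-module, and a character of K gives a
  -- left linear map θ from K to the character module of A.
  refine CharacterModule.eq_zero_of_character_apply fun χ => ?_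
  have hl' : ∀ u u' m, d m = 0 → aug R α u = aug R α u' → l u m = l u' m := fun u u' m hm hu => by
    rw [← sub_eq_zero, ← LinearMap.sub_apply, ← map_sub]
    exact hl _ _ (by rw [map_sub, hu, sub_self]) hm
  have hK : ∀ u (m : K), l u m ∈ K := fun u m => by
    change d (l u m) = 0
    rw [hd, show d m = 0 from m.2, mul_zero]
  let θ : K →ₗ[R] CharacterModule A :=
    { toFun := fun m => toChar (AddMonoidHom.mk' (fun a => χ ⟨l (s a) m, hK _ m⟩) (fun a b => by
        rw [← map_add]
        refine congrArg χ (Subtype.ext ?_)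
        change l (s (a + b)) m = l (s a) m + l (s b) m
        rw [← LinearMap.add_apply, ← map_add]
        exact hl' _ _ _ m.2 (by rw [map_add, hs, hs, hs])))
      map_add' := fun m m' => CharacterModule.ext A fun a => by
        refine (congrArg χ (Subtype.ext ?_)).trans (map_add χ _ _)
        exact map_add _ _ _
      map_smul' := fun r m => CharacterModule.ext A fun a => by
        refine congrArg χ (Subtype.ext ?_)
        change l (s a) (r • m) = l (s (r • a)) m
        rw [map_smul, ← LinearMap.smul_apply, ← map_smul]
        exact hl' _ _ _ m.2 (by rw [map_smul, hs, hs]) }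
  have hQ := (Module.Flat.iff_characterModule_baer (R := R) (M := A)).1 inferInstance
  -- By injectivity θ extends to ψ on all of M₁. The defect of linearity of ψ at a generator kills
  -- K, so it is a function on d(M₁), which extends to the free algebra by injectivity once more.
  obtain ⟨ψ, hψ⟩ := hQ.extension_property K.subtype K.injective_subtype θ
  have hψ' : ∀ m : K, ψ m = θ m := fun m => LinearMap.congr_fun hψ m
  let ε : X → M₁ →ₗ[R] CharacterModule A := fun x =>
    ψ.comp (l (FreeAlgebra.ι R x)) - (charAct R (α x)).comp ψ
  have hε : ∀ x m, ε x m = ψ (l (FreeAlgebra.ι R x) m) - charAct R (α x) (ψ m) := fun x m => rfl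
  have hε' : ∀ x, K ≤ LinearMap.ker (ε x) := fun x m hm => by
    have e₁ := hψ' ⟨m, hm⟩
    have e₂ := hψ' ⟨l (FreeAlgebra.ι R x) m, hK _ ⟨m, hm⟩⟩
    change ψ m = _ at e₁
    change ψ (l (FreeAlgebra.ι R x) m) = _ at e₂
    rw [LinearMap.mem_ker, hε, e₁, e₂, sub_eq_zero]
    refine CharacterModule.ext A fun a => congrArg χ (Subtype.ext ?_)
    change l (s a) (l (FreeAlgebra.ι R x) m) = l (s (a * α x)) m
    rw [← Module.End.mul_apply, ← map_mul]
    exact hl' _ _ _ hm (by rw [map_mul, hs, hs, aug_ι])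
  have hext : ∀ x, ∃ e : FreeAlgebra R X →ₗ[R] CharacterModule A, ∀ m, e (d m) = ε x m := fun x => by
    obtain ⟨e, he⟩ := hQ.extension_property (K.liftQ d le_rfl)
      (LinearMap.ker_eq_bot.1 (Submodule.ker_liftQ_eq_bot K d le_rfl le_rfl))
      (K.liftQ (ε x) (hε' x))
    exact ⟨e, fun m => LinearMap.congr_fun he (Submodule.Quotient.mk m)⟩
  choose e he using hext
  -- The extended defects define the correction m ↦ Δ(d m)(1), and ψ minus it is linear over the
  -- free algebra. It therefore kills the products of relations with M₁, in particular `n`, where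
  -- the correction vanishes because d(n) = 0.
  obtain ⟨Δ, hΔ₁, hΔ₂⟩ := exists_blockMap (Algebra.lmul R (FreeAlgebra R X))
    ((charAct R).comp (aug R α)) e
  let ζ : M₁ →ₗ[R] CharacterModule A := ψ - (Δ.flip 1).comp d
  have hζ : ∀ m, ζ m = ψ m - Δ (d m) 1 := fun m => rfl
  have hζ' : ∀ u m, ζ (l u m) = charAct R (aug R α u) (ζ m) := fun u => by
    induction u using FreeAlgebra.induction with
    | grade0 r =>
      intro m
      simp only [AlgHom.commutes, Module.algebraMap_end_apply, map_smul]
    | grade1 x =>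
      intro m
      have e₁ : Δ (FreeAlgebra.ι R x) ((Algebra.lmul R (FreeAlgebra R X)) (d m) 1) = ε x m := by
        rw [hΔ₁, ← he]
        exact congrArg (e x) (mul_one _)
      rw [hζ, hζ, hd, hΔ₂, e₁, hε, map_sub, AlgHom.comp_apply, aug_ι]
      abel
    | mul u v hu hv =>
      intro m
      rw [map_mul, map_mul, map_mul, Module.End.mul_apply, Module.End.mul_apply, hu, hv]
    | add u v hu hv =>
      intro m
      rw [map_add, map_add, map_add, LinearMap.add_apply, LinearMap.add_apply, map_add, hu, hv]
  have hζ₀ : ζ n = 0 := by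
    clear hn
    induction hJ using AddSubgroup.closure_induction with
    | mem z hz =>
      obtain ⟨u, m, hu, rfl⟩ := hz
      rw [hζ', hu, map_zero, LinearMap.zero_apply]
    | zero => exact map_zero ζ
    | add z w _ _ hz hw => rw [map_add, hz, hw, add_zero]
    | neg z _ hz => rw [map_neg, hz, neg_zero]
  rw [hζ, hn, map_zero, LinearMap.zero_apply, sub_zero] at hζ₀
  have h₁ := hψ' ⟨n, hn⟩
  change ψ n = _ at h₁
  rw [hζ₀] at h₁
  have h₂ : θ ⟨n, hn⟩ 1 = 0 := by rw [← h₁]; rfl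
  rw [← h₂]
  refine congrArg χ (Subtype.ext ?_)
  change n = l (s 1) n
  rw [hl' (s 1) 1 n hn (by rw [hs, map_one]), map_one]
  rfl

end Characters

/-! ### The conormal bimodule of a multiplicative extension -/

section EnvModule

open MulOpposite

variable {R : Type u} [CommRing R] {A : Type u} [Ring A] [Algebra R A] {Q : Type u}
  [AddCommGroup Q] [Module R Q]

/-- The action of the enveloping algebra given by commuting left and right actions. -/
noncomputable def envAct (l r : A →ₗ[R] Module.End R Q) (hl₁ : l 1 = 1) (hr₁ : r 1 = 1)
    (hl : ∀ a b, l (a * b) = l a * l b) (hr : ∀ a b, r (a * b) = r b * r a)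
    (hlr : ∀ a b, l a * r b = r b * l a) : Env R A →ₐ[R] Module.End R Q :=
  Algebra.TensorProduct.lift (AlgHom.ofLinearMap l hl₁ hl)
    (AlgHom.ofLinearMap (r ∘ₗ (opLinearEquiv R).symm.toLinearMap) hr₁
      (fun a b => hr b.unop a.unop)) (fun a b => hlr a b.unop)

theorem envAct_lft (l r : A →ₗ[R] Module.End R Q) (hl₁ : l 1 = 1) (hr₁ : r 1 = 1)
    (hl : ∀ a b, l (a * b) = l a * l b) (hr : ∀ a b, r (a * b) = r b * r a)
    (hlr : ∀ a b, l a * r b = r b * l a) (a : A) :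
    envAct l r hl₁ hr₁ hl hr hlr (lft a) = l a := by
  have h : envAct l r hl₁ hr₁ hl hr hlr (lft a) = l a * r 1 :=
    Algebra.TensorProduct.lift_tmul _ _ _ _ _
  rw [h, hr₁, mul_one]

theorem envAct_rgt (l r : A →ₗ[R] Module.End R Q) (hl₁ : l 1 = 1) (hr₁ : r 1 = 1)
    (hl : ∀ a b, l (a * b) = l a * l b) (hr : ∀ a b, r (a * b) = r b * r a)
    (hlr : ∀ a b, l a * r b = r b * l a) (a : A) :
    envAct l r hl₁ hr₁ hl hr hlr (rgt a) = r a := by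
  have h : envAct l r hl₁ hr₁ hl hr hlr (rgt a) = l 1 * r a :=
    Algebra.TensorProduct.lift_tmul _ _ _ _ _
  rw [h, hl₁, one_mul]

end EnvModule

namespace DGExt

variable {R : Type u} [CommRing R] {A : Type u} [Ring A] [Algebra R A]
  {N : Type u} [AddCommGroup N]

section Conormal

variable (C : DGExt R A N)

/-- The submodule of `C₁` generated by the products with elements of the kernel of `C₀ → A`. -/
def kerMul : Submodule R C.C₁ := Submodule.span R {z | ∃ x c, C.a x = 0 ∧ C.lmul x c = z}

theorem lmul_mem_kerMul {x : C.C₀} (hx : C.a x = 0) (c : C.C₁) : C.lmul x c ∈ C.kerMul :=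
  Submodule.subset_span ⟨x, c, hx, rfl⟩

theorem lmul_kerMul (y : C.C₀) {z : C.C₁} (hz : z ∈ C.kerMul) : C.lmul y z ∈ C.kerMul := by
  induction hz using Submodule.span_induction with
  | mem z h =>
    obtain ⟨x, c, hx, rfl⟩ := h
    rw [← C.mul_lmul]
    exact C.lmul_mem_kerMul (by rw [map_mul, hx, mul_zero]) c
  | zero => rw [map_zero]; exact zero_mem _
  | add z z' _ _ h h' => rw [map_add]; exact add_mem h h'
  | smul r z _ h => rw [map_smul]; exact Submodule.smul_mem _ _ h

theorem rmul_kerMul {z : C.C₁} (hz : z ∈ C.kerMul) (y : C.C₀) : C.rmul z y ∈ C.kerMul := by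
  induction hz using Submodule.span_induction with
  | mem z h =>
    obtain ⟨x, c, hx, rfl⟩ := h
    rw [C.lmul_rmul]
    exact C.lmul_mem_kerMul hx _
  | zero => rw [map_zero]; exact zero_mem _
  | add z z' _ _ h h' => rw [map_add]; exact add_mem h h'
  | smul r z _ h => rw [map_smul]; exact Submodule.smul_mem _ _ h

/-- Scalars are absorbed by the factor from Ker a, so additive generation suffices;
`eq_zero_of_mem_closure` needs this form. -/
theorem kerMul_le_closure {z : C.C₁} (hz : z ∈ C.kerMul) :
    z ∈ AddSubgroup.closure {z | ∃ x c, C.a x = 0 ∧ C.lmul x c = z} := by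
  have h : ∀ r : R, r • z ∈ AddSubgroup.closure {z | ∃ x c, C.a x = 0 ∧ C.lmul x c = z} := by
    induction hz using Submodule.span_induction with
    | mem z h =>
      obtain ⟨x, c, hx, rfl⟩ := h
      intro r
      exact AddSubgroup.subset_closure
        ⟨r • x, c, by rw [map_smul, hx, smul_zero], C.lmul.map_smul₂ _ _ _⟩
    | zero => intro r; rw [smul_zero]; exact zero_mem _
    | add z z' _ _ h h' => intro r; rw [smul_add]; exact add_mem (h r) (h' r)
    | smul s z _ h => intro r; rw [smul_smul]; exact h _
  exact one_smul R z ▸ h 1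

variable [Module (Env R A) N] {C}

/-- An element of Ker a is a boundary d(c'), and c d(c') = d(c) c' by the Leibniz rule. So right
multiples by Ker a are also left multiples, and the quotient is a bimodule over A. -/
theorem rmul_mem_kerMul (hC : C.IsElementary) (c : C.C₁) {x : C.C₀} (hx : C.a x = 0) :
    C.rmul c x ∈ C.kerMul := by
  obtain ⟨c', rfl⟩ := (hC.exact_d_a x).1 hx
  rw [← C.leibniz]
  exact C.lmul_mem_kerMul ((hC.exact_d_a _).2 ⟨c, rfl⟩) c'

/-- The left and right actions of `C₀` on the quotient of `C₁` by `kerMul`. -/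
theorem exists_conormalAct (hC : C.IsElementary) : ∃ l r : A →ₗ[R] Module.End R (C.C₁ ⧸ C.kerMul),
    (∀ x c, l (C.a x) (Submodule.Quotient.mk c) = Submodule.Quotient.mk (C.lmul x c)) ∧
    ∀ x c, r (C.a x) (Submodule.Quotient.mk c) = Submodule.Quotient.mk (C.rmul c x) := by
  let s := Function.surjInv hC.a_surjective
  have hs : ∀ a, C.a (s a) = a := Function.surjInv_eq hC.a_surjective
  let l₀ : C.C₀ →ₗ[R] Module.End R (C.C₁ ⧸ C.kerMul) :=
    { toFun := fun x => C.kerMul.mapQ C.kerMul (C.lmul x) (fun _ h => C.lmul_kerMul x h)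
      map_add' := fun x y => Submodule.linearMap_qext _ (LinearMap.ext fun c =>
        congrArg (Submodule.Quotient.mk (p := C.kerMul)) (C.lmul.map_add₂ x y c))
      map_smul' := fun r x => Submodule.linearMap_qext _ (LinearMap.ext fun c =>
        congrArg (Submodule.Quotient.mk (p := C.kerMul)) (C.lmul.map_smul₂ r x c)) }
  let r₀ : C.C₀ →ₗ[R] Module.End R (C.C₁ ⧸ C.kerMul) :=
    { toFun := fun x => C.kerMul.mapQ C.kerMul (C.rmul.flip x) (fun _ h => C.rmul_kerMul h x)
      map_add' := fun x y => Submodule.linearMap_qext _ (LinearMap.ext fun c =>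
        congrArg (Submodule.Quotient.mk (p := C.kerMul)) (map_add (C.rmul c) x y))
      map_smul' := fun r x => Submodule.linearMap_qext _ (LinearMap.ext fun c =>
        congrArg (Submodule.Quotient.mk (p := C.kerMul)) (map_smul (C.rmul c) r x)) }
  have key : ∀ f : C.C₀ →ₗ[R] Module.End R (C.C₁ ⧸ C.kerMul), (∀ x, C.a x = 0 → f x = 0) →
      ∃ g : A →ₗ[R] Module.End R (C.C₁ ⧸ C.kerMul), ∀ x, g (C.a x) = f x := fun f hf => by
    have h : ∀ x y, C.a x = C.a y → f x = f y := fun x y e => by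
      rw [← sub_eq_zero, ← map_sub]
      exact hf _ (by rw [map_sub, e, sub_self])
    refine ⟨{ toFun := fun a => f (s a), map_add' := fun a b => ?_, map_smul' := fun r a => ?_ },
      fun x => h _ _ (hs _)⟩
    · rw [← map_add]
      exact h _ _ (by rw [map_add, hs, hs, hs])
    · rw [RingHom.id_apply, ← map_smul]
      exact h _ _ (by rw [map_smul, hs, hs])
  obtain ⟨l, hl⟩ := key l₀ fun x hx => Submodule.linearMap_qext _ (LinearMap.ext fun c =>
    (Submodule.Quotient.mk_eq_zero C.kerMul).2 (C.lmul_mem_kerMul hx c))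
  obtain ⟨r, hr⟩ := key r₀ fun x hx => Submodule.linearMap_qext _ (LinearMap.ext fun c =>
    (Submodule.Quotient.mk_eq_zero C.kerMul).2 (rmul_mem_kerMul hC c hx))
  refine ⟨l, r, fun x c => ?_, fun x c => ?_⟩
  · rw [hl]; rfl
  · rw [hr]; rfl

theorem exists_conormalEnvAct (hC : C.IsElementary) :
    ∃ ρ : Env R A →ₐ[R] Module.End R (C.C₁ ⧸ C.kerMul),
    (∀ x c, ρ (lft (C.a x)) (Submodule.Quotient.mk c) = Submodule.Quotient.mk (C.lmul x c)) ∧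
    ∀ x c, ρ (rgt (C.a x)) (Submodule.Quotient.mk c) = Submodule.Quotient.mk (C.rmul c x) := by
  obtain ⟨l, r, hl, hr⟩ := exists_conormalAct hC
  have hA : ∀ a, ∃ x, C.a x = a := hC.a_surjective
  refine ⟨envAct l r ?_ ?_ ?_ ?_ ?_, fun x c => by rw [envAct_lft, hl],
    fun x c => by rw [envAct_rgt, hr]⟩
  · refine Submodule.linearMap_qext _ (LinearMap.ext fun c => ?_)
    change l 1 (Submodule.Quotient.mk c) = Submodule.Quotient.mk c
    rw [← map_one C.a, hl, C.one_lmul]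
  · refine Submodule.linearMap_qext _ (LinearMap.ext fun c => ?_)
    change r 1 (Submodule.Quotient.mk c) = Submodule.Quotient.mk c
    rw [← map_one C.a, hr, C.rmul_one]
  · intro a b
    obtain ⟨x, rfl⟩ := hA a
    obtain ⟨y, rfl⟩ := hA b
    refine Submodule.linearMap_qext _ (LinearMap.ext fun c => ?_)
    change l _ (Submodule.Quotient.mk c) = l _ (l _ (Submodule.Quotient.mk c))
    rw [← map_mul, hl, hl, hl, C.mul_lmul]
  · intro a b
    obtain ⟨x, rfl⟩ := hA a
    obtain ⟨y, rfl⟩ := hA b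
    refine Submodule.linearMap_qext _ (LinearMap.ext fun c => ?_)
    change r _ (Submodule.Quotient.mk c) = r _ (r _ (Submodule.Quotient.mk c))
    rw [← map_mul, hr, hr, hr, C.rmul_mul]
  · intro a b
    obtain ⟨x, rfl⟩ := hA a
    obtain ⟨y, rfl⟩ := hA b
    refine Submodule.linearMap_qext _ (LinearMap.ext fun c => ?_)
    change l _ (r _ (Submodule.Quotient.mk c)) = r _ (l _ (Submodule.Quotient.mk c))
    rw [hl, hr, hr, hl, C.lmul_rmul]

/-- The conormal bimodule `C₁ / Ker(a) C₁` of a multiplicative elementary extension. -/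
def Conormal (_ : C.IsElementary) : Type u := C.C₁ ⧸ C.kerMul

namespace Conormal

variable (hC : C.IsElementary)

noncomputable instance : AddCommGroup (Conormal hC) := inferInstanceAs (AddCommGroup (C.C₁ ⧸ C.kerMul))

noncomputable instance : Module (Env R A) (Conormal hC) :=
  Module.compHom (C.C₁ ⧸ C.kerMul) (exists_conormalEnvAct hC).choose.toRingHom

/-- The class of an element of `C₁`. -/
def mk : C.C₁ →+ Conormal hC := C.kerMul.mkQ.toAddMonoidHom

theorem lft_smul_mk (x : C.C₀) (c : C.C₁) :
    (lft (C.a x) : Env R A) • mk hC c = mk hC (C.lmul x c) :=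
  (exists_conormalEnvAct hC).choose_spec.1 x c

theorem rgt_smul_mk (x : C.C₀) (c : C.C₁) :
    (rgt (C.a x) : Env R A) • mk hC c = mk hC (C.rmul c x) :=
  (exists_conormalEnvAct hC).choose_spec.2 x c

theorem mk_surjective : Function.Surjective (mk hC) := Submodule.Quotient.mk_surjective _

theorem mk_eq_zero {c : C.C₁} : mk hC c = 0 ↔ c ∈ C.kerMul := Submodule.Quotient.mk_eq_zero _

/-- Bimodule maps out of the conormal bimodule. -/
noncomputable def lift {E : Type u} [AddCommGroup E] [Module (Env R A) E] (f : C.C₁ →+ E)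
    (hl : ∀ x c, f (C.lmul x c) = (lft (C.a x) : Env R A) • f c)
    (hr : ∀ x c, f (C.rmul c x) = (rgt (C.a x) : Env R A) • f c) :
    Conormal hC →ₗ[Env R A] E :=
  have h₀ : ∀ c ∈ C.kerMul, f c = 0 := fun c hc => by
    have h : ∀ c ∈ C.kerMul, ∀ r : R, f (r • c) = 0 := fun c hc => by
      induction hc using Submodule.span_induction with
      | mem z h =>
        obtain ⟨x, c, hx, rfl⟩ := h
        intro r
        rw [← LinearMap.map_smul₂, hl, map_smul, hx, smul_zero, lft_zero_smul]
      | zero => intro r; rw [smul_zero, map_zero]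
      | add z z' _ _ h h' => intro r; rw [smul_add, map_add, h, h', add_zero]
      | smul s z _ h => intro r; rw [smul_smul, h]
    rw [← one_smul R c]
    exact h c hc 1
  have hA : ∀ a, ∃ x, C.a x = a := hC.a_surjective
  let g : Conormal hC →+ E := QuotientAddGroup.lift C.kerMul.toAddSubgroup f h₀
  envLin g
    (fun a e => by
      obtain ⟨x, rfl⟩ := hA a
      obtain ⟨c, rfl⟩ := mk_surjective hC e
      rw [lft_smul_mk]
      exact hl x c)
    (fun a e => by
      obtain ⟨x, rfl⟩ := hA a
      obtain ⟨c, rfl⟩ := mk_surjective hC e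
      rw [rgt_smul_mk]
      exact hr x c)

/-- The inclusion of `N` in the conormal bimodule. -/
noncomputable def incl : N →ₗ[Env R A] Conormal hC :=
  have hA : ∀ a, ∃ x, C.a x = a := hC.a_surjective
  envLin ((mk hC).comp C.b)
    (fun a e => by
      obtain ⟨x, rfl⟩ := hA a
      refine Eq.trans (congrArg (mk hC) ?_) (lft_smul_mk hC x (C.b e)).symm
      exact (hC.lmul_b x e).symm)
    (fun a e => by
      obtain ⟨x, rfl⟩ := hA a
      refine Eq.trans (congrArg (mk hC) ?_) (rgt_smul_mk hC x (C.b e)).symm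
      exact (hC.rmul_b e x).symm)

theorem incl_apply (n : N) : incl hC n = mk hC (C.b n) := rfl

end Conormal

end Conormal

/-! ### Extensions with a free algebra in degree zero -/

section Pullback

variable (C : DGExt R A N)

/-- The map from the free algebra on `C₀`. -/
noncomputable def eval₀ : FreeAlgebra R C.C₀ →ₐ[R] C.C₀ := FreeAlgebra.lift R id

theorem eval₀_ι (x : C.C₀) : C.eval₀ (FreeAlgebra.ι R x) = x := FreeAlgebra.lift_ι_apply id x

theorem a_eval₀ (u : FreeAlgebra R C.C₀) : C.a (C.eval₀ u) = aug R C.a u := by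
  have h : C.a.comp C.eval₀ = aug R C.a := FreeAlgebra.hom_ext (funext fun x => by
    change C.a (C.eval₀ (FreeAlgebra.ι R x)) = aug R C.a (FreeAlgebra.ι R x)
    rw [eval₀_ι, aug_ι])
  exact DFunLike.congr_fun h u

/-- The fibre product of `C₁` and of the free algebra on `C₀`. -/
noncomputable def pull₁ : Submodule R (C.C₁ × FreeAlgebra R C.C₀) :=
  LinearMap.eqLocus (C.d ∘ₗ LinearMap.fst R _ _) (C.eval₀.toLinearMap ∘ₗ LinearMap.snd R _ _)

theorem mem_pull₁ {z : C.C₁ × FreeAlgebra R C.C₀} : z ∈ C.pull₁ ↔ C.d z.1 = C.eval₀ z.2 := Iff.rfl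

/-- The extension with a free algebra in degree zero which is equivalent to `C`. -/
noncomputable def pull (h : ∀ n, C.d (C.b n) = 0) : DGExt R A N where
  C₀ := FreeAlgebra R C.C₀
  C₁ := C.pull₁
  d := LinearMap.snd R _ _ ∘ₗ C.pull₁.subtype
  a := aug R C.a
  b := AddMonoidHom.mk' (fun n => ⟨(C.b n, 0), by rw [mem_pull₁, h, map_zero]⟩)
    (fun n n' => Subtype.ext (Prod.ext (map_add C.b n n') (add_zero _).symm))
  lmul := LinearMap.mk₂ R
    (fun u z => ⟨(C.lmul (C.eval₀ u) z.1.1, u * z.1.2), by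
      rw [mem_pull₁, C.d_lmul, map_mul, C.mem_pull₁.1 z.2]⟩)
    (fun u v z => Subtype.ext (Prod.ext
      ((congrArg (fun x => C.lmul x z.1.1) (map_add _ u v)).trans (C.lmul.map_add₂ _ _ _))
      (add_mul _ _ _)))
    (fun r u z => Subtype.ext (Prod.ext
      ((congrArg (fun x => C.lmul x z.1.1) (map_smul _ r u)).trans (C.lmul.map_smul₂ _ _ _))
      (smul_mul_assoc _ _ _)))
    (fun u z w => Subtype.ext (Prod.ext (map_add (C.lmul _) _ _) (mul_add _ _ _)))
    (fun r u z => Subtype.ext (Prod.ext (map_smul (C.lmul _) _ _) (mul_smul_comm _ _ _)))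
  rmul := LinearMap.mk₂ R
    (fun z u => ⟨(C.rmul z.1.1 (C.eval₀ u), z.1.2 * u), by
      rw [mem_pull₁, C.d_rmul, map_mul, C.mem_pull₁.1 z.2]⟩)
    (fun z w u => Subtype.ext (Prod.ext (C.rmul.map_add₂ _ _ _) (add_mul _ _ _)))
    (fun r z u => Subtype.ext (Prod.ext (C.rmul.map_smul₂ _ _ _) (smul_mul_assoc _ _ _)))
    (fun z u v => Subtype.ext (Prod.ext
      ((congrArg (C.rmul z.1.1) (map_add _ u v)).trans (map_add (C.rmul _) _ _)) (mul_add _ _ _)))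
    (fun r z u => Subtype.ext (Prod.ext
      ((congrArg (C.rmul z.1.1) (map_smul _ r u)).trans (map_smul (C.rmul _) _ _))
      (mul_smul_comm _ _ _)))
  one_lmul z := Subtype.ext (Prod.ext
    ((congrArg (fun x => C.lmul x z.1.1) (map_one C.eval₀)).trans (C.one_lmul _)) (one_mul _))
  rmul_one z := Subtype.ext (Prod.ext
    ((congrArg (C.rmul z.1.1) (map_one C.eval₀)).trans (C.rmul_one _)) (mul_one _))
  mul_lmul u v z := Subtype.ext (Prod.ext
    ((congrArg (fun x => C.lmul x z.1.1) (map_mul C.eval₀ u v)).trans (C.mul_lmul _ _ _))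
    (mul_assoc _ _ _))
  rmul_mul z u v := Subtype.ext (Prod.ext
    ((congrArg (C.rmul z.1.1) (map_mul C.eval₀ u v)).trans (C.rmul_mul _ _ _))
    (mul_assoc _ _ _).symm)
  lmul_rmul u z v := Subtype.ext (Prod.ext (C.lmul_rmul _ _ _) (mul_assoc _ _ _))
  d_lmul u z := rfl
  d_rmul z u := rfl
  leibniz z w := Subtype.ext (Prod.ext (by
    change C.lmul (C.eval₀ z.1.2) w.1.1 = C.rmul z.1.1 (C.eval₀ w.1.2)
    rw [← C.mem_pull₁.1 z.2, ← C.mem_pull₁.1 w.2, C.leibniz]) rfl)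

variable [Module (Env R A) N] {C}

theorem IsElementary.d_b (hC : C.IsElementary) (n : N) : C.d (C.b n) = 0 :=
  (hC.exact_b_d _).2 ⟨n, rfl⟩

/-- Pulling back along F → C₀ changes neither the kernel of the differential nor, as the composite F
→ A is still onto, its cokernel. -/
theorem pull_isElementary (hC : C.IsElementary) : (C.pull hC.d_b).IsElementary where
  b_injective n n' h := hC.b_injective (congrArg (fun z : C.pull₁ => z.1.1) h)
  exact_b_d z := by
    constructor
    · intro h
      have h₀ : z.1.2 = 0 := h
      have h₁ : C.d z.1.1 = 0 := by rw [C.mem_pull₁.1 z.2, h₀, map_zero]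
      obtain ⟨n, hn⟩ := (hC.exact_b_d _).1 h₁
      exact ⟨n, Subtype.ext (Prod.ext hn h₀.symm)⟩
    · rintro ⟨n, rfl⟩
      rfl
  exact_d_a u := by
    constructor
    · intro h
      have h₁ : C.a (C.eval₀ u) = 0 := (C.a_eval₀ u).trans h
      obtain ⟨c, hc⟩ := (hC.exact_d_a _).1 h₁
      exact ⟨⟨(c, u), hc⟩, rfl⟩
    · rintro ⟨z, rfl⟩
      change aug R C.a z.1.2 = 0
      rw [← a_eval₀, ← C.mem_pull₁.1 z.2]
      exact (hC.exact_d_a _).2 ⟨_, rfl⟩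
  a_surjective := aug_surjective hC.a_surjective
  lmul_b u n := Subtype.ext (Prod.ext (by
    refine (hC.lmul_b (C.eval₀ u) n).trans ?_
    exact congrArg (fun a => C.b ((lft a : Env R A) • n)) (C.a_eval₀ u)) (mul_zero _))
  rmul_b n u := Subtype.ext (Prod.ext (by
    refine (hC.rmul_b n (C.eval₀ u)).trans ?_
    exact congrArg (fun a => C.b ((rgt a : Env R A) • n)) (C.a_eval₀ u)) (zero_mul _))

/-- The equivalence of `C` with its pullback. -/
noncomputable def pullHom (h : ∀ n, C.d (C.b n) = 0) : DGExt.Hom (C.pull h) C where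
  f₀ := C.eval₀
  f₁ := LinearMap.fst R _ _ ∘ₗ C.pull₁.subtype
  comm_a := C.a_eval₀
  comm_b _ := rfl
  comm_d z := C.mem_pull₁.1 z.2
  map_lmul _ _ := rfl
  map_rmul _ _ := rfl

/-- `N` embeds in the conormal bimodule of the pullback. -/
theorem pull_incl_injective [Module.Flat R A] (hC : C.IsElementary) :
    Function.Injective (Conormal.incl (pull_isElementary hC)) := by
  refine (injective_iff_map_eq_zero _).2 fun n hn => ?_
  have h₁ := kerMul_le_closure _ ((Conormal.mk_eq_zero (pull_isElementary hC)).1 hn)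
  let C' := C.pull hC.d_b
  have hC' : C'.IsElementary := pull_isElementary hC
  let l : FreeAlgebra R C.C₀ →ₐ[R] Module.End R C.pull₁ :=
    AlgHom.ofLinearMap C'.lmul (LinearMap.ext C'.one_lmul)
      (fun x y => LinearMap.ext fun c => C'.mul_lmul x y c)
  -- The kernel of the differential is N, on which relations act by zero because N is a bimodule
  -- over A.
  have h₂ := eq_zero_of_mem_closure (M₁ := C.pull₁) hC.a_surjective l C'.d C'.d_lmul
    (fun u m hu hm => by
      obtain ⟨n, rfl⟩ := (hC'.exact_b_d m).1 hm
      refine (hC'.lmul_b u n).trans ?_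
      have : C'.a u = 0 := hu
      rw [this]
      exact (congrArg C'.b (lft_zero_smul n)).trans (map_zero _))
    (hC'.d_b n) (by
      refine AddSubgroup.closure_mono ?_ h₁
      rintro z ⟨x, c, hx, rfl⟩
      exact ⟨x, c, hx, rfl⟩)
  exact hC'.b_injective (h₂.trans (map_zero _).symm)

end Pullback

end DGExt

/-! ### The classes defined by a presentation of the differentials -/

section DimensionShift

open Abelian

universe v w w'

variable {𝒞 : Type v} [Category.{w} 𝒞] [Abelian 𝒞] [HasExt.{w'} 𝒞] {S : ShortComplex 𝒞}
  (hS : S.ShortExact) {Y : 𝒞}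

/-- Dimension shifting: the kernel of the connecting map comes from Ext of the projective middle
term, which vanishes in positive degrees only, hence the degree `n + 1`. -/
theorem eq_zero_of_extClass_comp [Projective S.X₂] {n m : ℕ} (x : Ext S.X₁ Y (n + 1))
    (h : 1 + (n + 1) = m) (hx : hS.extClass.comp x h = 0) : x = 0 := by
  obtain ⟨x₂, rfl⟩ := Ext.contravariant_sequence_exact₁ hS Y x h hx
  rw [Ext.eq_zero_of_projective x₂, Ext.comp_zero]

theorem exists_extClass_comp [Projective S.X₂] {n : ℕ} (x : Ext S.X₃ Y (n + 1)) :
    ∃ y : Ext S.X₁ Y n, hS.extClass.comp y (add_comm 1 n) = x :=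
  Ext.contravariant_sequence_exact₃ hS Y x (Ext.eq_zero_of_projective _) (add_comm 1 n)

theorem exists_mk₀ {X Y : 𝒞} (x : Ext X Y 0) : ∃ f : X ⟶ Y, Ext.mk₀ f = x :=
  (Ext.mk₀_bijective X Y).2 x

/-- The degree-zero end of the long exact sequence, where the shift need not be injective: the
pushout extension along `f` splits exactly when `f` extends to the middle term. -/
theorem extClass_comp_mk₀_eq_zero_iff (f : S.X₁ ⟶ Y) :
    hS.extClass.comp (Ext.mk₀ f) (add_zero 1) = 0 ↔ ∃ g, S.f ≫ g = f := by
  constructor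
  · intro h
    obtain ⟨x, hx⟩ := Ext.contravariant_sequence_exact₁ hS Y (Ext.mk₀ f) (add_zero 1) h
    obtain ⟨g, rfl⟩ := exists_mk₀ x
    rw [Ext.mk₀_comp_mk₀] at hx
    exact ⟨g, (Ext.mk₀_bijective _ _).1 hx⟩
  · rintro ⟨g, rfl⟩
    rw [← Ext.mk₀_comp_mk₀, hS.extClass_comp_assoc]

theorem extClass_eq_zero_iff : hS.extClass = 0 ↔ ∃ g, S.f ≫ g = 𝟙 S.X₁ := by
  rw [← extClass_comp_mk₀_eq_zero_iff hS, Ext.comp_mk₀_id]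

end DimensionShift

/-! ### The presentation of Ω by a free bimodule, and the classes it defines. -/

section FreePresentation

open Abelian

variable {R A X : Type u} [CommRing R] [Ring A] [Algebra R A] {α : X → A}
  (hα : Function.Surjective α)

instance : Projective (omegaSeq R A).X₂ :=
  inferInstanceAs (Projective (ModuleCat.of (Env R A) (Env R A)))

variable (R) in
/-- The bimodule of relations in the presentation of the differentials. -/
noncomputable abbrev RelBimod (α : X → A) : Submodule (Env R A) (FreeBimod R A X) := LinearMap.ker (freePi R α)

variable (R) in
/-- The presentation of the bimodule of differentials, as a short complex. -/
noncomputable def freeSeq (α : X → A) : ShortComplex (ModuleCat.{u} (Env R A)) where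
  X₁ := ModuleCat.of (Env R A) (RelBimod R α)
  X₂ := ModuleCat.of (Env R A) (FreeBimod R A X)
  X₃ := ModuleCat.of (Env R A) (Omega R A)
  f := ModuleCat.ofHom (X := RelBimod R α) (Y := FreeBimod R A X) (RelBimod R α).subtype
  g := ModuleCat.ofHom (freePi R α)
  zero := ModuleCat.hom_ext (LinearMap.ext (fun x : RelBimod R α => x.2))

include hα in
theorem freeSeq_shortExact : (freeSeq R α).ShortExact where
  exact := (ShortComplex.moduleCat_exact_iff _).2 (fun x hx => ⟨(⟨x, hx⟩ : RelBimod R α), rfl⟩)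
  mono_f := (ModuleCat.mono_iff_injective _).2
    (Subtype.val_injective (p := fun x => x ∈ RelBimod R α))
  epi_g := (ModuleCat.epi_iff_surjective _).2 (freePi_surjective hα)

instance : Module.Projective (Env R A) (FreeBimod R A X) :=
  Module.Projective.of_basis ⟨LinearEquiv.refl (Env R A) (FreeBimod R A X)⟩

instance : Projective (freeSeq R α).X₂ :=
  inferInstanceAs (Projective (ModuleCat.of (Env R A) (FreeBimod R A X)))

/-- The class of `0 → K → E₀ → A ⊗ Aᵒᵖ → A → 0` for a presentation of the differentials. -/
noncomputable def relClass :
    Ext (ModuleCat.of (Env R A) A) (ModuleCat.of (Env R A) (RelBimod R α)) 2 :=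
  (omegaClass R A).comp (freeSeq_shortExact hα).extClass (rfl : 1 + 1 = 2)

variable {Y : ModuleCat.{u} (Env R A)}

/-- Two dimension shifts, through A ⊗ Aᵒᵖ and through the free bimodule. -/
theorem relClass_comp_eq_zero (x : Ext (ModuleCat.of (Env R A) (RelBimod R α)) Y 1)
    (hx : (relClass hα).comp x (rfl : 2 + 1 = 3) = 0) : x = 0 := by
  have h := Ext.comp_assoc (omegaClass R A) (freeSeq_shortExact hα).extClass x
    (rfl : 1 + 1 = 2) (rfl : 1 + 1 = 2) rfl
  have h₁ := eq_zero_of_extClass_comp (omegaSeq_shortExact R A)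
    ((freeSeq_shortExact hα).extClass.comp x (rfl : 1 + 1 = 2)) (rfl : 1 + 2 = 3) (h.symm.trans hx)
  exact eq_zero_of_extClass_comp (freeSeq_shortExact hα) x (rfl : 1 + 1 = 2) h₁

/-- The class in the second Hochschild cohomology of a map out of the bimodule of relations. -/
noncomputable def relPush (θ : ModuleCat.of (Env R A) (RelBimod R α) ⟶ Y) :
    Ext (ModuleCat.of (Env R A) A) Y 2 :=
  (relClass hα).comp (Ext.mk₀ θ) (add_zero 2)

theorem relPush_eq (θ : ModuleCat.of (Env R A) (RelBimod R α) ⟶ Y) :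
    relPush hα θ = (omegaClass R A).comp
      ((freeSeq_shortExact hα).extClass.comp (Ext.mk₀ θ) (add_zero 1)) (rfl : 1 + 1 = 2) :=
  Ext.comp_assoc _ _ _ _ _ rfl

theorem relPush_add (θ θ' : ModuleCat.of (Env R A) (RelBimod R α) ⟶ Y) :
    relPush hα (θ + θ') = relPush hα θ + relPush hα θ' := by
  rw [relPush, Ext.mk₀_add, Ext.comp_add]; rfl

/-- The shift through A ⊗ Aᵒᵖ starts in degree one and is injective. The shift through the free
bimodule starts in degree zero, and its kernel consists of the maps that extend. -/
theorem relPush_eq_zero_iff (θ : ModuleCat.of (Env R A) (RelBimod R α) ⟶ Y) :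
    relPush hα θ = 0 ↔ ∃ Ψ, (freeSeq R α).f ≫ Ψ = θ := by
  refine Iff.trans ?_ (extClass_comp_mk₀_eq_zero_iff (freeSeq_shortExact hα) θ)
  rw [relPush_eq]
  exact ⟨eq_zero_of_extClass_comp (omegaSeq_shortExact R A) _ _,
    fun h => (congrArg (fun x => (omegaClass R A).comp x (rfl : 1 + 1 = 2)) h).trans
      (Ext.comp_zero _ _ _ _ _)⟩

theorem relPush_surjective : Function.Surjective (relPush (Y := Y) hα) := fun x => by
  obtain ⟨y, rfl⟩ := exists_extClass_comp (omegaSeq_shortExact R A) x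
  obtain ⟨z, rfl⟩ := exists_extClass_comp (freeSeq_shortExact hα) y
  obtain ⟨θ, rfl⟩ := exists_mk₀ z
  exact ⟨θ, relPush_eq hα θ⟩

/-- A map of extensions of the differentials computes the class. -/
theorem relPush_eq_of_map {E : ModuleCat.{u} (Env R A)} (ι : Y ⟶ E)
    (π : E ⟶ ModuleCat.of (Env R A) (Omega R A)) (w : ι ≫ π = 0)
    (h : (ShortComplex.mk ι π w).ShortExact)
    (θ : ModuleCat.of (Env R A) (RelBimod R α) ⟶ Y) (Φ : (freeSeq R α).X₂ ⟶ E)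
    (h₁ : θ ≫ ι = (freeSeq R α).f ≫ Φ) (h₂ : Φ ≫ π = (freeSeq R α).g) :
    relPush hα θ = (omegaClass R A).comp h.extClass (rfl : 1 + 1 = 2) := by
  have := (freeSeq_shortExact hα).extClass_naturality h
    { τ₁ := θ, τ₂ := Φ, τ₃ := 𝟙 _, comm₁₂ := h₁, comm₂₃ := h₂.trans (Category.comp_id _).symm }
  rw [relPush_eq]
  exact congrArg (fun x => (omegaClass R A).comp x (rfl : 1 + 1 = 2))
    (this.trans (Ext.mk₀_id_comp _))

end FreePresentation

/-! ### The obstruction class -/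

namespace FourTerm

open Abelian

variable {R A N : Type u} [CommRing R] [Ring A] [Algebra R A] [AddCommGroup N] [Module (Env R A) N]

/-- Maps of exact sequences which are the identity at both ends preserve the class. -/
theorem cls_eq_of_map (E E' : FourTerm R A N) (Φ₁ : E.E₁ ⟶ E'.E₁) (Φ₀ : E.E₀ ⟶ E'.E₀)
    (hι : E.ι ≫ Φ₁ = E'.ι) (hπ : Φ₀ ≫ E'.π = E.π)
    (hΦ : E.p ≫ E.j ≫ Φ₀ = Φ₁ ≫ E'.p ≫ E'.j) : E.cls = E'.cls := by
  have : Mono E'.j := E'.exact₀.mono_f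
  let κ : E.K ⟶ E'.K := E'.exact₀.exact.lift (E.j ≫ Φ₀) (by
    change (E.j ≫ Φ₀) ≫ E'.π = 0
    rw [Category.assoc, hπ, E.j_π])
  have hκ : κ ≫ E'.j = E.j ≫ Φ₀ := E'.exact₀.exact.lift_f _ _
  have h₀ := E.exact₀.extClass_naturality E'.exact₀
    { τ₁ := κ, τ₂ := Φ₀, τ₃ := 𝟙 _, comm₁₂ := hκ, comm₂₃ := hπ.trans (Category.comp_id _).symm }
  have h₁ := E.exact₁.extClass_naturality E'.exact₁
    { τ₁ := 𝟙 _, τ₂ := Φ₁, τ₃ := κ, comm₁₂ := (Category.id_comp _).trans hι.symm,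
      comm₂₃ := by
        change Φ₁ ≫ E'.p = E.p ≫ κ
        rw [← cancel_mono E'.j, Category.assoc, Category.assoc, hκ, hΦ] }
  rw [Ext.mk₀_id_comp] at h₀
  rw [Ext.comp_mk₀_id] at h₁
  rw [cls, cls, ← h₀, h₁, ← Ext.comp_assoc_of_third_deg_zero, Ext.comp_assoc_of_second_deg_zero]

end FourTerm

section Obstruction

variable {R A N : Type u} [CommRing R] [Ring A] [Algebra R A] [AddCommGroup N] [Module (Env R A) N]
  {C : DGExt R A N}

/-- The pullback of a derivation. -/
def DGDer.comp {C' : DGExt R A N} {E : FourTerm R A N} (D : DGDer C E) (f : DGExt.Hom C' C) :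
    DGDer C' E where
  D₀ := D.D₀.comp f.f₀.toRingHom.toAddMonoidHom
  D₁ := D.D₁.comp f.f₁.toAddMonoidHom
  map_mul x y := by
    change D.D₀ (f.f₀ (x * y)) = _ • D.D₀ (f.f₀ y) + _ • D.D₀ (f.f₀ x)
    rw [_root_.map_mul, D.map_mul, f.comm_a, f.comm_a]
  map_scalar r := by
    change D.D₀ (f.f₀ (algebraMap R C'.C₀ r)) = 0
    rw [AlgHom.commutes, D.map_scalar]
  map_lmul x c := by
    change D.D₁ (f.f₁ (C'.lmul x c)) = _ • D.D₁ (f.f₁ c)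
    rw [f.map_lmul, D.map_lmul, f.comm_a]
  map_rmul c x := by
    change D.D₁ (f.f₁ (C'.rmul c x)) = _ • D.D₁ (f.f₁ c)
    rw [f.map_rmul, D.map_rmul, f.comm_a]
  map_d c := by
    change D.D₀ (f.f₀ (C'.d c)) = _
    rw [← f.comm_d, D.map_d]
    rfl
  map_b n := by
    change D.D₁ (f.f₁ (C'.b n)) = _
    rw [f.comm_b, D.map_b]
  π_D₀ x := by
    change E.π.hom (D.D₀ (f.f₀ x)) = _
    rw [D.π_D₀, f.comm_a]

namespace DGExt

variable (hC : C.IsElementary)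

include hC in
theorem aug_snd_pull₁ (z : C.pull₁) : aug R C.a z.1.2 = 0 :=
  ((pull_isElementary hC).exact_d_a z.1.2).2 ⟨z, rfl⟩

/-- The map from the conormal bimodule to the free bimodule. -/
noncomputable def conormalDer : Conormal (pull_isElementary hC) →ₗ[Env R A] FreeBimod R A C.C₀ :=
  Conormal.lift (pull_isElementary hC)
    ((freeDer R R C.a).toAddMonoidHom.comp (C.pull hC.d_b).d.toAddMonoidHom)
    (fun u z => freeDer_mul_of_right (α := C.a) u (aug_snd_pull₁ hC z))
    (fun u z => freeDer_mul_of_left (α := C.a) (aug_snd_pull₁ hC z) u)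

/-- The map from the conormal bimodule to the bimodule of relations. -/
noncomputable def conormalRel : Conormal (pull_isElementary hC) →ₗ[Env R A] RelBimod R C.a :=
  (conormalDer hC).codRestrict _ fun e => by
    obtain ⟨(z : C.pull₁), rfl⟩ := Conormal.mk_surjective (pull_isElementary hC) e
    change freePi R C.a (freeDer R R C.a z.1.2) = 0
    rw [freePi_freeDer, aug_snd_pull₁ hC z, ← map_zero (algebraMap R A), univDer_algebraMap]

theorem conormalRel_surjective : Function.Surjective (conormalRel hC) := fun e => by
  obtain ⟨w, hw, he⟩ := exists_freeDer_eq (k := R) (R := R) Function.surjective_id hC.a_surjective e.2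
  obtain ⟨z, rfl⟩ := ((pull_isElementary hC).exact_d_a w).1 hw
  exact ⟨Conormal.mk (pull_isElementary hC) z, Subtype.ext he⟩

/-- If the derivative of z vanishes, the image of z in F is a sum of products of two relations. Each
product x · d(c) is the differential of x c, which is zero in the conormal bimodule; after these are
subtracted, z becomes a cycle, that is, an element of N. -/
theorem exact_incl_conormalRel [Module.Flat R A] :
    Function.Exact (Conormal.incl (pull_isElementary hC)) (conormalRel hC) := fun e => by
  have hC' := pull_isElementary hC
  constructor
  · intro h
    obtain ⟨(z : C.pull₁), rfl⟩ := Conormal.mk_surjective hC' e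
    have h₁ : freeDer R R C.a z.1.2 = 0 := congrArg Subtype.val h
    have h₂ := mem_closure_of_freeDer_eq_zero (k := R) Function.surjective_id hC.a_surjective
      (aug_snd_pull₁ hC z) h₁
    generalize hw : z.1.2 = w at h₂
    obtain ⟨y, hy, hyz⟩ : ∃ y ∈ (C.pull hC.d_b).kerMul, (C.pull hC.d_b).d y = w := by
      clear hw
      induction h₂ using AddSubgroup.closure_induction with
      | mem w hw =>
        rcases hw with ⟨x, y, hx, hy, rfl⟩ | ⟨r, x, hr, rfl⟩
        · obtain ⟨c, rfl⟩ := (hC'.exact_d_a y).1 hy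
          exact ⟨_, (C.pull hC.d_b).lmul_mem_kerMul hx c, rfl⟩
        -- The base ring of F is R itself, so the scalars contribute nothing.
        · have hr' : r = 0 := hr
          exact ⟨0, zero_mem _, by rw [hr', zero_smul, map_zero]; rfl⟩
      | zero => exact ⟨0, zero_mem _, map_zero _⟩
      | add w w' _ _ h h' =>
        obtain ⟨y, hy, rfl⟩ := h
        obtain ⟨y', hy', rfl⟩ := h'
        exact ⟨y + y', add_mem hy hy', map_add _ _ _⟩
      | neg w _ h =>
        obtain ⟨y, hy, rfl⟩ := h
        exact ⟨-y, neg_mem hy, map_neg _ _⟩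
    obtain ⟨n, hn⟩ := (hC'.exact_b_d ((show (C.pull hC.d_b).C₁ from z) - y)).1 (by
      rw [map_sub, hyz]
      exact sub_eq_zero.2 hw)
    refine ⟨n, ?_⟩
    rw [Conormal.incl_apply, hn, map_sub, (Conormal.mk_eq_zero hC').2 hy, sub_zero]
  · rintro ⟨n, rfl⟩
    exact Subtype.ext (map_zero (freeDer R R C.a))

/-- The exact sequence of bimodules attached to a multiplicative elementary extension. -/
noncomputable def fourTerm [Module.Flat R A] : FourTerm R A N where
  E₁ := ModuleCat.of (Env R A) (Conormal (pull_isElementary hC))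
  K := (freeSeq R C.a).X₁
  E₀ := (freeSeq R C.a).X₂
  ι := ModuleCat.ofHom (Conormal.incl (pull_isElementary hC))
  p := ModuleCat.ofHom (conormalRel hC)
  j := (freeSeq R C.a).f
  π := (freeSeq R C.a).g
  ι_p := ModuleCat.hom_ext (LinearMap.ext fun n => (exact_incl_conormalRel hC _).2 ⟨n, rfl⟩)
  j_π := (freeSeq R C.a).zero
  exact₁ :=
    { exact := (ShortComplex.moduleCat_exact_iff _).2
        fun x hx => (exact_incl_conormalRel hC x).1 hx
      mono_f := (ModuleCat.mono_iff_injective _).2 (pull_incl_injective hC)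
      epi_g := (ModuleCat.epi_iff_surjective _).2 (conormalRel_surjective hC) }
  exact₀ := freeSeq_shortExact hC.a_surjective

/-- The universal derivation on the pullback. -/
noncomputable def derFourTerm [Module.Flat R A] : DGDer (C.pull hC.d_b) (fourTerm hC) where
  D₀ := (freeDer R R C.a).toAddMonoidHom
  D₁ := Conormal.mk (pull_isElementary hC)
  map_mul := freeDer_mul C.a
  map_scalar := freeDer_algebraMap C.a
  map_lmul u z := (Conormal.lft_smul_mk (pull_isElementary hC) u z).symm
  map_rmul z u := (Conormal.rgt_smul_mk (pull_isElementary hC) u z).symm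
  map_d _ := rfl
  map_b _ := rfl
  π_D₀ := freePi_freeDer C.a

/-- The derivation of the pullback is universal: in degree zero because F is free, in degree one
because a DG derivation kills Ker(a) C₁. Any other derivation factors through it by a map of exact
sequences that is the identity at both ends. -/
theorem fourTerm_cls_eq [Module.Flat R A] {E : FourTerm R A N} (D : DGDer (C.pull hC.d_b) E) :
    (fourTerm hC).cls = E.cls := by
  let D₀ : FreeAlgebra R C.C₀ →+ E.E₀ := D.D₀
  have h := eq_comp_freeDer (R := R) (α := C.a) D₀ D.map_mul D.map_scalar
  let Φ : FreeBimod R A C.C₀ →ₗ[Env R A] E.E₀ :=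
    FreeBimod.lift (fun x => D₀ (FreeAlgebra.ι R x))
  refine FourTerm.cls_eq_of_map _ _
    (ModuleCat.ofHom (Conormal.lift (pull_isElementary hC) D.D₁ D.map_lmul
      (fun x c => D.map_rmul c x)))
    (ModuleCat.ofHom Φ) ?_ ?_ ?_
  · refine ModuleCat.hom_ext (LinearMap.ext fun n => ?_)
    exact D.map_b n
  · refine ModuleCat.hom_ext (FreeBimod.hom_ext fun x => ?_)
    change E.π.hom (FreeBimod.lift _ (FreeBimod.gen x)) = freePi R C.a (FreeBimod.gen x)
    rw [FreeBimod.lift_gen, freePi, FreeBimod.lift_gen]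
    refine (D.π_D₀ _).trans ?_
    exact congrArg (univDer R A) (aug_ι C.a x)
  · refine ModuleCat.hom_ext (LinearMap.ext fun e => ?_)
    obtain ⟨(z : C.pull₁), rfl⟩ := Conormal.mk_surjective (pull_isElementary hC) e
    exact (h z.1.2).symm.trans (D.map_d z)

/-- The pullback maps to every equivalent extension. -/
theorem nonempty_hom_pull {C' : DGExt R A N} (hC' : C'.IsElementary) (f : Hom C' C) :
    Nonempty (Hom (C.pull hC.d_b) C') := by
  let s : A → C'.C₀ := Function.surjInv hC'.a_surjective
  have hs : ∀ a, C'.a (s a) = a := Function.surjInv_eq hC'.a_surjective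
  let g : FreeAlgebra R C.C₀ →ₐ[R] C'.C₀ := FreeAlgebra.lift R fun x => s (C.a x)
  have hg : ∀ u, C'.a (g u) = aug R C.a u := fun u => by
    have h : C'.a.comp g = aug R C.a := FreeAlgebra.hom_ext (funext fun x => by
      change C'.a (g (FreeAlgebra.ι R x)) = aug R C.a (FreeAlgebra.ι R x)
      rw [aug_ι, FreeAlgebra.lift_ι_apply, hs])
    exact DFunLike.congr_fun h u
  -- The maps `eval₀` and `q` from F to C₀ agree over A, so they differ by boundaries. Elements `e`
  -- chosen on generators extend to a twisted derivation δ, which is a homotopy between the two.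
  let q : FreeAlgebra R C.C₀ →ₐ[R] C.C₀ := f.f₀.comp g
  have he : ∀ x, ∃ c, C.d c = x - q (FreeAlgebra.ι R x) := fun x => (hC.exact_d_a _).1 (by
    change C.a (x - f.f₀ (g (FreeAlgebra.ι R x))) = 0
    rw [map_sub, f.comm_a, hg, aug_ι, sub_self])
  choose e he using he
  let l : FreeAlgebra R C.C₀ →ₐ[R] Module.End R C.C₁ :=
    (AlgHom.ofLinearMap C.lmul (LinearMap.ext C.one_lmul)
      (fun x y => LinearMap.ext fun c => C.mul_lmul x y c)).comp C.eval₀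
  obtain ⟨δ, hδ, hδ_mul, hδ_alg⟩ := exists_twistedDer l q C.rmul C.rmul_one C.rmul_mul
    (fun u b c => (C.lmul_rmul _ _ _).symm) e
  have hl : ∀ u c, l u c = C.lmul (C.eval₀ u) c := fun u c => rfl
  have hdδ : ∀ u, C.d (δ u) = C.eval₀ u - q u := fun u => by
    induction u using FreeAlgebra.induction with
    | grade0 r => rw [hδ_alg, map_zero, AlgHom.commutes, AlgHom.commutes, sub_self]
    | grade1 x => rw [hδ, he, eval₀_ι]
    | add u v hu hv => rw [map_add, map_add, map_add, map_add, hu, hv]; abel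
    | mul u v hu hv =>
      rw [hδ_mul, map_add, hl, C.d_lmul, C.d_rmul, hu, hv, map_mul, map_mul]
      noncomm_ring
  -- Since `f` is the identity on N, an element of degree one in C' is determined by its boundary
  -- and its image in C.
  have inj : ∀ c, C'.d c = 0 → f.f₁ c = 0 → c = 0 := fun c h₁ h₂ => by
    obtain ⟨n, rfl⟩ := (hC'.exact_b_d c).1 h₁
    rw [f.comm_b] at h₂
    rw [hC.b_injective (h₂.trans (map_zero _).symm), map_zero]
  have ext : ∀ c c', C'.d c = C'.d c' → f.f₁ c = f.f₁ c' → c = c' := fun c c' h₁ h₂ =>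
    sub_eq_zero.1 (inj _ (by rw [map_sub, h₁, sub_self]) (by rw [map_sub, h₂, sub_self]))
  -- The map in degree one is thus prescribed by two values, its boundary and its image in C₁, the
  -- latter corrected by the homotopy. Each identity required of it is checked on these two values.
  have hT : ∀ z : C.pull₁, ∃ c, C'.d c = g z.1.2 ∧ f.f₁ c = z.1.1 - δ z.1.2 := fun z => by
    obtain ⟨c, hc⟩ := (hC'.exact_d_a (g z.1.2)).1 (by rw [hg, aug_snd_pull₁ hC])
    obtain ⟨n, hn⟩ := (hC.exact_b_d (z.1.1 - δ z.1.2 - f.f₁ c)).1 (by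
      rw [map_sub, map_sub, f.comm_d, hc, C.mem_pull₁.1 z.2, hdδ]
      change _ - _ - q z.1.2 = 0
      abel)
    exact ⟨c + C'.b n, by rw [map_add, hC'.d_b, add_zero, hc],
      by rw [map_add, f.comm_b, hn, add_sub_cancel]⟩
  choose T hT₀ hT₁ using hT
  have hq : ∀ z, C.d (f.f₁ (T z)) = q z.1.2 := fun z => by rw [f.comm_d, hT₀]; rfl
  have hT_add : ∀ z w, T (z + w) = T z + T w := fun z w => ext _ _
    (by rw [map_add, hT₀, hT₀, hT₀, ← map_add]; rfl)
    (by
      rw [map_add, hT₁, hT₁, hT₁, Submodule.coe_add, Prod.fst_add, Prod.snd_add, map_add]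
      abel)
  have hT_smul : ∀ (r : R) z, T (r • z) = r • T z := fun r z => ext _ _
    (by rw [map_smul, hT₀, hT₀, ← map_smul]; rfl)
    (by
      rw [map_smul, hT₁, hT₁, Submodule.coe_smul, Prod.smul_fst, Prod.smul_snd, map_smul, smul_sub])
  have hT_b : ∀ n (z : C.pull₁), z.1 = (C.b n, 0) → T z = C'.b n := fun n z h => ext _ _
    (by rw [hT₀, h, hC'.d_b, map_zero]) (by rw [hT₁, h, f.comm_b, map_zero, sub_zero])
  have hT_l : ∀ u (z z' : C.pull₁), z'.1 = (C.lmul (C.eval₀ u) z.1.1, u * z.1.2) →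
      T z' = C'.lmul (g u) (T z) := fun u z z' e => ext _ _
    (by rw [hT₀, C'.d_lmul, hT₀, e, map_mul])
    (by
      -- The Leibniz rule turns the cross term of δ into the difference of the left actions through
      -- `eval₀` and `q`.
      have h : C.lmul (C.d (δ u)) (f.f₁ (T z)) = C.rmul (δ u) (q z.1.2) := by
        rw [C.leibniz, hq]
      rw [hdδ, map_sub, LinearMap.sub_apply, hT₁] at h
      rw [f.map_lmul, hT₁, hT₁, e]
      change C.lmul (C.eval₀ u) z.1.1 - δ (u * z.1.2) = C.lmul (q u) _
      rw [hδ_mul, hl, ← h, map_sub]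
      abel)
  have hT_r : ∀ u (z z' : C.pull₁), z'.1 = (C.rmul z.1.1 (C.eval₀ u), z.1.2 * u) →
      T z' = C'.rmul (T z) (g u) := fun u z z' e => ext _ _
    (by rw [hT₀, C'.d_rmul, hT₀, e, map_mul])
    (by
      have h : C.lmul (C.d z.1.1) (δ u) = C.rmul z.1.1 (C.eval₀ u - q u) := by
        rw [C.leibniz, hdδ]
      rw [C.mem_pull₁.1 z.2, map_sub] at h
      rw [f.map_rmul, hT₁, hT₁, e]
      change C.rmul z.1.1 (C.eval₀ u) - δ (z.1.2 * u) = C.rmul _ (q u)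
      rw [hδ_mul, hl, h, LinearMap.map_sub₂]
      abel)
  exact ⟨{
    f₀ := g
    f₁ := { toFun := T, map_add' := hT_add, map_smul' := hT_smul }
    comm_a := hg
    comm_b := fun n => hT_b n _ rfl
    comm_d := hT₀
    map_lmul := fun u z => hT_l u z _ rfl
    map_rmul := fun z u => hT_r u z _ rfl }⟩

/-- Every admissible C' receives a map from the pullback, so its derivation restricts to the
pullback and is compared there with the universal one. The pullback itself gives existence. -/
theorem isObstructionClass_iff [Module.Flat R A] (o : HH R A N 3) :
    IsObstructionClass C o ↔ o = (fourTerm hC).cls := by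
  constructor
  · rintro ⟨C', hC', f, E, D, rfl⟩
    obtain ⟨g⟩ := nonempty_hom_pull hC hC' f
    exact (fourTerm_cls_eq hC (D.comp g)).symm
  · rintro rfl
    exact ⟨_, pull_isElementary hC, pullHom hC.d_b, _, derFourTerm hC, rfl⟩

/-- The relation bimodule is two dimension shifts away from A, so the class vanishes if and only if
the extension of that bimodule by N splits. -/
theorem fourTerm_cls_eq_zero_iff [Module.Flat R A] : (fourTerm hC).cls = 0 ↔
    ∃ β : Conormal (pull_isElementary hC) →ₗ[Env R A] N,
      ∀ n, β (Conormal.incl (pull_isElementary hC) n) = n := by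
  have h : (fourTerm hC).cls = 0 ↔ (fourTerm hC).exact₁.extClass = 0 :=
    ⟨relClass_comp_eq_zero hC.a_surjective _, fun h => by
      rw [FourTerm.cls, h, Abelian.Ext.comp_zero]⟩
  rw [h, extClass_eq_zero_iff]
  constructor
  · rintro ⟨β, hβ⟩
    exact ⟨β.hom, fun n => congrArg (fun k => k.hom n) hβ⟩
  · rintro ⟨β, hβ⟩
    exact ⟨ModuleCat.ofHom β, ModuleCat.hom_ext (LinearMap.ext hβ)⟩

end DGExt

end Obstruction

/-! ### Multiplicative splittings and retractions -/

namespace DGExt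

variable {R A N : Type u} [CommRing R] [Ring A] [Algebra R A] [AddCommGroup N]

section Semidirect

variable (C : DGExt R A N)

/-- The product on `F ⊕ C₁`, for the free algebra `F` on `C₀`. -/
noncomputable def semiMul : (FreeAlgebra R C.C₀ × C.C₁) →ₗ[R] (FreeAlgebra R C.C₀ × C.C₁) →ₗ[R]
    (FreeAlgebra R C.C₀ × C.C₁) :=
  -- The last term is the product d(c) c', which makes C₁ itself a nonunital algebra.
  LinearMap.mk₂ R
    (fun x y => (x.1 * y.1, C.lmul (C.eval₀ x.1) y.2 + C.rmul x.2 (C.eval₀ y.1) +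
      C.lmul (C.d x.2) y.2))
    (fun x x' y => Prod.ext (add_mul _ _ _) (by
      simp only [Prod.fst_add, Prod.snd_add, map_add, LinearMap.add_apply]
      abel))
    (fun r x y => Prod.ext (smul_mul_assoc _ _ _) (by
      simp only [Prod.smul_fst, Prod.smul_snd, map_smul, LinearMap.smul_apply, smul_add]))
    (fun x y y' => Prod.ext (mul_add _ _ _) (by
      simp only [Prod.fst_add, Prod.snd_add, map_add]
      abel))
    (fun r x y => Prod.ext (mul_smul_comm _ _ _) (by
      simp only [Prod.smul_fst, Prod.smul_snd, map_smul, smul_add]))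

theorem semiMul_apply (x y : FreeAlgebra R C.C₀ × C.C₁) : C.semiMul x y =
    (x.1 * y.1, C.lmul (C.eval₀ x.1) y.2 + C.rmul x.2 (C.eval₀ y.1) + C.lmul (C.d x.2) y.2) := rfl

/-- The algebra `F ⊕ C₁`, for the free algebra `F` on `C₀`. -/
noncomputable def semi : BilinAlg R (FreeAlgebra R C.C₀ × C.C₁) where
  mul := C.semiMul
  one := (1, 0)
  assoc x y z := by
    simp only [semiMul_apply]
    refine Prod.ext (mul_assoc _ _ _) ?_
    simp only [map_mul, map_add, LinearMap.add_apply, C.mul_lmul, C.lmul_rmul, C.rmul_mul, C.d_lmul,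
      C.d_rmul]
    abel
  one_mul x := by
    rw [semiMul_apply]
    refine Prod.ext (one_mul _) ?_
    simp only [map_one, C.one_lmul, map_zero, LinearMap.zero_apply, add_zero]
  mul_one x := by
    rw [semiMul_apply]
    refine Prod.ext (mul_one _) ?_
    simp only [map_one, C.rmul_one, map_zero, add_zero, zero_add]

/-- The map from `F ⊕ C₁` to `C₀`. -/
noncomputable def semiMap : (FreeAlgebra R C.C₀ × C.C₁) →ₗ[R] C.C₀ :=
  C.eval₀.toLinearMap.coprod C.d

theorem semiMap_apply (x : FreeAlgebra R C.C₀ × C.C₁) :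
    C.semiMap x = C.eval₀ x.1 + C.d x.2 := rfl

theorem semiMap_mul (x y : FreeAlgebra R C.C₀ × C.C₁) :
    C.semiMap (C.semi.mul x y) = C.semiMap x * C.semiMap y := by
  change C.semiMap (C.semiMul x y) = _
  simp only [semiMul_apply, semiMap_apply, map_mul, map_add, C.d_lmul, C.d_rmul]
  noncomm_ring

variable {C} [Module (Env R A) N] (hC : C.IsElementary)

/-- A map on the conormal bimodule of the pullback, as a map on `pull₁`. -/
noncomputable def onPull (β : Conormal (pull_isElementary hC) →ₗ[Env R A] N) : C.pull₁ →+ N :=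
  β.toAddMonoidHom.comp (Conormal.mk (pull_isElementary hC))

variable (β : Conormal (pull_isElementary hC) →ₗ[Env R A] N)

theorem onPull_lmul (u : FreeAlgebra R C.C₀) {z z' : C.pull₁}
    (h : z'.1 = (C.lmul (C.eval₀ u) z.1.1, u * z.1.2)) :
    onPull hC β z' = (lft (aug R C.a u) : Env R A) • onPull hC β z := by
  obtain rfl : z' = (C.pull hC.d_b).lmul u z := Subtype.ext h
  exact (congrArg β (Conormal.lft_smul_mk (pull_isElementary hC) u z)).symm.trans (map_smul β _ _)

theorem onPull_rmul (u : FreeAlgebra R C.C₀) {z z' : C.pull₁}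
    (h : z'.1 = (C.rmul z.1.1 (C.eval₀ u), z.1.2 * u)) :
    onPull hC β z' = (rgt (aug R C.a u) : Env R A) • onPull hC β z := by
  obtain rfl : z' = (C.pull hC.d_b).rmul z u := Subtype.ext h
  exact (congrArg β (Conormal.rgt_smul_mk (pull_isElementary hC) u z)).symm.trans (map_smul β _ _)

/-- The part of the kernel of `F ⊕ C₁ → C₀` on which a bimodule map vanishes. -/
noncomputable def semiKer : Submodule R (FreeAlgebra R C.C₀ × C.C₁) where
  -- The sign: a pair (w, c) maps to zero in C₀ exactly when (c, -w) lies in the fibre product.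
  carrier := {x | ∃ z : C.pull₁, z.1 = (x.2, -x.1) ∧ onPull hC β z = 0}
  zero_mem' := ⟨0, Prod.ext rfl neg_zero.symm, map_zero _⟩
  add_mem' := by
    rintro x y ⟨z, hz, h⟩ ⟨w, hw, h'⟩
    refine ⟨z + w, ?_, by rw [map_add, h, h', add_zero]⟩
    rw [Submodule.coe_add, hz, hw, Prod.mk_add_mk, Prod.fst_add, Prod.snd_add, neg_add]
  smul_mem' := by
    rintro r x ⟨z, hz, h⟩
    refine ⟨r • z, ?_, ?_⟩
    · rw [Submodule.coe_smul, hz, Prod.smul_mk, Prod.smul_fst, Prod.smul_snd, smul_neg]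
    · rw [onPull_lmul hC β (algebraMap R _ r) (z := z), h, smul_zero]
      rw [AlgHom.commutes, Algebra.algebraMap_eq_smul_one, LinearMap.map_smul₂, C.one_lmul,
        ← Algebra.smul_def]
      rfl

variable {hC} {β}

theorem semiMap_of_mem {x : FreeAlgebra R C.C₀ × C.C₁} (hx : x ∈ semiKer hC β) : C.semiMap x = 0 := by
  obtain ⟨z, hz, -⟩ := hx
  have h := C.mem_pull₁.1 z.2
  rw [hz, map_neg] at h
  rw [semiMap_apply, h, add_neg_cancel]

/-- If x maps to zero in C₀, the terms with the second component of y add up, by the Leibniz rule,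
to that component times the image of x, which is zero. Only the action of the first component of y
remains, and β is compatible with it. -/
theorem mul_mem_semiKer (y : FreeAlgebra R C.C₀ × C.C₁) {x : FreeAlgebra R C.C₀ × C.C₁}
    (hx : x ∈ semiKer hC β) : C.semi.mul y x ∈ semiKer hC β := by
  have h := semiMap_of_mem hx
  obtain ⟨z, hz, h₀⟩ := hx
  let z' : C.pull₁ := (C.pull hC.d_b).lmul y.1 z
  have hz' : z'.1 = (C.lmul (C.eval₀ y.1) z.1.1, y.1 * z.1.2) := rfl
  refine ⟨z', ?_, by rw [onPull_lmul hC β y.1 hz', h₀, smul_zero]⟩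
  · change (C.lmul (C.eval₀ y.1) z.1.1, y.1 * z.1.2) = ((C.semiMul y x).2, -(C.semiMul y x).1)
    rw [semiMap_apply] at h
    have e : C.rmul y.2 (C.eval₀ x.1) + C.lmul (C.d y.2) x.2 = 0 := by
      rw [C.leibniz, ← map_add, h, map_zero]
    rw [semiMul_apply, hz, add_assoc, e, add_zero, mul_neg]

theorem semiKer_mul {x : FreeAlgebra R C.C₀ × C.C₁} (hx : x ∈ semiKer hC β)
    (y : FreeAlgebra R C.C₀ × C.C₁) : C.semi.mul x y ∈ semiKer hC β := by
  have h := semiMap_of_mem hx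
  obtain ⟨z, hz, h₀⟩ := hx
  let z' : C.pull₁ := (C.pull hC.d_b).rmul z y.1
  have hz' : z'.1 = (C.rmul z.1.1 (C.eval₀ y.1), z.1.2 * y.1) := rfl
  refine ⟨z', ?_, by rw [onPull_rmul hC β y.1 hz', h₀, smul_zero]⟩
  · change (C.rmul z.1.1 (C.eval₀ y.1), z.1.2 * y.1) = ((C.semiMul x y).2, -(C.semiMul x y).1)
    rw [semiMap_apply] at h
    have e : C.lmul (C.eval₀ x.1) y.2 + C.lmul (C.d x.2) y.2 = 0 := by
      rw [← LinearMap.add_apply, ← map_add, h, map_zero, LinearMap.zero_apply]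
    rw [semiMul_apply, hz, add_right_comm, e, zero_add, neg_mul]

/-- The splitting given by a retraction of the conormal bimodule onto `N`. -/
noncomputable def splOfRetraction
    (hβ : ∀ n, β (Conormal.incl (pull_isElementary hC) n) = n) : Spl C where
  carrier := (FreeAlgebra R C.C₀ × C.C₁) ⧸ semiKer hC β
  c₁ := (semiKer hC β).mkQ ∘ₗ LinearMap.inr R (FreeAlgebra R C.C₀) C.C₁
  c₀ := (semiKer hC β).liftQ C.semiMap fun x hx => semiMap_of_mem hx
  c₀_c₁ := fun c => by
    change C.semiMap (0, c) = _
    rw [semiMap_apply, map_zero, zero_add]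
  c₁_injective := by
    refine (injective_iff_map_eq_zero _).2 fun c hc => ?_
    obtain ⟨z, hz, h⟩ := (Submodule.Quotient.mk_eq_zero _).1 hc
    have h₁ : C.d c = 0 := by
      have := C.mem_pull₁.1 z.2
      rwa [hz, LinearMap.inr_apply, neg_zero, map_zero] at this
    obtain ⟨n, rfl⟩ := (hC.exact_b_d c).1 h₁
    have e : z = (C.pull hC.d_b).b n := Subtype.ext (hz.trans (Prod.ext rfl neg_zero))
    have h₂ : onPull hC β z = n := by
      rw [e]
      exact hβ n
    rw [← h₂, h, map_zero]
  c₀_surjective := fun x => ⟨Submodule.Quotient.mk (FreeAlgebra.ι R x, 0), by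
    change C.semiMap _ = x
    rw [semiMap_apply, eval₀_ι, map_zero, add_zero]⟩
  cartesian := fun ζ => by
    obtain ⟨x, rfl⟩ := Submodule.Quotient.mk_surjective _ ζ
    rintro ⟨c, hc⟩
    have hc' : C.d c = C.eval₀ x.1 + C.d x.2 := hc
    -- The elements x and c have the same image in C₀, so their difference lies in the fibre
    -- product. Subtracting from c the value n of β on it makes that value zero, because β is a
    -- retraction.
    let z : C.pull₁ := ⟨(c - x.2, x.1), by rw [C.mem_pull₁, map_sub, hc', add_sub_cancel_right]⟩
    let n := onPull hC β z
    let b : C.pull₁ := (C.pull hC.d_b).b n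
    refine ⟨c - C.b n, (Submodule.Quotient.eq _).2 ⟨z - b, ?_, ?_⟩⟩
    · rw [Submodule.coe_sub]
      refine Prod.ext ?_ ?_
      · change c - x.2 - C.b n = c - C.b n - x.2
        abel
      · change x.1 - 0 = -(0 - x.1)
        abel
    · rw [map_sub]
      exact sub_eq_zero.2 (hβ n).symm

variable (β) in
/-- The product on the splitting given by a retraction. -/
noncomputable def semiQuot : BilinAlg R ((FreeAlgebra R C.C₀ × C.C₁) ⧸ semiKer hC β) :=
  C.semi.quot (semiKer hC β) (fun y _ hx => mul_mem_semiKer y hx) (fun _ hx y => semiKer_mul hx y)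

/-- The multiplicative splitting given by a retraction of the conormal bimodule onto `N`. -/
noncomputable def mulSplOfRetraction
    (hβ : ∀ n, β (Conormal.incl (pull_isElementary hC) n) = n) : MulSpl C :=
  (splOfRetraction hβ).toMulSpl (semiQuot β)
    (by
      change C.semiMap (1, 0) = 1
      rw [semiMap_apply, map_one, map_zero, add_zero])
    (fun ζ ξ => by
      obtain ⟨x, rfl⟩ := Submodule.Quotient.mk_surjective _ ζ
      obtain ⟨y, rfl⟩ := Submodule.Quotient.mk_surjective _ ξ
      exact C.semiMap_mul x y)
    (fun ζ c => by
      obtain ⟨x, rfl⟩ := Submodule.Quotient.mk_surjective _ ζ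
      refine congrArg (Submodule.Quotient.mk (p := semiKer hC β)) (?_ : _ = C.semiMul x (0, c))
      rw [semiMul_apply]
      refine Prod.ext (mul_zero _).symm ?_
      change C.lmul (C.eval₀ x.1 + C.d x.2) c = _
      simp only [map_add, LinearMap.add_apply, map_zero, add_zero])
    (fun c ζ => by
      obtain ⟨x, rfl⟩ := Submodule.Quotient.mk_surjective _ ζ
      refine congrArg (Submodule.Quotient.mk (p := semiKer hC β)) (?_ : _ = C.semiMul (0, c) x)
      rw [semiMul_apply]
      refine Prod.ext (zero_mul _).symm ?_
      change C.rmul c (C.eval₀ x.1 + C.d x.2) = _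
      simp only [map_add, map_zero, LinearMap.zero_apply, zero_add, C.leibniz])

-- Lift `eval₀` to an algebra map s from the free algebra to the splitting. For (c, u) in the fibre
-- product, c₁(c) - s(u) dies in C₀, hence lies in N. This is the retraction, and it is a bimodule
-- map because s is multiplicative.
variable (hC) in
theorem exists_retraction (B : MulSpl C) :
    ∃ β : Conormal (pull_isElementary hC) →ₗ[Env R A] N,
      ∀ n, β (Conormal.incl (pull_isElementary hC) n) = n := by
  let s : FreeAlgebra R C.C₀ →ₐ[R] B.carrier :=
    FreeAlgebra.lift R (Function.surjInv B.c₀_surjective)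
  have hs : ∀ u, B.c₀ (s u) = C.eval₀ u := fun u => by
    have h : B.c₀.comp s = C.eval₀ := FreeAlgebra.hom_ext (funext fun x => by
      change B.c₀ (s (FreeAlgebra.ι R x)) = C.eval₀ (FreeAlgebra.ι R x)
      rw [eval₀_ι, FreeAlgebra.lift_ι_apply]
      exact Function.surjInv_eq B.c₀_surjective x)
    exact DFunLike.congr_fun h u
  have inj : Function.Injective fun n => B.c₁ (C.b n) := B.c₁_injective.comp hC.b_injective
  have hβ : ∀ z : C.pull₁, ∃ n, B.c₁ (C.b n) = B.c₁ z.1.1 - s z.1.2 := fun z => by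
    have h : B.c₀ (B.c₁ z.1.1 - s z.1.2) = 0 := by
      rw [map_sub, B.c₀_c₁, hs, C.mem_pull₁.1 z.2, sub_self]
    obtain ⟨c, hc⟩ := B.cartesian _ ⟨0, by rw [h, map_zero]⟩
    obtain ⟨n, rfl⟩ := (hC.exact_b_d c).1 (by rw [← B.c₀_c₁, hc, h])
    exact ⟨n, hc⟩
  choose β hβ using hβ
  let β' : C.pull₁ →+ N := AddMonoidHom.mk' β fun z w => inj (by
    change B.c₁ (C.b _) = B.c₁ (C.b _)
    rw [map_add C.b, map_add B.c₁, hβ, hβ, hβ, Submodule.coe_add, Prod.fst_add, Prod.snd_add,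
      map_add, map_add]
    abel)
  have hl : ∀ u (z z' : C.pull₁), z'.1 = (C.lmul (C.eval₀ u) z.1.1, u * z.1.2) →
      β z' = (lft (aug R C.a u) : Env R A) • β z := fun u z z' e => inj (by
    change B.c₁ (C.b _) = B.c₁ (C.b _)
    have e₁ := hC.lmul_b (C.eval₀ u) (β z)
    rw [a_eval₀] at e₁
    rw [hβ, lft, ← e₁, ← hs, B.c₁_lmul, hβ, mul_sub, e, ← hs, B.c₁_lmul, map_mul])
  have hr : ∀ u (z z' : C.pull₁), z'.1 = (C.rmul z.1.1 (C.eval₀ u), z.1.2 * u) →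
      β z' = (rgt (aug R C.a u) : Env R A) • β z := fun u z z' e => inj (by
    change B.c₁ (C.b _) = B.c₁ (C.b _)
    have e₁ := hC.rmul_b (β z) (C.eval₀ u)
    rw [a_eval₀] at e₁
    rw [hβ, rgt, ← e₁, ← hs, B.c₁_rmul, hβ, sub_mul, e, ← hs, B.c₁_rmul, map_mul])
  refine ⟨Conormal.lift (pull_isElementary hC) β' (fun u z => hl u z _ rfl)
    (fun u z => hr u z _ rfl), fun n => inj ?_⟩
  refine (hβ _).trans ?_
  exact (congrArg (B.c₁ (C.b n) - ·) (map_zero s)).trans (sub_zero _)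

variable (hC) in
theorem fourTerm_cls_eq_zero_iff_nonempty [Module.Flat R A] :
    (fourTerm hC).cls = 0 ↔ Nonempty (MulSpl C) :=
  (fourTerm_cls_eq_zero_iff hC).trans
    ⟨fun ⟨_, hβ⟩ => ⟨mulSplOfRetraction (hC := hC) hβ⟩, fun ⟨B⟩ => exists_retraction hC B⟩

end Semidirect

end DGExt

/-- Liftings of an algebra exist precisely when the obstruction class vanishes. -/
theorem fourTerm_cls_eq_zero_iff_nonempty_algLift {R R' M : Type u} [CommRing R] [CommRing R']
    [Algebra R' R] [AddCommGroup M] [Module R M] {X : SqZero R M R'} {φ : MulExt R M}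
    (S : Corr X φ.toElemExt) (A : Type u) [Ring A] [Algebra R A] [Module.Flat R A] :
    (DGExt.fourTerm (φ.eval_isElementary (A := A))).cls = 0 ↔ Nonempty (AlgLift R' R A) :=
  (DGExt.fourTerm_cls_eq_zero_iff_nonempty φ.eval_isElementary).trans
    ⟨fun ⟨B⟩ => ⟨mulCompLift S.mulCorr B⟩, fun ⟨L⟩ => ⟨mulDiffSpl S.mulCorr L⟩⟩

/-! ### The class of the difference of two liftings -/

section Transition

variable {R R' M A T : Type u} [CommRing R] [CommRing R'] [Algebra R' R] [AddCommGroup M] [Module R M]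
  (X : SqZero R M R') [Ring A] [Algebra R A] {α : T → A}

namespace AlgLift

theorem proj_j (L : AlgLift R' R A) (n : A ⊗[R] M) : L.proj ((L.data X).j n) = 0 := (L.data X).p_j n

theorem exists_j_eq (L : AlgLift R' R A) {y : L.carrier} (h : L.proj y = 0) :
    ∃ n, (L.data X).j n = y := ((L.data X).exact y).1 h

theorem mul_j (L : AlgLift R' R A) (y : L.carrier) (n : A ⊗[R] M) :
    y * (L.data X).j n = (L.data X).j ((lft (L.proj y) : Env R A) • n) :=
  (L.data X).mul_j' (map_mul L.proj) y n

theorem j_mul (L : AlgLift R' R A) (y : L.carrier) (n : A ⊗[R] M) :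
    (L.data X).j n * y = (L.data X).j ((rgt (L.proj y) : Env R A) • n) :=
  (L.data X).j_mul' (map_mul L.proj) y n

end AlgLift

variable [Algebra R' A] [IsScalarTower R' R A]

/-- A presentation of a lifting over a presentation of `A`. -/
def IsCover (α : T → A) (L : AlgLift R' R A) (G : FreeAlgebra R' T →ₐ[R'] L.carrier) : Prop :=
  ∀ w, L.proj (G w) = aug R' α w

theorem isCover_of_ι {L : AlgLift R' R A} {G : FreeAlgebra R' T →ₐ[R'] L.carrier}
    (h : ∀ x, L.proj (G (FreeAlgebra.ι R' x)) = α x) : IsCover α L G := fun w => by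
  induction w using FreeAlgebra.induction with
  | grade0 r =>
    rw [AlgHom.commutes, AlgHom.commutes, L.proj_algebraMap, ← IsScalarTower.algebraMap_apply]
  | grade1 x => rw [h, aug_ι]
  | mul u v hu hv => rw [map_mul, map_mul, map_mul, hu, hv]
  | add u v hu hv => rw [map_add, map_add, map_add, hu, hv]

include X in
theorem exists_isCover (α : T → A) (L : AlgLift R' R A) : ∃ G, IsCover α L G := by
  refine ⟨FreeAlgebra.lift R' fun x => Function.surjInv (L.data X).p_surjective (α x),
    isCover_of_ι fun x => ?_⟩
  rw [FreeAlgebra.lift_ι_apply]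
  exact Function.surjInv_eq (L.data X).p_surjective _

/-- `θ` is the difference of the restrictions to the relations of two presentations. -/
def IsTransition {L L' : AlgLift R' R A} (G : FreeAlgebra R' T →ₐ[R'] L.carrier)
    (G' : FreeAlgebra R' T →ₐ[R'] L'.carrier) (θ : RelBimod R α →ₗ[Env R A] A ⊗[R] M) : Prop :=
  ∀ w n n' κ, aug R' α w = 0 → (L.data X).j n = G w → (L'.data X).j n' = G' w →
    κ.1 = freeDer R' R α w → θ κ = n' - n

variable {X} {L L' L'' : AlgLift R' R A} {G : FreeAlgebra R' T →ₐ[R'] L.carrier}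
  {G' : FreeAlgebra R' T →ₐ[R'] L'.carrier} {G'' : FreeAlgebra R' T →ₐ[R'] L''.carrier}

omit [IsScalarTower R' R A] in
theorem IsCover.exists_j_eq (hG : IsCover α L G) {w : FreeAlgebra R' T} (hw : aug R' α w = 0) :
    ∃ n, (L.data X).j n = G w := L.exists_j_eq X ((hG w).trans hw)

theorem IsTransition.exists_eq {θ : RelBimod R α →ₗ[Env R A] A ⊗[R] M} (hθ : IsTransition X G G' θ)
    (hα : Function.Surjective α) (hG : IsCover α L G) (hG' : IsCover α L' G') (κ : RelBimod R α) :
    ∃ w n n', aug R' α w = 0 ∧ (L.data X).j n = G w ∧ (L'.data X).j n' = G' w ∧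
      κ.1 = freeDer R' R α w ∧ θ κ = n' - n := by
  obtain ⟨w, hw, hκ⟩ := exists_freeDer_eq (k := R') X.q_surjective hα κ.2
  obtain ⟨n, hn⟩ := hG.exists_j_eq (X := X) hw
  obtain ⟨n', hn'⟩ := hG'.exists_j_eq (X := X) hw
  exact ⟨w, n, n', hw, hn, hn', hκ.symm, hθ _ _ _ _ hw hn hn' hκ.symm⟩

/-- Two presentations agree on the relations whose universal derivative vanishes. -/
theorem exists_j_eq_of_freeDer_eq_zero [Module.Flat R A] (hα : Function.Surjective α)
    (hG : IsCover α L G) (hG' : IsCover α L' G')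
    {w : FreeAlgebra R' T} (hw : aug R' α w = 0) (hD : freeDer R' R α w = 0) :
    ∃ n, (L.data X).j n = G w ∧ (L'.data X).j n = G' w := by
  have h := mem_closure_of_freeDer_eq_zero (k := R') X.q_surjective hα hw hD
  clear hD hw
  induction h using AddSubgroup.closure_induction with
  | mem w hw =>
    rcases hw with ⟨x, y, hx, hy, rfl⟩ | ⟨r, x, hr, rfl⟩
    · obtain ⟨n, hn⟩ := hG.exists_j_eq (X := X) hy
      obtain ⟨n', hn'⟩ := hG'.exists_j_eq (X := X) hy
      -- Both factors of a product of relations land in A ⊗ M, which has square zero.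
      refine ⟨0, ?_, ?_⟩
      · rw [map_mul, ← hn, L.mul_j, hG, hx, lft_zero_smul]
      · rw [map_mul, ← hn', L'.mul_j, hG', hx, lft_zero_smul]
    -- A scalar i(m) acts through A, by the same recipe on both liftings.
    · obtain ⟨m, rfl⟩ := (X.exact r).1 hr
      refine ⟨aug R' α x ⊗ₜ m, ?_, ?_⟩
      · rw [map_smul, ← (L.data X).j_tmul, L.data_p, hG]
      · rw [map_smul, ← (L'.data X).j_tmul, L'.data_p, hG']
  | zero => exact ⟨0, by rw [map_zero, map_zero], by rw [map_zero, map_zero]⟩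
  | add w w' _ _ h h' =>
    obtain ⟨n, h₁, h₂⟩ := h
    obtain ⟨n', h₃, h₄⟩ := h'
    exact ⟨n + n', by rw [map_add, map_add, h₁, h₃], by rw [map_add, map_add, h₂, h₄]⟩
  | neg w _ h =>
    obtain ⟨n, h₁, h₂⟩ := h
    exact ⟨-n, by rw [map_neg, map_neg, h₁], by rw [map_neg, map_neg, h₂]⟩

/-- On a relation w both presentations take values in A ⊗ M, and the difference of the values
depends only on D(w), because the values coincide when D(w) = 0. Every element of the relation
bimodule is some D(w), so this defines θ. -/
theorem exists_isTransition [Module.Flat R A] (hα : Function.Surjective α)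
    (hG : IsCover α L G) (hG' : IsCover α L' G') : ∃ θ, IsTransition (α := α) X G G' θ := by
  have h : ∀ κ : RelBimod R α, ∃ w n n', aug R' α w = 0 ∧ (L.data X).j n = G w ∧
      (L'.data X).j n' = G' w ∧ κ.1 = freeDer R' R α w := fun κ => by
    obtain ⟨w, hw, hκ⟩ := exists_freeDer_eq (k := R') X.q_surjective hα κ.2
    obtain ⟨n, hn⟩ := hG.exists_j_eq (X := X) hw
    obtain ⟨n', hn'⟩ := hG'.exists_j_eq (X := X) hw
    exact ⟨w, n, n', hw, hn, hn', hκ.symm⟩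
  choose w n n' hw hn hn' hκ using h
  have key : ∀ v m m' (κ : RelBimod R α), aug R' α v = 0 → (L.data X).j m = G v →
      (L'.data X).j m' = G' v → κ.1 = freeDer R' R α v → n' κ - n κ = m' - m :=
    fun v m m' κ hv hm hm' hκ' => by
      obtain ⟨a, h₁, h₂⟩ := exists_j_eq_of_freeDer_eq_zero (X := X) (w := v - w κ) hα hG hG'
        (by rw [map_sub, hv, hw, sub_zero]) (by rw [map_sub, ← hκ', ← hκ, sub_self])
      have h₃ : a = m - n κ := (L.data X).j_injective (by rw [h₁, map_sub, map_sub, hm, hn])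
      have h₄ : a = m' - n' κ := (L'.data X).j_injective (by rw [h₂, map_sub, map_sub, hm', hn'])
      rw [sub_eq_sub_iff_sub_eq_sub, ← neg_sub m' (n' κ), ← neg_sub m (n κ), ← h₃, ← h₄]
  refine ⟨envLin (AddMonoidHom.mk' (fun κ => n' κ - n κ) fun κ κ' => ?_) (fun a κ => ?_)
    fun a κ => ?_, fun v m m' κ => key v m m' κ⟩
  · rw [key (w κ + w κ') (n κ + n κ') (n' κ + n' κ') (κ + κ') (by rw [map_add, hw, hw, add_zero])
      (by rw [map_add, map_add, hn, hn]) (by rw [map_add, map_add, hn', hn'])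
      (by rw [map_add, ← hκ, ← hκ]; rfl)]
    abel
  · obtain ⟨u, rfl⟩ := aug_surjective (k := R') hα a
    refine (key (u * w κ) ((lft (aug R' α u) : Env R A) • n κ)
      ((lft (aug R' α u) : Env R A) • n' κ) _ (by rw [map_mul, hw, mul_zero])
      (by rw [map_mul, ← hn, L.mul_j, hG]) (by rw [map_mul, ← hn', L'.mul_j, hG'])
      (by rw [freeDer_mul_of_right u (hw κ), ← hκ]; rfl)).trans (smul_sub _ _ _).symm
  · obtain ⟨u, rfl⟩ := aug_surjective (k := R') hα a
    refine (key (w κ * u) ((rgt (aug R' α u) : Env R A) • n κ)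
      ((rgt (aug R' α u) : Env R A) • n' κ) _ (by rw [map_mul, hw, zero_mul])
      (by rw [map_mul, ← hn, L.j_mul, hG]) (by rw [map_mul, ← hn', L'.j_mul, hG'])
      (by rw [freeDer_mul_of_left (hw κ) u, ← hκ]; rfl)).trans (smul_sub _ _ _).symm

theorem IsTransition.unique {θ θ' : RelBimod R α →ₗ[Env R A] A ⊗[R] M}
    (hθ : IsTransition X G G' θ) (hθ' : IsTransition X G G' θ') (hα : Function.Surjective α)
    (hG : IsCover α L G) (hG' : IsCover α L' G') : θ = θ' := LinearMap.ext fun κ => by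
  obtain ⟨w, n, n', hw, hn, hn', hκ, h⟩ := hθ.exists_eq hα hG hG' κ
  rw [h, hθ' w n n' κ hw hn hn' hκ]

theorem IsTransition.add {θ θ' : RelBimod R α →ₗ[Env R A] A ⊗[R] M}
    (hθ : IsTransition X G G' θ) (hθ' : IsTransition X G' G'' θ') (hG' : IsCover α L' G') :
    IsTransition X G G'' (θ + θ') := fun w n n'' κ hw hn hn'' hκ => by
  obtain ⟨n', hn'⟩ := hG'.exists_j_eq (X := X) hw
  rw [LinearMap.add_apply, hθ w n n' κ hw hn hn' hκ, hθ' w n' n'' κ hw hn' hn'' hκ]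
  abel

end Transition

/-! ### Pushouts of extensions of modules -/

theorem exists_pushout_shortExact {Λ : Type u} [Ring Λ] {S : ShortComplex (ModuleCat.{u} Λ)}
    (hS : S.ShortExact) {N : ModuleCat.{u} Λ} (θ : S.X₁ ⟶ N) :
    ∃ (E : ModuleCat.{u} Λ) (ι : N ⟶ E) (π : E ⟶ S.X₃) (w : ι ≫ π = 0)
      (_ : (ShortComplex.mk ι π w).ShortExact) (Φ : S.X₂ ⟶ E), θ ≫ ι = S.f ≫ Φ ∧ Φ ≫ π = S.g := by
  let U : Submodule Λ (S.X₂ × N) := LinearMap.range (S.f.hom.prod (-θ.hom))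
  have hU : ∀ x : S.X₂ × N, U.mkQ x = 0 ↔ ∃ κ, S.f κ = x.1 ∧ -θ κ = x.2 := fun x => by
    refine (Submodule.Quotient.mk_eq_zero _).trans ?_
    constructor
    · rintro ⟨κ, rfl⟩
      exact ⟨κ, rfl, rfl⟩
    · rintro ⟨κ, h, h'⟩
      exact ⟨κ, Prod.ext h h'⟩
  have hfg : ∀ κ, S.g (S.f κ) = 0 := fun κ => congrArg (fun k => k.hom κ) S.zero
  have hf : Function.Injective S.f := (ModuleCat.mono_iff_injective _).1 hS.mono_f
  have hg : Function.Surjective S.g := (ModuleCat.epi_iff_surjective _).1 hS.epi_g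
  let ι : N ⟶ ModuleCat.of Λ ((S.X₂ × N) ⧸ U) := ModuleCat.ofHom (U.mkQ ∘ₗ LinearMap.inr Λ S.X₂ N)
  let Φ : S.X₂ ⟶ ModuleCat.of Λ ((S.X₂ × N) ⧸ U) := ModuleCat.ofHom (U.mkQ ∘ₗ LinearMap.inl Λ S.X₂ N)
  let π : ModuleCat.of Λ ((S.X₂ × N) ⧸ U) ⟶ S.X₃ :=
    ModuleCat.ofHom (U.liftQ (S.g.hom ∘ₗ LinearMap.fst Λ S.X₂ N) (by
      rintro _ ⟨κ, rfl⟩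
      exact hfg κ))
  have w : ι ≫ π = 0 := ModuleCat.hom_ext (LinearMap.ext fun _ => map_zero S.g.hom)
  refine ⟨_, ι, π, w,
    { exact := (ShortComplex.moduleCat_exact_iff _).2 fun x hx => ?_
      mono_f := (ModuleCat.mono_iff_injective _).2
        ((injective_iff_map_eq_zero ι.hom).2 fun n hn => ?_)
      epi_g := (ModuleCat.epi_iff_surjective _).2 fun x => ?_ }, Φ,
    ModuleCat.hom_ext (LinearMap.ext fun κ => ?_), rfl⟩
  · obtain ⟨x, rfl⟩ := U.mkQ_surjective x
    obtain ⟨κ, hκ⟩ := (ShortComplex.moduleCat_exact_iff _).1 hS.exact x.1 hx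
    refine ⟨x.2 + θ κ, ?_⟩
    change U.mkQ (0, x.2 + θ κ) = U.mkQ x
    rw [eq_comm, ← sub_eq_zero, ← map_sub, hU]
    refine ⟨κ, hκ.trans (sub_zero x.1).symm, ?_⟩
    change -θ κ = x.2 - (x.2 + θ κ)
    abel
  · obtain ⟨κ, h, h'⟩ := (hU _).1 hn
    rw [(map_eq_zero_iff S.f.hom hf).1 h, map_zero, neg_zero] at h'
    exact h'.symm
  · obtain ⟨e, rfl⟩ := hg x
    exact ⟨U.mkQ (e, 0), rfl⟩
  · change U.mkQ (0, θ κ) = U.mkQ (S.f κ, 0)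
    rw [eq_comm, ← sub_eq_zero, ← map_sub, hU]
    exact ⟨κ, (sub_zero (S.f κ)).symm, (zero_sub (θ κ)).symm⟩

/-! ### The derivation attached to a transition -/

section Derivation

variable {R R' M A T : Type u} [CommRing R] [CommRing R'] [Algebra R' R] [AddCommGroup M] [Module R M]
  {X : SqZero R M R'} [Ring A] [Algebra R A] [Algebra R' A] [IsScalarTower R' R A] {α : T → A}
  {L L' : AlgLift R' R A} {G : FreeAlgebra R' T →ₐ[R'] L.carrier}
  {G' : FreeAlgebra R' T →ₐ[R'] L'.carrier}

omit [IsScalarTower R' R A] in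
theorem IsCover.mul_eq (hG : IsCover α L G) (u v : FreeAlgebra R' T) (n m : A ⊗[R] M) :
    (G u + (L.data X).j n) * (G v + (L.data X).j m) = G (u * v) +
      (L.data X).j ((lft (aug R' α u) : Env R A) • m + (rgt (aug R' α v) : Env R A) • n) := by
  rw [add_mul, mul_add, mul_add, map_mul, L.mul_j, L.mul_j, L.j_mul, L.proj_j, lft_zero_smul, map_zero,
    map_add, hG, hG]
  abel

omit [IsScalarTower R' R A] in
theorem IsCover.exists_eq (hG : IsCover α L G) (w : FreeAlgebra R' T) (y : L.carrier)
    (h : L.proj y = aug R' α w) : ∃ n, y = G w + (L.data X).j n := by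
  obtain ⟨n, hn⟩ := L.exists_j_eq X (y := y - G w) (by rw [map_sub, hG, h, sub_self])
  exact ⟨n, by rw [hn, add_sub_cancel]⟩

variable {θ : RelBimod R α →ₗ[Env R A] A ⊗[R] M}

omit [IsScalarTower R' R A] in
theorem exists_pair (hα : Function.Surjective α) (hG : IsCover α L G) (hG' : IsCover α L' G')
    (z : fibre L L') : ∃ w n n', z.1.1 = G w + (L.data X).j n ∧ z.1.2 = G' w + (L'.data X).j n' := by
  obtain ⟨w, hw⟩ := aug_surjective (k := R') hα (L.proj z.1.1)
  obtain ⟨n, hn⟩ := hG.exists_eq (X := X) w z.1.1 hw.symm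
  obtain ⟨n', hn'⟩ := hG'.exists_eq (X := X) w z.1.2 (Eq.trans (Eq.symm z.2) hw.symm)
  exact ⟨w, n, n', hn, hn'⟩

section

variable {E : ModuleCat.{u} (Env R A)} {Φ : FreeBimod R A T →ₗ[Env R A] E}
  {ι : A ⊗[R] M →ₗ[Env R A] E}

/-- An element of the fibre product can be written (G w + n, G' w + n') in many ways. Two of them
differ by a relation, whose derivative lies in the relation bimodule, where Φ and ι θ agree; so Φ(D
w) + ι(n' - n) depends on the element alone. -/
theorem IsTransition.eq_of_eq (hθ : IsTransition X G G' θ) (hG : IsCover α L G)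
    (hΦ : ∀ κ : RelBimod R α, ι (θ κ) = Φ κ.1)
    {w v : FreeAlgebra R' T} {n n' m m' : A ⊗[R] M}
    (h : G w + (L.data X).j n = G v + (L.data X).j m)
    (h' : G' w + (L'.data X).j n' = G' v + (L'.data X).j m') :
    Φ (freeDer R' R α w) + ι (n' - n) = Φ (freeDer R' R α v) + ι (m' - m) := by
  have hw : aug R' α (w - v) = 0 := by
    have := congrArg L.proj h
    rw [map_add, map_add, L.proj_j, L.proj_j, add_zero, add_zero, hG, hG] at this
    rw [map_sub, this, sub_self]
  have e : (L.data X).j (m - n) = G (w - v) := by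
    rw [map_sub, map_sub, sub_eq_sub_iff_add_eq_add, add_comm, ← h, add_comm]
  have e' : (L'.data X).j (m' - n') = G' (w - v) := by
    rw [map_sub, map_sub, sub_eq_sub_iff_add_eq_add, add_comm, ← h', add_comm]
  let κ : RelBimod R α := ⟨freeDer R' R α (w - v), by
    rw [LinearMap.mem_ker, freePi_freeDer, hw, ← map_zero (algebraMap R A), univDer_algebraMap]⟩
  have hκ := hΦ κ
  rw [hθ (w - v) _ _ κ hw e e' rfl, show κ.1 = freeDer R' R α w - freeDer R' R α v from map_sub _ _ _,
    map_sub Φ, eq_sub_iff_add_eq] at hκ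
  rw [← hκ, add_comm (ι _) (Φ _), add_assoc, ← map_add]
  congr 2
  abel

theorem IsTransition.exists_der (hθ : IsTransition X G G' θ) (hα : Function.Surjective α)
    (hG : IsCover α L G) (hG' : IsCover α L' G') (hΦ : ∀ κ : RelBimod R α, ι (θ κ) = Φ κ.1) :
    ∃ D : fibre L L' →+ E,
      ∀ z w n n', z.1.1 = G w + (L.data X).j n → z.1.2 = G' w + (L'.data X).j n' →
        D z = Φ (freeDer R' R α w) + ι (n' - n) := by
  choose w n n' h h' using exists_pair (X := X) hα hG hG'
  have key : ∀ z v m m', z.1.1 = G v + (L.data X).j m → z.1.2 = G' v + (L'.data X).j m' →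
      Φ (freeDer R' R α (w z)) + ι (n' z - n z) = Φ (freeDer R' R α v) + ι (m' - m) :=
    fun z v m m' e e' => hθ.eq_of_eq hG hΦ ((h z).symm.trans e) ((h' z).symm.trans e')
  refine ⟨AddMonoidHom.mk' (fun z => Φ (freeDer R' R α (w z)) + ι (n' z - n z))
    fun x y => ?_, key⟩
  rw [key (x + y) (w x + w y) (n x + n y) (n' x + n' y)
    (by rw [Subring.coe_add, Prod.fst_add, h, h, map_add, map_add]; abel)
    (by rw [Subring.coe_add, Prod.snd_add, h', h', map_add, map_add]; abel), map_add, map_add,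
    add_sub_add_comm, map_add]
  abel

end

/-- The extension E is the pushout of the free presentation along θ, and the derivation is Φ(D w) +
ι(n' - n). It vanishes on the diagonal copy of A ⊗ M because only n' - n enters. -/
theorem IsTransition.isDiffClass (hθ : IsTransition X G G' θ) (hα : Function.Surjective α)
    (hG : IsCover α L G) (hG' : IsCover α L' G') :
    IsDiffClass X L L' (relPush hα (ModuleCat.ofHom θ)) := by
  obtain ⟨E, ι, π, hw, h, Φ, h₁, h₂⟩ :=
    exists_pushout_shortExact (freeSeq_shortExact (R := R) hα) (ModuleCat.ofHom θ)
  let ι' : A ⊗[R] M →ₗ[Env R A] E := ι.hom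
  let Φ' : FreeBimod R A T →ₗ[Env R A] E := Φ.hom
  have hπι : ∀ n, π.hom (ι' n) = 0 := fun n => congrArg (fun k => k.hom n) hw
  have hπΦ : ∀ e, π.hom (Φ' e) = freePi R α e := fun e => congrArg (fun k => k.hom e) h₂
  obtain ⟨D, hD⟩ := hθ.exists_der (ι := ι') (Φ := Φ') hα hG hG'
    fun κ => congrArg (fun k => k.hom κ) h₁
  refine ⟨E, ι, π, hw, h, D, fun x y => ?_, fun r => ?_, fun m y => ?_, fun z => ?_,
    relPush_eq_of_map hα ι π hw h _ Φ h₁ h₂⟩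
  · obtain ⟨u, n, n', h₁, h₂⟩ := exists_pair (X := X) hα hG hG' x
    obtain ⟨v, m, m', h₃, h₄⟩ := exists_pair (X := X) hα hG hG' y
    have e₁ : L.proj x.1.1 = aug R' α u := by rw [h₁, map_add, hG, L.proj_j, add_zero]
    have e₂ : L.proj y.1.1 = aug R' α v := by rw [h₃, map_add, hG, L.proj_j, add_zero]
    have h := hD (x * y) (u * v) _ _
      (by rw [Subring.coe_mul, Prod.fst_mul, h₁, h₃, hG.mul_eq])
      (by rw [Subring.coe_mul, Prod.snd_mul, h₂, h₄, hG'.mul_eq])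
    rw [h, e₁, e₂, hD x u n n' h₁ h₂, hD y v m m' h₃ h₄, freeDer_mul, add_sub_add_comm,
      ← smul_sub, ← smul_sub, map_add, map_add, map_smul, map_smul, map_smul, map_smul, smul_add,
      smul_add]
    abel
  · refine (hD _ (algebraMap R' _ r) 0 0 ?_ ?_).trans ?_
    · rw [map_zero, add_zero, AlgHom.commutes]; rfl
    · rw [map_zero, add_zero, AlgHom.commutes]; rfl
    · rw [freeDer_algebraMap, sub_zero, map_zero, map_zero, add_zero]
  · refine (hD _ 0 0 (L'.proj y ⊗ₜ m) ?_ ?_).trans ?_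
    · rw [map_zero, map_zero, add_zero]; rfl
    · rw [map_zero, zero_add]
      exact ((L'.data X).j_tmul y m).symm
    · rw [map_zero, sub_zero, map_zero, zero_add]
  · obtain ⟨w, n, n', h, h'⟩ := exists_pair (X := X) hα hG hG' z
    have e : L.proj z.1.1 = aug R' α w := by rw [h, map_add, hG, L.proj_j, add_zero]
    rw [hD z w n n' h h', e, ← freePi_freeDer (k := R') (R := R) α w, ← hπΦ, ← add_zero (π.hom _),
      ← hπι (n' - n)]
    exact map_add π.hom _ _

/-- On the pairs (G w, G' w) the derivation becomes one of the free algebra, hence is given by a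
bimodule map Φ on the free bimodule. On a relation such a pair is the diagonal element of n plus (0,
n' - n), so Φ restricts to ι θ, and the resulting map of extensions computes the class. -/
theorem IsDiffClass.eq_relPush {ξ : HH R A (A ⊗[R] M) 2} (hξ : IsDiffClass X L L' ξ)
    (hα : Function.Surjective α) (hG : IsCover α L G) (hG' : IsCover α L' G')
    (hθ : IsTransition X G G' θ) : ξ = relPush hα (ModuleCat.ofHom θ) := by
  obtain ⟨E, ι, π, hw, h, D, hm, hs, hι, hπ, rfl⟩ := hξ
  have hjj : ∀ n, ((L.data X).j n, (L'.data X).j n) ∈ fibre L L' := fun n =>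
    (L.proj_j X n).trans (L'.proj_j X n).symm
  have hj : ∀ n, ((0 : L.carrier), (L'.data X).j n) ∈ fibre L L' := fun n =>
    (map_zero L.proj).trans (L'.proj_j X n).symm
  -- The diagonal copy of A ⊗ M consists of sums of scalars i(m) times pairs; D kills scalars, and
  -- i(m) is zero in A.
  have hd : ∀ n (z : fibre L L'), z.1 = ((L.data X).j n, (L'.data X).j n) → D z = 0 := fun n => by
    induction n with
    | zero =>
      intro z hz
      rw [map_zero, map_zero] at hz
      rw [show z = 0 from Subtype.ext hz, map_zero]
    | add n n' ihn ihn' =>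
      intro z hz
      rw [show z = ⟨_, hjj n⟩ + ⟨_, hjj n'⟩ from Subtype.ext (by
        rw [hz, map_add, map_add]; rfl), map_add, ihn _ rfl, ihn' _ rfl, add_zero]
    | tmul a m =>
      intro z hz
      obtain ⟨y, rfl⟩ := (L.data X).p_surjective a
      obtain ⟨y', hy'⟩ := (L'.data X).p_surjective ((L.data X).p y)
      have hj' : (L'.data X).j ((L.data X).p y ⊗ₜ m) = X.i m • y' := by
        rw [← hy', (L'.data X).j_tmul]
      have hz' : z = fibreScalar L L' (X.i m) * ⟨(y, y'), hy'.symm⟩ := Subtype.ext (by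
        rw [hz, (L.data X).j_tmul, hj', Algebra.smul_def, Algebra.smul_def]
        rfl)
      rw [hz', hm, hs, smul_zero, add_zero]
      have h₀ : L.proj (fibreScalar L L' (X.i m)).1.1 = 0 :=
        (L.proj_algebraMap _).trans (by rw [X.algebraMap_i, map_zero])
      rw [h₀, lft_zero_smul]
  have hi : ∀ n (z : fibre L L'), z.1 = (0, (L'.data X).j n) → D z = ι.hom n := fun n => by
    induction n with
    | zero =>
      intro z hz
      rw [map_zero] at hz
      rw [show z = 0 from Subtype.ext hz, map_zero, map_zero]
    | add n n' ihn ihn' =>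
      intro z hz
      rw [show z = ⟨_, hj n⟩ + ⟨_, hj n'⟩ from Subtype.ext (by
        rw [hz, map_add]
        exact Prod.ext (add_zero (0 : L.carrier)).symm rfl), map_add, ihn _ rfl, ihn' _ rfl, map_add]
    | tmul a m =>
      intro z hz
      obtain ⟨y, rfl⟩ := (L'.data X).p_surjective a
      refine Eq.trans (congrArg D (Subtype.ext ?_)) (hι m y)
      rw [hz, (L'.data X).j_tmul]
      rfl
  let P : FreeAlgebra R' T → fibre L L' := fun w => ⟨(G w, G' w), (hG w).trans (hG' w).symm⟩
  let Dg : FreeAlgebra R' T →+ E := AddMonoidHom.mk' (fun w => D (P w)) fun u v => by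
    rw [← map_add]
    exact congrArg D (Subtype.ext (Prod.ext (map_add G u v) (map_add G' u v)))
  have hΦ := eq_comp_freeDer (R := R) (α := α) Dg
    (fun u v => by
      rw [← hG u, ← hG v]
      exact (congrArg D (Subtype.ext (Prod.ext (map_mul G u v) (map_mul G' u v)))).trans
        (hm (P u) (P v)))
    (fun s => (congrArg D (Subtype.ext (Prod.ext (G.commutes s) (G'.commutes s)))).trans (hs s))
  let Φ : FreeBimod R A T →ₗ[Env R A] E := FreeBimod.lift (fun x => Dg (FreeAlgebra.ι R' x))
  refine (relPush_eq_of_map hα ι π hw h (ModuleCat.ofHom θ) (ModuleCat.ofHom Φ) ?_ ?_).symm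
  · refine ModuleCat.hom_ext (LinearMap.ext fun (κ : RelBimod R α) => ?_)
    obtain ⟨w, n, n', h₀, hn, hn', hκ, e⟩ := hθ.exists_eq hα hG hG' κ
    change ι.hom (θ κ) = Φ κ.1
    rw [e, hκ, ← hi (n' - n) ⟨_, hj _⟩ rfl]
    refine Eq.trans ?_ (hΦ w)
    change _ = D (P w)
    rw [← sub_eq_zero, ← map_sub, ← neg_eq_zero, ← map_neg]
    refine hd n _ (Prod.ext ?_ ?_)
    · change -(0 - G w) = _
      rw [hn]; abel
    · change -((L'.data X).j (n' - n) - G' w) = _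
      rw [map_sub, hn']; abel
  · refine ModuleCat.hom_ext (FreeBimod.hom_ext fun x => ?_)
    change π.hom (FreeBimod.lift _ (FreeBimod.gen x)) = freePi R α (FreeBimod.gen x)
    rw [FreeBimod.lift_gen, freePi, FreeBimod.lift_gen]
    refine (hπ _).trans ?_
    exact congrArg (univDer R A) ((hG _).trans (aug_ι α x))

theorem isDiffClass_iff {ξ : HH R A (A ⊗[R] M) 2} (hα : Function.Surjective α)
    (hG : IsCover α L G) (hG' : IsCover α L' G') (hθ : IsTransition X G G' θ) :
    IsDiffClass X L L' ξ ↔ ξ = relPush hα (ModuleCat.ofHom θ) :=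
  ⟨fun h => h.eq_relPush hα hG hG' hθ, fun h => h ▸ hθ.isDiffClass hα hG hG'⟩

end Derivation

/-! ### Liftings with vanishing difference -/

section Isomorphism

variable {R R' M A T : Type u} [CommRing R] [CommRing R'] [Algebra R' R] [AddCommGroup M] [Module R M]
  {X : SqZero R M R'} [Ring A] [Algebra R A] [Algebra R' A] {α : T → A}
  {L L' : AlgLift R' R A} {G : FreeAlgebra R' T →ₐ[R'] L.carrier}
  {G' : FreeAlgebra R' T →ₐ[R'] L'.carrier}

theorem IsCover.comp (hG : IsCover α L G) (f : L ⟶ L') : IsCover α L' (f.1.toAlgHom.comp G) :=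
  fun w => (f.2 (G w)).trans (hG w)

omit [Algebra R' A] in
theorem AlgLift.map_j (f : L ⟶ L') (n : A ⊗[R] M) : f.1 ((L.data X).j n) = (L'.data X).j n :=
  (L.data X).map_j (L'.data X) f.1.toLinearEquiv.toLinearMap f.2 n

theorem IsCover.exists_add (hα : Function.Surjective α) (hG : IsCover α L G) (y : L.carrier) :
    ∃ w n, y = G w + (L.data X).j n := by
  obtain ⟨w, hw⟩ := aug_surjective (k := R') hα (L.proj y)
  obtain ⟨n, hn⟩ := hG.exists_eq (X := X) w y hw.symm
  exact ⟨w, n, hn⟩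

variable [IsScalarTower R' R A]

theorem isTransition_comp (f : L ⟶ L') :
    IsTransition (α := α) X G (f.1.toAlgHom.comp G) (0 : RelBimod R α →ₗ[Env R A] A ⊗[R] M) :=
  fun w n n' κ _ hn hn' _ => by
    have h : (L'.data X).j n' = (L'.data X).j n := by
      rw [hn', ← AlgLift.map_j f, hn]
      rfl
    rw [(L'.data X).j_injective h, sub_self, LinearMap.zero_apply]

/-- The rule G w + n ↦ G' w + n is well defined: two expressions of one element differ by a
relation, on which G and G' take the same value in A ⊗ M. -/
theorem nonempty_iso_of_isTransition_zero (hα : Function.Surjective α) (hG : IsCover α L G)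
    (hG' : IsCover α L' G')
    (h : IsTransition (α := α) X G G' (0 : RelBimod R α →ₗ[Env R A] A ⊗[R] M)) :
    Nonempty (L ≅ L') := by
  have key : ∀ w v n m, G w + (L.data X).j n = G v + (L.data X).j m →
      G' w + (L'.data X).j n = G' v + (L'.data X).j m := fun w v n m e => by
    have hw : aug R' α (w - v) = 0 := by
      have := congrArg L.proj e
      rw [map_add, map_add, L.proj_j, L.proj_j, add_zero, add_zero, hG, hG] at this
      rw [map_sub, this, sub_self]
    obtain ⟨n', hn'⟩ := hG'.exists_j_eq (X := X) hw
    let κ : RelBimod R α := ⟨freeDer R' R α (w - v), by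
      rw [LinearMap.mem_ker, freePi_freeDer, hw, ← map_zero (algebraMap R A), univDer_algebraMap]⟩
    have hκ := h (w - v) (m - n) n' κ hw (by
      rw [map_sub, map_sub, sub_eq_sub_iff_add_eq_add, add_comm, ← e, add_comm]) hn' rfl
    rw [LinearMap.zero_apply, eq_comm, sub_eq_zero] at hκ
    rw [hκ, map_sub, map_sub, sub_eq_sub_iff_add_eq_add] at hn'
    rw [← hn', add_comm]
  choose w n hy using hG.exists_add (X := X) hα
  let f : L.carrier → L'.carrier := fun y => G' (w y) + (L'.data X).j (n y)
  have hf : ∀ y v m, y = G v + (L.data X).j m → f y = G' v + (L'.data X).j m :=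
    fun y v m e => key _ _ _ _ ((hy y).symm.trans e)
  let fl : L.carrier →ₗ[R'] L'.carrier :=
    { toFun := f
      map_add' := fun x y => by
        rw [hf (x + y) (w x + w y) (n x + n y) (by
          rw [map_add, map_add, add_add_add_comm, ← hy, ← hy]), map_add, map_add, add_add_add_comm]
      map_smul' := fun r x => by
        rw [hf (r • x) (r • w x) (algebraMap R' R r • n x) (by
          rw [map_smul, (L.data X).j_smul, ← smul_add, ← hy]), map_smul, (L'.data X).j_smul,
          ← smul_add]
        rfl }
  have hp : ∀ y, L'.proj (fl y) = L.proj y := fun y => by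
    rw [hy y]
    refine (congrArg L'.proj (hf _ (w y) (n y) rfl)).trans ?_
    rw [map_add, map_add, L.proj_j, L'.proj_j, hG, hG']
  let g : L.carrier →ₐ[R'] L'.carrier := AlgHom.ofLinearMap fl
    ((hf 1 1 0 (by rw [map_one, map_zero, add_zero])).trans (by rw [map_one, map_zero, add_zero]))
    (fun x y => by
      refine (hf (x * y) (w x * w y) _ (by rw [← hG.mul_eq, ← hy, ← hy])).trans ?_
      rw [← hG'.mul_eq]
      rfl)
  let e : L.carrier ≃ₐ[R'] L'.carrier :=
    AlgEquiv.ofBijective g ((L.data X).bijective_of_comp (L'.data X) fl hp)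
  have he : ∀ y, L.proj (e.symm y) = L'.proj y := fun y =>
    (hp (e.symm y)).symm.trans (congrArg L'.proj (e.apply_symm_apply y))
  exact ⟨⟨⟨e, hp⟩, ⟨e.symm, he⟩, Subtype.ext (AlgEquiv.ext fun y => e.symm_apply_apply y),
    Subtype.ext (AlgEquiv.ext fun y => e.apply_symm_apply y)⟩⟩

/-- A presentation can be modified by a map on the free bimodule. -/
theorem exists_isTransition_comp (hG' : IsCover α L' G')
    (Ψ : FreeBimod R A T →ₗ[Env R A] A ⊗[R] M) :
    ∃ G₁ : FreeAlgebra R' T →ₐ[R'] L'.carrier, IsCover α L' G₁ ∧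
      ∀ w, G₁ w = G' w - (L'.data X).j (Ψ (freeDer R' R α w)) := by
  let G₁ : FreeAlgebra R' T →ₐ[R'] L'.carrier := FreeAlgebra.lift R' fun x =>
    G' (FreeAlgebra.ι R' x) - (L'.data X).j (Ψ (FreeBimod.gen x))
  have h : ∀ w, G₁ w = G' w - (L'.data X).j (Ψ (freeDer R' R α w)) := fun w => by
    induction w using FreeAlgebra.induction with
    | grade0 r =>
      rw [AlgHom.commutes, AlgHom.commutes, freeDer_algebraMap, map_zero, map_zero, sub_zero]
    | grade1 x => rw [FreeAlgebra.lift_ι_apply, freeDer_ι]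
    | mul u v hu hv =>
      rw [map_mul, hu, hv, sub_eq_add_neg, sub_eq_add_neg, ← map_neg (L'.data X).j,
        ← map_neg (L'.data X).j, hG'.mul_eq, freeDer_mul, map_add Ψ, map_smul Ψ, map_smul Ψ, smul_neg,
        smul_neg, ← neg_add, map_neg (L'.data X).j, ← sub_eq_add_neg]
    | add u v hu hv => rw [map_add, hu, hv, map_add, map_add, map_add, map_add]; abel
  exact ⟨G₁, fun w => by rw [h, map_sub, L'.proj_j, sub_zero, hG'], h⟩

/-- Two liftings are isomorphic if and only if their difference has trivial class. -/
theorem relPush_eq_zero_iff_nonempty_iso [Module.Flat R A] (hα : Function.Surjective α)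
    (hG : IsCover α L G) (hG' : IsCover α L' G') {θ : RelBimod R α →ₗ[Env R A] A ⊗[R] M}
    (hθ : IsTransition X G G' θ) :
    relPush hα (ModuleCat.ofHom θ) = 0 ↔ Nonempty (L ≅ L') := by
  constructor
  · intro h
    -- Zero class means that θ extends to a map Ψ on the free bimodule, and replacing G' by G' - Ψ D
    -- makes the transition zero.
    obtain ⟨Ψ, hΨ⟩ := (relPush_eq_zero_iff hα _).1 h
    let Ψ' : FreeBimod R A T →ₗ[Env R A] A ⊗[R] M := Ψ.hom
    have hΨ' : ∀ κ : RelBimod R α, Ψ' κ.1 = θ κ := fun κ => congrArg (fun k => k.hom κ) hΨ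
    obtain ⟨G₁, hG₁, h₁⟩ := exists_isTransition_comp (X := X) hG' Ψ'
    refine nonempty_iso_of_isTransition_zero (X := X) hα hG hG₁ fun w n n' κ hw hn hn' hκ => ?_
    obtain ⟨m, hm⟩ := hG'.exists_j_eq (X := X) hw
    rw [h₁, ← hκ, hΨ', ← hm, ← map_sub] at hn'
    rw [(L'.data X).j_injective hn', hθ w n m κ hw hn hm hκ, LinearMap.zero_apply]
    abel
  · rintro ⟨f⟩
    -- Transporting G along the isomorphism gives a presentation of L' with zero transition, and the
    -- class does not depend on the presentations.
    rw [← isDiffClass_iff hα hG hG' hθ |>.1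
      ((isTransition_comp f.hom).isDiffClass hα hG (hG.comp f.hom))]
    exact (relPush_eq_zero_iff hα _).2 ⟨0, Limits.comp_zero⟩

end Isomorphism

/-! ### Twisting a lifting -/

section Twist

variable {R R' M A T : Type u} [CommRing R] [CommRing R'] [Algebra R' R] [AddCommGroup M] [Module R M]
  (X : SqZero R M R') [Ring A] [Algebra R A] [Algebra R' A] [IsScalarTower R' R A] {α : T → A}
  {L : AlgLift R' R A} {G : FreeAlgebra R' T →ₐ[R'] L.carrier} (hG : IsCover α L G)
  (θ : RelBimod R α →ₗ[Env R A] A ⊗[R] M)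

theorem lft_algebraMap_smul (r : R') (n : A ⊗[R] M) :
    (lft (algebraMap R' A r) : Env R A) • n = r • n := by
  induction n with
  | zero => rw [smul_zero, smul_zero]
  | add n n' h h' => rw [smul_add, smul_add, h, h']
  | tmul a m => rw [lft_smul_tmul, TensorProduct.smul_tmul', Algebra.smul_def]

theorem rgt_algebraMap_smul (r : R') (n : A ⊗[R] M) :
    (rgt (algebraMap R' A r) : Env R A) • n = r • n := by
  induction n with
  | zero => rw [smul_zero, smul_zero]
  | add n n' h h' => rw [smul_add, smul_add, h, h']
  | tmul a m => rw [rgt_smul_tmul, TensorProduct.smul_tmul', Algebra.smul_def, Algebra.commutes]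

theorem lft_smul_scalar_smul (r : R') (a : A) (n : A ⊗[R] M) :
    (lft a : Env R A) • r • n = r • (lft a : Env R A) • n := by
  rw [← lft_algebraMap_smul, ← lft_algebraMap_smul, ← lft_mul_smul, ← lft_mul_smul,
    Algebra.commutes]

theorem rgt_smul_scalar_smul (r : R') (a : A) (n : A ⊗[R] M) :
    (rgt a : Env R A) • r • n = r • (rgt a : Env R A) • n := by
  rw [← lft_algebraMap_smul, ← lft_algebraMap_smul, lft_smul_rgt_smul]

variable (R R' M α) in
/-- The square-zero extension of the free algebra by the bimodule `A ⊗ M`. -/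
noncomputable def freeExt : BilinAlg R' (FreeAlgebra R' T × (A ⊗[R] M)) where
  mul := LinearMap.mk₂ R' (fun x y => (x.1 * y.1,
      (lft (aug R' α x.1) : Env R A) • y.2 + (rgt (aug R' α y.1) : Env R A) • x.2))
    (fun x x' y => Prod.ext (add_mul _ _ _) (by
      change (lft (aug R' α (x.1 + x'.1)) : Env R A) • y.2 +
        (rgt (aug R' α y.1) : Env R A) • (x.2 + x'.2) = _ + _ + (_ + _)
      rw [map_add, lft_add, add_smul, smul_add, add_add_add_comm]))
    (fun r x y => Prod.ext (smul_mul_assoc _ _ _) (by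
      change (lft (aug R' α (r • x.1)) : Env R A) • y.2 +
        (rgt (aug R' α y.1) : Env R A) • (r • x.2) = r • (_ + _)
      rw [map_smul, Algebra.smul_def, lft_mul_smul, lft_algebraMap_smul, rgt_smul_scalar_smul,
        smul_add]))
    (fun x y y' => Prod.ext (mul_add _ _ _) (by
      change (lft (aug R' α x.1) : Env R A) • (y.2 + y'.2) +
        (rgt (aug R' α (y.1 + y'.1)) : Env R A) • x.2 = _ + _ + (_ + _)
      rw [map_add, rgt_add, add_smul, smul_add, add_add_add_comm]))
    (fun r x y => Prod.ext (mul_smul_comm _ _ _) (by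
      change (lft (aug R' α x.1) : Env R A) • (r • y.2) +
        (rgt (aug R' α (r • y.1)) : Env R A) • x.2 = r • (_ + _)
      rw [map_smul, Algebra.smul_def, rgt_mul_smul, rgt_algebraMap_smul, lft_smul_scalar_smul,
        rgt_smul_scalar_smul, smul_add]))
  one := (1, 0)
  assoc x y z := Prod.ext (mul_assoc _ _ _) (by
    change (lft (aug R' α (x.1 * y.1)) : Env R A) • z.2 + (rgt (aug R' α z.1) : Env R A) •
      ((lft (aug R' α x.1) : Env R A) • y.2 + (rgt (aug R' α y.1) : Env R A) • x.2) =
      (lft (aug R' α x.1) : Env R A) • ((lft (aug R' α y.1) : Env R A) • z.2 +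
      (rgt (aug R' α z.1) : Env R A) • y.2) + (rgt (aug R' α (y.1 * z.1)) : Env R A) • x.2
    rw [map_mul, map_mul, lft_mul_smul, rgt_mul_smul, smul_add, smul_add, lft_smul_rgt_smul,
      add_assoc])
  one_mul x := Prod.ext (one_mul _) (by
    change (lft (aug R' α 1) : Env R A) • x.2 + (rgt (aug R' α x.1) : Env R A) • (0 : A ⊗[R] M) = _
    rw [map_one, smul_zero, add_zero, lft_one]
    exact one_smul _ _)
  mul_one x := Prod.ext (mul_one _) (by
    change (lft (aug R' α x.1) : Env R A) • (0 : A ⊗[R] M) + (rgt (aug R' α 1) : Env R A) • x.2 = _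
    rw [map_one, smul_zero, zero_add, rgt_one]
    exact one_smul _ _)

variable {X}

/-- The relations of the twist of a lifting. -/
noncomputable def twistRel : Submodule R' (FreeAlgebra R' T × (A ⊗[R] M)) where
  -- The lifting L is F ⊕ (A ⊗ M) modulo the pairs (w, -n) with w a relation and G w = n. The twist
  -- replaces n by n + θ(D w).
  carrier := {x | ∃ (n : A ⊗[R] M) (κ : RelBimod R α), (L.data X).j n = G x.1 ∧
    κ.1 = freeDer R' R α x.1 ∧ x.2 = -(n + θ κ)}
  zero_mem' := ⟨0, 0, (map_zero _).trans (map_zero G).symm, (map_zero (freeDer R' R α)).symm, by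
    rw [map_zero, add_zero, neg_zero]; rfl⟩
  add_mem' := by
    rintro x y ⟨n, κ, h₁, h₂, h₃⟩ ⟨n', κ', h₁', h₂', h₃'⟩
    refine ⟨n + n', κ + κ', ?_, ?_, ?_⟩
    · rw [map_add, h₁, h₁', Prod.fst_add, map_add]
    · rw [Prod.fst_add, map_add, ← h₂, ← h₂']; rfl
    · rw [Prod.snd_add, h₃, h₃', map_add]; abel
  smul_mem' := by
    rintro r x ⟨n, κ, h₁, h₂, h₃⟩
    refine ⟨r • n, (lft (algebraMap R' A r) : Env R A) • κ, ?_, ?_, ?_⟩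
    · rw [algebra_compatible_smul R r n, (L.data X).j_smul, h₁, ← map_smul]; rfl
    · change (lft (algebraMap R' A r) : Env R A) • κ.1 = freeDer R' R α (r • x.1)
      rw [map_smul, FreeBimod.scalar_smul, h₂]
    · change r • x.2 = _
      rw [h₃, map_smul, lft_algebraMap_smul, ← smul_add, smul_neg]

include hG in
theorem aug_of_mem_twistRel {x : FreeAlgebra R' T × (A ⊗[R] M)}
    (hx : x ∈ twistRel (X := X) (G := G) θ) : aug R' α x.1 = 0 := by
  obtain ⟨n, κ, h₁, -, -⟩ := hx
  rw [← hG, ← h₁, L.proj_j]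

include hG in
theorem mul_mem_twistRel (y : FreeAlgebra R' T × (A ⊗[R] M)) {x : FreeAlgebra R' T × (A ⊗[R] M)}
    (hx : x ∈ twistRel (X := X) (G := G) θ) :
    (freeExt R R' M α).mul y x ∈ twistRel (X := X) (G := G) θ := by
  have h₀ := aug_of_mem_twistRel hG θ hx
  obtain ⟨n, κ, h₁, h₂, h₃⟩ := hx
  refine ⟨(lft (aug R' α y.1) : Env R A) • n, (lft (aug R' α y.1) : Env R A) • κ, ?_, ?_, ?_⟩
  · rw [← hG, ← L.mul_j, h₁]
    exact (map_mul G y.1 x.1).symm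
  · refine Eq.trans ?_ (freeDer_mul_of_right y.1 h₀).symm
    rw [← h₂]; rfl
  · change (lft (aug R' α y.1) : Env R A) • x.2 + (rgt (aug R' α x.1) : Env R A) • y.2 = _
    rw [h₀, rgt_zero_smul, add_zero, h₃, map_smul, ← smul_add, smul_neg]

include hG in
theorem twistRel_mul {x : FreeAlgebra R' T × (A ⊗[R] M)} (hx : x ∈ twistRel (X := X) (G := G) θ)
    (y : FreeAlgebra R' T × (A ⊗[R] M)) :
    (freeExt R R' M α).mul x y ∈ twistRel (X := X) (G := G) θ := by
  have h₀ := aug_of_mem_twistRel hG θ hx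
  obtain ⟨n, κ, h₁, h₂, h₃⟩ := hx
  refine ⟨(rgt (aug R' α y.1) : Env R A) • n, (rgt (aug R' α y.1) : Env R A) • κ, ?_, ?_, ?_⟩
  · rw [← hG, ← L.j_mul, h₁]
    exact (map_mul G x.1 y.1).symm
  · refine Eq.trans ?_ (freeDer_mul_of_left h₀ y.1).symm
    rw [← h₂]; rfl
  · change (lft (aug R' α x.1) : Env R A) • y.2 + (rgt (aug R' α y.1) : Env R A) • x.2 = _
    rw [h₀, lft_zero_smul, zero_add, h₃, map_smul, ← smul_add, smul_neg]

/-- The product of the twist of a lifting. -/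
noncomputable def twistAlg :
    BilinAlg R' ((FreeAlgebra R' T × (A ⊗[R] M)) ⧸ twistRel (X := X) (G := G) θ) :=
  (freeExt R R' M α).quot _ (fun y _ hx => mul_mem_twistRel hG θ y hx)
    (fun _ hx y => twistRel_mul hG θ hx y)

/-- The twist of a lifting by a map on the relations, as an extension. -/
noncomputable def twistData (hα : Function.Surjective α) :
    LiftData X A ((FreeAlgebra R' T × (A ⊗[R] M)) ⧸ twistRel (X := X) (G := G) θ) where
  p := ((twistRel (X := X) (G := G) θ).liftQ
    ((aug R' α).toLinearMap ∘ₗ LinearMap.fst R' _ _)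
    (fun _ hx => aug_of_mem_twistRel hG θ hx)).toAddMonoidHom
  j := ((twistRel (X := X) (G := G) θ).mkQ ∘ₗ LinearMap.inr R' _ _).toAddMonoidHom
  p_smul r y := by
    obtain ⟨x, rfl⟩ := Submodule.Quotient.mk_surjective _ y
    change aug R' α (r • x.1) = algebraMap R' R r • aug R' α x.1
    rw [map_smul, algebra_compatible_smul R r]
  p_surjective a := by
    obtain ⟨w, hw⟩ := aug_surjective (k := R') hα a
    exact ⟨Submodule.Quotient.mk (w, 0), hw⟩
  j_injective := (injective_iff_map_eq_zero _).2 fun n hn => by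
    obtain ⟨m, κ, h₁, h₂, h₃⟩ := (Submodule.Quotient.mk_eq_zero _).1 hn
    have hm : m = 0 := ((L.data X).j_eq_zero_iff m).1 (h₁.trans (map_zero G))
    have hκ : κ = 0 := Subtype.ext (h₂.trans (map_zero (freeDer R' R α)))
    rw [hm, hκ, map_zero, add_zero, neg_zero] at h₃
    exact h₃
  exact y := by
    obtain ⟨x, rfl⟩ := Submodule.Quotient.mk_surjective _ y
    constructor
    · intro h
      have h₀ : aug R' α x.1 = 0 := h
      obtain ⟨n, hn⟩ := hG.exists_j_eq (X := X) h₀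
      let κ : RelBimod R α := ⟨freeDer R' R α x.1, by
        rw [LinearMap.mem_ker, freePi_freeDer, h₀, ← map_zero (algebraMap R A), univDer_algebraMap]⟩
      refine ⟨x.2 + (n + θ κ), ((Submodule.Quotient.eq _).2 (?_ : x - (0, _) ∈ _)).symm⟩
      refine ⟨n, κ, ?_, ?_, ?_⟩
      · rw [hn, Prod.fst_sub, sub_zero]
      · rw [Prod.fst_sub, sub_zero]
      · change x.2 - (x.2 + (n + θ κ)) = _
        abel
    · rintro ⟨n, hn⟩
      rw [← hn]
      exact map_zero (aug R' α)
  j_tmul y m := by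
    obtain ⟨x, rfl⟩ := Submodule.Quotient.mk_surjective _ y
    refine ((Submodule.Quotient.eq _).2 (?_ : X.i m • x - (0, aug R' α x.1 ⊗ₜ m) ∈ _)).symm
    refine ⟨aug R' α x.1 ⊗ₜ m, 0, ?_, ?_, ?_⟩
    · rw [Prod.fst_sub, sub_zero, Prod.smul_fst, map_smul, ← hG, ← (L.data X).j_tmul]
      rfl
    · rw [Prod.fst_sub, sub_zero, Prod.smul_fst, map_smul, FreeBimod.scalar_smul (R := R) (A := A),
        IsScalarTower.algebraMap_apply R' R A, X.algebraMap_i, map_zero, lft_zero_smul]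
      rfl
    · rw [Prod.snd_sub, Prod.smul_snd, algebra_compatible_smul R (X.i m) x.2, X.algebraMap_i,
        zero_smul, zero_sub, map_zero, add_zero]

include hG in
/-- Every map on the relations is the difference of two liftings. -/
theorem exists_twist [Module.Flat R A] (hα : Function.Surjective α) :
    ∃ (L' : AlgLift R' R A) (G' : FreeAlgebra R' T →ₐ[R'] L'.carrier),
      IsCover α L' G' ∧ IsTransition X G G' θ := by
  let U := twistRel (X := X) (G := G) θ
  let _ := (twistAlg (X := X) hG θ).toRing
  let _ := (twistAlg (X := X) hG θ).toAlgebra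
  let D := twistData (X := X) hG θ hα
  have h₁ : D.p 1 = 1 := map_one (aug R' α)
  have h : ∀ y y', D.p (y * y') = D.p y * D.p y' := fun y y' => by
    obtain ⟨x, rfl⟩ := Submodule.Quotient.mk_surjective _ y
    obtain ⟨x', rfl⟩ := Submodule.Quotient.mk_surjective _ y'
    exact map_mul (aug R' α) x.1 x'.1
  let L' : AlgLift R' R A := D.toAlgLift h₁ h
  have hj : ∀ n, (L'.data X).j n = U.mkQ (0, n) := fun n =>
    (D.map_j (L'.data X) LinearMap.id (fun y => D.toAlgLift_proj h₁ h y) n).symm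
  let G' : FreeAlgebra R' T →ₐ[R'] L'.carrier :=
    AlgHom.ofLinearMap (U.mkQ ∘ₗ LinearMap.inl R' _ _) rfl
      (fun u v => congrArg U.mkQ (Prod.ext rfl (by
        change (0 : A ⊗[R] M) = (lft (aug R' α u) : Env R A) • (0 : A ⊗[R] M) +
          (rgt (aug R' α v) : Env R A) • (0 : A ⊗[R] M)
        rw [smul_zero, smul_zero, add_zero])))
  refine ⟨L', G', fun w => D.toAlgLift_proj h₁ h _, fun w n n' κ _ hn hn' hκ => ?_⟩
  rw [hj] at hn'
  obtain ⟨m, κ', e₁, e₂, e₃⟩ := (Submodule.Quotient.eq U).1 hn'.symm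
  change (L.data X).j m = G (w - 0) at e₁
  change κ'.1 = freeDer R' R α (w - 0) at e₂
  change 0 - n' = -(m + θ κ') at e₃
  rw [sub_zero] at e₁ e₂
  rw [zero_sub, neg_inj] at e₃
  rw [e₃, show κ = κ' from Subtype.ext (hκ.trans e₂.symm),
    show m = n from (L.data X).j_injective (e₁.trans hn.symm), add_sub_cancel_left]

end Twist

/-! ### The torsor of liftings -/

/-- A torsor structure from its difference map. -/
@[reducible] noncomputable def addTorsorOfDiff {V P : Type*} [AddCommGroup V] [Nonempty P]
    (d : P → P → V) (hd : ∀ p q r, d p q + d q r = d p r)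
    (h : ∀ p, Function.Bijective (d p)) : AddTorsor V P where
  vadd v p := (Equiv.ofBijective _ (h p)).symm v
  zero_vadd p := (Equiv.symm_apply_eq _).2 (add_eq_left.1 (hd p p p)).symm
  add_vadd v w p := (Equiv.symm_apply_eq _).2 (by
    let q := (Equiv.ofBijective _ (h p)).symm w
    change v + w = d p ((Equiv.ofBijective _ (h q)).symm v)
    rw [← hd p q, Equiv.ofBijective_apply_symm_apply (d q) (h q) v,
      Equiv.ofBijective_apply_symm_apply (d p) (h p) w, add_comm])
  vsub q p := d p q
  vsub_vadd' p q := Equiv.ofBijective_symm_apply_apply _ (h q) p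
  vadd_vsub' v p := Equiv.ofBijective_apply_symm_apply _ (h p) v

section Torsor

variable {R R' M A : Type u} [CommRing R] [CommRing R'] [Algebra R' R] [AddCommGroup M] [Module R M]
  (X : SqZero R M R') [Ring A] [Algebra R A] [Module.Flat R A]

/-- The free algebra over R' on the set A presents all liftings at once, and the class of a pair is
that of the transition between chosen presentations. Transitions add up, have zero class exactly for
isomorphic liftings, and give every class by twisting. -/
theorem exists_diffCls : ∃ c : AlgLift R' R A → AlgLift R' R A → HH R A (A ⊗[R] M) 2,
    (∀ L L' ξ, IsDiffClass X L L' ξ ↔ ξ = c L L') ∧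
    (∀ L L' L'', c L L' + c L' L'' = c L L'') ∧
    (∀ L L', c L L' = 0 ↔ Nonempty (L ≅ L')) ∧
    ∀ L, Function.Surjective (c L) := by
  let _ : Algebra R' A := Algebra.compHom A (algebraMap R' R)
  have : IsScalarTower R' R A := IsScalarTower.of_algebraMap_eq fun _ => rfl
  have hα : Function.Surjective (id : A → A) := Function.surjective_id
  choose G hG using exists_isCover X (id : A → A)
  choose θ hθ using fun L L' : AlgLift R' R A => exists_isTransition (X := X) hα (hG L) (hG L')
  refine ⟨fun L L' => relPush hα (ModuleCat.ofHom (θ L L')),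
    fun L L' ξ => isDiffClass_iff hα (hG L) (hG L') (hθ L L'), fun L L' L'' => ?_,
    fun L L' => relPush_eq_zero_iff_nonempty_iso hα (hG L) (hG L') (hθ L L'), fun L ξ => ?_⟩
  · rw [← relPush_add, ← ModuleCat.ofHom_add,
      ((hθ L L').add (hθ L' L'') (hG L')).unique (hθ L L'') hα (hG L) (hG L'')]
  · obtain ⟨t, rfl⟩ := relPush_surjective hα ξ
    obtain ⟨L', G', hG', ht⟩ := exists_twist (X := X) (hG L) t.hom hα
    exact ⟨L', ((hθ L L').isDiffClass hα (hG L) (hG L')).eq_relPush hα (hG L) hG' ht⟩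

/-- By additivity isomorphic liftings have the same differences, so the difference map may be
defined on chosen representatives. Equal differences c(p, q) = c(p, q') force c(q, q') = 0, hence an
isomorphism. -/
theorem exists_addTorsor (h : Nonempty (AlgLift R' R A)) :
    ∃ t : AddTorsor (HH R A (A ⊗[R] M) 2) (LiftClasses R' R A),
      ∀ (L L' : AlgLift R' R A) (ξ : HH R A (A ⊗[R] M) 2),
        IsDiffClass X L L' ξ ↔ ξ = L'.toClass -ᵥ L.toClass := by
  obtain ⟨c, h₁, h₂, h₃, h₄⟩ := exists_diffCls (A := A) X
  have : Nonempty (LiftClasses R' R A) := h.map AlgLift.toClass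
  have hout : ∀ L : AlgLift R' R A, Nonempty (L.toClass.out ≅ L) := fun L =>
    Quotient.mk_out (s := isIsomorphicSetoid (AlgLift R' R A)) L
  have hc : ∀ L L' : AlgLift R' R A, c L.toClass.out L'.toClass.out = c L L' := fun L L' => by
    rw [← h₂ _ L, (h₃ _ L).2 (hout L), zero_add, ← h₂ L L',
      (h₃ L' _).2 ((hout L').map Iso.symm), add_zero]
  refine ⟨addTorsorOfDiff (fun p q => c p.out q.out) (fun p q r => h₂ _ _ _) fun p =>
    ⟨fun q q' hq => ?_, fun ξ => ?_⟩, fun L L' ξ => (h₁ L L' ξ).trans ?_⟩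
  · have h₀ : c q.out q'.out = 0 := by
      have := h₂ p.out q.out q'.out
      rwa [← show c p.out q.out = c p.out q'.out from hq, add_eq_left] at this
    rw [← q.out_eq, ← q'.out_eq]
    exact Quotient.sound ((h₃ _ _).1 h₀)
  · obtain ⟨L, rfl⟩ := h₄ p.out ξ
    refine ⟨L.toClass, ?_⟩
    change c p.out L.toClass.out = _
    rw [← h₂ p.out L, (h₃ L _).2 ((hout L).map Iso.symm), add_zero]
  · change _ ↔ ξ = c L.toClass.out L'.toClass.out
    rw [hc]

end Torsor

end SqZeroLift

theorem mainTheorem5 {R R' M : Type u} [CommRing R] [CommRing R'] [Algebra R' R]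
    [AddCommGroup M] [Module R M] (X : SqZero R M R') (φ : MulExt R M) (S : Corr X φ.toElemExt)
    (A : Type u) [Ring A] [Algebra R A] [Module.Flat R A] :
    (φ.eval A).IsElementary ∧
    Nonempty (MulCorr S) ∧
    (∃ (E : Lift R' R A ≌ Spl (φ.eval A)) (D : IsDiff S E.functor),
      ∀ μ : MulCorr S, ∃ E' : AlgLift R' R A ≌ MulSpl (φ.eval A),
        Nonempty (IsMulDiff D μ E'.functor)) ∧
    (∃ o : HH R A (A ⊗[R] M) 3,
      (∀ o' : HH R A (A ⊗[R] M) 3, IsObstructionClass (φ.eval A) o' ↔ o' = o) ∧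
      (o = 0 ↔ Nonempty (AlgLift R' R A))) ∧
    (Nonempty (AlgLift R' R A) →
      ∃ t : AddTorsor (HH R A (A ⊗[R] M) 2) (LiftClasses R' R A),
        ∀ (L L' : AlgLift R' R A) (ξ : HH R A (A ⊗[R] M) 2),
          IsDiffClass X L L' ξ ↔ ξ = L'.toClass -ᵥ L.toClass) := by
  refine ⟨φ.eval_isElementary, ⟨S.mulCorr⟩, ⟨(diffFunctor S A).asEquivalence, isDiff S A,
    fun μ => ⟨(mulDiffFunctor μ A).asEquivalence, ⟨isMulDiff μ A⟩⟩⟩,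
    ⟨_, DGExt.isObstructionClass_iff φ.eval_isElementary,
      fourTerm_cls_eq_zero_iff_nonempty_algLift S A⟩, exists_addTorsor X⟩
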